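/- **Setting.** Units with $c=1$. Let $V\subset\mathbb R^3$ be open and let $\mathbb R\times V$ carry a smooth static Lorentzian metric $g=-\lambda(x)^2dt^2+h_{ij}(x)dx^idx^j$ with $\lambda>0$ and $h$ positive definite; $\hat h=h/\lambda^2$ is its optical metric. Signals are future-pointing null geodesics. Let $U\subset V$ be open such that any two distinct static worldlines in $U$ are radar linkable in $V$: every event of either one is reached from the other by exactly one future-pointing and exactly one past-pointing null geodesic in $\mathbb R\times V$. Let $p\in U$. Five open machines $A_1,A_2,A_3,B_1,B_2$ are fixed at distinct places of $U$. Each has a clock of constant period, whose readings are written $m.\phi$ (count $m\in\mathbb Z$, phase $-\frac12<\phi\le\frac12$). $B_1$ is at $p$ and has a given proper period $p_\tau>0$, hence coordinate-time period $p_t=p_\tau/\lambda(p)$; the other periods are free. The echo count from $X$ to $Y$ at tick $m$ of $X$ is $\Delta$ if a signal sent by $X$ at $m$ and echoed at once by $Y$ returns at $X$-reading $m+\Delta$. For an integer $N\ge1$ put $n_{XY}=3$ if $X,Y$ are both among the $A$'s and $n_{XY}=2$ otherwise. The flat-space pattern has, on each of the ten two-way links $XY$, both channels $\{(k.0,(k+n_{XY}N).0):k=0,1,2,\dots\}$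 (null phases) and echo counts $2n_{XY}N$. An arrangement has axis $u$ if the signal from $B_1$ to $B_2$ leaves $B_1$ in the spatial direction $u$. **Proposition.** There are, for each of the ten links $e$, a linear functional $\kappa_e$ on $3\times3$ matrices that is not identically zero on symmetric matrices, and an open set $G$ of matrices whose symmetric elements are dense among the symmetric matrices, all independent of the spacetime, such that for all data as above the following hold. 1. (a) For every $\hat h$-orthonormal frame $E$ at $p$ and every link $e$ there is $\varepsilon>0$ such that, whenever $Np_\tau<\varepsilon$, there is an arrangement with axis $E_1$ in which all clocks have coordinate period $p_t$, all nine links other than $e$ have null phases and flat-space echo counts, and the echo counts on $e$ differ from $2n_eN$ by less than $N$. (b) For the tenth link the echo count depends on the curvature: for every $E$, $e$ and $\eta>0$ there is $\varepsilon>0$ such that, whenever $Np_\tau<\varepsilon$, in every arrangement with axis $E_1$ in which all nine links other than $e$ have flat-space echo counts, any echo count $\Delta$ on $e$ with $|\Delta-2n_eN|<N$ satisfies $$\bigl|\Delta-2n_eN-N(Np_t)^2\,\kappa_e(R)\bigr|\le\eta\,N(Np_t)^2,$$ where $R$ is the matrix of the Ricci tensor of $\hat h$ at $p$ in the frame $E$.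 (c) If $\hat h$ is curved at $p$ (its Ricci tensor, equivalently, in dimension three, its Riemann tensor, is not zero there), then for all $u$ in an open dense set of vectors there is $\varepsilon>0$ such that, whenever $Np_\tau<\varepsilon$, every arrangement with axis $u$ has at least one link with an echo count different from its flat-space value at every tick. 2. Suppose the curvature is generic, in the sense that $R\in G$ for some $\hat h$-orthonormal frame at $p$. Then for every $N$ there is $\varepsilon>0$ such that for every $p_\tau<\varepsilon$ for which no arrangement has all ten links with the flat-space channels and null phases, the following holds. Consider arrangements with channels $\{(k.0,(k+n_{XY}N).\phi_{XY,k})\}$ on all ten links. For $m=1,\dots,10$ the least possible maximum of $|\phi_{XY,k}|$, over the arrangements in which at most the links of some $m$-element set have non-zero phases, is attained and strictly decreases as $m$ grows from $1$ to $10$. Likewise, for each prescribed non-empty set $L$ of links allowed non-zero phases, the least possible maximum is attained, and it strictly decreases when $L$ is strictly enlarged. 3. The periods of all five clocks can be taken to be $p_t$, as in 1(a); in every arrangement with channels as in 2, for any $N\ge1$ and $p_\tau>0$, they all equal $p_t$. -/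

import Mathlib

open scoped ContDiff

namespace OpenMachines

noncomputable section

/-! ### Metrics in coordinates (units with speed of light one) -/

/-- Partial derivative of `f` along the `i`-th coordinate. -/
def pd {n : ℕ} (i : Fin n) (f : (Fin n → ℝ) → ℝ) (x : Fin n → ℝ) : ℝ :=
  fderiv ℝ f x (Pi.single i 1)

/-- Christoffel symbol `Γ^a_{bc}` of the metric tensor field `g`. -/
def christoffel {n : ℕ} (g : (Fin n → ℝ) → Matrix (Fin n) (Fin n) ℝ)
    (a b c : Fin n) (x : Fin n → ℝ) : ℝ :=
  (1 / 2) * ∑ d, (g x)⁻¹ a d *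
    (pd b (fun y => g y d c) x + pd c (fun y => g y d b) x - pd d (fun y => g y b c) x)

/-- Ricci tensor of the metric tensor field `g`. -/
def ricci {n : ℕ} (g : (Fin n → ℝ) → Matrix (Fin n) (Fin n) ℝ) (x : Fin n → ℝ) :
    Matrix (Fin n) (Fin n) ℝ :=
  Matrix.of fun b c =>
    ∑ a, (pd a (christoffel g a b c) x - pd c (christoffel g a b a) x
      + ∑ e, (christoffel g a a e x * christoffel g e b c x
        - christoffel g a c e x * christoffel g e b a x))

/-- A static spacetime region in adapted coordinates `(t, x)`: the set `ℝ × domain` with the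
Lorentzian metric `-(lapse x)² dt² + ∑ spatial x i j dxⁱ dxʲ`. -/
structure StaticSpacetime where
  domain : Set (Fin 3 → ℝ)
  isOpen_domain : IsOpen domain
  lapse : (Fin 3 → ℝ) → ℝ
  lapse_pos : ∀ x ∈ domain, 0 < lapse x
  lapse_smooth : ContDiffOn ℝ ∞ lapse domain
  spatial : (Fin 3 → ℝ) → Matrix (Fin 3) (Fin 3) ℝ
  spatial_posDef : ∀ x ∈ domain, (spatial x).PosDef
  spatial_smooth : ∀ i j, ContDiffOn ℝ ∞ (fun x => spatial x i j) domain

/-- The event with time coordinate `t` and space coordinates `x`. -/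
def event (t : ℝ) (x : Fin 3 → ℝ) : Fin 4 → ℝ := Matrix.vecCons t x

/-- The space coordinates of an event. -/
def place (z : Fin 4 → ℝ) : Fin 3 → ℝ := Matrix.vecTail z

namespace StaticSpacetime

variable (S : StaticSpacetime)

/-- The Lorentzian metric tensor; coordinate `0` is time. -/
def metric (z : Fin 4 → ℝ) : Matrix (Fin 4) (Fin 4) ℝ :=
  Matrix.of (Matrix.vecCons (event (-(S.lapse (place z)) ^ 2) 0)
    (fun i => event 0 (S.spatial (place z) i)))

/-- The optical metric `spatial / lapse²` on space. It is the spatial part of the conformal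
rescaling of the spacetime metric by `lapse⁻²`, whose time part is `-dt²`. -/
def opticalMetric (x : Fin 3 → ℝ) : Matrix (Fin 3) (Fin 3) ℝ :=
  ((S.lapse x) ^ 2)⁻¹ • S.spatial x

/-- Ricci tensor of the optical metric (space being three-dimensional, it determines the whole
Riemann tensor of the optical metric). -/
def opticalRicci (x : Fin 3 → ℝ) : Matrix (Fin 3) (Fin 3) ℝ := ricci S.opticalMetric x

/-- The curve `γ`, with velocity `w`, is a future-pointing null geodesic of the spacetime, affinely
parametrized by `[0, 1]`. -/
def IsNullGeodesic (γ w : ℝ → Fin 4 → ℝ) : Prop :=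
  ∀ r ∈ Set.Icc (0 : ℝ) 1,
    place (γ r) ∈ S.domain ∧
    HasDerivWithinAt γ (w r) (Set.Icc 0 1) r ∧
    HasDerivWithinAt w
      (fun a => -∑ b, ∑ c, christoffel S.metric a b c (γ r) * w r b * w r c) (Set.Icc 0 1) r ∧
    w r ⬝ᵥ (S.metric (γ r)).mulVec (w r) = 0 ∧
    0 < w r 0

/-- A light signal emitted at the event `z` is received at the event `z'`. -/
def Signal (z z' : Fin 4 → ℝ) : Prop :=
  ∃ γ w, S.IsNullGeodesic γ w ∧ γ 0 = z ∧ γ 1 = z'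

/-- Every event of the static worldline at `y` is reached by exactly one future-pointing null
geodesic from the static worldline at `x`, and by exactly one past-pointing null geodesic from it
(that is, it emits exactly one future-pointing null geodesic to it). -/
def ReachedUniquely (x y : Fin 3 → ℝ) : Prop :=
  ∀ t : ℝ,
    ((∃ γ w, S.IsNullGeodesic γ w ∧ place (γ 0) = x ∧ γ 1 = event t y) ∧
      ∀ γ w γ' w', S.IsNullGeodesic γ w → S.IsNullGeodesic γ' w' →
        place (γ 0) = x → γ 1 = event t y → place (γ' 0) = x → γ' 1 = event t y →
        Set.EqOn γ γ' (Set.Icc 0 1)) ∧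
    ((∃ γ w, S.IsNullGeodesic γ w ∧ γ 0 = event t y ∧ place (γ 1) = x) ∧
      ∀ γ w γ' w', S.IsNullGeodesic γ w → S.IsNullGeodesic γ' w' →
        γ 0 = event t y → place (γ 1) = x → γ' 0 = event t y → place (γ' 1) = x →
        Set.EqOn γ γ' (Set.Icc 0 1))

/-- Radar linkability of the static worldlines at `x` and at `y`. -/
def RadarLinkable (x y : Fin 3 → ℝ) : Prop :=
  S.ReachedUniquely x y ∧ S.ReachedUniquely y x

/-- Some light signal from the static worldline at `x` to the one at `y` leaves `x` in the spatial
direction `u`. -/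
def AimedAt (x y u : Fin 3 → ℝ) : Prop :=
  ∃ γ w, S.IsNullGeodesic γ w ∧ place (γ 0) = x ∧ place (γ 1) = y ∧
    ∃ c : ℝ, 0 < c ∧ place (w 0) = c • u

/-- The columns of `E` are an orthonormal frame of the optical metric at `x`. -/
def IsFrame (x : Fin 3 → ℝ) (E : Matrix (Fin 3) (Fin 3) ℝ) : Prop :=
  E.transpose * S.opticalMetric x * E = 1

/-- Components of the optical Ricci tensor at `x` in the frame `E`. -/
def frameRicci (x : Fin 3 → ℝ) (E : Matrix (Fin 3) (Fin 3) ℝ) : Matrix (Fin 3) (Fin 3) ℝ :=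
  E.transpose * S.opticalRicci x * E

end StaticSpacetime

/-! ### Machines, channels, echo counts -/

/-- An open machine fixed at a place in space, whose clock has a constant period
(`period` is measured in coordinate time, as is the time `start` of clock reading `0`). -/
structure Machine where
  pos : Fin 3 → ℝ
  start : ℝ
  period : ℝ
  period_pos : 0 < period

/-- The worldline of a machine, parametrized by its clock reading. -/
def Machine.worldline (A : Machine) (ζ : ℝ) : Fin 4 → ℝ :=
  event (A.start + A.period * ζ) A.pos

/-- The range of phases. -/
def phases : Set ℝ := Set.Ioc (-1 / 2) (1 / 2)

/-- The five machines: `A n` for `n : Fin 3` and `B j` for `j : Fin 2`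
(`B 0` and `B 1` are the machines called B1 and B2). -/
inductive Label where
  | A (n : Fin 3)
  | B (j : Fin 2)
  deriving DecidableEq, Fintype

/-- Cycles, in units of `N`, counted by a signal between two machines in the flat
arrangement: three between two `A`s, two otherwise. -/
def hop : Label → Label → ℕ
  | .A _, .A _ => 3
  | _, _ => 2

/-- The ten two-way links. -/
def links : Finset (Sym2 Label) := (⊤ : SimpleGraph Label).edgeFinset

namespace StaticSpacetime

variable (S : StaticSpacetime)

/-- Proper time elapsed on a machine during one period of its clock. -/
def properPeriod (A : Machine) : ℝ := S.lapse A.pos * A.period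

/-- The channel from `A` to `B`: the pairs of an `A`-reading and a `B`-reading, each of the form
(count, phase), such that a signal sent at the former is received at the latter. -/
def channel (A B : Machine) : Set ((ℤ × ℝ) × (ℤ × ℝ)) :=
  {q | q.1.2 ∈ phases ∧ q.2.2 ∈ phases ∧
    S.Signal (A.worldline (q.1.1 + q.1.2)) (B.worldline (q.2.1 + q.2.2))}

/-- `Δ` is the echo count from `A` to `B` at the tick `m` of `A`: a signal sent by `A` at `m` and
echoed by `B` at once is back at the `A`-reading `m + Δ`. -/
def EchoCount (A B : Machine) (m : ℤ) (Δ : ℝ) : Prop :=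
  ∃ ζ : ℝ, S.Signal (A.worldline m) (B.worldline ζ) ∧
    S.Signal (B.worldline ζ) (A.worldline (m + Δ))

/-- Five machines at distinct places of `U`, with `B1` at `p` and ticking at proper
period `τ`. -/
structure IsArrangement (U : Set (Fin 3 → ℝ)) (p : Fin 3 → ℝ) (τ : ℝ) (M : Label → Machine) :
    Prop where
  mem : ∀ i, (M i).pos ∈ U
  distinct : ∀ i j, i ≠ j → (M i).pos ≠ (M j).pos
  pos_B : (M (.B 0)).pos = p
  proper_B : S.properPeriod (M (.B 0)) = τ

/-- The channels between all the machines contain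
`(k.0, (k + hop * N).φ)` for `k = 0, 1, 2, …`, with phases `φ = φ i j k`. -/
def HasChannels (N : ℕ) (M : Label → Machine) (φ : Label → Label → ℕ → ℝ) : Prop :=
  ∀ i j, i ≠ j → ∀ k : ℕ,
    (((k : ℤ), (0 : ℝ)), ((k : ℤ) + (hop i j * N : ℕ), φ i j k)) ∈ S.channel (M i) (M j)

/-- The channel from `i` to `j` contains `(k.0, (k + hop * N).0)` for `k = 0, 1, 2, …`. -/
def NullChannel (N : ℕ) (M : Label → Machine) (i j : Label) : Prop :=
  ∀ k : ℕ,
    (((k : ℤ), (0 : ℝ)), ((k : ℤ) + (hop i j * N : ℕ), (0 : ℝ))) ∈ S.channel (M i) (M j)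

/-- The echo count from `i` to `j` is, at every tick, what it is in flat spacetime. -/
def FlatEcho (N : ℕ) (M : Label → Machine) (i j : Label) : Prop :=
  ∀ m : ℤ, S.EchoCount (M i) (M j) m (2 * hop i j * N)

/-- The bounds `a` for which some arrangement has channels with flat counts, with phases that are
null outside the set `L` of links and have amplitude at most `a`. The minimum of this set is the
least possible maximum amplitude of a phase. -/
def phaseBounds (U : Set (Fin 3 → ℝ)) (p : Fin 3 → ℝ) (N : ℕ) (τ : ℝ)
    (L : Finset (Sym2 Label)) : Set ℝ :=
  {a | ∃ M φ, S.IsArrangement U p τ M ∧ S.HasChannels N M φ ∧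
    (∀ i j, i ≠ j → s(i, j) ∉ L → ∀ k, φ i j k = 0) ∧
    (∀ i j, i ≠ j → ∀ k, |φ i j k| ≤ a)}

end StaticSpacetime

end

end OpenMachines

namespace OpenMachines
set_option maxSynthPendingDepth 3
noncomputable section

/-! ### The flat bipyramid -/

/-! Null geodesics are conformally invariant, and the spacetime metric divided by the squared lapse
is -dt² plus the optical metric. A signal between static places therefore follows an optical
geodesic and takes a coordinate time equal to its optical length, so echo counts and phases read off
optical distances in units of the clock period. With s = N p_t as unit of length, the flat pattern
asks that the ten mutual distances be those of a triangular bipyramid: axis B₁B₂ and lateral edges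
of length 2, triangle A₁A₂A₃ of side 3.

Five points of Euclidean space have 15 - 6 = 9 shape parameters but ten mutual distances, so the
squared distances satisfy one equation, the vanishing of `gramDet`. Its gradient at the bipyramid is
proportional to the self-stress `stress`, whose values are -9 on the axis, 6 on the lateral edges
and -4 on the sides of the triangle. As no value is zero, nine lengths can be prescribed and the
tenth is then locally determined. `exists_family` solves for the first nine by a contraction around
an explicit flat configuration; `exists_config` passes to any other exceptional link by the
intermediate value theorem.

In a curved optical geometry the squared distance, in rescaled coordinates, is the Euclidean one
between normal coordinates plus s² `corr` plus o(s²) (`sqDist_expand`). The Euclidean part obeys the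
Gram equation, so up to o(s²) it drops out of the stress-weighted sum of the defects. What remains
is s² times the stress-weighted sum of the corrections, and an algebraic identity
(`stressCorr_basis`) evaluates this sum as K(u) = -45 Ric(u,u) + (27/2) tr Ric, with u the unit
vector along the axis. The resulting relation, ∑ stress (q - side²) = s² K(u) + o(s²), is
`linkSq_expand`, and the claims about curvature rest on it.

If nine lengths are flat, the relation gives the defect of the tenth, hence its echo count, with
functional K / (stress · side). If all ten were flat, K(u) would have to vanish in the limit; K is a
non-zero quadratic form as soon as the Ricci tensor is non-zero, so this fails for an open dense set
of directions u.

For phases, channels for all ticks force equal periods, and the two phases of a link add up to 2N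
times the excess of its length. The least amplitude for a set L of links is thus N times the least
maximal deviation of lengths on L, over all orientations. The relation gives N s² (min |K|) / (sum
over L of 2 · side · |stress|) up to o(s²), and this drops strictly when L grows. Generic curvature
means that the form K is nonsingular. If K takes both signs, turning the axis while nine lengths
stay flat makes the tenth pass through its flat value, so null phases are possible everywhere, which
is excluded; otherwise |K| has a positive minimum on unit vectors and the estimate applies. -/

/-- Coordinate space. -/
abbrev Space := Fin 3 → ℝ

/-- Bilinear forms on coordinate space. -/
abbrev Form := Space →L[ℝ] Space →L[ℝ] ℝ

/-- Bilinear maps of coordinate space to itself. -/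
abbrev Bil := Space →L[ℝ] Space →L[ℝ] Space

/-- The bilinear form of a matrix. -/
def formOf (A : Matrix (Fin 3) (Fin 3) ℝ) : Form :=
  ∑ i, ∑ j, A i j • (ContinuousLinearMap.proj (R := ℝ) (φ := fun _ : Fin 3 => ℝ) i).smulRight
    (ContinuousLinearMap.proj (R := ℝ) (φ := fun _ : Fin 3 => ℝ) j)

theorem formOf_apply (A : Matrix (Fin 3) (Fin 3) ℝ) (u v : Space) :
    formOf A u v = u ⬝ᵥ A.mulVec v := by
  simp [formOf, dotProduct, Matrix.mulVec, Finset.mul_sum]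
  refine Finset.sum_congr rfl fun i _ => Finset.sum_congr rfl fun j _ => by ring

theorem formOf_comm {A : Matrix (Fin 3) (Fin 3) ℝ} (hA : A.IsSymm) (u v : Space) :
    formOf A u v = formOf A v u := by
  rw [formOf_apply, formOf_apply, Matrix.dotProduct_mulVec, ← Matrix.mulVec_transpose, hA,
    dotProduct_comm]

/-- The first machine of each link. -/
def fstL : Fin 10 → Label :=
  ![.B 0, .B 0, .B 0, .B 0, .B 1, .B 1, .B 1, .A 0, .A 0, .A 1]

/-- The second machine of each link. -/
def sndL : Fin 10 → Label :=
  ![.B 1, .A 0, .A 1, .A 2, .A 0, .A 1, .A 2, .A 1, .A 2, .A 2]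

/-- The link of index `k`. -/
def linkOf (k : Fin 10) : Sym2 Label := s(fstL k, sndL k)

/-- Side lengths of the bipyramid. -/
def side (k : Fin 10) : ℝ := hop (fstL k) (sndL k)

/-- The self-stress of the bipyramid. -/
def stress : Fin 10 → ℝ := ![-9, 6, 6, 6, 6, 6, 6, -4, -4, -4]

theorem stress_ne (k : Fin 10) : stress k ≠ 0 := by
  fin_cases k <;> norm_num [stress]

theorem side_eq : side = ![2, 2, 2, 2, 2, 2, 2, 3, 3, 3] := by
  funext k
  fin_cases k <;> simp [side, fstL, sndL, hop]

theorem fstL_ne_sndL (k : Fin 10) : fstL k ≠ sndL k := by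
  revert k; decide

theorem linkOf_injective : Function.Injective linkOf := by
  unfold Function.Injective; decide

theorem linkOf_mem (k : Fin 10) : linkOf k ∈ links := by
  simp [links, linkOf, fstL_ne_sndL]

theorem exists_linkOf (i j : Label) (h : i ≠ j) :
    ∃ k, (fstL k = i ∧ sndL k = j) ∨ (fstL k = j ∧ sndL k = i) := by
  revert i j; decide

theorem exists_linkOf_eq {e : Sym2 Label} (he : e ∈ links) : ∃ k, linkOf k = e := by
  induction e using Sym2.ind with
  | _ i j =>
    have hij : i ≠ j := by simpa [links] using he
    obtain ⟨k, ⟨h1, h2⟩ | ⟨h1, h2⟩⟩ := exists_linkOf i j hij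
    · exact ⟨k, by rw [linkOf, h1, h2]⟩
    · exact ⟨k, by rw [linkOf, h1, h2, Sym2.eq_swap]⟩

/-- Squared lengths of the links of a configuration. -/
def sqLen (H : Form) (P : Label → Space) (k : Fin 10) : ℝ :=
  H (P (sndL k) - P (fstL k)) (P (sndL k) - P (fstL k))

/-- The second-order correction to the squared distance from `z` to `z + D`. -/
def corr (H : Form) (Λ : Space →L[ℝ] Bil) (z D : Space) : ℝ :=
  H D (Λ z D D) + (1 / 3) * H D (Λ D D D) + H D (Λ z z D)

/-- The sum of the corrections over the links, weighted by the stress. -/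
def stressCorr (H : Form) (Λ : Space →L[ℝ] Bil) (P : Label → Space) : ℝ :=
  ∑ k, stress k * corr H Λ (P (fstL k)) (P (sndL k) - P (fstL k))

/-- The Ricci tensor of a connection with derivative `Λ` in normal coordinates. -/
def ricciOf (Λ : Space →L[ℝ] Bil) : Matrix (Fin 3) (Fin 3) ℝ :=
  Matrix.of fun b c => ∑ a, (Λ (Pi.single a 1) (Pi.single b 1) (Pi.single c 1)
    - Λ (Pi.single c 1) (Pi.single b 1) (Pi.single a 1)) a

/-- The curvature functional, without its normalization. -/
def curvK (R : Matrix (Fin 3) (Fin 3) ℝ) : ℝ := -45 * R 0 0 + 27 / 2 * R.trace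

theorem sum_single_smul (u : Space) : u = ∑ i, u i • (Pi.single i 1 : Space) := by
  ext j; simp [Finset.sum_apply, Pi.single_apply]

/-- A trace may be computed in any basis: `E * (E.transpose * H) = 1`, so cycling the factors
removes the frame. -/
theorem sum_form_frame {H E : Matrix (Fin 3) (Fin 3) ℝ} (hE : E.transpose * H * E = 1)
    (f : Space →L[ℝ] Space) :
    ∑ k, formOf H (fun i => E i k) (f fun i => E i k) = ∑ a, f (Pi.single a 1) a := by
  set F : Matrix (Fin 3) (Fin 3) ℝ := LinearMap.toMatrix' (f : Space →ₗ[ℝ] Space) with hF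
  have hf : ∀ v, f v = F.mulVec v := fun v => by
    rw [hF]
    exact (LinearMap.toMatrix'_mulVec (f : Space →ₗ[ℝ] Space) v).symm
  have h1 : (E.transpose * (H * F * E)).trace = F.trace := by
    have h2 : E * (E.transpose * H) = 1 := mul_eq_one_comm.mp hE
    calc (E.transpose * (H * F * E)).trace = ((E.transpose * H * F) * E).trace := by
          simp only [Matrix.mul_assoc]
      _ = (E * (E.transpose * H) * F).trace := by
          rw [Matrix.trace_mul_comm]; simp only [Matrix.mul_assoc]
      _ = F.trace := by rw [h2, one_mul]
  have h3 : ∀ a, f (Pi.single a 1) a = F a a := fun a => by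
    rw [hf]; simp
  simp only [h3]
  change _ = F.trace
  rw [← h1]
  simp only [Matrix.trace, Matrix.diag]
  refine Finset.sum_congr rfl fun k _ => ?_
  rw [formOf_apply, hf, Matrix.mulVec_mulVec, Matrix.mul_apply]
  simp only [dotProduct, Matrix.transpose_apply]
  refine Finset.sum_congr rfl fun i _ => ?_
  congr 1

theorem ricciOf_apply (Λ : Space →L[ℝ] Bil) (u v : Space) :
    u ⬝ᵥ (ricciOf Λ).mulVec v =
      ∑ a, (Λ (Pi.single a 1) u v - Λ v u (Pi.single a 1)) a := by
  conv_rhs => rw [sum_single_smul u, sum_single_smul v]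
  simp only [ricciOf, dotProduct, Matrix.mulVec, Matrix.of_apply, Fin.sum_univ_three, map_add,
    map_smul, add_apply, smul_apply, Pi.add_apply,
    Pi.smul_apply, Pi.sub_apply, smul_eq_mul]
  ring

theorem ricciOf_frame {H E : Matrix (Fin 3) (Fin 3) ℝ} (hE : E.transpose * H * E = 1)
    (Λ : Space →L[ℝ] Bil) (u v : Space) :
    u ⬝ᵥ (ricciOf Λ).mulVec v = ∑ k, (formOf H (fun i => E i k) (Λ (fun i => E i k) u v)
      - formOf H (fun i => E i k) (Λ v u (fun i => E i k))) := by
  rw [ricciOf_apply, Finset.sum_sub_distrib]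
  have h1 := sum_form_frame hE ((ContinuousLinearMap.apply ℝ Space v).comp
    ((ContinuousLinearMap.apply ℝ (Space →L[ℝ] Space) u).comp Λ))
  have h2 := sum_form_frame hE (Λ v u)
  simp only [ContinuousLinearMap.comp_apply, ContinuousLinearMap.apply_apply] at h1
  rw [h1, h2, ← Finset.sum_sub_distrib]
  rfl

/-- Both sides are the metric trace of `R`, that is, the trace of `R * H⁻¹`. -/
theorem trace_frame_eq {H E F R : Matrix (Fin 3) (Fin 3) ℝ} (hE : E.transpose * H * E = 1)
    (hF : F.transpose * H * F = 1) :
    (E.transpose * R * E).trace = (F.transpose * R * F).trace := by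
  have key : ∀ E : Matrix (Fin 3) (Fin 3) ℝ, E.transpose * H * E = 1 →
      (E.transpose * R * E).trace = (R * H⁻¹).trace := by
    intro E hE
    have h2 : E * E.transpose * H = 1 := by
      rw [Matrix.mul_assoc]; exact mul_eq_one_comm.mp hE
    rw [Matrix.inv_eq_left_inv h2, Matrix.mul_assoc, Matrix.trace_mul_comm, Matrix.mul_assoc]
  rw [key E hE, key F hF]

theorem frame_mul_entry (E R : Matrix (Fin 3) (Fin 3) ℝ) (i j : Fin 3) :
    (E.transpose * R * E) i j = (fun k => E k i) ⬝ᵥ R.mulVec (fun k => E k j) := by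
  rw [Matrix.mul_assoc, Matrix.mul_apply]
  simp only [dotProduct, Matrix.transpose_apply]
  refine Finset.sum_congr rfl fun i _ => ?_
  congr 1

theorem formOf_sub_self {H : Matrix (Fin 3) (Fin 3) ℝ} (hH : H.IsSymm) (u v : Space) :
    formOf H (u - v) (u - v) = formOf H u u + formOf H v v - 2 * formOf H u v := by
  have := formOf_comm hH u v
  simp only [map_sub, sub_apply]
  linarith

/-- A configuration with the side lengths of the bipyramid is a bipyramid, in the basis
`f₀, f₁, f₂` of an orthogonal frame. -/
theorem exists_frame_of_sqLen {H : Matrix (Fin 3) (Fin 3) ℝ} (hH : H.PosDef) {P : Label → Space}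
    (h0 : P (.B 0) = 0) (hP : ∀ k, sqLen (formOf H) P k = side k ^ 2) :
    ∃ f : Fin 3 → Space, P (.B 1) = (2 : ℝ) • f 0 ∧ P (.A 0) = f 0 + (2 : ℝ) • f 1 ∧
      P (.A 1) = f 0 - f 1 + (3 : ℝ) • f 2 ∧ P (.A 2) = f 0 - f 1 - (3 : ℝ) • f 2 ∧
      formOf H (f 0) (f 0) = 1 ∧ formOf H (f 1) (f 1) = 3 / 4 ∧ formOf H (f 2) (f 2) = 1 / 4 ∧
      formOf H (f 0) (f 1) = 0 ∧ formOf H (f 0) (f 2) = 0 ∧ formOf H (f 1) (f 2) = 0 := by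
  have hs : H.IsSymm := by simpa using! hH.isHermitian
  have c := formOf_comm hs
  have d := formOf_sub_self hs
  have e := fun k => (hP k)
  simp only [sqLen, side_eq] at e
  have e0 := e 0; have e1 := e 1; have e2 := e 2; have e3 := e 3; have e4 := e 4
  have e5 := e 5; have e6 := e 6; have e7 := e 7; have e8 := e 8; have e9 := e 9
  simp [fstL, sndL, h0] at e0 e1 e2 e3 e4 e5 e6 e7 e8 e9
  -- The centroid of the `A`s is the midpoint of the axis: the ten lengths determine the squared
  -- norm of this combination, which comes out as zero, and `H` is positive definite.
  have z : P (.A 0) + P (.A 1) + P (.A 2) - (3 / 2 : ℝ) • P (.B 1) = 0 := by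
    by_contra hne
    have hpos := hH.dotProduct_mulVec_pos hne
    simp only [star_trivial] at hpos
    rw [← formOf_apply] at hpos
    simp only [map_add, map_sub, map_smul, add_apply,
      sub_apply, smul_apply, smul_eq_mul] at *
    linarith [c (P (.A 0)) (P (.A 1)), c (P (.A 0)) (P (.A 2)), c (P (.A 2)) (P (.A 1)),
      c (P (.A 0)) (P (.B 1)), c (P (.B 1)) (P (.A 1)), c (P (.A 2)) (P (.B 1))]
  have z' : P (.A 2) = (3 / 2 : ℝ) • P (.B 1) - P (.A 0) - P (.A 1) := by
    have := sub_eq_zero.mp z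
    rw [← this]; abel
  -- Half the axis, half the vector from the midpoint of the axis to the first `A`, and a sixth of
  -- the opposite side of the triangle. Their lengths are 1, √3/2 and 1/2.
  refine ⟨![(1 / 2 : ℝ) • P (.B 1), (1 / 2 : ℝ) • P (.A 0) - (1 / 4 : ℝ) • P (.B 1),
    (1 / 6 : ℝ) • P (.A 1) - (1 / 6 : ℝ) • P (.A 2)], ?_, ?_, ?_, ?_, ?_⟩
  · simp [smul_smul]
  · simp only [Matrix.cons_val]; module
  · simp only [Matrix.cons_val, z']; module
  · simp only [Matrix.cons_val, z']; module
  · have c1 := c (P (.A 0)) (P (.A 1)); have c2 := c (P (.A 0)) (P (.A 2))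
    have c3 := c (P (.A 1)) (P (.A 2)); have c4 := c (P (.A 0)) (P (.B 1))
    have c5 := c (P (.A 1)) (P (.B 1)); have c6 := c (P (.A 2)) (P (.B 1))
    simp only [map_sub, map_smul, Matrix.cons_val, sub_apply, smul_apply, smul_eq_mul] at *
    refine ⟨?_, ?_, ?_, ?_, ?_, ?_⟩ <;> linarith

end

/-! ### The stress identity and the Gram determinant. -/

noncomputable section

set_option maxHeartbeats 1000000 in
/-- The identity that makes the stress-weighted corrections a curvature. -/
theorem stressCorr_basis (H : Form) (Λ : Space →L[ℝ] Bil) (f : Fin 3 → Space)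
    {P : Label → Space} (p0 : P (.B 0) = 0) (p1 : P (.B 1) = (2 : ℝ) • f 0)
    (p2 : P (.A 0) = f 0 + (2 : ℝ) • f 1) (p3 : P (.A 1) = f 0 - f 1 + (3 : ℝ) • f 2)
    (p4 : P (.A 2) = f 0 - f 1 - (3 : ℝ) • f 2)
    (sym : ∀ c d b, Λ c d b = Λ c b d)
    (cpt : ∀ a b c d, H a (Λ c d b) + H b (Λ c d a) = H a (Λ d c b) + H b (Λ d c a)) :
    let w : Fin 3 → ℝ := ![1, 4 / 3, 4]
    let ric : Fin 3 → Fin 3 → ℝ := fun b c =>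
      ∑ k, w k * (H (f k) (Λ (f k) (f b) (f c)) - H (f k) (Λ (f c) (f b) (f k)))
    stressCorr H Λ P = -45 * ric 0 0 + 27 / 2 * ∑ k, w k * ric k k := by
  intro w ric
  have s01 : ∀ c, Λ c (f 1) (f 0) = Λ c (f 0) (f 1) := fun c => sym c _ _
  have s02 : ∀ c, Λ c (f 2) (f 0) = Λ c (f 0) (f 2) := fun c => sym c _ _
  have s12 : ∀ c, Λ c (f 2) (f 1) = Λ c (f 1) (f 2) := fun c => sym c _ _
  -- These instances of skewness of the curvature are all that the identity needs besides
  -- torsion-freeness.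
  have c1 := cpt (f 0) (f 1) (f 0) (f 1)
  have c2 := cpt (f 0) (f 2) (f 0) (f 2)
  have c3 := cpt (f 1) (f 1) (f 0) (f 1)
  have c4 := cpt (f 1) (f 2) (f 1) (f 2)
  have c5 := cpt (f 2) (f 2) (f 0) (f 2)
  have c6 := cpt (f 2) (f 2) (f 1) (f 2)
  simp only [s01, s02, s12] at c1 c2 c3 c4 c5 c6
  simp only [stressCorr, corr, stress, fstL, sndL, ric, w, Fin.sum_univ_succ, Fin.succ_zero_eq_one,
    Fin.succ_one_eq_two, Finset.univ_unique, Fin.default_eq_zero, Finset.sum_singleton,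
    Matrix.cons_val_zero, Matrix.cons_val_succ, p0, p1, p2,
    p3, p4]
  simp only [sub_zero, map_zero, map_add, map_sub, map_smul, add_apply, sub_apply, smul_apply,
    zero_apply, smul_eq_mul, s01, s02, s12]
  -- From here the components of the connection derivative are independent real unknowns, in which
  -- the identity is linear.
  obtain ⟨L, hL⟩ : ∃ L : Fin 3 → Fin 3 → Fin 3 → Fin 3 → ℝ,
      ∀ c d b a, H (f a) (Λ (f c) (f d) (f b)) = L c d b a := ⟨_, fun _ _ _ _ => rfl⟩
  simp only [hL] at c1 c2 c3 c4 c5 c6 ⊢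
  generalize L 0 0 0 0 = x0000 at *; generalize L 0 0 0 1 = x0001 at *; generalize L 0 0 0 2 = x0002 at *
  generalize L 0 0 1 0 = x0010 at *; generalize L 0 0 1 1 = x0011 at *; generalize L 0 0 1 2 = x0012 at *
  generalize L 0 0 2 0 = x0020 at *; generalize L 0 0 2 1 = x0021 at *; generalize L 0 0 2 2 = x0022 at *
  generalize L 0 1 1 0 = x0110 at *; generalize L 0 1 1 1 = x0111 at *; generalize L 0 1 1 2 = x0112 at *
  generalize L 0 1 2 0 = x0120 at *; generalize L 0 1 2 1 = x0121 at *; generalize L 0 1 2 2 = x0122 at *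
  generalize L 0 2 2 0 = x0220 at *; generalize L 0 2 2 1 = x0221 at *; generalize L 0 2 2 2 = x0222 at *
  generalize L 1 0 0 0 = x1000 at *; generalize L 1 0 0 1 = x1001 at *; generalize L 1 0 0 2 = x1002 at *
  generalize L 1 0 1 0 = x1010 at *; generalize L 1 0 1 1 = x1011 at *; generalize L 1 0 1 2 = x1012 at *
  generalize L 1 0 2 0 = x1020 at *; generalize L 1 0 2 1 = x1021 at *; generalize L 1 0 2 2 = x1022 at *
  generalize L 1 1 1 0 = x1110 at *; generalize L 1 1 1 1 = x1111 at *; generalize L 1 1 1 2 = x1112 at *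
  generalize L 1 1 2 0 = x1120 at *; generalize L 1 1 2 1 = x1121 at *; generalize L 1 1 2 2 = x1122 at *
  generalize L 1 2 2 0 = x1220 at *; generalize L 1 2 2 1 = x1221 at *; generalize L 1 2 2 2 = x1222 at *
  generalize L 2 0 0 0 = x2000 at *; generalize L 2 0 0 1 = x2001 at *; generalize L 2 0 0 2 = x2002 at *
  generalize L 2 0 1 0 = x2010 at *; generalize L 2 0 1 1 = x2011 at *; generalize L 2 0 1 2 = x2012 at *
  generalize L 2 0 2 0 = x2020 at *; generalize L 2 0 2 1 = x2021 at *; generalize L 2 0 2 2 = x2022 at *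
  generalize L 2 1 1 0 = x2110 at *; generalize L 2 1 1 1 = x2111 at *; generalize L 2 1 1 2 = x2112 at *
  generalize L 2 1 2 0 = x2120 at *; generalize L 2 1 2 1 = x2121 at *; generalize L 2 1 2 2 = x2122 at *
  generalize L 2 2 2 0 = x2220 at *; generalize L 2 2 2 1 = x2221 at *; generalize L 2 2 2 2 = x2222 at *
  linear_combination (-66) * c1 - 198 * c2 + 72 * c3 + 216 * c4 + 216 * c5 - 216 * c6

/-- Scaling the adapted orthogonal frame by 1, 2/√3 and 2 makes it orthonormal; the weights 1, 4/3
and 4 of `stressCorr_basis` are the squares of these factors, so its weighted sums are true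
contractions. The factor 1/4 appears because the axis vector is twice a unit vector. -/
theorem stressCorr_eq {H : Matrix (Fin 3) (Fin 3) ℝ} (hH : H.PosDef) {P : Label → Space}
    (h0 : P (.B 0) = 0) (hP : ∀ k, sqLen (formOf H) P k = side k ^ 2)
    (Λ : Space →L[ℝ] Bil) (sym : ∀ c d b, Λ c d b = Λ c b d)
    (cpt : ∀ a b c d, formOf H a (Λ c d b) + formOf H b (Λ c d a)
      = formOf H a (Λ d c b) + formOf H b (Λ d c a))
    {E : Matrix (Fin 3) (Fin 3) ℝ} (hE : E.transpose * H * E = 1) :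
    stressCorr (formOf H) Λ P = -45 * ((1 / 4) * P (.B 1) ⬝ᵥ (ricciOf Λ).mulVec (P (.B 1)))
      + 27 / 2 * (E.transpose * ricciOf Λ * E).trace := by
  obtain ⟨f, p1, p2, p3, p4, n0, n1, n2, o01, o02, o12⟩ := exists_frame_of_sqLen hH h0 hP
  have hs : H.IsSymm := by simpa using! hH.isHermitian
  rw [stressCorr_basis _ Λ f h0 p1 p2 p3 p4 sym cpt]
  have o10 := formOf_comm hs (f 1) (f 0)
  have o20 := formOf_comm hs (f 2) (f 0)
  have o21 := formOf_comm hs (f 2) (f 1)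
  set F : Matrix (Fin 3) (Fin 3) ℝ :=
    Matrix.of fun i k => (![1, 2 / √3, 2] : Fin 3 → ℝ) k * f k i with hF
  have h3 : √3 ^ 2 = (3 : ℝ) := Real.sq_sqrt (by norm_num)
  have hcol : ∀ k, (fun i => F i k) = (![1, 2 / √3, 2] : Fin 3 → ℝ) k • f k := fun k => by
    ext i; simp [hF]
  have hFr : F.transpose * H * F = 1 := by
    ext i j
    rw [frame_mul_entry, ← formOf_apply, hcol, hcol]
    fin_cases i <;> fin_cases j <;>
      simp [o01, o02, o12, o10, o20, o21, n0, n1, n2]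
    · field_simp; linarith
    · norm_num
  have hw : ∀ k, (![1, 4 / 3, 4] : Fin 3 → ℝ) k = (![1, 2 / √3, 2] : Fin 3 → ℝ) k ^ 2 := by
    intro k
    fin_cases k
    · simp
    · simp [div_pow, h3]; norm_num
    · simp; norm_num
  have hric : ∀ b c, ∑ k, (![1, 4 / 3, 4] : Fin 3 → ℝ) k *
      (formOf H (f k) (Λ (f k) (f b) (f c)) - formOf H (f k) (Λ (f c) (f b) (f k)))
      = f b ⬝ᵥ (ricciOf Λ).mulVec (f c) := by
    intro b c
    rw [ricciOf_frame hFr]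
    refine Finset.sum_congr rfl fun k _ => ?_
    rw [hcol, hw]
    simp only [map_smul, smul_apply, smul_eq_mul]
    ring
  simp only [hric]
  rw [trace_frame_eq hE hFr, p1]
  congr 1
  · simp only [Matrix.mulVec_smul, dotProduct_smul, smul_dotProduct, smul_eq_mul]; ring
  · congr 1
    simp only [Matrix.trace, Matrix.diag]
    refine Finset.sum_congr rfl fun k _ => ?_
    rw [frame_mul_entry, hcol, hw]
    simp only [Matrix.mulVec_smul, dotProduct_smul, smul_dotProduct, smul_eq_mul]; ring

/-- Determinant of (twice) the Gram matrix of four vectors with given squared distances from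
each other and from the origin. -/
def gramDet (q : Fin 10 → ℝ) : ℝ :=
  Matrix.det !![2 * q 0, q 0 + q 1 - q 4, q 0 + q 2 - q 5, q 0 + q 3 - q 6;
    q 0 + q 1 - q 4, 2 * q 1, q 1 + q 2 - q 7, q 1 + q 3 - q 8;
    q 0 + q 2 - q 5, q 1 + q 2 - q 7, 2 * q 2, q 2 + q 3 - q 9;
    q 0 + q 3 - q 6, q 1 + q 3 - q 8, q 2 + q 3 - q 9, 2 * q 3]

/-- Four vectors in dimension three are linearly dependent, and the coefficients of a dependency
form a null vector of their Gram matrix. -/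
theorem gramDet_sqLen {H : Matrix (Fin 3) (Fin 3) ℝ} (hH : H.IsSymm) {P : Label → Space}
    (h0 : P (.B 0) = 0) : gramDet (sqLen (formOf H) P) = 0 := by
  have c := formOf_comm hH
  set v : Fin 4 → Space := ![P (.B 1), P (.A 0), P (.A 1), P (.A 2)] with hv
  have hdep : ¬ LinearIndependent ℝ v := fun h => by
    have := h.fintype_card_le_finrank
    simp at this
  obtain ⟨g, hg, i, hi⟩ := Fintype.not_linearIndependent_iff.mp hdep
  have hM : gramDet (sqLen (formOf H) P)
      = Matrix.det (Matrix.of fun i j => 2 * formOf H (v i) (v j)) := by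
    unfold gramDet
    congr 1
    ext i j
    fin_cases i <;> fin_cases j <;>
      simp [hv, sqLen, fstL, sndL, h0] <;>
      linarith [c (P (.A 0)) (P (.A 1)), c (P (.A 0)) (P (.A 2)), c (P (.A 2)) (P (.A 1)),
      c (P (.A 0)) (P (.B 1)), c (P (.B 1)) (P (.A 1)), c (P (.A 2)) (P (.B 1))]
  rw [hM, ← Matrix.exists_mulVec_eq_zero_iff]
  refine ⟨g, fun h => hi (by rw [h]; rfl), ?_⟩
  ext i
  have : formOf H (v i) (∑ j, g j • v j) = 0 := by rw [hg, map_zero]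
  simp only [map_sum, map_smul, smul_eq_mul] at this
  simp only [Matrix.mulVec, dotProduct, Matrix.of_apply, Pi.zero_apply]
  calc ∑ x, 2 * formOf H (v i) (v x) * g x = 2 * ∑ x, g x * formOf H (v i) (v x) := by
        rw [Finset.mul_sum]; exact Finset.sum_congr rfl fun _ _ => by ring
    _ = 0 := by rw [this, mul_zero]

theorem contDiff_gramDet : ContDiff ℝ 1 gramDet := by
  unfold gramDet
  simp [Matrix.det_succ_row_zero, Fin.sum_univ_succ, Fin.succAbove]
  fun_prop

/-- Halved quadratic coefficients of `gramDet` in its single variables at the bipyramid. -/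
def gramQuad : Fin 10 → ℝ := ![-243, -63, -63, -63, -63, -63, -63, -48, -48, -48]

/-- The linear coefficient identifies the gradient of `gramDet` at the bipyramid as 108 times the
self-stress; the other factor controls the second root, where the tenth length is far from its flat
value. -/
theorem gramDet_line (k : Fin 10) (t : ℝ) :
    gramDet (fun j => side j ^ 2 + t * (if j = k then 1 else 0))
      = t * (108 * stress k + gramQuad k * t) := by
  rw [side_eq]
  fin_cases k <;>
  simp [gramDet, stress, gramQuad, Matrix.det_succ_row_zero, Fin.sum_univ_succ, Fin.succAbove] <;>
  ring

end

/-! ### Estimates from the vanishing of the Gram determinant. -/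

noncomputable section

/-- Squared side lengths of the bipyramid. -/
def sideSq : Fin 10 → ℝ := fun k => side k ^ 2

theorem side_pos (k : Fin 10) : 0 < side k := by
  rw [side_eq]; fin_cases k <;> norm_num

theorem two_le_side (k : Fin 10) : 2 ≤ side k := by
  rw [side_eq]; fin_cases k <;> norm_num

theorem side_le_three (k : Fin 10) : side k ≤ 3 := by
  rw [side_eq]; fin_cases k <;> norm_num

theorem gramDet_sideSq_add_single (k : Fin 10) (t : ℝ) :
    gramDet (sideSq + t • Pi.single k 1) = t * (108 * stress k + gramQuad k * t) := by
  rw [← gramDet_line]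
  congr 1
  funext j
  simp [sideSq, Pi.single_apply]

/-- With the other nine lengths exact, the closing condition has a second solution: length zero on
the axis or a triangle side, length √(100/7) on a lateral edge. A length within 3/5 of the flat one
keeps away from it. -/
theorem le_abs_gramQuad {k : Fin 10} {t : ℝ} (ht : 0 ≤ sideSq k + t)
    (h : |√(sideSq k + t) - side k| ≤ 3 / 5) : 200 ≤ |108 * stress k + gramQuad k * t| := by
  obtain ⟨h1, h2⟩ := abs_le.mp h
  have hq := Real.sq_sqrt ht
  set r := √(sideSq k + t) with hr
  have hr0 : 0 ≤ r := Real.sqrt_nonneg _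
  have hs : sideSq k = side k ^ 2 := rfl
  have ht' : t = r ^ 2 - side k ^ 2 := by rw [hq, hs]; ring
  rw [le_abs]
  rw [side_eq] at *
  fin_cases k <;> simp [stress, gramQuad] at * <;> first | (left; nlinarith) | (right; nlinarith)

/-- The deviation on the exceptional link is not assumed small. Dropping the nine other deviations
changes `gramDet` by at most a Lipschitz constant times `ξ`; what is left is `δ k` times a factor of
absolute value at least 200. -/
theorem gram_exceptional : ∃ C > 0, ∀ (δ : Fin 10 → ℝ) (k : Fin 10) (ξ : ℝ), ξ ≤ 1 →
    gramDet (sideSq + δ) = 0 → (∀ j ≠ k, |δ j| ≤ ξ) → 0 ≤ sideSq k + δ k →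
    |√(sideSq k + δ k) - side k| ≤ 3 / 5 → |δ k| ≤ C * ξ := by
  -- Squared side lengths are at most 9 and the deviations that occur at most 4, whence the radius
  -- 13.
  obtain ⟨K, hK⟩ := (contDiff_gramDet.contDiffOn (s := Metric.closedBall (0 : Fin 10 → ℝ) 13)
    ).exists_lipschitzOnWith (by decide) (convex_closedBall _ _) (isCompact_closedBall _ _)
  refine ⟨(K + 1) / 200, by positivity, fun δ k ξ hξ hδ hj hk0 hk => ?_⟩
  have hξ0 : 0 ≤ ξ := by
    obtain ⟨j, hjk⟩ := exists_ne k
    exact (abs_nonneg _).trans (hj j hjk)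
  have hlow := le_abs_gramQuad hk0 hk
  have hsq := Real.sq_sqrt hk0
  have h2 := two_le_side k
  have h3 := side_le_three k
  obtain ⟨hk1, hk2⟩ := abs_le.mp hk
  have hsk : ∀ j, 4 ≤ sideSq j ∧ sideSq j ≤ 9 := fun j => by
    have := two_le_side j; have := side_le_three j
    constructor <;> simp only [sideSq] <;> nlinarith
  have hδk : -7 ≤ δ k ∧ δ k ≤ 4 := by
    have hs : sideSq k = side k ^ 2 := rfl
    constructor <;> nlinarith [Real.sqrt_nonneg (sideSq k + δ k)]
  have m1 : sideSq + δ ∈ Metric.closedBall (0 : Fin 10 → ℝ) 13 := by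
    rw [mem_closedBall_zero_iff, pi_norm_le_iff_of_nonneg (by norm_num)]
    intro j
    rw [Real.norm_eq_abs, abs_le, Pi.add_apply]
    by_cases hjk : j = k
    · subst hjk; constructor <;> linarith [(hsk j).1, (hsk j).2, hδk.1, hδk.2]
    · have := abs_le.mp (hj j hjk)
      constructor <;> linarith [(hsk j).1, (hsk j).2, this.1, this.2]
  have m2 : sideSq + δ k • Pi.single k 1 ∈ Metric.closedBall (0 : Fin 10 → ℝ) 13 := by
    rw [mem_closedBall_zero_iff, pi_norm_le_iff_of_nonneg (by norm_num)]
    intro j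
    rw [Real.norm_eq_abs, abs_le, Pi.add_apply]
    by_cases hjk : j = k
    · subst hjk; simp; constructor <;> linarith [(hsk j).1, (hsk j).2, hδk.1, hδk.2]
    · simp [hjk]; constructor <;> linarith [(hsk j).1, (hsk j).2]
  have hL := hK.dist_le_mul _ m2 _ m1
  rw [hδ, gramDet_sideSq_add_single, dist_zero_right, Real.norm_eq_abs, abs_mul] at hL
  have hd : dist (sideSq + δ k • (Pi.single k 1 : Fin 10 → ℝ)) (sideSq + δ) ≤ ξ := by
    rw [dist_add_left, dist_pi_le_iff hξ0]
    intro j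
    by_cases hjk : j = k
    · subst hjk; simpa using hξ0
    · simpa [hjk] using hj j hjk
  have h5 : |δ k| * 200 ≤ K * ξ := (mul_le_mul_of_nonneg_left hlow (abs_nonneg _)).trans
    (hL.trans (mul_le_mul_of_nonneg_left hd K.2))
  have : |δ k| ≤ K * ξ / 200 := by rw [le_div_iff₀ (by norm_num)]; exact h5
  calc |δ k| ≤ K * ξ / 200 := this
    _ ≤ (K + 1) / 200 * ξ := by nlinarith

/-- The derivative of `gramDet` at the bipyramid is 108 times the pairing with the stress, so on the
zero set this pairing is of smaller order than the deviation. -/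
theorem gram_stress (η : ℝ) (hη : 0 < η) : ∃ ξ > 0, ∀ δ : Fin 10 → ℝ, ‖δ‖ ≤ ξ →
    gramDet (sideSq + δ) = 0 → |∑ k, stress k * δ k| ≤ η * ‖δ‖ := by
  have hd : DifferentiableAt ℝ gramDet sideSq := contDiff_gramDet.differentiable (by decide) _
  set L := fderiv ℝ gramDet sideSq with hL
  have h0 : gramDet sideSq = 0 := by
    have := gramDet_sideSq_add_single 0 0
    simpa using this
  have hLk : ∀ k, L (Pi.single k 1) = 108 * stress k := by
    intro k
    have h1 : HasDerivAt (fun t : ℝ => sideSq + t • (Pi.single k 1 : Fin 10 → ℝ))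
        (Pi.single k 1) 0 := by
      simpa using ((hasDerivAt_id (0 : ℝ)).smul_const (Pi.single k 1 : Fin 10 → ℝ)).const_add
        sideSq
    have hd' : HasFDerivAt gramDet L (sideSq + (0 : ℝ) • (Pi.single k 1 : Fin 10 → ℝ)) := by
      simpa using hd.hasFDerivAt
    have h2 := hd'.comp_hasDerivAt (0 : ℝ) h1
    have h3 : HasDerivAt (fun t : ℝ => t * (108 * stress k + gramQuad k * t))
        (108 * stress k) 0 := by
      have := (hasDerivAt_id (0 : ℝ)).mul
        (((hasDerivAt_id (0 : ℝ)).const_mul (gramQuad k)).const_add (108 * stress k))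
      simpa using! this
    refine h2.unique (h3.congr_of_eventuallyEq (Filter.Eventually.of_forall fun t => ?_))
    exact gramDet_sideSq_add_single k t
  have hLs : ∀ δ : Fin 10 → ℝ, L δ = 108 * ∑ k, stress k * δ k := by
    intro δ
    have : δ = ∑ k, δ k • (Pi.single k 1 : Fin 10 → ℝ) := by
      ext j; simp [Finset.sum_apply, Pi.single_apply]
    conv_lhs => rw [this]
    rw [map_sum, Finset.mul_sum]
    refine Finset.sum_congr rfl fun k _ => ?_
    rw [map_smul, hLk, smul_eq_mul]; ring
  have ho := hd.hasFDerivAt.isLittleO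
  rw [Asymptotics.isLittleO_iff] at ho
  have ho' := ho hη
  rw [Metric.eventually_nhds_iff_ball] at ho'
  obtain ⟨ε, hε, hb⟩ := ho'
  refine ⟨ε / 2, by positivity, fun δ hδ hg => ?_⟩
  have h4 := hb (sideSq + δ) (by rw [mem_ball_iff_norm]; simp; linarith)
  rw [hg, h0, ← hL] at h4
  simp only [add_sub_cancel_left, sub_zero, zero_sub, norm_neg, Real.norm_eq_abs] at h4
  rw [hLs, abs_mul] at h4
  rw [abs_of_pos (by norm_num : (0 : ℝ) < 108)] at h4
  nlinarith [abs_nonneg (∑ k, stress k * δ k)]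

theorem continuous_sqLen (H : Form) (k : Fin 10) : Continuous fun P => sqLen H P k := by
  unfold sqLen
  exact (H.continuous.comp (by fun_prop)).clm_apply (by fun_prop)

theorem continuous_corr (H : Form) (Λ : Space →L[ℝ] Bil) :
    Continuous fun x : Space × Space => corr H Λ x.1 x.2 := by
  unfold corr
  have hz : Continuous fun x : Space × Space => x.1 := continuous_fst
  have hD : Continuous fun x : Space × Space => x.2 := continuous_snd
  have hH := H.continuous.comp hD
  have h1 := Λ.continuous.comp hz
  have h2 := Λ.continuous.comp hD
  exact ((hH.clm_apply ((h1.clm_apply hD).clm_apply hD)).add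
    (continuous_const.mul (hH.clm_apply ((h2.clm_apply hD).clm_apply hD)))).add
    (hH.clm_apply ((h1.clm_apply hz).clm_apply hD))

theorem continuous_stressCorr (H : Form) (Λ : Space →L[ℝ] Bil) :
    Continuous fun P => stressCorr H Λ P := by
  unfold stressCorr
  refine continuous_finsetSum _ fun k _ => continuous_const.mul ?_
  exact (continuous_corr H Λ).comp ((by fun_prop : Continuous fun P : Label → Space =>
    (P (fstL k), P (sndL k) - P (fstL k))))

/-- By compactness: on the bounded configurations that violate the estimate, the total deviation
from the bipyramid lengths attains its minimum, and `stressCorr_eq` says that this minimum is not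
zero. -/
theorem stressCorr_near {H : Matrix (Fin 3) (Fin 3) ℝ} (hH : H.PosDef)
    (Λ : Space →L[ℝ] Bil) (sym : ∀ c d b, Λ c d b = Λ c b d)
    (cpt : ∀ a b c d, formOf H a (Λ c d b) + formOf H b (Λ c d a)
      = formOf H a (Λ d c b) + formOf H b (Λ d c a))
    {E : Matrix (Fin 3) (Fin 3) ℝ} (hE : E.transpose * H * E = 1) (r η : ℝ) (hη : 0 < η) :
    ∃ ξ > 0, ∀ P : Label → Space, P (.B 0) = 0 → ‖P‖ ≤ r →
      (∀ k, |sqLen (formOf H) P k - sideSq k| ≤ ξ) →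
      |stressCorr (formOf H) Λ P - (-45 * ((1 / 4) * P (.B 1) ⬝ᵥ (ricciOf Λ).mulVec (P (.B 1)))
        + 27 / 2 * (E.transpose * ricciOf Λ * E).trace)| ≤ η := by
  set g : (Label → Space) → ℝ := fun P => |stressCorr (formOf H) Λ P
    - (-45 * ((1 / 4) * P (.B 1) ⬝ᵥ (ricciOf Λ).mulVec (P (.B 1)))
        + 27 / 2 * (E.transpose * ricciOf Λ * E).trace)| with hg
  have hgc : Continuous g := by
    refine ((continuous_stressCorr _ _).sub ?_).abs
    have : Continuous fun P : Label → Space => P (.B 1) ⬝ᵥ (ricciOf Λ).mulVec (P (.B 1)) := by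
      have h1 : Continuous fun P : Label → Space => P (.B 1) := by fun_prop
      exact h1.dotProduct (continuous_const.matrix_mulVec h1)
    fun_prop
  set d : (Label → Space) → ℝ := fun P => ∑ k, |sqLen (formOf H) P k - sideSq k| with hd
  have hdc : Continuous d := continuous_finsetSum _ fun k _ =>
    ((continuous_sqLen _ k).sub continuous_const).abs
  set S : Set (Label → Space) := {P | P (.B 0) = 0 ∧ η ≤ g P} ∩ Metric.closedBall 0 r with hS
  have hSc : IsCompact S := by
    refine (isCompact_closedBall _ _).inter_left ?_
    exact (isClosed_eq (by fun_prop) continuous_const).inter (isClosed_le continuous_const hgc)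
  by_cases hne : S.Nonempty
  · obtain ⟨P, hP, hmin⟩ := hSc.exists_isMinOn hne hdc.continuousOn
    have hdP : 0 < d P := by
      have h0 : 0 ≤ d P := Finset.sum_nonneg fun _ _ => abs_nonneg _
      refine lt_of_le_of_ne h0 fun h => ?_
      have h1 := (Finset.sum_eq_zero_iff_of_nonneg fun _ _ => abs_nonneg _).mp h.symm
      have h2 := stressCorr_eq hH hP.1.1 (fun k => by
        have := h1 k (Finset.mem_univ _)
        rw [abs_eq_zero, sub_eq_zero] at this
        exact this) Λ sym cpt hE
      have h3 := hP.1.2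
      rw [hg] at h3
      simp only [h2, sub_self, abs_zero] at h3
      linarith
    -- Ten links contribute, so deviations of `d P / 20` each stay below the minimum `d P`.
    refine ⟨d P / 20, by positivity, fun P' h0 hr hq => ?_⟩
    by_contra hcon
    have hm := hmin (show P' ∈ S from ⟨⟨h0, (not_le.mp hcon).le⟩, by simpa using hr⟩)
    have hm' : d P ≤ d P' := hm
    have : d P' ≤ ∑ _k : Fin 10, d P / 20 := Finset.sum_le_sum fun k _ => hq k
    simp at this
    linarith
  · refine ⟨1, one_pos, fun P' h0 hr _ => ?_⟩
    by_contra hcon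
    exact hne ⟨P', ⟨h0, (not_le.mp hcon).le⟩, by simpa using hr⟩

end

noncomputable section

/-! ### The Levi-Civita connection -/

theorem hasDerivWithinAt_bilinear {E F G : Type*} [NormedAddCommGroup E] [NormedSpace ℝ E]
    [NormedAddCommGroup F] [NormedSpace ℝ F] [NormedAddCommGroup G] [NormedSpace ℝ G]
    {L : ℝ → E →L[ℝ] F →L[ℝ] G} {L' : E →L[ℝ] F →L[ℝ] G} {u : ℝ → E} {u' : E} {v : ℝ → F} {v' : F}
    {s : Set ℝ} {t : ℝ} (hL : HasDerivWithinAt L L' s t) (hu : HasDerivWithinAt u u' s t)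
    (hv : HasDerivWithinAt v v' s t) :
    HasDerivWithinAt (fun r => L r (u r) (v r)) (L' (u t) (v t) + L t u' (v t) + L t (u t) v')
      s t := by
  have h := (hL.clm_apply hu).clm_apply hv
  simpa only [add_apply] using h

/-- The Christoffel symbols as a bilinear map. -/
def gammaOf (g : Space → Matrix (Fin 3) (Fin 3) ℝ) (x : Space) : Bil :=
  ∑ a, ∑ b, ∑ c, christoffel g a b c x •
    (ContinuousLinearMap.proj (R := ℝ) (φ := fun _ : Fin 3 => ℝ) b).smulRight
      ((ContinuousLinearMap.proj (R := ℝ) (φ := fun _ : Fin 3 => ℝ) c).smulRight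
        (Pi.single a 1 : Space))

theorem gammaOf_apply (g : Space → Matrix (Fin 3) (Fin 3) ℝ) (x u v : Space) (a : Fin 3) :
    gammaOf g x u v a = ∑ b, ∑ c, christoffel g a b c x * u b * v c := by
  simp only [gammaOf, sum_apply, smul_apply, ContinuousLinearMap.smulRight_apply,
    ContinuousLinearMap.proj_apply, Finset.sum_apply, Pi.smul_apply, smul_eq_mul]
  rw [Finset.sum_eq_single a]
  · refine Finset.sum_congr rfl fun b _ => Finset.sum_congr rfl fun c _ => ?_
    simp; ring
  · intro a' _ h
    simp [h.symm]
  · simp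

/-- A smooth Riemannian metric with its Levi-Civita connection on an open set. -/
structure IsLocalGeom (D : Set Space) (g : Space → Matrix (Fin 3) (Fin 3) ℝ) (Γ : Space → Bil) :
    Prop where
  isOpen : IsOpen D
  posDef : ∀ x ∈ D, (g x).PosDef
  smooth : ContDiffOn ℝ 2 (fun x => formOf (g x)) D
  smooth_conn : ContDiffOn ℝ 1 Γ D
  symm : ∀ x ∈ D, ∀ u v, Γ x u v = Γ x v u
  compat : ∀ x ∈ D, ∀ d u v, fderiv ℝ (fun y => formOf (g y)) x d u v
    = formOf (g x) (Γ x d u) v + formOf (g x) u (Γ x d v)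

theorem isSymm_of_posDef {A : Matrix (Fin 3) (Fin 3) ℝ} (h : A.PosDef) : A.IsSymm := by
  simpa using! h.isHermitian

theorem contDiffOn_det {n : WithTop ℕ∞} {D : Set Space} {k : ℕ}
    {M : Space → Matrix (Fin k) (Fin k) ℝ}
    (hM : ∀ i j, ContDiffOn ℝ n (fun x => M x i j) D) : ContDiffOn ℝ n (fun x => (M x).det) D := by
  simp only [Matrix.det_apply']
  exact ContDiffOn.sum fun σ _ => contDiffOn_const.mul (contDiffOn_prod fun i _ => hM _ _)

theorem contDiffOn_inv {n : WithTop ℕ∞} {D : Set Space} {k : ℕ}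
    {M : Space → Matrix (Fin k) (Fin k) ℝ}
    (hM : ∀ i j, ContDiffOn ℝ n (fun x => M x i j) D) (h0 : ∀ x ∈ D, (M x).det ≠ 0)
    (i j : Fin k) : ContDiffOn ℝ n (fun x => (M x)⁻¹ i j) D := by
  simp only [Matrix.inv_def, Matrix.smul_apply, Ring.inverse_eq_inv', smul_eq_mul,
    Matrix.adjugate_apply]
  refine ((contDiffOn_det hM).inv h0).mul (contDiffOn_det fun a b => ?_)
  by_cases h : a = j
  · subst h; simpa using contDiffOn_const
  · simpa [Matrix.updateRow_ne h] using hM a b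

theorem contDiffOn_pd {n : ℕ} {D : Set (Fin n → ℝ)} (hD : IsOpen D) {f : (Fin n → ℝ) → ℝ}
    (hf : ContDiffOn ℝ ∞ f D) (i : Fin n) : ContDiffOn ℝ ∞ (pd i f) D :=
  (hf.fderiv_of_isOpen hD (by simp)).clm_apply contDiffOn_const

theorem fderiv_eq_sum_pd {n : ℕ} (f : (Fin n → ℝ) → ℝ) (x d : Fin n → ℝ) :
    fderiv ℝ f x d = ∑ i, d i * pd i f x := by
  have : d = ∑ i, d i • (Pi.single i 1 : Fin n → ℝ) := by
    ext j; simp [Finset.sum_apply, Pi.single_apply]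
  conv_lhs => rw [this]
  rw [map_sum]
  exact Finset.sum_congr rfl fun i _ => by rw [map_smul, smul_eq_mul]; rfl

theorem two_le_infty : (2 : WithTop ℕ∞) ≤ ∞ := by
  exact WithTop.coe_le_coe.mpr (le_top : (2 : ℕ∞) ≤ ⊤)

theorem one_le_infty : (1 : WithTop ℕ∞) ≤ ∞ := by
  exact WithTop.coe_le_coe.mpr (le_top : (1 : ℕ∞) ≤ ⊤)

section smooth

variable {D : Set Space} {g : Space → Matrix (Fin 3) (Fin 3) ℝ} (hD : IsOpen D)
  (hg : ∀ i j, ContDiffOn ℝ ∞ (fun x => g x i j) D) (hp : ∀ x ∈ D, (g x).PosDef)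

include hD hg hp in
theorem contDiffOn_christoffel (a b c : Fin 3) : ContDiffOn ℝ ∞ (christoffel g a b c) D := by
  unfold christoffel
  refine contDiffOn_const.mul (ContDiffOn.sum fun d _ => ?_)
  refine (contDiffOn_inv hg (fun x hx => (hp x hx).det_pos.ne') a d).mul ?_
  exact ((contDiffOn_pd hD (hg d c) b).add (contDiffOn_pd hD (hg d b) c)).sub
    (contDiffOn_pd hD (hg b c) d)

include hD hg hp in
theorem contDiffOn_gammaOf : ContDiffOn ℝ ∞ (gammaOf g) D := by
  unfold gammaOf
  exact ContDiffOn.sum fun a _ => ContDiffOn.sum fun b _ => ContDiffOn.sum fun c _ =>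
    (ContinuousLinearMap.toSpanSingleton ℝ _).contDiff.comp_contDiffOn
      (contDiffOn_christoffel hD hg hp a b c)

include hg in
theorem contDiffOn_formOf : ContDiffOn ℝ ∞ (fun x => formOf (g x)) D := by
  unfold formOf
  exact ContDiffOn.sum fun a _ => ContDiffOn.sum fun b _ =>
    (ContinuousLinearMap.toSpanSingleton ℝ _).contDiff.comp_contDiffOn (hg a b)

include hD hp in
theorem pd_metric_symm {x : Space} (hx : x ∈ D) (c i j : Fin 3) :
    pd c (fun y => g y i j) x = pd c (fun y => g y j i) x := by
  unfold pd
  congr 1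
  apply Filter.EventuallyEq.fderiv_eq
  filter_upwards [hD.mem_nhds hx] with y hy
  exact (isSymm_of_posDef (hp y hy)).apply j i

include hD hp in
theorem christoffel_symm {x : Space} (hx : x ∈ D) (a b c : Fin 3) :
    christoffel g a b c x = christoffel g a c b x := by
  unfold christoffel
  congr 1
  refine Finset.sum_congr rfl fun d _ => ?_
  rw [pd_metric_symm hD hp hx d b c]
  ring

include hp in
theorem lower_christoffel {x : Space} (hx : x ∈ D) (e b c : Fin 3) :
    ∑ a, g x e a * christoffel g a b c x = (1 / 2) * (pd b (fun y => g y e c) x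
      + pd c (fun y => g y e b) x - pd e (fun y => g y b c) x) := by
  have hdet : IsUnit (g x).det := (hp x hx).det_pos.ne'.isUnit
  have h1 := Matrix.mul_nonsing_inv (g x) hdet
  set t : Fin 3 → ℝ := fun d => pd b (fun y => g y d c) x
      + pd c (fun y => g y d b) x - pd d (fun y => g y b c) x with ht
  have h2 : (g x).mulVec (((g x)⁻¹).mulVec t) = t := by rw [Matrix.mulVec_mulVec, h1, Matrix.one_mulVec]
  have h3 := congrFun h2 e
  simp only [Matrix.mulVec, dotProduct] at h3
  change _ = (1 / 2) * t e
  rw [← h3, Finset.mul_sum]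
  refine Finset.sum_congr rfl fun a _ => ?_
  unfold christoffel
  ring

-- For metric compatibility, lowering the index turns both connection terms into partial derivatives
-- of the metric, which cancel except for the derivative along `d`.
include hD hg hp in
theorem isLocalGeom : IsLocalGeom D g (gammaOf g) where
  isOpen := hD
  posDef := hp
  smooth := (contDiffOn_formOf hg).of_le two_le_infty
  smooth_conn := (contDiffOn_gammaOf hD hg hp).of_le one_le_infty
  symm := by
    intro x hx u v
    ext a
    rw [gammaOf_apply, gammaOf_apply, Finset.sum_comm]
    refine Finset.sum_congr rfl fun b _ => Finset.sum_congr rfl fun c _ => ?_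
    rw [christoffel_symm hD hp hx]; ring
  compat := by
    intro x hx d u v
    have hdiff : ∀ i j, DifferentiableAt ℝ (fun y => g y i j) x := fun i j =>
      ((hg i j).contDiffAt (hD.mem_nhds hx)).differentiableAt (by simp)
    have hF : DifferentiableAt ℝ (fun y => formOf (g y)) x :=
      ((contDiffOn_formOf hg).contDiffAt (hD.mem_nhds hx)).differentiableAt (by simp)
    have h1 := ((ContinuousLinearMap.apply ℝ ℝ v).comp
      (ContinuousLinearMap.apply ℝ (Space →L[ℝ] ℝ) u)).hasFDerivAt.comp x hF.hasFDerivAt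
    have h2 : HasFDerivAt (fun y => ∑ i, ∑ j, (u i * v j) * g y i j)
        (∑ i, ∑ j, (u i * v j) • fderiv ℝ (fun y => g y i j) x) x :=
      HasFDerivAt.fun_sum fun i _ => HasFDerivAt.fun_sum fun j _ =>
        (hdiff i j).hasFDerivAt.const_mul _
    have h3 : fderiv ℝ (fun y => formOf (g y)) x d u v
        = ∑ i, ∑ j, (u i * v j) * fderiv ℝ (fun y => g y i j) x d := by
      have h4 := h1.unique (h2.congr_of_eventuallyEq (Filter.Eventually.of_forall fun y => by
        simp only [Function.comp_apply, ContinuousLinearMap.comp_apply,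
          ContinuousLinearMap.apply_apply, formOf_apply, dotProduct, Matrix.mulVec,
          Finset.mul_sum]
        exact Finset.sum_congr rfl fun i _ => Finset.sum_congr rfl fun j _ => by ring))
      have h5 := congrArg (fun L => L d) h4
      simpa [sum_apply] using h5
    rw [h3]
    have hl := lower_christoffel hp hx
    have hs := pd_metric_symm hD hp hx
    have hsx := fun i j => (isSymm_of_posDef (hp x hx)).apply i j
    simp only [fderiv_eq_sum_pd, formOf_apply]
    have e1 : ∀ w z : Space, ∀ y : Space, w ⬝ᵥ (g x).mulVec (gammaOf g x y z)
        = ∑ i, ∑ c, ∑ j, w i * y c * z j * ((1 / 2) * (pd c (fun y => g y i j) x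
      + pd j (fun y => g y i c) x - pd i (fun y => g y c j) x)) := by
      intro w z y
      simp only [← hl, dotProduct, Matrix.mulVec, gammaOf_apply]
      refine Finset.sum_congr rfl fun i _ => ?_
      simp only [Finset.mul_sum]
      rw [Finset.sum_comm]
      refine Finset.sum_congr rfl fun b _ => ?_
      rw [Finset.sum_comm]
      refine Finset.sum_congr rfl fun c _ => Finset.sum_congr rfl fun a _ => by ring
    have e2 : (gammaOf g x d u) ⬝ᵥ (g x).mulVec v = v ⬝ᵥ (g x).mulVec (gammaOf g x d u) := by
      rw [← formOf_apply, formOf_comm (isSymm_of_posDef (hp x hx)), formOf_apply]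
    rw [e2, e1, e1]
    -- The roles of the first and the last index are exchanged, so that the cancellation can be made
    -- term by term.
    have e3 : ∑ i, ∑ c, ∑ j, v i * d c * u j * ((1 / 2) * (pd c (fun y => g y i j) x
        + pd j (fun y => g y i c) x - pd i (fun y => g y c j) x))
        = ∑ i, ∑ c, ∑ j, u i * d c * v j * ((1 / 2) * (pd c (fun y => g y i j) x
        + pd i (fun y => g y c j) x - pd j (fun y => g y i c) x)) := by
      rw [Finset.sum_comm]
      rw [Finset.sum_comm (s := Finset.univ (α := Fin 3)) (t := Finset.univ (α := Fin 3))
        (f := fun i c => ∑ j, u i * d c * v j * ((1 / 2) * (pd c (fun y => g y i j) x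
        + pd i (fun y => g y c j) x - pd j (fun y => g y i c) x)))]
      refine Finset.sum_congr rfl fun c _ => ?_
      rw [Finset.sum_comm]
      refine Finset.sum_congr rfl fun i _ => Finset.sum_congr rfl fun j _ => ?_
      rw [hs c j i, hs i j c, hs j c i]; ring
    rw [e3, ← Finset.sum_add_distrib]
    refine Finset.sum_congr rfl fun i _ => ?_
    rw [← Finset.sum_add_distrib]
    simp only [Finset.mul_sum]
    rw [Finset.sum_comm]
    refine Finset.sum_congr rfl fun c _ => ?_
    rw [← Finset.sum_add_distrib]
    refine Finset.sum_congr rfl fun j _ => ?_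
    ring

end smooth

/-- The derivative of the connection at `x` in coordinates that are normal to first order there. -/
def connDeriv (Γ : Space → Bil) (x : Space) : Space →L[ℝ] Bil :=
  fderiv ℝ Γ x + ((ContinuousLinearMap.compL ℝ Space (Space →L[ℝ] Space)
    (Space →L[ℝ] Space)).flip (Γ x)).comp
    ((ContinuousLinearMap.compL ℝ Space Space Space).comp (Γ x))

theorem connDeriv_apply (Γ : Space → Bil) (x c d b : Space) :
    connDeriv Γ x c d b = fderiv ℝ Γ x c d b + Γ x c (Γ x d b) := rfl

theorem fderiv_apply₂ {n : ℕ} {f : (Fin n → ℝ) → Bil} {x : Fin n → ℝ}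
    (hf : DifferentiableAt ℝ f x) (c : Fin n → ℝ) (u v : Space) (a : Fin 3) :
    fderiv ℝ (fun y => f y u v a) x c = fderiv ℝ f x c u v a := by
  have h1 := ((ContinuousLinearMap.proj (R := ℝ) (φ := fun _ : Fin 3 => ℝ) a).comp
    ((ContinuousLinearMap.apply ℝ Space v).comp
      (ContinuousLinearMap.apply ℝ (Space →L[ℝ] Space) u))).hasFDerivAt.comp x hf.hasFDerivAt
  exact congrArg (fun L => L c) h1.fderiv

theorem gammaOf_single (g : Space → Matrix (Fin 3) (Fin 3) ℝ) (x : Space) (a b c : Fin 3) :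
    gammaOf g x (Pi.single b 1) (Pi.single c 1) a = christoffel g a b c x := by
  rw [gammaOf_apply]
  simp [Pi.single_apply]

/-- The quadratic term that `connDeriv` adds to the derivative of the connection is the one in the
Ricci tensor. -/
theorem ricci_eq_ricciOf {g : Space → Matrix (Fin 3) (Fin 3) ℝ} {x : Space}
    (hΓ : DifferentiableAt ℝ (gammaOf g) x) : ricci g x = ricciOf (connDeriv (gammaOf g) x) := by
  ext b c
  simp only [ricci, ricciOf, Matrix.of_apply, connDeriv_apply]
  have h1 : ∀ a b c e, pd e (christoffel g a b c) x
      = fderiv ℝ (gammaOf g) x (Pi.single e 1) (Pi.single b 1) (Pi.single c 1) a := by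
    intro a b c e
    rw [← fderiv_apply₂ hΓ]
    simp only [gammaOf_single]
    rfl
  have h2 : ∀ a b c d, gammaOf g x (Pi.single d 1)
      (gammaOf g x (Pi.single b 1) (Pi.single c 1)) a
      = ∑ e, christoffel g a d e x * christoffel g e b c x := by
    intro a b c d
    rw [gammaOf_apply, Finset.sum_comm]
    refine Finset.sum_congr rfl fun e _ => ?_
    rw [gammaOf_single]
    simp [Pi.single_apply]
  refine Finset.sum_congr rfl fun a _ => ?_
  simp only [Pi.sub_apply, Pi.add_apply, h1, h2, Finset.sum_sub_distrib]
  ring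

theorem IsLocalGeom.connDeriv_symm {D : Set Space} {g : Space → Matrix (Fin 3) (Fin 3) ℝ}
    {Γ : Space → Bil} (h : IsLocalGeom D g Γ) {x : Space} (hx : x ∈ D) (c d b : Space) :
    connDeriv Γ x c d b = connDeriv Γ x c b d := by
  rw [connDeriv_apply, connDeriv_apply, h.symm x hx d b]
  congr 1
  have hΓ : DifferentiableAt ℝ Γ x :=
    (h.smooth_conn.contDiffAt (h.isOpen.mem_nhds hx)).differentiableAt (by simp)
  ext a
  rw [← fderiv_apply₂ hΓ, ← fderiv_apply₂ hΓ]
  congr 1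
  apply Filter.EventuallyEq.fderiv_eq
  filter_upwards [h.isOpen.mem_nhds hx] with y hy
  rw [h.symm y hy]

theorem hasDerivAt_comp_line {E G : Type*} [NormedAddCommGroup E] [NormedSpace ℝ E]
    [NormedAddCommGroup G] [NormedSpace ℝ G] {f : E → G} {f' : E →L[ℝ] G} {x : E}
    (hf : HasFDerivAt f f' x) (c : E) : HasDerivAt (fun t : ℝ => f (x + t • c)) (f' c) 0 := by
  have hl : HasDerivAt (fun t : ℝ => x + t • c) c 0 := by
    simpa using ((hasDerivAt_id (0 : ℝ)).smul_const c).const_add x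
  refine HasFDerivAt.comp_hasDerivAt (0 : ℝ) ?_ hl
  simpa using hf

/-- This is the skewness of the curvature operator. It comes from differentiating metric
compatibility once more and using that second derivatives of the metric commute. -/
theorem IsLocalGeom.connDeriv_compat {D : Set Space} {g : Space → Matrix (Fin 3) (Fin 3) ℝ}
    {Γ : Space → Bil} (h : IsLocalGeom D g Γ) {x : Space} (hx : x ∈ D) (a b c d : Space) :
    formOf (g x) a (connDeriv Γ x c d b) + formOf (g x) b (connDeriv Γ x c d a)
      = formOf (g x) a (connDeriv Γ x d c b) + formOf (g x) b (connDeriv Γ x d c a) := by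
  set F : Space → Form := fun y => formOf (g y) with hF
  have hs : ∀ y ∈ D, ∀ u v, F y u v = F y v u := fun y hy u v =>
    formOf_comm (isSymm_of_posDef (h.posDef y hy)) u v
  have hFd : HasFDerivAt F (fderiv ℝ F x) x :=
    ((h.smooth.contDiffAt (h.isOpen.mem_nhds hx)).differentiableAt (by simp)).hasFDerivAt
  have hΓd : HasFDerivAt Γ (fderiv ℝ Γ x) x :=
    ((h.smooth_conn.contDiffAt (h.isOpen.mem_nhds hx)).differentiableAt (by simp)).hasFDerivAt
  have hF2 : HasFDerivAt (fderiv ℝ F) (fderiv ℝ (fderiv ℝ F) x) x :=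
    (((h.smooth.contDiffAt (h.isOpen.mem_nhds hx)).fderiv_right (m := 1)
      (by norm_num)).differentiableAt (by simp)).hasFDerivAt
  have hsym : ∀ c d, fderiv ℝ (fderiv ℝ F) x c d = fderiv ℝ (fderiv ℝ F) x d c := fun c d =>
    ((h.smooth.contDiffAt (h.isOpen.mem_nhds hx)).isSymmSndFDerivAt (by simp)).eq c d
  -- The second bracket is symmetric in `c` and `d`, so comparing the two orders leaves only the
  -- first.
  have key : ∀ c d, fderiv ℝ (fderiv ℝ F) x c d a b =
      (F x (connDeriv Γ x c d a) b + F x a (connDeriv Γ x c d b)) +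
      (F x (Γ x d a) (Γ x c b) + F x (Γ x c a) (Γ x d b)) := by
    intro c d
    have e0 : x + (0 : ℝ) • c = x := by simp
    have l1 : HasDerivAt (fun t : ℝ => fderiv ℝ F (x + t • c) d a b)
        (fderiv ℝ (fderiv ℝ F) x c d a b) 0 := by
      have h2 := hasDerivWithinAt_bilinear ((hasDerivAt_comp_line hF2 c).clm_apply
        (hasDerivAt_const (0 : ℝ) d)).hasDerivWithinAt
        (hasDerivWithinAt_const (0 : ℝ) Set.univ a) (hasDerivWithinAt_const (0 : ℝ) Set.univ b)
      rw [hasDerivWithinAt_univ] at h2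
      simpa only [e0, map_zero, zero_apply, add_zero] using h2
    have l2 := hasDerivAt_comp_line hFd c
    have l3 := hasDerivAt_comp_line hΓd c
    have l4 : ∀ u v, HasDerivAt (fun t : ℝ => F (x + t • c) (Γ (x + t • c) d u) v)
        (fderiv ℝ F x c (Γ x d u) v + F x (fderiv ℝ Γ x c d u) v) 0 := by
      intro u v
      have h2 := hasDerivWithinAt_bilinear l3.hasDerivWithinAt
        (hasDerivWithinAt_const (0 : ℝ) Set.univ d) (hasDerivWithinAt_const (0 : ℝ) Set.univ u)
      have h3 := hasDerivWithinAt_bilinear l2.hasDerivWithinAt h2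
        (hasDerivWithinAt_const (0 : ℝ) Set.univ v)
      rw [hasDerivWithinAt_univ] at h3
      simpa only [e0, map_zero, zero_apply, add_zero] using h3
    have l5 := (l4 a b).add (l4 b a)
    have hev : (fun t : ℝ => fderiv ℝ F (x + t • c) d a b) =ᶠ[nhds 0]
        ((fun t : ℝ => F (x + t • c) (Γ (x + t • c) d a) b)
          + fun t : ℝ => F (x + t • c) (Γ (x + t • c) d b) a) := by
      have hcont : Filter.Tendsto (fun t : ℝ => x + t • c) (nhds 0) (nhds x) := by
        have : Continuous fun t : ℝ => x + t • c := by fun_prop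
        simpa only [e0] using this.tendsto 0
      filter_upwards [hcont (h.isOpen.mem_nhds hx)] with t ht
      exact (h.compat _ ht d a b).trans (congrArg _ (hs _ ht _ _))
    have l6 := l1.unique (l5.congr_of_eventuallyEq hev)
    have k1 := h.compat x hx c (Γ x d a) b
    have k2 := h.compat x hx c (Γ x d b) a
    change fderiv ℝ F x c _ _ = F x _ _ + F x _ _ at k1 k2
    rw [l6, k1, k2]
    simp only [connDeriv_apply, map_add, add_apply]
    rw [hs x hx (fderiv ℝ Γ x c d b) a, hs x hx (Γ x c (Γ x d b)) a, hs x hx (Γ x d b) (Γ x c a)]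
    ring
  have k1 := key c d
  have k2 := key d c
  rw [hsym c d] at k1
  have h1 := hs x hx b (connDeriv Γ x c d a)
  have h2 := hs x hx b (connDeriv Γ x d c a)
  change F x _ _ + F x _ _ = F x _ _ + F x _ _
  linarith [k1, k2]

end

noncomputable section

/-! ### Flows of small vector fields and boundary value problems -/

/-- A field bounded by `K ≤ 1` cannot move a point by more than 1 in unit time, so the solution
exists on the whole interval. The displacement, as a function of the starting point, has a Lipschitz
constant of order `K`: integrate the difference of the field along two solutions, which separate by
at most the factor exp K ≤ 3. -/
theorem exists_flow_of_small {E : Type*} [NormedAddCommGroup E] [NormedSpace ℝ E] [CompleteSpace E]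
    {F : ℝ → E → E} {R K : ℝ} (hK0 : 0 ≤ K) (hK1 : K ≤ 1)
    (hL : ∀ t ∈ Set.Icc (0 : ℝ) 1, ∀ x ∈ Metric.closedBall (0 : E) (R + 1),
      ∀ y ∈ Metric.closedBall (0 : E) (R + 1), ‖F t x - F t y‖ ≤ K * ‖x - y‖)
    (hc : ∀ x ∈ Metric.closedBall (0 : E) (R + 1), ContinuousOn (fun t => F t x) (Set.Icc 0 1))
    (hb : ∀ t ∈ Set.Icc (0 : ℝ) 1, ∀ x ∈ Metric.closedBall (0 : E) (R + 1), ‖F t x‖ ≤ K) :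
    ∃ φ : E → ℝ → E, ∀ x ∈ Metric.closedBall (0 : E) R, φ x 0 = x ∧
      (∀ t ∈ Set.Icc (0 : ℝ) 1, φ x t ∈ Metric.closedBall (0 : E) (R + 1) ∧
        HasDerivWithinAt (φ x) (F t (φ x t)) (Set.Icc 0 1) t ∧ ‖φ x t - x‖ ≤ K) ∧
      ∀ y ∈ Metric.closedBall (0 : E) R, ∀ t ∈ Set.Icc (0 : ℝ) 1,
        ‖(φ x t - x) - (φ y t - y)‖ ≤ 3 * K * ‖x - y‖ := by
  lift K to NNReal using hK0
  have hsub : ∀ x ∈ Metric.closedBall (0 : E) R, Metric.closedBall x 1 ⊆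
      Metric.closedBall (0 : E) (R + 1) := fun x hx => by
    refine Metric.closedBall_subset_closedBall' ?_
    rw [add_comm]
    exact add_le_add_left (Metric.mem_closedBall.mp hx) 1
  have hex : ∀ x ∈ Metric.closedBall (0 : E) R, ∃ α : ℝ → E, α 0 = x ∧
      ∀ t ∈ Set.Icc (0 : ℝ) 1, HasDerivWithinAt α (F t (α t)) (Set.Icc 0 1) t ∧
        α t ∈ Metric.closedBall x 1 := by
    intro x hx
    -- Initial point fixed, radius 1, and the same constant `K` as bound and as Lipschitz constant.
    have hP : IsPicardLindelof F (tmin := 0) (tmax := 1) ⟨0, by simp⟩ x 1 0 K K := by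
      refine ⟨fun t ht => ?_, fun y hy => hc y (hsub x hx hy),
        fun t ht y hy => hb t ht y (hsub x hx hy), ?_⟩
      · refine LipschitzOnWith.of_dist_le_mul fun y hy z hz => ?_
        rw [dist_eq_norm, dist_eq_norm]
        exact hL t ht y (hsub x hx hy) z (hsub x hx hz)
      · simp; exact hK1
    have hx0 := Metric.mem_closedBall_self (x := x) (ε := ((0 : NNReal) : ℝ)) (by simp)
    obtain ⟨α, hα⟩ := ODE.FunSpace.exists_isFixedPt_next hP hx0
    have hmem : ∀ t, α.compProj t ∈ Metric.closedBall x 1 := fun t =>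
      α.compProj_mem_closedBall hP.mul_max_le
    have heq : ∀ t ∈ Set.Icc (0 : ℝ) 1, α.compProj t = ODE.picard F 0 x α.compProj t := by
      intro t ht
      conv_lhs => rw [← show ODE.FunSpace.next hP hx0 α = α from hα]
      rw [ODE.FunSpace.compProj_apply, ODE.FunSpace.next_apply, Set.projIcc_of_mem _ ht]
    refine ⟨α.compProj, ?_, fun t ht => ⟨?_, hmem t⟩⟩
    · rw [heq 0 (by simp), ODE.picard_apply₀]
    · have hcont : ContinuousOn (Function.uncurry F)
          (Set.Icc (0 : ℝ) 1 ×ˢ Metric.closedBall x 1) := by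
        have := continuousOn_prod_of_continuousOn_lipschitzOnWith' (Function.uncurry F)
          (s := Set.Icc (0 : ℝ) 1) (t := Metric.closedBall x 1) K hP.lipschitzOnWith
          hP.continuousOn
        exact this
      refine (ODE.hasDerivWithinAt_picard_Icc (by simp) hcont α.continuous_compProj.continuousOn
        (fun t _ => hmem t) x ht).congr heq (heq t ht)
  choose! φ hφ0 hφ using hex
  have key : ∀ x ∈ Metric.closedBall (0 : E) R, ∀ t ∈ Set.Icc (0 : ℝ) 1,
      φ x t ∈ Metric.closedBall (0 : E) (R + 1) := fun x hx t ht => hsub x hx (hφ x hx t ht).2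
  have hright : ∀ x ∈ Metric.closedBall (0 : E) R, ∀ t ∈ Set.Ico (0 : ℝ) 1,
      HasDerivWithinAt (φ x) (F t (φ x t)) (Set.Ici t) t := fun x hx t ht =>
    (hφ x hx t ⟨ht.1, ht.2.le⟩).1.mono_of_mem_nhdsWithin
      (Icc_mem_nhdsGE_of_mem ht)
  have hcts : ∀ x ∈ Metric.closedBall (0 : E) R, ContinuousOn (φ x) (Set.Icc 0 1) :=
    fun x hx t ht => (hφ x hx t ht).1.continuousWithinAt
  refine ⟨φ, fun x hx => ⟨hφ0 x hx, fun t ht => ⟨key x hx t ht, (hφ x hx t ht).1, ?_⟩, ?_⟩⟩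
  · have := norm_image_sub_le_of_norm_deriv_le_segment' (fun r hr => (hφ x hx r hr).1)
      (fun r hr => hb r ⟨hr.1, hr.2.le⟩ _ (key x hx r ⟨hr.1, hr.2.le⟩)) t ht
    rw [hφ0 x hx, sub_zero] at this
    exact this.trans (mul_le_of_le_one_right K.2 ht.2)
  · intro y hy t ht
    have hG := dist_le_of_trajectories_ODE_of_mem (v := F) (K := K)
      (s := fun _ => Metric.closedBall (0 : E) (R + 1)) (a := 0) (b := 1)
      (fun t ht => LipschitzOnWith.of_dist_le_mul fun u hu w hw => by
        rw [dist_eq_norm, dist_eq_norm]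
        exact hL t ⟨ht.1, ht.2.le⟩ u hu w hw)
      (hcts x hx) (hright x hx) (fun t ht => key x hx t ⟨ht.1, ht.2.le⟩)
      (hcts y hy) (hright y hy) (fun t ht => key y hy t ⟨ht.1, ht.2.le⟩)
      (δ := ‖x - y‖) (by rw [hφ0 x hx, hφ0 y hy, dist_eq_norm])
    have hexp : Real.exp K ≤ 3 := by
      have h1 := Real.exp_one_lt_d9
      have h2 := Real.exp_le_exp.mpr hK1
      linarith
    have hbd : ∀ r ∈ Set.Ico (0 : ℝ) 1, ‖F r (φ x r) - F r (φ y r)‖ ≤ 3 * K * ‖x - y‖ := by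
      intro r hr
      have hr' : r ∈ Set.Icc (0 : ℝ) 1 := ⟨hr.1, hr.2.le⟩
      have h1 := hG r hr'
      rw [dist_eq_norm, sub_zero] at h1
      have h2 : Real.exp (K * r) ≤ 3 :=
        (Real.exp_le_exp.mpr (mul_le_of_le_one_right K.2 hr'.2)).trans hexp
      have h3 : ‖φ x r - φ y r‖ ≤ ‖x - y‖ * 3 :=
        h1.trans (mul_le_mul_of_nonneg_left h2 (norm_nonneg _))
      calc _ ≤ K * ‖φ x r - φ y r‖ := hL r hr' _ (key x hx r hr') _ (key y hy r hr')
        _ ≤ K * (‖x - y‖ * 3) := mul_le_mul_of_nonneg_left h3 K.2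
        _ = _ := by ring
    have := norm_image_sub_le_of_norm_deriv_le_segment'
      (fun r hr => (hφ x hx r hr).1.sub (hφ y hy r hr).1) hbd t ht
    simp only [Pi.sub_apply, hφ0 x hx, hφ0 y hy, sub_zero] at this
    calc ‖(φ x t - x) - (φ y t - y)‖ = ‖φ x t - φ y t - (x - y)‖ := by congr 1; abel
      _ ≤ _ := this.trans (mul_le_of_le_one_right (by positivity) ht.2)

/-- A small perturbation of the identity is inverted by Banach's theorem, applied to the map sending
`v` to `w - e v` on the ball. -/
theorem exists_add_eq {V : Type*} [NormedAddCommGroup V] [CompleteSpace V] {e : V → V}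
    {R c : ℝ} {w : V} (hR0 : 0 ≤ R)
    (hL : ∀ x ∈ Metric.closedBall (0 : V) R, ∀ y ∈ Metric.closedBall (0 : V) R,
      ‖e x - e y‖ ≤ 1 / 2 * ‖x - y‖)
    (hc : ∀ x ∈ Metric.closedBall (0 : V) R, ‖e x‖ ≤ c) (hw : ‖w‖ + c ≤ R) :
    (∃ v ∈ Metric.closedBall (0 : V) R, v + e v = w) ∧
      ∀ v ∈ Metric.closedBall (0 : V) R, ∀ v' ∈ Metric.closedBall (0 : V) R,
        v + e v = w → v' + e v' = w → v = v' := by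
  refine ⟨?_, ?_⟩
  · have hmaps : Set.MapsTo (fun v => w - e v) (Metric.closedBall (0 : V) R)
        (Metric.closedBall (0 : V) R) := fun v hv => by
      rw [mem_closedBall_zero_iff]
      exact (norm_sub_le _ _).trans ((add_le_add_right (hc v hv) _).trans hw)
    · have hcontr : ContractingWith (1 / 2 : NNReal) (hmaps.restrict _ _ _) := by
        refine ⟨by norm_num, LipschitzWith.of_dist_le_mul fun x y => ?_⟩
        rw [Subtype.dist_eq, dist_eq_norm]
        simp only [Set.MapsTo.val_restrict_apply, sub_sub_sub_cancel_left]
        rw [norm_sub_rev, Subtype.dist_eq, dist_eq_norm]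
        exact hL _ x.2 _ y.2
      obtain ⟨v, hv, hfix, -⟩ := hcontr.exists_fixedPoint' Metric.isClosed_closedBall.isComplete
        hmaps (Metric.mem_closedBall_self hR0) (edist_ne_top _ _)
      refine ⟨v, hv, ?_⟩
      have : w - e v = v := hfix
      exact (eq_sub_iff_add_eq.mp this.symm)
  · intro v hv v' hv' h h'
    have h1 := hL v hv v' hv'
    have h2 : v - v' = -(e v - e v') := by
      rw [← sub_eq_zero]
      have : v + e v - (v' + e v') = 0 := by rw [h, h', sub_self]
      rw [← this]; abel
    have h3 : ‖v - v'‖ = ‖e v - e v'‖ := by rw [h2, norm_neg]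
    have : ‖v - v'‖ ≤ 0 := by linarith [norm_nonneg (v - v')]
    exact sub_eq_zero.mp (norm_le_zero_iff.mp this)

end

noncomputable section

/-! ### Short geodesics -/

theorem IsLocalGeom.exists_bounds {D : Set Space} {g : Space → Matrix (Fin 3) (Fin 3) ℝ}
    {Γ : Space → Bil} (h : IsLocalGeom D g Γ) {p : Space} (hp : p ∈ D) :
    ∃ ρ > 0, ∃ M > 0, Metric.closedBall p ρ ⊆ D ∧
      (∀ x ∈ Metric.closedBall p ρ, ‖Γ x‖ ≤ M ∧ ‖formOf (g x)‖ ≤ M) ∧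
      ∀ x ∈ Metric.closedBall p ρ, ∀ y ∈ Metric.closedBall p ρ, ‖Γ x - Γ y‖ ≤ M * ‖x - y‖ ∧
        ‖formOf (g x) - formOf (g y)‖ ≤ M * ‖x - y‖ := by
  obtain ⟨ρ, hρ, hsub⟩ := Metric.nhds_basis_closedBall.mem_iff.mp (h.isOpen.mem_nhds hp)
  have hc := isCompact_closedBall p ρ
  obtain ⟨K1, hK1⟩ := (h.smooth_conn.mono hsub).exists_lipschitzOnWith (by simp)
    (convex_closedBall p ρ) hc
  obtain ⟨K2, hK2⟩ := (h.smooth.mono hsub).exists_lipschitzOnWith (by simp)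
    (convex_closedBall p ρ) hc
  obtain ⟨M1, hM1⟩ := hc.exists_bound_of_continuousOn (h.smooth_conn.continuousOn.mono hsub)
  obtain ⟨M2, hM2⟩ := hc.exists_bound_of_continuousOn (h.smooth.continuousOn.mono hsub)
  refine ⟨ρ, hρ, max (max M1 M2) (max K1 K2) + 1, ?_, hsub, fun x hx => ⟨?_, ?_⟩,
    fun x hx y hy => ⟨?_, ?_⟩⟩
  · have : (0 : ℝ) ≤ K1 := K1.2
    have : (K1 : ℝ) ≤ max (max M1 M2) (max K1 K2) := le_max_of_le_right (le_max_left _ _)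
    linarith
  · have := hM1 x hx
    have : M1 ≤ max (max M1 M2) (max K1 K2) := le_max_of_le_left (le_max_left _ _)
    linarith
  · have := hM2 x hx
    have : M2 ≤ max (max M1 M2) (max K1 K2) := le_max_of_le_left (le_max_right _ _)
    linarith
  · have h1 := hK1.dist_le_mul x hx y hy
    rw [dist_eq_norm, dist_eq_norm] at h1
    have : (K1 : ℝ) ≤ max (max M1 M2) (max K1 K2) := le_max_of_le_right (le_max_left _ _)
    exact h1.trans (mul_le_mul_of_nonneg_right (by linarith) (norm_nonneg _))
  · have h1 := hK2.dist_le_mul x hx y hy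
    rw [dist_eq_norm, dist_eq_norm] at h1
    have : (K2 : ℝ) ≤ max (max M1 M2) (max K1 K2) := le_max_of_le_right (le_max_right _ _)
    exact h1.trans (mul_le_mul_of_nonneg_right (by linarith) (norm_nonneg _))

/-- Geodesics of the connection `Γ` between all pairs of points of the ball of radius `R`, in the
coordinates rescaled by the factor `s` about `p`, with uniform estimates. -/
structure BVP (D : Set Space) (Γ : Space → Bil) (p : Space) (R C s : ℝ) where
  /-- The initial velocity of the geodesic from `a` to `b`. -/
  V : Space → Space → Space
  /-- The geodesic from `a` to `b`. -/
  Y : Space → Space → ℝ → Space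
  /-- The velocity of the geodesic from `a` to `b`. -/
  W : Space → Space → ℝ → Space
  /-- The exponential map at the origin. -/
  X : Space → Space
  geod : ∀ a ∈ Metric.closedBall (0 : Space) R, ∀ b ∈ Metric.closedBall (0 : Space) R,
    ∀ r ∈ Set.Icc (0 : ℝ) 1, p + s • Y a b r ∈ D ∧
      HasDerivWithinAt (Y a b) (W a b r) (Set.Icc 0 1) r ∧
      HasDerivWithinAt (W a b) (-(s • Γ (p + s • Y a b r) (W a b r) (W a b r))) (Set.Icc 0 1) r ∧
      ‖Y a b r - (a + r • (b - a))‖ ≤ C * s ∧ ‖W a b r - (b - a)‖ ≤ C * s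
  Y_zero : ∀ a ∈ Metric.closedBall (0 : Space) R, ∀ b ∈ Metric.closedBall (0 : Space) R,
    Y a b 0 = a
  Y_one : ∀ a ∈ Metric.closedBall (0 : Space) R, ∀ b ∈ Metric.closedBall (0 : Space) R,
    Y a b 1 = b
  W_zero : ∀ a ∈ Metric.closedBall (0 : Space) R, ∀ b ∈ Metric.closedBall (0 : Space) R,
    W a b 0 = V a b
  V_lip : ∀ a ∈ Metric.closedBall (0 : Space) R, ∀ b ∈ Metric.closedBall (0 : Space) R,
    ∀ a' ∈ Metric.closedBall (0 : Space) R, ∀ b' ∈ Metric.closedBall (0 : Space) R,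
    ‖(V a b - (b - a)) - (V a' b' - (b' - a'))‖ ≤ C * s * (‖a - a'‖ + ‖b - b'‖)
  X_mem : ∀ v ∈ Metric.closedBall (0 : Space) (R - 1), X v ∈ Metric.closedBall (0 : Space) R
  V_X : ∀ v ∈ Metric.closedBall (0 : Space) (R - 1), V 0 (X v) = v
  X_near : ∀ v ∈ Metric.closedBall (0 : Space) (R - 1), ‖X v - v‖ ≤ C * s
  X_lip : ∀ v ∈ Metric.closedBall (0 : Space) (R - 1),
    ∀ v' ∈ Metric.closedBall (0 : Space) (R - 1),
    ‖(X v - v) - (X v' - v')‖ ≤ C * s * ‖v - v'‖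

/-- The vector field of the geodesic flow, in the variables position minus time times velocity,
and velocity. -/
def geodField (Γ : Space → Bil) (p : Space) (s t : ℝ) (z : Space × Space) : Space × Space :=
  (t • (s • Γ (p + s • (z.1 + t • z.2)) z.2 z.2), -(s • Γ (p + s • (z.1 + t • z.2)) z.2 z.2))

theorem norm_bil_sub_le {L L' : Bil} {M B : ℝ} (hB : 0 ≤ B) {v v' : Space}
    (hL' : ‖L'‖ ≤ M) (hv : ‖v‖ ≤ B) (hv' : ‖v'‖ ≤ B) :
    ‖L v v - L' v' v'‖ ≤ ‖L - L'‖ * B * B + 2 * M * B * ‖v - v'‖ := by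
  have e : L v v - L' v' v' = (L - L') v v + L' (v - v') v + L' v' (v - v') := by
    simp only [sub_apply, map_sub]; abel
  have hM : 0 ≤ M := (norm_nonneg _).trans hL'
  rw [e]
  have h1 : ‖(L - L') v v‖ ≤ ‖L - L'‖ * B * B := ((L - L').le_opNorm₂ v v).trans (by gcongr)
  have h2 : ‖L' (v - v') v‖ ≤ M * ‖v - v'‖ * B := (L'.le_opNorm₂ _ _).trans (by gcongr)
  have h3 : ‖L' v' (v - v')‖ ≤ M * B * ‖v - v'‖ := (L'.le_opNorm₂ _ _).trans (by gcongr)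
  calc _ ≤ ‖(L - L') v v‖ + ‖L' (v - v') v‖ + ‖L' v' (v - v')‖ := norm_add₃_le
    _ ≤ _ := by linarith

section field

variable {Γ : Space → Bil} {p : Space} {ρ M B s : ℝ} (hs : 0 < s) (hs1 : s ≤ 1)
  (hsB : s * (2 * B) ≤ ρ)

include hs hsB in
theorem mem_closedBall_of_field {t : ℝ} (ht : t ∈ Set.Icc (0 : ℝ) 1) {z : Space × Space}
    (hz : ‖z‖ ≤ B) : p + s • (z.1 + t • z.2) ∈ Metric.closedBall p ρ := by
  rw [mem_closedBall_iff_norm, add_sub_cancel_left, norm_smul, Real.norm_of_nonneg hs.le]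
  refine le_trans (mul_le_mul_of_nonneg_left ?_ hs.le) hsB
  have h1 : ‖z.1‖ ≤ B := (norm_fst_le z).trans hz
  have h2 : ‖z.2‖ ≤ B := (norm_snd_le z).trans hz
  have h3 : ‖t • z.2‖ ≤ ‖z.2‖ := by
    rw [norm_smul, Real.norm_of_nonneg ht.1]
    exact mul_le_of_le_one_left (norm_nonneg _) ht.2
  exact (norm_add_le _ _).trans (by linarith)

-- The factor `s` in the constant is the point: in these variables uniform straight motion is at
-- rest, so the whole field is a perturbation of order `s`.
include hs hs1 hsB in
theorem geodField_lip (hB : 0 ≤ B) (hM : 0 ≤ M)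
    (hb : ∀ x ∈ Metric.closedBall p ρ, ‖Γ x‖ ≤ M)
    (hL : ∀ x ∈ Metric.closedBall p ρ, ∀ y ∈ Metric.closedBall p ρ, ‖Γ x - Γ y‖ ≤ M * ‖x - y‖)
    {t : ℝ} (ht : t ∈ Set.Icc (0 : ℝ) 1) {z w : Space × Space} (hz : ‖z‖ ≤ B) (hw : ‖w‖ ≤ B) :
    ‖geodField Γ p s t z - geodField Γ p s t w‖ ≤ s * (2 * M * B * B + 2 * M * B) * ‖z - w‖ := by
  have mz := mem_closedBall_of_field (p := p) hs hsB ht hz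
  have mw := mem_closedBall_of_field (p := p) hs hsB ht hw
  have h1 : ‖z.1 - w.1‖ ≤ ‖z - w‖ := norm_fst_le (z - w)
  have h2 : ‖z.2 - w.2‖ ≤ ‖z - w‖ := norm_snd_le (z - w)
  have h0 := hL _ mz _ mw
  have h3 : ‖p + s • (z.1 + t • z.2) - (p + s • (w.1 + t • w.2))‖ ≤ 2 * ‖z - w‖ := by
    have e : p + s • (z.1 + t • z.2) - (p + s • (w.1 + t • w.2))
        = s • ((z.1 - w.1) + t • (z.2 - w.2)) := by
      simp only [smul_add, smul_sub]; abel
    rw [e, norm_smul, Real.norm_of_nonneg hs.le]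
    have h4 : ‖t • (z.2 - w.2)‖ ≤ ‖z.2 - w.2‖ := by
      rw [norm_smul, Real.norm_of_nonneg ht.1]
      exact mul_le_of_le_one_left (norm_nonneg _) ht.2
    have h5 := norm_add_le (z.1 - w.1) (t • (z.2 - w.2))
    have h6 : ‖(z.1 - w.1) + t • (z.2 - w.2)‖ ≤ 2 * ‖z - w‖ := by linarith
    exact (mul_le_of_le_one_left (norm_nonneg _) hs1).trans h6
  have h4 := norm_bil_sub_le (L := Γ (p + s • (z.1 + t • z.2))) hB (hb _ mw)
    ((norm_snd_le z).trans hz) ((norm_snd_le w).trans hw)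
  have h5 : ‖Γ (p + s • (z.1 + t • z.2)) z.2 z.2 - Γ (p + s • (w.1 + t • w.2)) w.2 w.2‖
      ≤ (2 * M * B * B + 2 * M * B) * ‖z - w‖ := by
    refine h4.trans ?_
    have h6 := h0.trans (mul_le_mul_of_nonneg_left h3 hM)
    have h7 := mul_le_mul_of_nonneg_right h6 (mul_nonneg hB hB)
    have h8 := mul_le_mul_of_nonneg_left h2 (by positivity : 0 ≤ 2 * M * B)
    nlinarith
  have h6 : ‖s • Γ (p + s • (z.1 + t • z.2)) z.2 z.2 - s • Γ (p + s • (w.1 + t • w.2)) w.2 w.2‖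
      ≤ s * (2 * M * B * B + 2 * M * B) * ‖z - w‖ := by
    rw [← smul_sub, norm_smul, Real.norm_of_nonneg hs.le, mul_assoc]
    exact mul_le_mul_of_nonneg_left h5 hs.le
  rw [Prod.norm_def]
  refine max_le ?_ ?_
  · simp only [geodField, Prod.fst_sub]
    rw [← smul_sub, norm_smul, Real.norm_of_nonneg ht.1]
    exact (mul_le_of_le_one_left (norm_nonneg _) ht.2).trans h6
  · simp only [geodField, Prod.snd_sub]
    rw [neg_sub_neg, norm_sub_rev]
    exact h6

include hs hsB in
theorem geodField_norm_le (hB : 0 ≤ B) (hM : 0 ≤ M)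
    (hb : ∀ x ∈ Metric.closedBall p ρ, ‖Γ x‖ ≤ M)
    {t : ℝ} (ht : t ∈ Set.Icc (0 : ℝ) 1) {z : Space × Space} (hz : ‖z‖ ≤ B) :
    ‖geodField Γ p s t z‖ ≤ s * (2 * M * B * B + 2 * M * B) := by
  have mz := mem_closedBall_of_field (p := p) hs hsB ht hz
  have h2 : ‖z.2‖ ≤ B := (norm_snd_le z).trans hz
  have h1 : ‖s • Γ (p + s • (z.1 + t • z.2)) z.2 z.2‖ ≤ s * (2 * M * B * B + 2 * M * B) := by
    rw [norm_smul, Real.norm_of_nonneg hs.le]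
    refine mul_le_mul_of_nonneg_left ?_ hs.le
    have h3 : ‖Γ (p + s • (z.1 + t • z.2)) z.2 z.2‖ ≤ M * B * B :=
      ((Γ _).le_opNorm₂ _ _).trans (by have := hb _ mz; gcongr)
    have : 0 ≤ M * B * B := by positivity
    have : 0 ≤ M * B := by positivity
    linarith
  rw [Prod.norm_def]
  refine max_le ?_ ?_
  · simp only [geodField]
    rw [norm_smul, Real.norm_of_nonneg ht.1]
    exact (mul_le_of_le_one_left (norm_nonneg _) ht.2).trans h1
  · simp only [geodField]
    rw [norm_neg]
    exact h1

include hs hsB in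
theorem geodField_continuousOn (hΓ : ContinuousOn Γ (Metric.closedBall p ρ))
    {z : Space × Space} (hz : ‖z‖ ≤ B) :
    ContinuousOn (fun t => geodField Γ p s t z) (Set.Icc 0 1) := by
  have h1 : ContinuousOn (fun t : ℝ => Γ (p + s • (z.1 + t • z.2))) (Set.Icc 0 1) :=
    hΓ.comp (by fun_prop) fun t ht => mem_closedBall_of_field hs hsB ht hz
  have h2 : ContinuousOn (fun t : ℝ => s • Γ (p + s • (z.1 + t • z.2)) z.2 z.2) (Set.Icc 0 1) :=
    ((h1.clm_apply continuousOn_const).clm_apply continuousOn_const).const_smul s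
  exact (continuousOn_id.smul h2).prodMk h2.neg

end field

/-- The geodesic starting at `a` with velocity `v` is, at time one, at `a + v + err (a, v)` with an
error of order `s`. To join `a` to `b` is to solve `v + err (a, v) = b - a`, which is a small
perturbation of the identity. -/
theorem IsLocalGeom.exists_bvp {D : Set Space} {g : Space → Matrix (Fin 3) (Fin 3) ℝ}
    {Γ : Space → Bil} (h : IsLocalGeom D g Γ) {p : Space} (hp : p ∈ D) {R : ℝ} (hR : 1 ≤ R) :
    ∃ C > 0, ∃ s₀ > 0, ∀ s, 0 < s → s ≤ s₀ → Nonempty (BVP D Γ p R C s) := by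
  obtain ⟨ρ, hρ, M, hM, hsub, hb, hL⟩ := h.exists_bounds hp
  -- The difference of two end points has norm at most `2 * R`, the correction to the velocity takes
  -- another 1, and the flow the last 1.
  set B : ℝ := 2 * R + 1 + 1 with hB
  set M1 : ℝ := 2 * M * B * B + 2 * M * B with hM1
  have hB0 : 0 < B := by linarith
  have hM1p : 0 < M1 := by positivity
  refine ⟨24 * M1, by positivity, min (min 1 (ρ / (2 * B))) (1 / (12 * M1)), by positivity,
    fun s hs hs0 => ?_⟩
  have hs1 : s ≤ 1 := hs0.trans ((min_le_left _ _).trans (min_le_left _ _))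
  have hsB : s * (2 * B) ≤ ρ := by
    rw [← le_div_iff₀ (by positivity)]
    exact hs0.trans ((min_le_left _ _).trans (min_le_right _ _))
  have hsK : s * M1 ≤ 1 / 12 := by
    have : s ≤ 1 / (12 * M1) := hs0.trans (min_le_right _ _)
    rw [le_div_iff₀ (by positivity)] at this
    linarith
  set K := s * M1 with hK
  have hK0 : 0 ≤ K := by positivity
  have hmB : ∀ z ∈ Metric.closedBall (0 : Space × Space) (2 * R + 1 + 1), ‖z‖ ≤ B := fun z hz => by
    simpa using hz
  obtain ⟨φ, hφ⟩ := exists_flow_of_small (F := geodField Γ p s) (R := 2 * R + 1) hK0 (by linarith)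
    (fun t ht z hz w hw => geodField_lip hs hs1 hsB hB0.le hM.le (fun x hx => (hb x hx).1)
      (fun x hx y hy => (hL x hx y hy).1) ht (hmB z hz) (hmB w hw))
    (fun z hz => geodField_continuousOn hs hsB (h.smooth_conn.continuousOn.mono hsub) (hmB z hz))
    (fun t ht z hz => geodField_norm_le hs hsB hB0.le hM.le (fun x hx => (hb x hx).1) ht
      (hmB z hz))
  -- Adding the two components of the flow at time one gives the position, since the first component
  -- is position minus time times velocity.
  set err : Space × Space → Space := fun z => (φ z 1).1 - z.1 + ((φ z 1).2 - z.2) with herr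
  have one_mem : (1 : ℝ) ∈ Set.Icc (0 : ℝ) 1 := by simp
  have zero_mem : (0 : ℝ) ∈ Set.Icc (0 : ℝ) 1 := by simp
  have herr_lip : ∀ z ∈ Metric.closedBall (0 : Space × Space) (2 * R + 1),
      ∀ w ∈ Metric.closedBall (0 : Space × Space) (2 * R + 1),
      ‖err z - err w‖ ≤ 6 * K * ‖z - w‖ := by
    intro z hz w hw
    have h1 := (hφ z hz).2.2 w hw 1 one_mem
    have h2 := (norm_fst_le _).trans h1
    have h3 := (norm_snd_le _).trans h1
    have e : err z - err w = (φ z 1 - z - (φ w 1 - w)).1 + (φ z 1 - z - (φ w 1 - w)).2 := by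
      simp only [herr, Prod.fst_sub, Prod.snd_sub]; abel
    rw [e]
    exact (norm_add_le _ _).trans (by linarith)
  have herr_le : ∀ z ∈ Metric.closedBall (0 : Space × Space) (2 * R + 1), ‖err z‖ ≤ 2 * K := by
    intro z hz
    have h1 := ((hφ z hz).2.1 1 one_mem).2.2
    have h2 := (norm_fst_le _).trans h1
    have h3 := (norm_snd_le _).trans h1
    exact (norm_add_le (φ z 1 - z).1 (φ z 1 - z).2).trans (by linarith)
  have hpair : ∀ a ∈ Metric.closedBall (0 : Space) R,
      ∀ v ∈ Metric.closedBall (0 : Space) (2 * R + 1),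
      (a, v) ∈ Metric.closedBall (0 : Space × Space) (2 * R + 1) := by
    intro a ha v hv
    rw [mem_closedBall_zero_iff] at *
    rw [Prod.norm_def]
    exact max_le (by simp only; linarith) hv
  have hfp : ∀ a ∈ Metric.closedBall (0 : Space) R, ∀ b ∈ Metric.closedBall (0 : Space) R,
      (∃ v ∈ Metric.closedBall (0 : Space) (2 * R + 1), v + err (a, v) = b - a) ∧
      ∀ v ∈ Metric.closedBall (0 : Space) (2 * R + 1),
        ∀ v' ∈ Metric.closedBall (0 : Space) (2 * R + 1),
        v + err (a, v) = b - a → v' + err (a, v') = b - a → v = v' := by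
    intro a ha b hb'
    refine exists_add_eq (e := fun v => err (a, v)) (c := 2 * K) (by linarith) ?_ ?_ ?_
    · intro v hv v' hv'
      have h1 := herr_lip _ (hpair a ha v hv) _ (hpair a ha v' hv')
      have h2 : ‖((a, v) : Space × Space) - (a, v')‖ = ‖v - v'‖ := by
        rw [Prod.mk_sub_mk, sub_self, Prod.norm_def]; simp
      rw [h2] at h1
      exact h1.trans (mul_le_mul_of_nonneg_right (by linarith) (norm_nonneg _))
    · exact fun v hv => herr_le _ (hpair a ha v hv)
    · have h1 := norm_sub_le b a
      rw [mem_closedBall_zero_iff] at ha hb'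
      linarith
  choose! V hV hVeq using fun a ha b hb' => (hfp a ha b hb').1
  have hX : ∀ v ∈ Metric.closedBall (0 : Space) (R - 1),
      v + err (0, v) ∈ Metric.closedBall (0 : Space) R ∧
        v ∈ Metric.closedBall (0 : Space) (2 * R + 1) := by
    intro v hv
    have h0 : (0 : Space) ∈ Metric.closedBall (0 : Space) R := by simp; linarith
    have hv' : v ∈ Metric.closedBall (0 : Space) (2 * R + 1) :=
      Metric.closedBall_subset_closedBall (by linarith) hv
    refine ⟨?_, hv'⟩
    have := herr_le _ (hpair 0 h0 v hv')
    rw [mem_closedBall_zero_iff] at *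
    exact (norm_add_le _ _).trans (by linarith)
  have h0R : (0 : Space) ∈ Metric.closedBall (0 : Space) R := by simp; linarith
  refine ⟨⟨V, fun a b r => (φ (a, V a b) r).1 + r • (φ (a, V a b) r).2,
    fun a b r => (φ (a, V a b) r).2, fun v => v + err (0, v), ?_, ?_, ?_, ?_, ?_, ?_, ?_, ?_, ?_⟩⟩
  · intro a ha b hb' r hr
    have hz := hpair a ha _ (hV a ha b hb')
    set z : Space × Space := (a, V a b) with hzd
    obtain ⟨hφ0, hφ1, -⟩ := hφ z hz
    obtain ⟨m1, d1, n1⟩ := hφ1 r hr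
    have d2 : HasDerivWithinAt (fun r => (φ z r).1) (geodField Γ p s r (φ z r)).1
        (Set.Icc 0 1) r :=
      (ContinuousLinearMap.fst ℝ Space Space).hasFDerivAt.comp_hasDerivWithinAt r d1
    have d3 : HasDerivWithinAt (fun r => (φ z r).2) (geodField Γ p s r (φ z r)).2
        (Set.Icc 0 1) r :=
      (ContinuousLinearMap.snd ℝ Space Space).hasFDerivAt.comp_hasDerivWithinAt r d1
    have hmem := mem_closedBall_of_field (p := p) hs hsB hr (hmB _ m1)
    refine ⟨hsub hmem, ?_, d3, ?_, ?_⟩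
    · have d4 := d2.add ((hasDerivWithinAt_id r (Set.Icc (0 : ℝ) 1)).smul d3)
      refine d4.congr_deriv ?_
      simp only [geodField, id]
      module
    · have e : (φ z r).1 + r • (φ z r).2 - (a + r • (b - a))
          = (φ z r - z).1 + r • ((φ z r - z).2 - err z) := by
        have := hVeq a ha b hb'
        rw [← this, hzd]
        simp only [Prod.fst_sub, Prod.snd_sub]
        module
      rw [e]
      have h1 := (norm_fst_le _).trans n1
      have h2 := (norm_snd_le _).trans n1
      have h3 := herr_le z hz
      have h4 : ‖r • ((φ z r - z).2 - err z)‖ ≤ ‖(φ z r - z).2 - err z‖ := by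
        rw [norm_smul, Real.norm_of_nonneg hr.1]
        exact mul_le_of_le_one_left (norm_nonneg _) hr.2
      have h5 := norm_sub_le (φ z r - z).2 (err z)
      refine (norm_add_le _ _).trans ?_
      linarith
    · have e : (φ z r).2 - (b - a) = (φ z r - z).2 - err z := by
        have := hVeq a ha b hb'
        rw [← this, hzd]
        simp only [Prod.snd_sub]
        module
      rw [e]
      have h2 := (norm_snd_le _).trans n1
      have h3 := herr_le z hz
      have h5 := norm_sub_le (φ z r - z).2 (err z)
      linarith
  · intro a ha b hb'
    simp only [zero_smul, add_zero]
    rw [(hφ _ (hpair a ha _ (hV a ha b hb'))).1]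
  · intro a ha b hb'
    have := hVeq a ha b hb'
    have e : b = V a b + err (a, V a b) + a := by rw [this]; abel
    conv_rhs => rw [e]
    simp only [herr, one_smul]
    abel
  · intro a ha b hb'
    rw [(hφ _ (hpair a ha _ (hV a ha b hb'))).1]
  · intro a ha b hb1 a' ha' b' hb'
    have e1 := hVeq a ha b hb1
    have e2 := hVeq a' ha' b' hb'
    have h1 := herr_lip _ (hpair a ha _ (hV a ha b hb1)) _ (hpair a' ha' _ (hV a' ha' b' hb'))
    have e3 : V a b - (b - a) - (V a' b' - (b' - a'))
        = -(err (a, V a b) - err (a', V a' b')) := by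
      rw [← e1, ← e2]; abel
    rw [e3, norm_neg]
    -- The velocities occur on both sides: their difference is bounded through `L`, and the
    -- resulting multiple `6 * K * L ≤ L / 2` is absorbed.
    set L := ‖err (a, V a b) - err (a', V a' b')‖ with hL'
    have h2 : ‖((a, V a b) : Space × Space) - (a', V a' b')‖ ≤ 2 * ‖a - a'‖ + ‖b - b'‖ + L := by
      rw [Prod.mk_sub_mk, Prod.norm_def]
      have hL0 : 0 ≤ L := norm_nonneg _
      have e4 : V a b - V a' b' = (b - b') - (a - a') - (err (a, V a b) - err (a', V a' b')) := by
        have e5 : V a b = b - a - err (a, V a b) := by rw [← e1]; abel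
        have e6 : V a' b' = b' - a' - err (a', V a' b') := by rw [← e2]; abel
        conv_lhs => rw [e5, e6]
        abel
      have h3 : ‖V a b - V a' b'‖ ≤ ‖b - b'‖ + ‖a - a'‖ + L := by
        rw [e4]
        exact (norm_sub_le _ _).trans (add_le_add_left (norm_sub_le _ _) _)
      refine max_le ?_ ?_
      · simp only; linarith [norm_nonneg (a - a'), norm_nonneg (b - b')]
      · simp only; linarith [norm_nonneg (a - a')]
    have h3 : L ≤ 6 * K * (2 * ‖a - a'‖ + ‖b - b'‖ + L) :=
      h1.trans (mul_le_mul_of_nonneg_left h2 (by positivity))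
    have hn1 := norm_nonneg (a - a')
    have hn2 := norm_nonneg (b - b')
    have hL0 : 0 ≤ L := norm_nonneg _
    have h4 : 6 * K * L ≤ 1 / 2 * L := mul_le_mul_of_nonneg_right (by linarith) hL0
    have h5 : 0 ≤ K * ‖b - b'‖ := by positivity
    have h6 : 24 * M1 * s = 24 * K := by rw [hK]; ring
    rw [h6]
    nlinarith
  · exact fun v hv => (hX v hv).1
  -- Both `v` and the velocity chosen for the end point `X v` solve the same boundary equation, so
  -- uniqueness applies.
  · intro v hv
    have h1 := (hX v hv).1
    refine (hfp 0 h0R _ h1).2 _ (hV 0 h0R _ h1) _ (hX v hv).2 (hVeq 0 h0R _ h1) ?_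
    simp
  · intro v hv
    have h1 := herr_le _ (hpair 0 h0R v (hX v hv).2)
    rw [add_sub_cancel_left]
    linarith
  · intro v hv v' hv'
    have h1 := herr_lip _ (hpair 0 h0R v (hX v hv).2) _ (hpair 0 h0R v' (hX v' hv').2)
    have h2 : ‖((0, v) : Space × Space) - (0, v')‖ = ‖v - v'‖ := by
      rw [Prod.mk_sub_mk, sub_self, Prod.norm_def]; simp
    rw [h2] at h1
    rw [add_sub_cancel_left, add_sub_cancel_left]
    refine h1.trans (mul_le_mul_of_nonneg_right ?_ (norm_nonneg _))
    linarith

end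

noncomputable section

/-! ### Second-order expansion of the squared distance -/

theorem uniform_of_continuous {E G : Type*} [NormedAddCommGroup E] [ProperSpace E]
    [NormedAddCommGroup G] {f : E → G} (hf : Continuous f) (r : ℝ) {ε : ℝ} (hε : 0 < ε) :
    ∃ δ > 0, ∀ x y, ‖x‖ ≤ r → ‖y‖ ≤ r → ‖x - y‖ ≤ δ → ‖f x - f y‖ ≤ ε := by
  have h := (isCompact_closedBall (0 : E) r).uniformContinuousOn_of_continuous hf.continuousOn
  obtain ⟨δ, hδ, h⟩ := Metric.uniformContinuousOn_iff.mp h ε hε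
  refine ⟨δ / 2, by positivity, fun x y hx hy hxy => ?_⟩
  have := h x (by simpa using hx) y (by simpa using hy) (by rw [dist_eq_norm]; linarith)
  rw [dist_eq_norm] at this
  exact this.le

theorem expand_of_hasFDerivAt {G : Type*} [NormedAddCommGroup G] [NormedSpace ℝ G]
    {f : Space → G} {f' : Space →L[ℝ] G} {p : Space} (hf : HasFDerivAt f f' p) {r ε : ℝ}
    (hr : 0 < r) (hε : 0 < ε) : ∃ s₁ > 0, ∀ s, 0 ≤ s → s ≤ s₁ → ∀ y, ‖y‖ ≤ r →
      ‖f (p + s • y) - f p - s • f' y‖ ≤ ε * s := by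
  have ho := hf.isLittleO
  rw [Asymptotics.isLittleO_iff] at ho
  have ho' := ho (show 0 < ε / r by positivity)
  rw [Metric.eventually_nhds_iff_ball] at ho'
  obtain ⟨δ, hδ, hb⟩ := ho'
  refine ⟨δ / (2 * r), by positivity, fun s hs hs1 y hy => ?_⟩
  rw [le_div_iff₀ (by positivity)] at hs1
  have hn : ‖s • y‖ ≤ s * r := by
    rw [norm_smul, Real.norm_of_nonneg hs]; exact mul_le_mul_of_nonneg_left hy hs
  have h1 := hb (p + s • y) (by
    rw [mem_ball_iff_norm, add_sub_cancel_left]; nlinarith)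
  rw [add_sub_cancel_left, map_smul] at h1
  refine h1.trans ?_
  calc ε / r * ‖s • y‖ ≤ ε / r * (s * r) := mul_le_mul_of_nonneg_left hn (by positivity)
    _ = ε * s := by field_simp

variable {D : Set Space} {g : Space → Matrix (Fin 3) (Fin 3) ℝ} {Γ : Space → Bil}

theorem IsLocalGeom.hasFDerivAt_conn (h : IsLocalGeom D g Γ) {p : Space} (hp : p ∈ D) :
    HasFDerivAt Γ (fderiv ℝ Γ p) p :=
  ((h.smooth_conn.contDiffAt (h.isOpen.mem_nhds hp)).differentiableAt (by simp)).hasFDerivAt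

theorem IsLocalGeom.hasFDerivAt_form (h : IsLocalGeom D g Γ) {p : Space} (hp : p ∈ D) :
    HasFDerivAt (fun x => formOf (g x)) (fderiv ℝ (fun x => formOf (g x)) p) p :=
  ((h.smooth.contDiffAt (h.isOpen.mem_nhds hp)).differentiableAt (by simp)).hasFDerivAt

theorem IsLocalGeom.form_comm (h : IsLocalGeom D g Γ) {p : Space} (hp : p ∈ D) (u v : Space) :
    formOf (g p) u v = formOf (g p) v u :=
  formOf_comm (isSymm_of_posDef (h.posDef p hp)) u v

/-- The derivative of the lowered connection along a line. -/
theorem IsLocalGeom.lowered_expand (h : IsLocalGeom D g Γ) {p : Space} (hp : p ∈ D) {r ε : ℝ}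
    (hr : 0 < r) (hε : 0 < ε) : ∃ s₁ > 0, ∀ s, 0 ≤ s → s ≤ s₁ → ∀ a v, ‖a‖ ≤ r → ‖v‖ ≤ r →
      p + s • a ∈ D ∧
      |formOf (g (p + s • a)) (Γ (p + s • a) a v) v - formOf (g p) (Γ p a v) v
        - s * (formOf (g p) (Γ p a v) (Γ p a v) + formOf (g p) v (connDeriv Γ p a a v))|
        ≤ ε * s := by
  obtain ⟨ρ, hρ, M, hM, hsub, hb, hL⟩ := h.exists_bounds hp
  set ε' : ℝ := ε / (3 * ((M + 1) * r ^ 3 + 1)) with hε'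
  have hε'0 : 0 < ε' := by positivity
  obtain ⟨s1, hs1, h1⟩ := expand_of_hasFDerivAt (h.hasFDerivAt_form hp) hr hε'0
  obtain ⟨s2, hs2, h2⟩ := expand_of_hasFDerivAt (h.hasFDerivAt_conn hp) hr hε'0
  set F' := fderiv ℝ (fun x => formOf (g x)) p with hF'
  set N := ‖F'‖ with hN
  refine ⟨min (min s1 s2) (min (ρ / r) (ε' / ((N + 1) * (M + 1) * r ^ 5 + 1))), by positivity,
    fun s hs hs0 a v ha hv => ?_⟩
  have l1 := h1 s hs (hs0.trans ((min_le_left _ _).trans (min_le_left _ _))) a ha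
  have l2 := h2 s hs (hs0.trans ((min_le_left _ _).trans (min_le_right _ _))) a ha
  have l3 : s * r ≤ ρ := by
    rw [← le_div_iff₀ hr]
    exact hs0.trans ((min_le_right _ _).trans (min_le_left _ _))
  have l4 : s * ((N + 1) * (M + 1) * r ^ 5 + 1) ≤ ε' := by
    rw [← le_div_iff₀ (by positivity)]
    exact hs0.trans ((min_le_right _ _).trans (min_le_right _ _))
  have hN0 : 0 ≤ N := norm_nonneg _
  have hsa : ‖s • a‖ ≤ s * r := by
    rw [norm_smul, Real.norm_of_nonneg hs]; exact mul_le_mul_of_nonneg_left ha hs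
  have hmem : p + s • a ∈ Metric.closedBall p ρ := by
    rw [mem_closedBall_iff_norm, add_sub_cancel_left]; exact hsa.trans l3
  have hpm : p ∈ Metric.closedBall p ρ := Metric.mem_closedBall_self hρ.le
  refine ⟨hsub hmem, ?_⟩
  have l5 := (hL _ hmem _ hpm).1
  rw [add_sub_cancel_left] at l5
  have l6 : ‖Γ (p + s • a) - Γ p‖ ≤ M * (s * r) := l5.trans (mul_le_mul_of_nonneg_left hsa hM.le)
  have hc := h.compat p hp a (Γ p a v) v
  -- Three remainders: that of the metric to first order, the variation of the connection against
  -- the derivative of the metric, and that of the connection to first order. Compatibility at `p`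
  -- accounts for the main term.
  have e : formOf (g (p + s • a)) (Γ (p + s • a) a v) v - formOf (g p) (Γ p a v) v
        - s * (formOf (g p) (Γ p a v) (Γ p a v) + formOf (g p) v (connDeriv Γ p a a v))
      = (formOf (g (p + s • a)) - formOf (g p) - s • F' a) (Γ (p + s • a) a v) v
        + s * F' a ((Γ (p + s • a) - Γ p) a v) v
        + formOf (g p) ((Γ (p + s • a) - Γ p - s • fderiv ℝ Γ p a) a v) v := by
    rw [h.form_comm hp v, connDeriv_apply]
    simp only [sub_apply, smul_apply, map_sub, map_smul, smul_eq_mul, map_add, add_apply]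
    have : F' a (Γ p a v) v = formOf (g p) (Γ p a (Γ p a v)) v
      + formOf (g p) (Γ p a v) (Γ p a v) := hc
    linear_combination s * this
  rw [e]
  have b1 : ‖(formOf (g (p + s • a)) - formOf (g p) - s • F' a) (Γ (p + s • a) a v) v‖
      ≤ ε' * s * (M * r * r) * r := by
    refine (ContinuousLinearMap.le_opNorm₂ _ _ _).trans ?_
    have : ‖Γ (p + s • a) a v‖ ≤ M * r * r :=
      (ContinuousLinearMap.le_opNorm₂ _ _ _).trans (by have := (hb _ hmem).1; gcongr)
    gcongr
  have b2 : ‖F' a ((Γ (p + s • a) - Γ p) a v) v‖ ≤ N * r * (M * (s * r) * r * r) * r := by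
    refine (ContinuousLinearMap.le_opNorm₂ _ _ _).trans ?_
    have h3 : ‖(Γ (p + s • a) - Γ p) a v‖ ≤ M * (s * r) * r * r :=
      (ContinuousLinearMap.le_opNorm₂ _ _ _).trans (by gcongr)
    have h4 : ‖F' a‖ ≤ N * r := (F'.le_opNorm a).trans (by gcongr)
    gcongr
  have b3 : ‖formOf (g p) ((Γ (p + s • a) - Γ p - s • fderiv ℝ Γ p a) a v) v‖
      ≤ M * (ε' * s * r * r) * r := by
    refine (ContinuousLinearMap.le_opNorm₂ _ _ _).trans ?_
    have h3 : ‖(Γ (p + s • a) - Γ p - s • fderiv ℝ Γ p a) a v‖ ≤ ε' * s * r * r :=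
      (ContinuousLinearMap.le_opNorm₂ _ _ _).trans (by gcongr)
    have := (hb _ hpm).2
    gcongr
  rw [Real.norm_eq_abs] at b1 b2 b3
  refine (abs_add_three _ _ _).trans ?_
  rw [abs_mul, abs_of_nonneg hs]
  have hε'' : ε' * ((M + 1) * r ^ 3 + 1) = ε / 3 := by rw [hε']; field_simp
  have hr3 : 0 < r ^ 3 := by positivity
  have hr5 : 0 < r ^ 5 := by positivity
  have hMr : M * r ^ 3 ≤ (M + 1) * r ^ 3 + 1 := by linarith
  have hMr' : 1 ≤ (M + 1) * r ^ 3 + 1 := by linarith [mul_pos (by linarith : 0 < M + 1) hr3]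
  have hNr : N * M * r ^ 5 ≤ (N + 1) * (M + 1) * r ^ 5 + 1 := by
    linarith [mul_nonneg hN0 hr5.le, mul_pos hM hr5]
  have c0 : ε' * s * (M * r ^ 3) ≤ ε / 3 * s := by
    calc ε' * s * (M * r ^ 3) ≤ ε' * s * ((M + 1) * r ^ 3 + 1) :=
          mul_le_mul_of_nonneg_left hMr (mul_nonneg hε'0.le hs)
      _ = ε / 3 * s := by rw [← hε'']; ring
  have c1 : ε' * s * (M * r * r) * r ≤ ε / 3 * s := le_trans (le_of_eq (by ring)) c0
  have c3 : M * (ε' * s * r * r) * r ≤ ε / 3 * s := le_trans (le_of_eq (by ring)) c0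
  have c2 : s * (N * r * (M * (s * r) * r * r) * r) ≤ ε / 3 * s := by
    calc s * (N * r * (M * (s * r) * r * r) * r) = s * (N * M * r ^ 5) * s := by ring
      _ ≤ s * ((N + 1) * (M + 1) * r ^ 5 + 1) * s :=
          mul_le_mul_of_nonneg_right (mul_le_mul_of_nonneg_left hNr hs) hs
      _ ≤ ε' * s := mul_le_mul_of_nonneg_right l4 hs
      _ ≤ ε / 3 * s := by
          refine mul_le_mul_of_nonneg_right ?_ hs
          rw [← hε'']
          exact le_mul_of_one_le_right hε'0.le hMr'
  have := mul_le_mul_of_nonneg_left b2 hs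
  linarith

/-- Product rule for the covariant derivative: the derivative is governed by `Γ d v + v'`, which
vanishes for the velocity of a geodesic. -/
theorem IsLocalGeom.hasDerivAt_form_line (h : IsLocalGeom D g Γ) {x : ℝ → Space} {d : Space}
    {t : ℝ} {S : Set ℝ} (hx : x t ∈ D) (hd : HasDerivWithinAt x d S t) {v : ℝ → Space} {v' : Space}
    (hv : HasDerivWithinAt v v' S t) :
    HasDerivWithinAt (fun r => formOf (g (x r)) (v r) (v r))
      (2 * formOf (g (x t)) (Γ (x t) d (v t) + v') (v t)) S t := by
  have h1 : HasDerivWithinAt (fun r => formOf (g (x r)))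
      (fderiv ℝ (fun x => formOf (g x)) (x t) d) S t :=
    (h.hasFDerivAt_form hx).comp_hasDerivWithinAt t hd
  refine (hasDerivWithinAt_bilinear h1 hv hv).congr_deriv ?_
  rw [h.compat _ hx, h.form_comm hx (v t), h.form_comm hx (v t), map_add, add_apply]
  ring

/-- The derivative of g(v, v) along the segment towards `a` is twice the lowered connection, so
`lowered_expand` can be integrated. Completing the square puts the first-order term into `v + s • Γ
p a v`, the form in which a velocity appears in normal coordinates. -/
theorem IsLocalGeom.metric_expand (h : IsLocalGeom D g Γ) {p : Space} (hp : p ∈ D) {r ε : ℝ}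
    (hr : 0 < r) (hε : 0 < ε) : ∃ s₁ > 0, ∀ s, 0 < s → s ≤ s₁ → ∀ a v, ‖a‖ ≤ r → ‖v‖ ≤ r →
      |formOf (g (p + s • a)) v v - (formOf (g p) (v + s • Γ p a v) (v + s • Γ p a v)
        + s ^ 2 * formOf (g p) v (connDeriv Γ p a a v))| ≤ ε * s ^ 2 := by
  obtain ⟨s1, hs1, h1⟩ := h.lowered_expand hp hr (half_pos hε)
  refine ⟨s1, hs1, fun s hs hs0 a v ha hv => ?_⟩
  have key : ∀ t ∈ Set.Icc (0 : ℝ) 1, HasDerivWithinAt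
      (fun t : ℝ => formOf (g (p + (t * s) • a)) v v -
        (formOf (g p) v v + (t * s) * (2 * formOf (g p) (Γ p a v) v) + (t * s) ^ 2 *
          (formOf (g p) (Γ p a v) (Γ p a v) + formOf (g p) v (connDeriv Γ p a a v))))
      (2 * s * (formOf (g (p + (t * s) • a)) (Γ (p + (t * s) • a) a v) v
        - formOf (g p) (Γ p a v) v
        - (t * s) * (formOf (g p) (Γ p a v) (Γ p a v) + formOf (g p) v (connDeriv Γ p a a v))))
      (Set.Icc 0 1) t := by
    intro t ht
    have hts : t * s ≤ s1 := (mul_le_of_le_one_left hs.le ht.2).trans hs0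
    have hm := (h1 (t * s) (mul_nonneg ht.1 hs.le) hts a v ha hv).1
    have d1 : HasDerivWithinAt (fun t : ℝ => p + (t * s) • a) (s • a) (Set.Icc 0 1) t := by
      have := (((hasDerivAt_id t).mul_const s).smul_const a).const_add p
      simpa using! this.hasDerivWithinAt
    have d2 := h.hasDerivAt_form_line hm d1 (hasDerivWithinAt_const t (Set.Icc 0 1) v)
    have d3 : HasDerivAt (fun t : ℝ => t * s) s t := by simpa using (hasDerivAt_id t).mul_const s
    have d4 := ((d3.mul_const (2 * formOf (g p) (Γ p a v) v)).const_add (formOf (g p) v v)).add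
      ((d3.pow 2).mul_const
        (formOf (g p) (Γ p a v) (Γ p a v) + formOf (g p) v (connDeriv Γ p a a v)))
    refine (d2.sub d4.hasDerivWithinAt).congr_deriv ?_
    simp only [add_zero, map_smul, smul_apply, smul_eq_mul, Nat.cast_ofNat]
    ring
  have hmv := norm_image_sub_le_of_norm_deriv_le_segment_01' (C := ε * s ^ 2) key (fun t ht => by
    have ht' : t ∈ Set.Icc (0 : ℝ) 1 := ⟨ht.1, ht.2.le⟩
    have hts : t * s ≤ s := mul_le_of_le_one_left hs.le ht'.2
    have := (h1 (t * s) (mul_nonneg ht.1 hs.le) (hts.trans hs0) a v ha hv).2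
    rw [Real.norm_eq_abs, abs_mul, abs_of_pos (by positivity : 0 < 2 * s)]
    calc _ ≤ 2 * s * (ε / 2 * (t * s)) := mul_le_mul_of_nonneg_left this (by positivity)
      _ ≤ 2 * s * (ε / 2 * s) := by gcongr
      _ = _ := by ring)
  simp only [zero_mul, zero_smul, one_mul, add_zero, ne_eq, OfNat.ofNat_ne_zero, not_false_eq_true,
    zero_pow, sub_self, sub_zero] at hmv
  rw [Real.norm_eq_abs] at hmv
  convert hmv using 2
  simp only [map_add, map_smul, add_apply, smul_apply, smul_eq_mul]
  rw [h.form_comm hp v (Γ p a v)]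
  ring

end

/-! ### Geodesics in normal coordinates and the squared distance. -/

noncomputable section

variable {D : Set Space} {g : Space → Matrix (Fin 3) (Fin 3) ℝ} {Γ : Space → Bil}

/-- Rescaled coordinates that are normal to first order. -/
def normalCoord (Γ : Space → Bil) (p : Space) (s : ℝ) (y : Space) : Space :=
  y + (s / 2) • Γ p y y

/-- Taylor's formula for a second derivative that is affine up to `c`. The sign is that of the
geodesic equation, where the acceleration is minus a connection term. -/
theorem taylor_third {E : Type*} [NormedAddCommGroup E] [NormedSpace ℝ E] {z z' z'' : ℝ → E}
    {u w : E} {c : ℝ} (h1 : ∀ r ∈ Set.Icc (0 : ℝ) 1, HasDerivWithinAt z (z' r) (Set.Icc 0 1) r)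
    (h2 : ∀ r ∈ Set.Icc (0 : ℝ) 1, HasDerivWithinAt z' (z'' r) (Set.Icc 0 1) r)
    (h3 : ∀ r ∈ Set.Icc (0 : ℝ) 1, ‖z'' r + (u + r • w)‖ ≤ c) :
    ‖z 1 - z 0 - z' 0 + ((1 / 2 : ℝ) • u + (1 / 6 : ℝ) • w)‖ ≤ c := by
  have hc : 0 ≤ c := (norm_nonneg _).trans (h3 0 (by simp))
  have k2 : ∀ r ∈ Set.Icc (0 : ℝ) 1, HasDerivWithinAt
      (fun r => z' r - z' 0 + (r • u + (r ^ 2 / 2) • w)) (z'' r + (u + r • w)) (Set.Icc 0 1) r := by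
    intro r hr
    have d1 : HasDerivAt (fun r : ℝ => r • u + (r ^ 2 / 2) • w) (u + r • w) r := by
      have e1 := (hasDerivAt_id r).smul_const u
      have e2 := (((hasDerivAt_id r).pow 2).div_const 2).smul_const w
      refine (e1.add e2).congr_deriv ?_
      simp
    exact ((h2 r hr).sub_const _).add d1.hasDerivWithinAt
  have k2' : ∀ r ∈ Set.Icc (0 : ℝ) 1, ‖z' r - z' 0 + (r • u + (r ^ 2 / 2) • w)‖ ≤ c := by
    intro r hr
    have := norm_image_sub_le_of_norm_deriv_le_segment' k2
      (fun t ht => h3 t ⟨ht.1, ht.2.le⟩) r hr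
    simp only [sub_self, zero_smul, ne_eq, OfNat.ofNat_ne_zero, not_false_eq_true, zero_pow,
      zero_div, add_zero, sub_zero] at this
    exact this.trans (mul_le_of_le_one_right hc hr.2)
  have k1 : ∀ r ∈ Set.Icc (0 : ℝ) 1, HasDerivWithinAt
      (fun r => z r - r • z' 0 + ((r ^ 2 / 2) • u + (r ^ 3 / 6) • w))
      (z' r - z' 0 + (r • u + (r ^ 2 / 2) • w)) (Set.Icc 0 1) r := by
    intro r hr
    have d1 : HasDerivAt (fun r : ℝ => (r ^ 2 / 2) • u + (r ^ 3 / 6) • w)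
        (r • u + (r ^ 2 / 2) • w) r := by
      have e1 := (((hasDerivAt_id r).pow 2).div_const 2).smul_const u
      have e2 := (((hasDerivAt_id r).pow 3).div_const 6).smul_const w
      refine (e1.add e2).congr_deriv ?_
      simp only [id, Nat.cast_ofNat, mul_one]
      congr 2
      · norm_num
      · norm_num; ring
    have d2 : HasDerivAt (fun r : ℝ => r • z' 0) (z' 0) r := by
      simpa using (hasDerivAt_id r).smul_const (z' 0)
    exact ((h1 r hr).sub d2.hasDerivWithinAt).add d1.hasDerivWithinAt
  have := norm_image_sub_le_of_norm_deriv_le_segment_01' k1 (fun t ht => k2' t ⟨ht.1, ht.2.le⟩)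
  simp only [one_smul, one_pow, zero_smul, ne_eq, OfNat.ofNat_ne_zero, not_false_eq_true, zero_pow,
      zero_div, add_zero, sub_zero] at this
  convert this using 2
  abel

instance : ProperSpace (Bil × Space × Space) := FiniteDimensional.proper_real _

/-- In normal coordinates the acceleration of a geodesic has no term of order `s`. Its term of order
s² is minus `connDeriv` taken at a point of the straight segment, hence affine in the parameter up
to a small error, and two integrations produce the weights 1/2 and 1/6. -/
theorem IsLocalGeom.geodesic_expand (h : IsLocalGeom D g Γ) {p : Space} (hp : p ∈ D) {R C ε : ℝ}
    (hR : 1 ≤ R) (hC : 0 < C) (hε : 0 < ε) : ∃ s₁ > 0, ∀ s, 0 < s → s ≤ s₁ →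
      ∀ B : BVP D Γ p R C s, ∀ a ∈ Metric.closedBall (0 : Space) R,
      ∀ b ∈ Metric.closedBall (0 : Space) R,
      ‖normalCoord Γ p s b - normalCoord Γ p s a - (B.V a b + s • Γ p a (B.V a b))
        + s ^ 2 • ((1 / 2 : ℝ) • connDeriv Γ p a (b - a) (b - a)
          + (1 / 6 : ℝ) • connDeriv Γ p (b - a) (b - a) (b - a))‖ ≤ ε * s ^ 2 := by
  obtain ⟨ρ, hρ, M, hM, hsub, hb, hL⟩ := h.exists_bounds hp
  set r0 : ℝ := 3 * R + 1 + M with hr0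
  have hr0p : 0 < r0 := by linarith
  -- Uniform continuity of the second-order term lets the segment and its constant velocity replace
  -- the geodesic and its velocity, which are within `C * s` of them.
  have hΨ : Continuous fun x : Bil × Space × Space =>
      fderiv ℝ Γ p x.2.1 x.2.2 x.2.2 + Γ p x.2.1 (x.1 x.2.2 x.2.2) := by
    have c1 : Continuous fun x : Bil × Space × Space => x.2.1 := by fun_prop
    have c2 : Continuous fun x : Bil × Space × Space => x.2.2 := by fun_prop
    have c3 : Continuous fun x : Bil × Space × Space => x.1 := by fun_prop
    exact ((((fderiv ℝ Γ p).continuous.comp c1).clm_apply c2).clm_apply c2).add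
      (((Γ p).continuous.comp c1).clm_apply ((c3.clm_apply c2).clm_apply c2))
  obtain ⟨δ, hδ, hu⟩ := uniform_of_continuous hΨ r0 (half_pos hε)
  have hε2 : 0 < ε / (2 * r0 ^ 2) := by positivity
  obtain ⟨s1, hs1, h1⟩ := expand_of_hasFDerivAt (h.hasFDerivAt_conn hp) hr0p hε2
  refine ⟨min (min s1 (1 / C)) (min (ρ / r0) (min (δ / (M * r0)) (δ / C))), by positivity,
    fun s hs hs0 B a ha b hb' => ?_⟩
  have l1 : s ≤ s1 := hs0.trans ((min_le_left _ _).trans (min_le_left _ _))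
  have l2 : C * s ≤ 1 := by
    rw [mul_comm, ← le_div_iff₀ hC]
    exact hs0.trans ((min_le_left _ _).trans (min_le_right _ _))
  have l3 : s * r0 ≤ ρ := by
    rw [← le_div_iff₀ hr0p]
    exact hs0.trans ((min_le_right _ _).trans (min_le_left _ _))
  have l4 : s * (M * r0) ≤ δ := by
    rw [← le_div_iff₀ (by positivity)]
    exact hs0.trans ((min_le_right _ _).trans ((min_le_right _ _).trans (min_le_left _ _)))
  have l5 : C * s ≤ δ := by
    rw [mul_comm, ← le_div_iff₀ hC]
    exact hs0.trans ((min_le_right _ _).trans ((min_le_right _ _).trans (min_le_right _ _)))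
  have na : ‖a‖ ≤ R := by simpa using ha
  have nb : ‖b‖ ≤ R := by simpa using hb'
  have nΔ : ‖b - a‖ ≤ 2 * R := (norm_sub_le _ _).trans (by linarith)
  have hg := B.geod a ha b hb'
  set Y := B.Y a b with hY
  set W := B.W a b with hW
  set Δ := b - a with hΔ
  have nm : ∀ r ∈ Set.Icc (0 : ℝ) 1, ‖a + r • Δ‖ ≤ 3 * R := fun r hr => by
    refine (norm_add_le _ _).trans ?_
    rw [norm_smul, Real.norm_of_nonneg hr.1]
    have := mul_le_of_le_one_left (norm_nonneg Δ) hr.2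
    linarith
  have nY : ∀ r ∈ Set.Icc (0 : ℝ) 1, ‖Y r‖ ≤ r0 := fun r hr => by
    have h2 := (hg r hr).2.2.2.1
    have h3 := norm_sub_norm_le (Y r) (a + r • Δ)
    have := nm r hr
    linarith
  have nW : ∀ r ∈ Set.Icc (0 : ℝ) 1, ‖W r‖ ≤ r0 := fun r hr => by
    have h2 := (hg r hr).2.2.2.2
    have h3 := norm_sub_norm_le (W r) Δ
    linarith
  have hpm : p ∈ Metric.closedBall p ρ := Metric.mem_closedBall_self hρ.le
  have main := taylor_third (z := fun r => normalCoord Γ p s (Y r))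
    (z' := fun r => W r + s • Γ p (Y r) (W r))
    (z'' := fun r => -(s • Γ (p + s • Y r) (W r) (W r))
      + s • (Γ p (W r) (W r) + Γ p (Y r) (-(s • Γ (p + s • Y r) (W r) (W r)))))
    (u := s ^ 2 • connDeriv Γ p a Δ Δ) (w := s ^ 2 • connDeriv Γ p Δ Δ Δ) (c := ε * s ^ 2)
    ?_ ?_ ?_
  · simp only [hY, hW, B.Y_zero a ha b hb', B.Y_one a ha b hb', B.W_zero a ha b hb'] at main
    refine le_of_eq_of_le (congrArg norm ?_) main
    module
  · intro r hr
    obtain ⟨-, d1, d2, -, -⟩ := hg r hr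
    have d3 := hasDerivWithinAt_bilinear (hasDerivWithinAt_const r (Set.Icc (0 : ℝ) 1) (Γ p)) d1 d1
    refine (d1.add (d3.const_smul (s / 2))).congr_deriv ?_
    rw [h.symm p hp (W r) (Y r)]
    simp only [zero_apply, zero_add]
    module
  · intro r hr
    obtain ⟨-, d1, d2, -, -⟩ := hg r hr
    have d3 := hasDerivWithinAt_bilinear (hasDerivWithinAt_const r (Set.Icc (0 : ℝ) 1) (Γ p)) d1 d2
    refine (d2.add (d3.const_smul s)).congr_deriv ?_
    simp only [zero_apply, zero_add]
  · intro r hr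
    obtain ⟨-, -, -, d4, d5⟩ := hg r hr
    have hx : ‖s • Y r‖ ≤ s * r0 := by
      rw [norm_smul, Real.norm_of_nonneg hs.le]; exact mul_le_mul_of_nonneg_left (nY r hr) hs.le
    have hmem : p + s • Y r ∈ Metric.closedBall p ρ := by
      rw [mem_closedBall_iff_norm, add_sub_cancel_left]; exact hx.trans l3
    set G := Γ (p + s • Y r) with hG
    have hGG : ‖G - Γ p‖ ≤ δ := by
      have := (hL _ hmem _ hpm).1
      rw [add_sub_cancel_left] at this
      refine this.trans ((mul_le_mul_of_nonneg_left hx hM.le).trans ?_)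
      linarith
    have hGn : ‖G‖ ≤ r0 := (hb _ hmem).1.trans (by linarith)
    have hGn' : ‖Γ p‖ ≤ r0 := (hb _ hpm).1.trans (by linarith)
    have h2 := hu (G, Y r, W r) (Γ p, a + r • Δ, Δ)
      (by rw [Prod.norm_def, Prod.norm_def]; exact max_le hGn (max_le (nY r hr) (nW r hr)))
      (by
        rw [Prod.norm_def, Prod.norm_def]
        have := nm r hr
        exact max_le hGn' (max_le (by simp only; linarith) (by simp only; linarith)))
      (by
        rw [Prod.mk_sub_mk, Prod.mk_sub_mk, Prod.norm_def, Prod.norm_def]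
        exact max_le hGG (max_le (d4.trans l5) (d5.trans l5)))
    simp only at h2
    have h3 := h1 s hs.le l1 (Y r) (nY r hr)
    have e : -(s • G (W r) (W r)) + s • (Γ p (W r) (W r) + Γ p (Y r) (-(s • G (W r) (W r))))
        + (s ^ 2 • connDeriv Γ p a Δ Δ + r • s ^ 2 • connDeriv Γ p Δ Δ Δ)
        = -(s • (G - Γ p - s • fderiv ℝ Γ p (Y r)) (W r) (W r))
          - s ^ 2 • (fderiv ℝ Γ p (Y r) (W r) (W r) + Γ p (Y r) (G (W r) (W r))
            - (fderiv ℝ Γ p (a + r • Δ) Δ Δ + Γ p (a + r • Δ) (Γ p Δ Δ))) := by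
      simp only [connDeriv_apply, map_add, map_smul, map_neg, add_apply, sub_apply, smul_apply]
      module
    rw [e]
    have h4 : ‖(G - Γ p - s • fderiv ℝ Γ p (Y r)) (W r) (W r)‖
        ≤ ε / (2 * r0 ^ 2) * s * r0 * r0 := by
      refine (ContinuousLinearMap.le_opNorm₂ _ _ _).trans ?_
      have := nW r hr
      gcongr
    have h5 : ε / (2 * r0 ^ 2) * s * r0 * r0 = ε / 2 * s := by field_simp
    refine (norm_sub_le _ _).trans ?_
    rw [norm_neg, norm_smul, norm_smul, Real.norm_of_nonneg hs.le,
      Real.norm_of_nonneg (sq_nonneg s)]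
    have h6 := mul_le_mul_of_nonneg_left (h4.trans h5.le) hs.le
    have h7 := mul_le_mul_of_nonneg_left h2 (sq_nonneg s)
    linarith

/-- The squared distance in rescaled coordinates. -/
def BVP.sqDist {p : Space} {R C s : ℝ} (B : BVP D Γ p R C s)
    (g : Space → Matrix (Fin 3) (Fin 3) ℝ) (a b : Space) : ℝ :=
  formOf (g (p + s • a)) (B.V a b) (B.V a b)

/-- By `metric_expand` the squared length of the initial velocity is that of `v + s • Γ p a v` plus
a metric term, and by `geodesic_expand` this vector is the difference `u` of normal coordinates plus
`s ^ 2 • q` up to a small error. The cross term and the metric term together make up `corr`. -/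
theorem IsLocalGeom.sqDist_expand (h : IsLocalGeom D g Γ) {p : Space} (hp : p ∈ D) {R C ε : ℝ}
    (hR : 1 ≤ R) (hC : 0 < C) (hε : 0 < ε) : ∃ s₁ > 0, ∀ s, 0 < s → s ≤ s₁ →
      ∀ B : BVP D Γ p R C s, ∀ a ∈ Metric.closedBall (0 : Space) R,
      ∀ b ∈ Metric.closedBall (0 : Space) R,
      |B.sqDist g a b - (formOf (g p) (normalCoord Γ p s b - normalCoord Γ p s a)
          (normalCoord Γ p s b - normalCoord Γ p s a)
        + s ^ 2 * corr (formOf (g p)) (connDeriv Γ p) a (b - a))| ≤ ε * s ^ 2 := by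
  obtain ⟨ρ, hρ, M, hM, hsub, hb, hL⟩ := h.exists_bounds hp
  have hpm : p ∈ Metric.closedBall p ρ := Metric.mem_closedBall_self hρ.le
  set H := formOf (g p) with hH
  set Λ := connDeriv Γ p with hΛ
  set r0 : ℝ := 2 * R + 1 + M * R ^ 2 with hr0
  have hr0p : 0 < r0 := by positivity
  have hHn : ‖H‖ ≤ M := (hb _ hpm).2
  have hΓn : ‖Γ p‖ ≤ M := (hb _ hpm).1
  -- The coefficient of s², with separate slots for `u` and `v`; it becomes `corr` when both slots
  -- are filled with the coordinate difference `Δ`.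
  set Θ : Space × Space × Space × Space → ℝ := fun x =>
    2 * H x.2.2.1 ((1 / 2 : ℝ) • Λ x.1 x.2.1 x.2.1 + (1 / 6 : ℝ) • Λ x.2.1 x.2.1 x.2.1)
      + H x.2.2.2 (Λ x.1 x.1 x.2.2.2) with hΘd
  have hΘ : Continuous Θ := by
    have c1 : Continuous fun x : Space × Space × Space × Space => x.1 := by fun_prop
    have c2 : Continuous fun x : Space × Space × Space × Space => x.2.1 := by fun_prop
    have c3 : Continuous fun x : Space × Space × Space × Space => x.2.2.1 := by fun_prop
    have c4 : Continuous fun x : Space × Space × Space × Space => x.2.2.2 := by fun_prop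
    have k1 := Λ.continuous.comp c1
    have k2 := Λ.continuous.comp c2
    exact (continuous_const.mul ((H.continuous.comp c3).clm_apply
      ((((k1.clm_apply c2).clm_apply c2).const_smul (1 / 2 : ℝ)).add
        (((k2.clm_apply c2).clm_apply c2).const_smul (1 / 6 : ℝ))))).add
      ((H.continuous.comp c4).clm_apply ((k1.clm_apply c1).clm_apply c4))
  obtain ⟨δ, hδ, hu⟩ := uniform_of_continuous hΘ r0 (show 0 < ε / 4 by positivity)
  obtain ⟨s1, hs1, h1⟩ := h.metric_expand hp hr0p (show 0 < ε / 4 by positivity)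
  set ε1 : ℝ := min 1 (ε / (8 * M * r0)) with hε1
  have hε1p : 0 < ε1 := by positivity
  obtain ⟨s2, hs2, h2⟩ := h.geodesic_expand hp hR hC hε1p
  set qM : ℝ := ‖Λ‖ * r0 * r0 * r0 + 1 with hqM
  have hqMp : 0 < qM := by positivity
  refine ⟨min (min (min s1 s2) (min 1 (1 / C)))
    (min (δ / C) (min (δ / (M * R ^ 2)) (ε / (4 * M * qM ^ 2)))), by positivity,
    fun s hs hs0 B a ha b hb' => ?_⟩
  have l1 : s ≤ s1 := hs0.trans ((min_le_left _ _).trans ((min_le_left _ _).trans (min_le_left _ _)))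
  have l2 : s ≤ s2 :=
    hs0.trans ((min_le_left _ _).trans ((min_le_left _ _).trans (min_le_right _ _)))
  have l3 : s ≤ 1 :=
    hs0.trans ((min_le_left _ _).trans ((min_le_right _ _).trans (min_le_left _ _)))
  have l4 : C * s ≤ 1 := by
    rw [mul_comm, ← le_div_iff₀ hC]
    exact hs0.trans ((min_le_left _ _).trans ((min_le_right _ _).trans (min_le_right _ _)))
  have l5 : C * s ≤ δ := by
    rw [mul_comm, ← le_div_iff₀ hC]
    exact hs0.trans ((min_le_right _ _).trans (min_le_left _ _))
  have l6 : s * (M * R ^ 2) ≤ δ := by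
    rw [← le_div_iff₀ (by positivity)]
    exact hs0.trans ((min_le_right _ _).trans ((min_le_right _ _).trans (min_le_left _ _)))
  have l7 : s * (4 * M * qM ^ 2) ≤ ε := by
    rw [← le_div_iff₀ (by positivity)]
    exact hs0.trans ((min_le_right _ _).trans ((min_le_right _ _).trans (min_le_right _ _)))
  have na : ‖a‖ ≤ R := by simpa using ha
  have nb : ‖b‖ ≤ R := by simpa using hb'
  have nΔ : ‖b - a‖ ≤ 2 * R := (norm_sub_le _ _).trans (by linarith)
  have hMR : 0 ≤ M * R ^ 2 := by positivity
  set Δ := b - a with hΔ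
  set v := B.V a b with hv
  set u := normalCoord Γ p s b - normalCoord Γ p s a with hu'
  have nvΔ : ‖v - Δ‖ ≤ C * s := by
    have := (B.geod a ha b hb' 0 (by simp)).2.2.2.2
    rwa [B.W_zero a ha b hb'] at this
  have nv : ‖v‖ ≤ r0 := by
    have := norm_sub_norm_le v Δ
    linarith
  have nuΔ : ‖u - Δ‖ ≤ s * (M * R ^ 2) := by
    have e : u - Δ = (s / 2) • (Γ p b b - Γ p a a) := by
      rw [hu', hΔ]; simp only [normalCoord]; module
    have k : ∀ y : Space, ‖y‖ ≤ R → ‖Γ p y y‖ ≤ M * R * R := fun y hy =>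
      (ContinuousLinearMap.le_opNorm₂ _ _ _).trans (by gcongr)
    rw [e, norm_smul, Real.norm_of_nonneg (by positivity)]
    have := norm_sub_le (Γ p b b) (Γ p a a)
    have k1 := k a na
    have k2 := k b nb
    calc s / 2 * ‖Γ p b b - Γ p a a‖ ≤ s / 2 * (M * R * R + M * R * R) :=
          mul_le_mul_of_nonneg_left (by linarith) (by positivity)
      _ = _ := by ring
  have nu : ‖u‖ ≤ r0 := by
    have k1 := norm_sub_norm_le u Δ
    have k2 : s * (M * R ^ 2) ≤ M * R ^ 2 := mul_le_of_le_one_left hMR l3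
    linarith
  have m1 := h1 s hs l1 a v (by linarith) nv
  have m2 := h2 s hs l2 B a ha b hb'
  rw [← hu', ← hv, ← hΔ, ← hΛ] at m2
  set q := (1 / 2 : ℝ) • Λ a Δ Δ + (1 / 6 : ℝ) • Λ Δ Δ Δ with hq
  set e1 := u - (v + s • Γ p a v) + s ^ 2 • q with he1
  set d := s ^ 2 • q - e1 with hd
  have eA : v + s • Γ p a v = u + d := by rw [hd, he1]; abel
  have nq : ‖q‖ ≤ qM - 1 := by
    have k : ∀ y : Space, ‖y‖ ≤ r0 → ‖Λ y Δ Δ‖ ≤ ‖Λ‖ * r0 * r0 * r0 := fun y hy => by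
      refine (ContinuousLinearMap.le_opNorm₂ _ _ _).trans ?_
      have h3 := (Λ.le_opNorm y).trans (mul_le_mul_of_nonneg_left hy (norm_nonneg _))
      have h4 : ‖Δ‖ ≤ r0 := by linarith
      gcongr
    have k1 := k a (by linarith)
    have k2 := k Δ (by linarith)
    rw [hq, hqM]
    refine (norm_add_le _ _).trans ?_
    rw [norm_smul, norm_smul]
    norm_num
    linarith [norm_nonneg (Λ a Δ Δ), norm_nonneg (Λ Δ Δ Δ)]
  have nd : ‖d‖ ≤ s ^ 2 * qM := by
    refine (norm_sub_le _ _).trans ?_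
    rw [norm_smul, Real.norm_of_nonneg (sq_nonneg s)]
    have k1 := mul_le_mul_of_nonneg_left nq (sq_nonneg s)
    have k2 : ε1 * s ^ 2 ≤ 1 * s ^ 2 :=
      mul_le_mul_of_nonneg_right (min_le_left _ _) (sq_nonneg s)
    linarith
  have m3 := hu (a, Δ, u, v) (a, Δ, Δ, Δ)
    (by
      simp only [Prod.norm_def]
      exact max_le (by linarith) (max_le (by linarith) (max_le nu nv)))
    (by
      simp only [Prod.norm_def]
      exact max_le (by linarith) (max_le (by linarith) (max_le (by linarith) (by linarith))))
    (by
      simp only [Prod.mk_sub_mk, Prod.norm_def, sub_self, norm_zero]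
      exact max_le hδ.le (max_le hδ.le (max_le (nuΔ.trans l6) (nvΔ.trans l5))))
  have e2 : corr H Λ a Δ = Θ (a, Δ, Δ, Δ) := by
    simp only [corr, hΘd, map_add, map_smul, smul_eq_mul]; ring
  have e3 : H (u + d) (u + d) = H u u + 2 * s ^ 2 * H u q - 2 * H u e1 + H d d := by
    have : H d u = H u d := h.form_comm hp d u
    have k : H u d = s ^ 2 * H u q - H u e1 := by
      rw [hd, map_sub, map_smul, smul_eq_mul]
    simp only [map_add, add_apply, this]
    linarith
  have e4 : Θ (a, Δ, u, v) = 2 * H u q + H v (Λ a a v) := rfl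
  rw [eA, e3] at m1
  rw [Real.norm_eq_abs] at m3
  have b1 : |H u e1| ≤ ε / 8 * s ^ 2 := by
    have k1 : ‖H u e1‖ ≤ M * r0 * (ε1 * s ^ 2) :=
      (ContinuousLinearMap.le_opNorm₂ _ _ _).trans (by gcongr)
    rw [Real.norm_eq_abs] at k1
    refine k1.trans ?_
    have k2 : ε1 ≤ ε / (8 * M * r0) := min_le_right _ _
    rw [le_div_iff₀ (by positivity)] at k2
    calc M * r0 * (ε1 * s ^ 2) = (ε1 * (8 * M * r0)) / 8 * s ^ 2 := by ring
      _ ≤ ε / 8 * s ^ 2 := by gcongr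
  have b2 : |H d d| ≤ ε / 4 * s ^ 2 := by
    have k1 : ‖H d d‖ ≤ M * (s ^ 2 * qM) * (s ^ 2 * qM) :=
      (ContinuousLinearMap.le_opNorm₂ _ _ _).trans (by gcongr)
    rw [Real.norm_eq_abs] at k1
    refine k1.trans ?_
    calc M * (s ^ 2 * qM) * (s ^ 2 * qM) = (s * (4 * M * qM ^ 2)) / 4 * s * s ^ 2 := by ring
      _ ≤ ε / 4 * 1 * s ^ 2 := by gcongr
      _ = _ := by ring
  have e5 : B.sqDist g a b = formOf (g (p + s • a)) v v := rfl
  rw [e5, e2]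
  rw [e4] at m3
  have m4 := mul_le_mul_of_nonneg_left m3 (sq_nonneg s)
  rw [← abs_of_nonneg (sq_nonneg s), ← abs_mul, abs_of_nonneg (sq_nonneg s)] at m4
  rw [abs_le] at *
  constructor <;> linarith [m1.1, m1.2, m4.1, m4.2, b1.1, b1.2, b2.1, b2.2]

end

noncomputable section

/-! ### Null geodesics of static spacetimes -/

theorem sum_mul_christoffel {n : ℕ} {g : (Fin n → ℝ) → Matrix (Fin n) (Fin n) ℝ} {x : Fin n → ℝ}
    (hdet : IsUnit (g x).det) (e b c : Fin n) :
    ∑ a, g x e a * christoffel g a b c x = (1 / 2) * (pd b (fun y => g y e c) x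
      + pd c (fun y => g y e b) x - pd e (fun y => g y b c) x) := by
  have h1 := Matrix.mul_nonsing_inv (g x) hdet
  set t : Fin n → ℝ := fun d => pd b (fun y => g y d c) x
      + pd c (fun y => g y d b) x - pd d (fun y => g y b c) x with ht
  have h2 : (g x).mulVec (((g x)⁻¹).mulVec t) = t := by
    rw [Matrix.mulVec_mulVec, h1, Matrix.one_mulVec]
  have h3 := congrFun h2 e
  simp only [Matrix.mulVec, dotProduct] at h3
  change _ = (1 / 2) * t e
  rw [← h3, Finset.mul_sum]
  refine Finset.sum_congr rfl fun a _ => ?_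
  unfold christoffel
  ring

/-- The geodesic equation with lowered index. -/
theorem eq_neg_christoffel_of_lowered {n : ℕ} {g : (Fin n → ℝ) → Matrix (Fin n) (Fin n) ℝ}
    {x : Fin n → ℝ} (hdet : IsUnit (g x).det) {w w' : Fin n → ℝ}
    (h : ∀ e, ∑ a, g x e a * w' a = -∑ b, ∑ c, (1 / 2) * (pd b (fun y => g y e c) x
      + pd c (fun y => g y e b) x - pd e (fun y => g y b c) x) * w b * w c) :
    w' = fun a => -∑ b, ∑ c, christoffel g a b c x * w b * w c := by
  have h1 : (g x).mulVec w' = (g x).mulVec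
      (fun a => -∑ b, ∑ c, christoffel g a b c x * w b * w c) := by
    funext e
    simp only [Matrix.mulVec, dotProduct]
    rw [h e]
    simp only [← sum_mul_christoffel hdet, mul_neg, Finset.sum_neg_distrib, Finset.mul_sum,
      Finset.sum_mul]
    congr 1
    rw [Finset.sum_comm' (s := Finset.univ) (t := fun _ => Finset.univ) (s' := fun _ => Finset.univ)
      (t' := Finset.univ) (by simp)]
    conv_rhs => rw [Finset.sum_comm]
    rw [Finset.sum_comm]
    refine Finset.sum_congr rfl fun b _ => ?_
    rw [Finset.sum_comm]
    refine Finset.sum_congr rfl fun c _ => Finset.sum_congr rfl fun a _ => by ring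
  have := Matrix.mulVec_injective_iff_isUnit.mpr ((Matrix.isUnit_iff_isUnit_det _).mpr hdet)
  exact this h1

theorem place_apply (z : Fin 4 → ℝ) (i : Fin 3) : place z i = z i.succ := rfl

/-- The projection to space as a continuous linear map. -/
def placeL : (Fin 4 → ℝ) →L[ℝ] Space :=
  ContinuousLinearMap.pi fun i => ContinuousLinearMap.proj i.succ

theorem placeL_apply (z : Fin 4 → ℝ) : placeL z = place z := rfl

@[simp] theorem place_event (t : ℝ) (x : Space) : place (event t x) = x := by
  ext i; simp [place, event]

@[simp] theorem event_zero (t : ℝ) (x : Space) : event t x 0 = t := rfl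

@[simp] theorem event_succ (t : ℝ) (x : Space) (i : Fin 3) : event t x i.succ = x i := rfl

theorem event_place (z : Fin 4 → ℝ) : event (z 0) (place z) = z := by
  funext i
  refine Fin.cases rfl (fun i => rfl) i

theorem pd_zero_place {f : Space → ℝ} {z : Fin 4 → ℝ} (hf : DifferentiableAt ℝ f (place z)) :
    pd 0 (fun y => f (place y)) z = 0 := by
  have h1 : HasFDerivAt (fun y => f (place y)) ((fderiv ℝ f (place z)).comp placeL) z :=
    HasFDerivAt.comp z (by exact hf.hasFDerivAt) placeL.hasFDerivAt
  rw [pd, h1.fderiv, ContinuousLinearMap.comp_apply, placeL_apply]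
  have : place (Pi.single 0 1) = 0 := by ext i; simp [place_apply]
  rw [this, map_zero]

theorem pd_succ_place {f : Space → ℝ} {z : Fin 4 → ℝ} (hf : DifferentiableAt ℝ f (place z))
    (i : Fin 3) : pd i.succ (fun y => f (place y)) z = pd i f (place z) := by
  have h1 : HasFDerivAt (fun y => f (place y)) ((fderiv ℝ f (place z)).comp placeL) z :=
    HasFDerivAt.comp z (by exact hf.hasFDerivAt) placeL.hasFDerivAt
  rw [pd, h1.fderiv, ContinuousLinearMap.comp_apply, placeL_apply]
  have : place (Pi.single i.succ 1) = Pi.single i 1 := by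
    ext j; simp [place_apply, Pi.single_apply]
  rw [this]; rfl

namespace StaticSpacetime

variable (S : StaticSpacetime)

theorem metric_zero_zero (z : Fin 4 → ℝ) : S.metric z 0 0 = -(S.lapse (place z)) ^ 2 := rfl

theorem metric_zero_succ (z : Fin 4 → ℝ) (i : Fin 3) : S.metric z 0 i.succ = 0 := rfl

theorem metric_succ_zero (z : Fin 4 → ℝ) (i : Fin 3) : S.metric z i.succ 0 = 0 := rfl

theorem metric_succ_succ (z : Fin 4 → ℝ) (i j : Fin 3) :
    S.metric z i.succ j.succ = S.spatial (place z) i j := rfl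

theorem spatial_eq {x : Space} (hx : x ∈ S.domain) (i j : Fin 3) :
    S.spatial x i j = S.lapse x ^ 2 * S.opticalMetric x i j := by
  have := (S.lapse_pos x hx).ne'
  simp only [opticalMetric, Matrix.smul_apply, smul_eq_mul]
  field_simp

theorem optical_smooth (i j : Fin 3) : ContDiffOn ℝ ∞ (fun x => S.opticalMetric x i j) S.domain := by
  simp only [opticalMetric, Matrix.smul_apply, smul_eq_mul]
  exact ((S.lapse_smooth.pow 2).inv fun x hx => pow_ne_zero 2 (S.lapse_pos x hx).ne').mul
    (S.spatial_smooth i j)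

theorem optical_posDef {x : Space} (hx : x ∈ S.domain) : (S.opticalMetric x).PosDef :=
  (S.spatial_posDef x hx).smul (by have := S.lapse_pos x hx; positivity)

theorem optical_isLocalGeom : IsLocalGeom S.domain S.opticalMetric (gammaOf S.opticalMetric) :=
  isLocalGeom S.isOpen_domain S.optical_smooth fun _ hx => S.optical_posDef hx

theorem isUnit_det_metric {z : Fin 4 → ℝ} (hz : place z ∈ S.domain) :
    IsUnit (S.metric z).det := by
  rw [isUnit_iff_ne_zero]
  intro h0
  obtain ⟨v, hv, hm⟩ := Matrix.exists_mulVec_eq_zero_iff.mpr h0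
  apply hv
  have h1 := congrFun hm 0
  simp only [Matrix.mulVec, dotProduct, Fin.sum_univ_succ (n := 3), metric_zero_zero,
    metric_zero_succ, zero_mul, Finset.sum_const_zero, add_zero, Pi.zero_apply] at h1
  have hl := (S.lapse_pos _ hz)
  have hv0 : v 0 = 0 := by
    rcases mul_eq_zero.mp h1 with h | h
    · exfalso; have := pow_pos hl 2; linarith
    · exact h
  have h2 : (S.spatial (place z)).mulVec (place v) = 0 := by
    funext i
    have := congrFun hm i.succ
    simp only [Matrix.mulVec, dotProduct, Fin.sum_univ_succ (n := 3), metric_succ_zero,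
      metric_succ_succ, zero_mul, zero_add, Pi.zero_apply] at this
    simpa only [Matrix.mulVec, dotProduct, place_apply, Pi.zero_apply] using this
  have h3 : place v = 0 := by
    by_contra hne
    have := (S.spatial_posDef _ hz).dotProduct_mulVec_pos hne
    rw [h2] at this
    simp at this
  rw [← event_place v, hv0, h3]
  funext i
  exact Fin.cases rfl (fun _ => rfl) i

/-- The spacetime metric is the squared lapse times the product of -dt² with the optical metric. -/
theorem null_iff {z w : Fin 4 → ℝ} (hz : place z ∈ S.domain) :
    w ⬝ᵥ (S.metric z).mulVec w = 0 ↔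
      formOf (S.opticalMetric (place z)) (place w) (place w) = w 0 ^ 2 := by
  have hl := pow_pos (S.lapse_pos _ hz) 2
  have e : w ⬝ᵥ (S.metric z).mulVec w = S.lapse (place z) ^ 2 *
      (formOf (S.opticalMetric (place z)) (place w) (place w) - w 0 ^ 2) := by
    rw [formOf_apply]
    simp only [Matrix.mulVec, dotProduct, Fin.sum_univ_succ (n := 3), metric_zero_zero,
      metric_zero_succ, metric_succ_zero, metric_succ_succ, S.spatial_eq hz, zero_mul, zero_add,
      Finset.sum_const_zero, add_zero]
    simp only [Fin.sum_univ_three, place_apply]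
    ring
  rw [e, mul_eq_zero, or_iff_right hl.ne', sub_eq_zero]

/-- A null geodesic survives a conformal change of the metric up to reparametrization. The
coefficient `d`, minus the logarithmic derivative of the squared lapse along the curve, is the
effect of the change of affine parameter. -/
theorem geodesic_eq {z w w' : Fin 4 → ℝ} (hz : place z ∈ S.domain)
    (hnull : formOf (S.opticalMetric (place z)) (place w) (place w) = w 0 ^ 2) {d : ℝ}
    (hd : S.lapse (place z) ^ 2 * d = -fderiv ℝ (fun y => S.lapse y ^ 2) (place z) (place w))
    (h0 : w' 0 = d * w 0)
    (h1 : place w' = d • place w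
      - gammaOf S.opticalMetric (place z) (place w) (place w)) :
    w' = fun a => -∑ b, ∑ c, christoffel S.metric a b c z * w b * w c := by
  set x := place z with hx
  have hl := pow_pos (S.lapse_pos _ hz) 2
  have hnh := S.isOpen_domain.mem_nhds hz
  have dφ : DifferentiableAt ℝ (fun y => S.lapse y ^ 2) x :=
    ((S.lapse_smooth.pow 2).contDiffAt hnh).differentiableAt (by simp)
  have dg : ∀ i j, DifferentiableAt ℝ (fun y => S.opticalMetric y i j) x := fun i j =>
    ((S.optical_smooth i j).contDiffAt hnh).differentiableAt (by simp)
  have dh : ∀ i j, DifferentiableAt ℝ (fun y => S.spatial y i j) x := fun i j =>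
    ((S.spatial_smooth i j).contDiffAt hnh).differentiableAt (by simp)
  have dn : DifferentiableAt ℝ (fun y => -S.lapse y ^ 2) x := dφ.neg
  have pn : ∀ c, pd c (fun y => -S.lapse y ^ 2) x = -pd c (fun y => S.lapse y ^ 2) x := by
    intro c
    have : HasFDerivAt (fun y => -S.lapse y ^ 2) (-fderiv ℝ (fun y => S.lapse y ^ 2) x) x :=
      dφ.hasFDerivAt.neg
    rw [pd, this.fderiv]; rfl
  have ph : ∀ c i j, pd c (fun y => S.spatial y i j) x
      = pd c (fun y => S.lapse y ^ 2) x * S.opticalMetric x i j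
        + S.lapse x ^ 2 * pd c (fun y => S.opticalMetric y i j) x := by
    intro c i j
    have h2 : HasFDerivAt (fun y => S.spatial y i j)
        (S.lapse x ^ 2 • fderiv ℝ (fun y => S.opticalMetric y i j) x
          + S.opticalMetric x i j • fderiv ℝ (fun y => S.lapse y ^ 2) x) x := by
      refine (dφ.hasFDerivAt.mul (dg i j).hasFDerivAt).congr_of_eventuallyEq ?_
      filter_upwards [hnh] with y hy
      exact S.spatial_eq hy i j
    rw [pd, h2.fderiv]
    simp only [add_apply, smul_apply, smul_eq_mul, pd]
    ring
  have q00 : ∀ c : Fin 3, pd c.succ (fun y => S.metric y 0 0) z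
      = -pd c (fun y => S.lapse y ^ 2) x := fun c => by
    rw [← pn]; exact pd_succ_place dn c
  have q00' : pd 0 (fun y => S.metric y 0 0) z = 0 := pd_zero_place dn
  have qij : ∀ c i j : Fin 3, pd c.succ (fun y => S.metric y i.succ j.succ) z
      = pd c (fun y => S.spatial y i j) x := fun c i j => pd_succ_place (dh i j) c
  have qij' : ∀ i j : Fin 3, pd 0 (fun y => S.metric y i.succ j.succ) z = 0 :=
    fun i j => pd_zero_place (dh i j)
  have q0i : ∀ (c : Fin 4) (i : Fin 3), pd c (fun y => S.metric y 0 i.succ) z = 0 := fun c i => by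
    simp only [metric_zero_succ, pd]; simp
  have qi0 : ∀ (c : Fin 4) (i : Fin 3), pd c (fun y => S.metric y i.succ 0) z = 0 := fun c i => by
    simp only [metric_succ_zero, pd]; simp
  have hdφ : fderiv ℝ (fun y => S.lapse y ^ 2) x (place w)
      = ∑ c, w c.succ * pd c (fun y => S.lapse y ^ 2) x := fderiv_eq_sum_pd _ _ _
  apply eq_neg_christoffel_of_lowered (S.isUnit_det_metric hz)
  intro e
  refine Fin.cases ?_ (fun e => ?_) e
  · simp only [Fin.sum_univ_succ (n := 3), q00, q00', q0i, qij', qi0]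
    simp only [metric_zero_zero, metric_zero_succ,
      zero_mul, Finset.sum_const_zero, add_zero, sub_zero, mul_zero, zero_add, h0, ← hx]
    have : ∀ c : Fin 3, 1 / 2 * -pd c (fun y => S.lapse y ^ 2) x * w 0 * w c.succ
        = (-(1 / 2) * w 0) * (w c.succ * pd c (fun y => S.lapse y ^ 2) x) := fun c => by ring
    have t' : ∀ c : Fin 3, 1 / 2 * -pd c (fun y => S.lapse y ^ 2) x * w c.succ * w 0
        = (-(1 / 2) * w 0) * (w c.succ * pd c (fun y => S.lapse y ^ 2) x) := fun c => by ring
    simp only [this, t', ← Finset.mul_sum, ← hdφ]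
    linear_combination (-w 0) * hd
  · have hv : ∀ a : Fin 3, w' a.succ = d * w a.succ
        - ∑ b, ∑ c, christoffel S.opticalMetric a b c x * w b.succ * w c.succ := by
      intro a
      have := congrFun h1 a
      rw [Pi.sub_apply, gammaOf_apply] at this
      exact this
    have hdet : IsUnit (S.opticalMetric x).det := (S.optical_posDef hz).det_pos.ne'.isUnit
    have hlow := fun b c => sum_mul_christoffel hdet e b c
    have key : ∑ a, S.opticalMetric x e a *
        (∑ b, ∑ c, christoffel S.opticalMetric a b c x * w b.succ * w c.succ)
        = ∑ b, ∑ c, (1 / 2) * (pd b (fun y => S.opticalMetric y e c) x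
      + pd c (fun y => S.opticalMetric y e b) x - pd e (fun y => S.opticalMetric y b c) x)
        * w b.succ * w c.succ := by
      simp only [← hlow, Finset.mul_sum, Finset.sum_mul]
      rw [Finset.sum_comm]
      refine Finset.sum_congr rfl fun b _ => ?_
      rw [Finset.sum_comm]
      refine Finset.sum_congr rfl fun c _ => Finset.sum_congr rfl fun a _ => by ring
    have hnull' : ∑ b, ∑ c, S.opticalMetric x b c * w b.succ * w c.succ = w 0 ^ 2 := by
      rw [← hnull, formOf_apply]
      simp only [dotProduct, Matrix.mulVec, Finset.mul_sum, place_apply]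
      refine Finset.sum_congr rfl fun b _ => Finset.sum_congr rfl fun c _ => by ring
    have e1 : ∑ b, ∑ c, 1 / 2 * (pd b (fun y => S.spatial y e c) x
        + pd c (fun y => S.spatial y e b) x - pd e (fun y => S.spatial y b c) x)
          * w b.succ * w c.succ
        = S.lapse x ^ 2 * (∑ b, ∑ c, (1 / 2) * (pd b (fun y => S.opticalMetric y e c) x
      + pd c (fun y => S.opticalMetric y e b) x - pd e (fun y => S.opticalMetric y b c) x)
        * w b.succ * w c.succ)
        + (∑ c, w c.succ * pd c (fun y => S.lapse y ^ 2) x)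
          * (∑ a, S.opticalMetric x e a * w a.succ)
        - 1 / 2 * pd e (fun y => S.lapse y ^ 2) x
          * (∑ b, ∑ c, S.opticalMetric x b c * w b.succ * w c.succ) := by
      simp only [ph, Fin.sum_univ_three]
      ring
    have e2 : ∑ a, S.spatial x e a * w' a.succ = S.lapse x ^ 2 *
        (d * (∑ a, S.opticalMetric x e a * w a.succ) - ∑ a, S.opticalMetric x e a *
        (∑ b, ∑ c, christoffel S.opticalMetric a b c x * w b.succ * w c.succ)) := by
      rw [Finset.mul_sum, ← Finset.sum_sub_distrib, Finset.mul_sum]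
      refine Finset.sum_congr rfl fun a _ => ?_
      rw [hv, S.spatial_eq hz]
      ring
    simp only [Fin.sum_univ_succ (n := 3), q00, q0i, qij', qij, qi0]
    simp only [metric_succ_zero, metric_succ_succ, zero_mul, Finset.sum_const_zero, add_zero, sub_zero, mul_zero, zero_add, ← hx]
    -- Nullity makes the gradient terms of the squared lapse from the time block and from the space
    -- block cancel.
    rw [e1, e2, key, hnull', ← hdφ]
    linear_combination (∑ a, S.opticalMetric x e a * w a.succ) * hd

end StaticSpacetime

end

/-! ### From optical geodesics to signals: delays, directions and speed. -/

noncomputable section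

/-- The curve `x` with velocity `v` is a geodesic of the connection `Γ`. -/
def IsGeod (D : Set Space) (Γ : Space → Bil) (x v : ℝ → Space) : Prop :=
  ∀ r ∈ Set.Icc (0 : ℝ) 1, x r ∈ D ∧ HasDerivWithinAt x (v r) (Set.Icc 0 1) r ∧
    HasDerivWithinAt v (-(Γ (x r) (v r) (v r))) (Set.Icc 0 1) r

theorem eq_of_hasDerivWithinAt_zero {f : ℝ → ℝ}
    (hf : ∀ r ∈ Set.Icc (0 : ℝ) 1, HasDerivWithinAt f 0 (Set.Icc 0 1) r) {r : ℝ}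
    (hr : r ∈ Set.Icc (0 : ℝ) 1) : f r = f 0 := by
  refine constant_of_has_deriv_right_zero (fun r hr => (hf r hr).continuousWithinAt) ?_ r hr
  intro r hr
  exact (hf r (Set.Ico_subset_Icc_self hr)).mono_of_mem_nhdsWithin (Icc_mem_nhdsGE_of_mem hr)

namespace IsGeod

variable {D : Set Space} {g : Space → Matrix (Fin 3) (Fin 3) ℝ} {Γ : Space → Bil}
  {x v : ℝ → Space}

theorem form_eq (hx : IsGeod D Γ x v) (h : IsLocalGeom D g Γ) {r : ℝ}
    (hr : r ∈ Set.Icc (0 : ℝ) 1) :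
    formOf (g (x r)) (v r) (v r) = formOf (g (x 0)) (v 0) (v 0) := by
  refine eq_of_hasDerivWithinAt_zero (f := fun r => formOf (g (x r)) (v r) (v r))
    (fun r hr => ?_) hr
  obtain ⟨h1, h2, h3⟩ := hx r hr
  refine (h.hasDerivAt_form_line h1 h2 h3).congr_deriv ?_
  simp

/-- Speed is conserved, so a geodesic that starts with zero velocity never moves and could not join
distinct points. -/
theorem form_ne_zero (hx : IsGeod D Γ x v) (h : IsLocalGeom D g Γ) (hne : x 0 ≠ x 1) :
    0 < formOf (g (x 0)) (v 0) (v 0) := by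
  have h0 := (h.posDef _ (hx 0 (by simp)).1)
  rw [formOf_apply]
  by_cases hv : v 0 = 0
  · exfalso
    have hv' : ∀ r ∈ Set.Icc (0 : ℝ) 1, v r = 0 := by
      intro r hr
      by_contra hn
      have := (h.posDef _ (hx r hr).1).dotProduct_mulVec_pos hn
      have e := hx.form_eq h hr
      rw [formOf_apply, hv, map_zero] at e
      simp only [star_trivial] at this
      linarith
    have : ∀ i, x 1 i = x 0 i := fun i => by
      refine eq_of_hasDerivWithinAt_zero (f := fun r => x r i) (fun r hr => ?_) (by simp)
      have := (hasDerivWithinAt_pi.mp (hx r hr).2.1) i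
      rwa [hv' r hr] at this
    exact hne (funext fun i => (this i).symm)
  · simpa using h0.dotProduct_mulVec_pos hv

/-- The geodesic equation is even in the velocity. Reversed geodesics carry the signals back, with
the same duration. -/
theorem reverse (hx : IsGeod D Γ x v) :
    IsGeod D Γ (fun r => x (1 - r)) (fun r => -v (1 - r)) := by
  intro r hr
  have hr' : 1 - r ∈ Set.Icc (0 : ℝ) 1 := ⟨by linarith [hr.2], by linarith [hr.1]⟩
  obtain ⟨h1, h2, h3⟩ := hx _ hr'
  have hm : Set.MapsTo (fun r : ℝ => 1 - r) (Set.Icc 0 1) (Set.Icc 0 1) := fun r hr =>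
    ⟨by linarith [hr.2], by linarith [hr.1]⟩
  have hd : HasDerivWithinAt (fun r : ℝ => 1 - r) (-1) (Set.Icc 0 1) r :=
    ((hasDerivAt_id r).const_sub 1).hasDerivWithinAt
  refine ⟨h1, ?_, ?_⟩
  · exact (h2.scomp r hd hm).congr_deriv (by simp)
  · refine (h3.scomp r hd hm).neg.congr_deriv ?_
    simp

end IsGeod

theorem BVP.isGeod {D : Set Space} {Γ : Space → Bil} {p : Space} {R C s : ℝ}
    (B : BVP D Γ p R C s) {a b : Space} (ha : a ∈ Metric.closedBall (0 : Space) R)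
    (hb : b ∈ Metric.closedBall (0 : Space) R) :
    IsGeod D Γ (fun r => p + s • B.Y a b r) (fun r => s • B.W a b r) := by
  intro r hr
  obtain ⟨h1, h2, h3, -⟩ := B.geod a ha b hb r hr
  refine ⟨h1, (h2.const_smul s).const_add p, (h3.const_smul s).congr_deriv ?_⟩
  simp only [map_smul, smul_apply, smul_neg]

/-- Reparametrization of the unit interval by a positive speed. -/
theorem exists_reparam {f : ℝ → ℝ} (hf : Continuous f) {m : ℝ} (hm : 0 < m) (hfm : ∀ r, m ≤ f r) :
    ∃ A > 0, ∃ σ : ℝ → ℝ, σ 0 = 0 ∧ σ 1 = 1 ∧ Monotone σ ∧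
      ∀ r, HasDerivAt σ (A / f (σ r)) r := by
  -- The reparametrization sends `r` to the inverse of this integral at `L 1 * r`, so the constant
  -- `A` is `L 1`.
  set L : ℝ → ℝ := fun b => ∫ r in (0 : ℝ)..b, f r with hL
  have hd : ∀ b, HasDerivAt L (f b) b := fun b => hf.integral_hasStrictDerivAt 0 b |>.hasDerivAt
  have hpos : ∀ r, 0 < f r := fun r => hm.trans_le (hfm r)
  have hmono : StrictMono L := strictMono_of_hasDerivAt_pos hd hpos
  have hL0 : L 0 = 0 := by simp [hL]
  have hcont : Continuous L := continuous_iff_continuousAt.mpr fun b => (hd b).continuousAt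
  have hmono2 : Monotone fun b => L b - m * b := by
    refine monotone_of_deriv_nonneg (fun b => ?_) fun b => ?_
    · exact ((hd b).sub ((hasDerivAt_id' b).const_mul m)).differentiableAt
    · have h1 : HasDerivAt (fun b => L b - m * b) (f b - m * 1) b :=
        (hd b).sub ((hasDerivAt_id' b).const_mul m)
      rw [h1.deriv]
      have := hfm b; linarith
  have hsurj : Function.Surjective L := by
    refine hcont.surjective ?_ ?_
    · refine Filter.tendsto_atTop_mono' _ ?_ (Filter.tendsto_id.const_mul_atTop hm)
      filter_upwards [Filter.eventually_ge_atTop 0] with b hb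
      have := hmono2 hb
      simp only [hL0, mul_zero, sub_zero] at this
      simp only [id]; linarith
    · refine Filter.tendsto_atBot_mono' _ ?_ (Filter.tendsto_id.const_mul_atBot hm)
      filter_upwards [Filter.eventually_le_atBot 0] with b hb
      have := hmono2 hb
      simp only [hL0, mul_zero, sub_zero] at this
      simp only [id]; linarith
  set e := StrictMono.orderIsoOfSurjective L hmono hsurj with he
  have heL : ∀ b, e b = L b := fun b => rfl
  have hA : 0 < L 1 := by rw [← hL0]; exact hmono one_pos
  have hLe : ∀ y, L (e.symm y) = y := fun y => e.apply_symm_apply y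
  refine ⟨L 1, hA, fun r => e.symm (L 1 * r), ?_, ?_, ?_, fun r => ?_⟩
  · simp only [mul_zero]; exact (e.symm_apply_eq).mpr hL0.symm
  · simp only [mul_one]; rw [← heL, e.symm_apply_apply]
  · intro a b hab
    exact e.symm.monotone (mul_le_mul_of_nonneg_left hab hA.le)
  · have h1 : HasDerivAt e.symm (f (e.symm (L 1 * r)))⁻¹ (L 1 * r) :=
      HasDerivAt.of_local_left_inverse e.symm.continuous.continuousAt (hd _) (hpos _).ne'
        (Filter.Eventually.of_forall hLe)
    have h2 : HasDerivAt (fun r : ℝ => L 1 * r) (L 1) r := by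
      simpa using (hasDerivAt_id r).const_mul (L 1)
    refine (h1.comp r h2).congr_deriv ?_
    rw [div_eq_inv_mul]

theorem hasDerivWithinAt_event {t : ℝ → ℝ} {x : ℝ → Space} {t' : ℝ} {x' : Space} {s : Set ℝ} {r : ℝ}
    (ht : HasDerivWithinAt t t' s r) (hx : HasDerivWithinAt x x' s r) :
    HasDerivWithinAt (fun r => event (t r) (x r)) (event t' x') s r := by
  rw [hasDerivWithinAt_pi]
  refine fun i => Fin.cases ht (fun i => ?_) i
  exact (hasDerivWithinAt_pi.mp hx) i

namespace StaticSpacetime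

variable (S : StaticSpacetime)

/-- The connection of the optical metric. -/
def conn : Space → Bil := gammaOf S.opticalMetric

/-- Along an optical geodesic with time proportional to arc length, the affine parameter of the
spacetime metric has the squared lapse as density. Running through the geodesic with speed
proportional to its inverse therefore gives an affinely parametrized null geodesic of duration `ℓ`.
-/
theorem exists_null_of_isGeod {x v : ℝ → Space} (hx : IsGeod S.domain S.conn x v) {ℓ : ℝ}
    (hℓ : 0 < ℓ) (hv : formOf (S.opticalMetric (x 0)) (v 0) (v 0) = ℓ ^ 2) (t : ℝ) :
    ∃ γ w, S.IsNullGeodesic γ w ∧ γ 0 = event t (x 0) ∧ γ 1 = event (t + ℓ) (x 1) ∧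
      ∃ c : ℝ, 0 < c ∧ place (w 0) = c • v 0 := by
  have hxc : ContinuousOn x (Set.Icc 0 1) := fun r hr => (hx r hr).2.1.continuousWithinAt
  have hlc : ContinuousOn (fun r => S.lapse (x r) ^ 2) (Set.Icc 0 1) :=
    (S.lapse_smooth.continuousOn.comp hxc fun r hr => (hx r hr).1).pow 2
  -- The squared lapse along the curve, extended by constants so that it is positive and bounded
  -- away from zero on the whole line.
  set f : ℝ → ℝ := Set.IccExtend (zero_le_one' ℝ)
    ((Set.Icc (0:ℝ) 1).domRestrict fun r => S.lapse (x r) ^ 2) with hf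
  have hfe : ∀ r ∈ Set.Icc (0:ℝ) 1, f r = S.lapse (x r) ^ 2 := fun r hr => by
    rw [hf, Set.IccExtend_of_mem _ _ hr]; rfl
  have hfc : Continuous f := (continuousOn_iff_continuous_domRestrict.mp hlc).Icc_extend'
  obtain ⟨r0, hr0, hmin⟩ := isCompact_Icc.exists_isMinOn (Set.nonempty_Icc.mpr zero_le_one) hlc
  have hm : 0 < S.lapse (x r0) ^ 2 := pow_pos (S.lapse_pos _ (hx r0 hr0).1) 2
  have hfm : ∀ r, S.lapse (x r0) ^ 2 ≤ f r := fun r =>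
    hmin (Set.projIcc (0:ℝ) 1 zero_le_one r).2
  obtain ⟨A, hA, σ, hσ0, hσ1, hσm, hσd⟩ := exists_reparam hfc hm hfm
  have hmaps : Set.MapsTo σ (Set.Icc 0 1) (Set.Icc 0 1) := fun r hr =>
    ⟨hσ0 ▸ hσm hr.1, hσ1 ▸ hσm hr.2⟩
  set σ' : ℝ → ℝ := fun r => A / S.lapse (x (σ r)) ^ 2 with hσ'
  have hpos : ∀ r ∈ Set.Icc (0:ℝ) 1, 0 < S.lapse (x (σ r)) ^ 2 := fun r hr =>
    pow_pos (S.lapse_pos _ (hx _ (hmaps hr)).1) 2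
  have hd1 : ∀ r ∈ Set.Icc (0:ℝ) 1, HasDerivWithinAt σ (σ' r) (Set.Icc 0 1) r := fun r hr => by
    have := (hσd r).hasDerivWithinAt (s := Set.Icc 0 1)
    rwa [hfe _ (hmaps hr)] at this
  have hdx : ∀ r ∈ Set.Icc (0:ℝ) 1, HasDerivWithinAt (fun r => x (σ r)) (σ' r • v (σ r))
      (Set.Icc 0 1) r := fun r hr => (hx _ (hmaps hr)).2.1.scomp r (hd1 r hr) hmaps
  have hdv : ∀ r ∈ Set.Icc (0:ℝ) 1, HasDerivWithinAt (fun r => v (σ r))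
      (σ' r • -(S.conn (x (σ r)) (v (σ r)) (v (σ r)))) (Set.Icc 0 1) r := fun r hr =>
    (hx _ (hmaps hr)).2.2.scomp r (hd1 r hr) hmaps
  set q : ℝ → ℝ := fun r => fderiv ℝ (fun y => S.lapse y ^ 2) (x (σ r)) (σ' r • v (σ r)) with hq
  -- The logarithmic derivative of the speed of reparametrization, which is the coefficient required
  -- by `geodesic_eq`.
  set d : ℝ → ℝ := fun r => -q r / S.lapse (x (σ r)) ^ 2 with hdd
  have hd2 : ∀ r ∈ Set.Icc (0:ℝ) 1, HasDerivWithinAt σ' (d r * σ' r) (Set.Icc 0 1) r := by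
    intro r hr
    have hnh := S.isOpen_domain.mem_nhds (hx _ (hmaps hr)).1
    have dφ : HasFDerivAt (fun y => S.lapse y ^ 2) (fderiv ℝ (fun y => S.lapse y ^ 2) (x (σ r)))
        (x (σ r)) :=
      (((S.lapse_smooth.pow 2).contDiffAt hnh).differentiableAt (by simp)).hasFDerivAt
    have h1 : HasDerivWithinAt (fun r => S.lapse (x (σ r)) ^ 2) (q r) (Set.Icc 0 1) r :=
      HasFDerivAt.comp_hasDerivWithinAt (l := fun y => S.lapse y ^ 2) r dφ (hdx r hr)
    have h2 := (h1.fun_inv (hpos r hr).ne').const_mul A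
    have e : (fun r => A * (S.lapse (x (σ r)) ^ 2)⁻¹) = σ' := by
      funext r; simp only [hσ', div_eq_mul_inv]
    rw [e] at h2
    refine h2.congr_deriv ?_
    simp only [hdd, hσ']
    field_simp
  refine ⟨fun r => event (t + ℓ * σ r) (x (σ r)), fun r => event (ℓ * σ' r) (σ' r • v (σ r)),
    fun r hr => ?_, by simp [hσ0], by simp [hσ1], σ' 0, ?_, by simp [hσ0]⟩
  · have hxD := (hx _ (hmaps hr)).1
    have hnull : formOf (S.opticalMetric (place (event (t + ℓ * σ r) (x (σ r)))))
        (place (event (ℓ * σ' r) (σ' r • v (σ r)))) (place (event (ℓ * σ' r) (σ' r • v (σ r))))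
        = (event (ℓ * σ' r) (σ' r • v (σ r)) 0) ^ 2 := by
      simp only [place_event, event_zero, map_smul, smul_apply, smul_eq_mul]
      rw [hx.form_eq S.optical_isLocalGeom (hmaps hr), hv]
      ring
    have hzD : place (event (t + ℓ * σ r) (x (σ r))) ∈ S.domain := by rw [place_event]; exact hxD
    refine ⟨hzD, ?_, ?_, (S.null_iff hzD).mpr hnull, ?_⟩
    · exact hasDerivWithinAt_event (((hd1 r hr).const_mul ℓ).const_add t) (hdx r hr)
    · have h3 := hasDerivWithinAt_event ((hd2 r hr).const_mul ℓ) ((hd2 r hr).smul (hdv r hr))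
      refine h3.congr_deriv ?_
      refine S.geodesic_eq hzD hnull (d := d r) ?_ ?_ ?_
      · simp only [place_event]
        change _ * d r = -q r
        simp only [hdd]
        rw [mul_div_cancel₀ _ (hpos r hr).ne']
      · simp only [event_zero]; ring
      · simp only [place_event]
        change _ = _ - S.conn _ _ _
        simp only [map_smul, smul_apply, smul_neg, smul_smul]
        abel
    · exact mul_pos hℓ (div_pos hA (hpos r hr))
  · exact div_pos hA (hpos 0 (by simp))

variable {S}

/-- Staticity: the metric and its derivatives do not depend on time. -/
theorem IsNullGeodesic.translate {γ w : ℝ → Fin 4 → ℝ} (h : S.IsNullGeodesic γ w) (a : ℝ) :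
    S.IsNullGeodesic (fun r => event (γ r 0 + a) (place (γ r))) w := by
  intro r hr
  obtain ⟨h1, h2, h3, h4, h5⟩ := h r hr
  have hm : ∀ z, S.metric (event (z 0 + a) (place z)) = S.metric z := fun z => by
    simp only [metric, place_event]
  have hz : place (event (γ r 0 + a) (place (γ r))) ∈ S.domain := by rwa [place_event]
  have hc : christoffel S.metric = fun i b c z => christoffel S.metric i b c z := rfl
  have hpd : ∀ (i j k : Fin 4), pd k (fun z => S.metric z i j)
      (event (γ r 0 + a) (place (γ r))) = pd k (fun z => S.metric z i j) (γ r) := by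
    intro i j k
    have e : event (γ r 0 + a) (place (γ r)) = γ r + event a 0 := by
      conv_rhs => rw [← event_place (γ r)]
      funext i
      exact Fin.cases rfl (fun i => by simp [Pi.add_apply]) i
    have e2 : (fun z => S.metric z i j) = fun z => S.metric (z + event a 0) i j := by
      funext z
      have : place (z + event a 0) = place z := by ext i; simp [place_apply]
      simp only [metric, this]
    rw [e, pd, pd]
    conv_rhs => rw [e2]
    rw [fderiv_comp_add_right (f := fun z => S.metric z i j)]
  refine ⟨hz, ?_, ?_, ?_, h5⟩
  · have d0 := (hasDerivWithinAt_pi.mp h2)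
    have := hasDerivWithinAt_event ((d0 0).add_const a)
      (x := fun r => place (γ r)) (x' := place (w r)) (hasDerivWithinAt_pi.mpr fun i => d0 i.succ)
    rwa [event_place] at this
  · refine h3.congr_deriv ?_
    funext i
    simp only [christoffel, hpd, hm]
  · rw [hm]; exact h4

theorem IsNullGeodesic.time_lt {γ w : ℝ → Fin 4 → ℝ} (h : S.IsNullGeodesic γ w) :
    StrictMonoOn (fun r => γ r 0) (Set.Icc 0 1) := by
  have hd : ∀ r ∈ Set.Icc (0:ℝ) 1, HasDerivWithinAt (fun r => γ r 0) (w r 0) (Set.Icc 0 1) r :=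
    fun r hr => hasDerivWithinAt_pi.mp (h r hr).2.1 0
  refine strictMonoOn_of_hasDerivWithinAt_pos (convex_Icc 0 1)
    (fun r hr => (hd r hr).continuousWithinAt) (f' := fun r => w r 0) (fun r hr => ?_)
    fun r hr => (h r (interior_subset hr)).2.2.2.2
  exact (hd r (interior_subset hr)).mono interior_subset

theorem IsNullGeodesic.velocity_eq {γ w γ' w' : ℝ → Fin 4 → ℝ} (h : S.IsNullGeodesic γ w)
    (h' : S.IsNullGeodesic γ' w') (e : Set.EqOn γ γ' (Set.Icc 0 1)) : w 0 = w' 0 := by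
  have h1 := (h 0 (by simp)).2.1
  have h2 := ((h' 0 (by simp)).2.1).congr e (e (by simp))
  exact (uniqueDiffOn_Icc (zero_lt_one' ℝ) 0 (by simp)).eq_deriv _ h1 h2

/-- A time translation carries the unique null geodesic that arrives at time 0 to the one that
arrives at any other time, so all signals take equally long. -/
theorem exists_delay {x y : Space} (h : S.ReachedUniquely x y) :
    ∃ T > 0, ∀ t t', S.Signal (event t x) (event t' y) ↔ t' = t + T := by
  obtain ⟨γ, w, hγ, hx, hy⟩ := (h 0).1.1
  have key : ∀ t' (γ' w' : ℝ → Fin 4 → ℝ), S.IsNullGeodesic γ' w' → place (γ' 0) = x →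
      γ' 1 = event t' y → Set.EqOn γ' (fun r => event (γ r 0 + t') (place (γ r))) (Set.Icc 0 1) := by
    intro t' γ' w' h1 h2 h3
    refine (h t').1.2 _ _ _ _ h1 (hγ.translate t') h2 h3 ?_ ?_
    · rw [place_event, hx]
    · rw [hy, place_event, event_zero, zero_add]
  refine ⟨-γ 0 0, ?_, fun t t' => ⟨?_, ?_⟩⟩
  · have := hγ.time_lt (by simp) (by simp) zero_lt_one
    simp only [hy, event_zero] at this
    linarith
  · rintro ⟨γ', w', h1, h2, h3⟩
    have := key t' γ' w' h1 (by rw [h2, place_event]) h3 (Set.left_mem_Icc.mpr zero_le_one)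
    rw [h2] at this
    have := congrFun this 0
    simp only [event_zero] at this
    linarith
  · rintro rfl
    refine ⟨_, _, hγ.translate (t - γ 0 0), ?_, ?_⟩
    · simp only [hx]; congr 1; ring
    · simp only [hy, place_event, event_zero]; congr 1; ring

/-- The null geodesics between two linked worldlines leave in only one direction. -/
theorem direction_unique {x y : Space} (h : S.ReachedUniquely x y) {γ w γ' w' : ℝ → Fin 4 → ℝ}
    (hγ : S.IsNullGeodesic γ w) (hγ' : S.IsNullGeodesic γ' w') (h0 : place (γ 0) = x)
    (h0' : place (γ' 0) = x) (h1 : place (γ 1) = y) (h1' : place (γ' 1) = y) : w 0 = w' 0 := by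
  refine (hγ.translate (-γ 1 0)).velocity_eq (hγ'.translate (-γ' 1 0))
    ((h 0).1.2 _ _ _ _ (hγ.translate _) (hγ'.translate _) ?_ ?_ ?_ ?_)
  · rw [place_event, h0]
  · rw [h1]; congr 1; ring
  · rw [place_event, h0']
  · rw [h1']; congr 1; ring

/-- A signal of short duration does not go far. -/
theorem exists_near_of_time (S : StaticSpacetime) {p : Space} (hp : p ∈ S.domain) :
    ∃ K > 0, ∃ ε > 0, ∀ x T, T < ε → S.Signal (event 0 p) (event T x) → ‖x - p‖ ≤ K * T := by
  obtain ⟨ρ, hρ, hsub⟩ := Metric.nhds_basis_closedBall.mem_iff.mp (S.isOpen_domain.mem_nhds hp)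
  have hc : ContinuousOn (fun z : Space × Space => formOf (S.opticalMetric z.1) z.2 z.2)
      (Metric.closedBall p ρ ×ˢ Metric.sphere 0 1) := by
    have h1 : ContinuousOn (fun z : Space × Space => formOf (S.opticalMetric z.1))
        (Metric.closedBall p ρ ×ˢ Metric.sphere 0 1) :=
      S.optical_isLocalGeom.smooth.continuousOn.comp continuousOn_fst fun z hz => hsub hz.1
    exact (h1.clm_apply continuousOn_snd).clm_apply continuousOn_snd
  have hne : (Metric.closedBall p ρ ×ˢ Metric.sphere (0 : Space) 1).Nonempty :=
    (Metric.nonempty_closedBall.mpr hρ.le).prod (NormedSpace.sphere_nonempty.mpr zero_le_one)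
  obtain ⟨z0, hz0, hmin⟩ := ((isCompact_closedBall p ρ).prod
    (isCompact_sphere (0 : Space) 1)).exists_isMinOn hne hc
  set m := formOf (S.opticalMetric z0.1) z0.2 z0.2 with hm
  have hm0 : 0 < m := by
    rw [hm, formOf_apply]
    have hne : z0.2 ≠ 0 := by
      rintro h0
      have := hz0.2
      rw [h0] at this
      simp at this
    simpa using (S.optical_posDef (hsub hz0.1)).dotProduct_mulVec_pos hne
  have hlow : ∀ x ∈ Metric.closedBall p ρ, ∀ v : Space,
      m * ‖v‖ ^ 2 ≤ formOf (S.opticalMetric x) v v := by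
    intro x hx v
    rcases eq_or_ne v 0 with rfl | hv
    · simp
    have hv' : 0 < ‖v‖ := norm_pos_iff.mpr hv
    have := hmin (a := (x, ‖v‖⁻¹ • v)) ⟨hx, by simp [norm_smul, hv'.ne']⟩
    simp only [Set.mem_ofPred_eq, map_smul, smul_apply, smul_eq_mul] at this
    rw [← hm] at this
    calc m * ‖v‖ ^ 2 ≤ (‖v‖⁻¹ * (‖v‖⁻¹ * formOf (S.opticalMetric x) v v)) * ‖v‖ ^ 2 := by gcongr
      _ = _ := by field_simp
  -- Twice the largest coordinate speed allowed by the lower bound `m`; the factor 2 gives the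
  -- strict inequality that the comparison of derivatives requires.
  set K := 2 / √m with hK
  have hsm : 0 < √m := Real.sqrt_pos.mpr hm0
  have hK0 : 0 < K := by positivity
  refine ⟨K, hK0, ρ / K, by positivity, fun x T hT hsig => ?_⟩
  obtain ⟨γ, w, hγ, hγ0, hγ1⟩ := hsig
  have hd := fun r hr => hasDerivWithinAt_pi.mp (hγ r hr).2.1
  have hdp : ∀ r ∈ Set.Icc (0:ℝ) 1, HasDerivWithinAt (fun r => place (γ r) - p) (place (w r))
      (Set.Icc 0 1) r := fun r hr =>
    (hasDerivWithinAt_pi.mpr fun i => hd r hr i.succ : HasDerivWithinAt (fun r => place (γ r)) _ _ _).sub_const p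
  have hdt : ∀ r ∈ Set.Icc (0:ℝ) 1, HasDerivWithinAt (fun r => K * γ r 0) (K * w r 0)
      (Set.Icc 0 1) r := fun r hr => (hd r hr 0).const_mul K
  have hle : ∀ r ∈ Set.Icc (0:ℝ) 1, γ r 0 ≤ T := fun r hr => by
    have := hγ.time_lt.monotoneOn hr (Set.right_mem_Icc.mpr zero_le_one) hr.2
    simpa [hγ1] using this
  have hIci : ∀ {r}, r ∈ Set.Ico (0:ℝ) 1 → Set.Icc (0:ℝ) 1 ∈ nhdsWithin r (Set.Ici r) :=
    fun hr => Icc_mem_nhdsGE_of_mem hr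
  have := image_norm_le_of_norm_deriv_right_lt_deriv_boundary'
    (f := fun r => place (γ r) - p) (f' := fun r => place (w r)) (a := 0) (b := 1)
    (fun r hr => (hdp r hr).continuousWithinAt)
    (fun r hr => (hdp r (Set.Ico_subset_Icc_self hr)).mono_of_mem_nhdsWithin (hIci hr))
    (B := fun r => K * γ r 0) (B' := fun r => K * w r 0) (by simp [hγ0])
    (fun r hr => (hdt r hr).continuousWithinAt)
    (fun r hr => (hdt r (Set.Ico_subset_Icc_self hr)).mono_of_mem_nhdsWithin (hIci hr))
    (fun r hr heq => ?_) (Set.right_mem_Icc.mpr zero_le_one)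
  · simpa [hγ1] using this
  · have hr' := Set.Ico_subset_Icc_self hr
    obtain ⟨h1, -, -, h4, h5⟩ := hγ r hr'
    -- Where the bound is attained, the elapsed time is still so short that the point lies in the
    -- ball on which the lower bound for the metric holds.
    have hmem : place (γ r) ∈ Metric.closedBall p ρ := by
      rw [mem_closedBall_iff_norm, heq]
      have : γ r 0 ≤ ρ / K := (hle r hr').trans hT.le
      calc K * γ r 0 ≤ K * (ρ / K) := by gcongr
        _ = ρ := by field_simp
    have h6 := hlow _ hmem (place (w r))
    rw [(S.null_iff h1).mp h4] at h6
    have h7 : √m * ‖place (w r)‖ ≤ w r 0 := by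
      refine abs_le_of_sq_le_sq' ?_ h5.le |>.2
      rw [mul_pow, Real.sq_sqrt hm0.le]; exact h6
    have h8 : ‖place (w r)‖ ≤ w r 0 / √m := by rw [le_div_iff₀ hsm]; linarith
    refine h8.trans_lt ?_
    rw [hK, div_mul_eq_mul_div]
    gcongr
    linarith

end StaticSpacetime

end

/-! ### The linear relation between the ten optical lengths. -/

noncomputable section

variable {D : Set Space} {g : Space → Matrix (Fin 3) (Fin 3) ℝ} {Γ : Space → Bil}

theorem abs_form_sub_le (L : Form) (a b : Space) :
    |L a a - L b b| ≤ ‖L‖ * (‖a‖ + ‖b‖) * ‖a - b‖ := by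
  have e : L a a - L b b = L (a - b) a + L b (a - b) := by
    simp only [map_sub, sub_apply]; ring
  rw [e]
  refine (abs_add_le _ _).trans ?_
  have h1 : |L (a - b) a| ≤ ‖L‖ * ‖a - b‖ * ‖a‖ := L.le_opNorm₂ _ _
  have h2 : |L b (a - b)| ≤ ‖L‖ * ‖b‖ * ‖a - b‖ := L.le_opNorm₂ _ _
  linarith

/-- Squared optical distances along the links of a configuration, in scaled coordinates. -/
def BVP.linkSq {p : Space} {R C s : ℝ} (B : BVP D Γ p R C s)
    (g : Space → Matrix (Fin 3) (Fin 3) ℝ) (y : Label → Space) (k : Fin 10) : ℝ :=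
  B.sqDist g (y (fstL k)) (y (sndL k))

/-- The curvature of the direction `u`, for a Ricci tensor `Ric` of trace `t`. -/
def dirCurv (Ric : Matrix (Fin 3) (Fin 3) ℝ) (t : ℝ) (u : Space) : ℝ :=
  -45 * formOf Ric u u + 27 / 2 * t

theorem sum_abs_stress : ∑ k, |stress k| = 57 := by
  simp [stress, Fin.sum_univ_succ]; norm_num

theorem abs_sum_stress_le {f : Fin 10 → ℝ} {c : ℝ} (hf : ∀ k, |f k| ≤ c) :
    |∑ k, stress k * f k| ≤ 57 * c := by
  refine (Finset.abs_sum_le_sum_abs _ _).trans ?_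
  rw [← sum_abs_stress, Finset.sum_mul]
  refine Finset.sum_le_sum fun k _ => ?_
  rw [abs_mul]
  exact mul_le_mul_of_nonneg_left (hf k) (abs_nonneg _)

theorem norm_normalCoord_sub_le (Γ : Space → Bil) (p : Space) {s R : ℝ} (hs : 0 ≤ s) {y : Space}
    (hy : ‖y‖ ≤ R) : ‖normalCoord Γ p s y - y‖ ≤ s * (‖Γ p‖ * R ^ 2) := by
  have hR := (norm_nonneg y).trans hy
  rw [normalCoord, add_sub_cancel_left, norm_smul, Real.norm_of_nonneg (by linarith)]
  have h1 : ‖Γ p y y‖ ≤ ‖Γ p‖ * R * R := ((Γ p).le_opNorm₂ _ _).trans (by gcongr)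
  have h2 : 0 ≤ ‖Γ p y y‖ := norm_nonneg _
  nlinarith

theorem exists_corr_bound (F : Form) (Λ : Space →L[ℝ] Bil) (R : ℝ) :
    ∃ Mc, ∀ a ∈ Metric.closedBall (0 : Space) R,
      ∀ b ∈ Metric.closedBall (0 : Space) R, |corr F Λ a (b - a)| ≤ Mc := by
  have h1 : Continuous fun z : Space × Space => (z.1, z.2 - z.1) := by fun_prop
  have hcont := (continuous_corr F Λ).comp h1
  obtain ⟨Mc, hMc⟩ := ((isCompact_closedBall (0 : Space) R).prod
    (isCompact_closedBall (0 : Space) R)).exists_bound_of_continuousOn hcont.continuousOn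
  exact ⟨Mc, fun a ha b hb => hMc (a, b) ⟨ha, hb⟩⟩

/-- If nine squared lengths are close to those of the bipyramid, so is the tenth. -/
theorem exists_defect_bound {C₁ A : ℝ} (hC₁ : 0 < C₁) (hA : 0 < A) :
    ∃ C₅ > 0, ∃ s₁ > 0, ∀ s, 0 < s → s ≤ s₁ → ∀ (q Q : Fin 10 → ℝ) (k : Fin 10),
      (∀ j, |Q j - q j| ≤ A * s ^ 2) → (∀ j ≠ k, |Q j - sideSq j| ≤ C₁ * s ^ 2) →
      |√(Q k) - side k| ≤ 1 / 2 → 0 ≤ q k → gramDet q = 0 →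
      ∀ j, |q j - sideSq j| ≤ C₅ * s ^ 2 := by
  obtain ⟨C4, hC4, hex⟩ := gram_exceptional
  have hp : 0 < C4 * (C₁ + A) := by positivity
  refine ⟨(C₁ + A) + C4 * (C₁ + A), by positivity, min 1 (1 / (10 * (C₁ + A))), by positivity,
    fun s hs hs0 q Q k hQq hk hkk hq0 hgram => ?_⟩
  obtain ⟨hs1, hs2⟩ := le_min_iff.mp hs0
  rw [le_div_iff₀ (by positivity)] at hs2
  have hs20 : 0 ≤ s ^ 2 := sq_nonneg s
  have hss : s ^ 2 ≤ s := by rw [sq]; exact mul_le_of_le_one_left hs.le hs1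
  have hle : (C₁ + A) * s ^ 2 ≤ 1 / 10 := by
    have := mul_le_mul_of_nonneg_left hss (show 0 ≤ C₁ + A by positivity)
    linarith
  have hAs : A * s ^ 2 ≤ 1 / 10 := by
    have : 0 ≤ C₁ * s ^ 2 := by positivity
    linarith
  have hδ : sideSq + (fun j => q j - sideSq j) = q := by
    funext j; simp
  have hj : ∀ j ≠ k, |q j - sideSq j| ≤ (C₁ + A) * s ^ 2 := fun j hj => by
    have := abs_sub_le (q j) (Q j) (sideSq j)
    rw [abs_sub_comm (q j) (Q j)] at this
    linarith [hk j hj, hQq j]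
  have hδk : |q k - sideSq k| ≤ C4 * ((C₁ + A) * s ^ 2) := by
    refine hex (fun j => q j - sideSq j) k _ (by linarith) (by rw [hδ]; exact hgram) hj
      (by simpa using hq0) ?_
    have e : sideSq k + (q k - sideSq k) = q k := by ring
    simp only [e]
    have hside := two_le_side k
    have hQk : 3 / 2 ≤ √(Q k) := by have := (abs_le.mp hkk).1; linarith
    have hQk0 : 0 ≤ Q k := by
      by_contra hn
      rw [Real.sqrt_eq_zero_of_nonpos (by linarith)] at hQk
      norm_num at hQk
    -- Passing from `Q` to `q` costs at most 1/10, so that the assumed 1/2 grows to the 3/5 allowed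
    -- by `gram_exceptional`.
    have hd : |√(q k) - √(Q k)| ≤ 1 / 10 := by
      have h0 : 0 ≤ √(q k) := Real.sqrt_nonneg _
      have h1 : |√(q k) - √(Q k)| * (√(q k) + √(Q k)) = |q k - Q k| := by
        conv_lhs => rw [← abs_of_nonneg (show 0 ≤ √(q k) + √(Q k) by linarith)]
        rw [← abs_mul]
        congr 1
        have h2 := Real.sq_sqrt hq0
        have h3 := Real.sq_sqrt hQk0
        linear_combination h2 - h3
      have h2 := hQq k
      rw [abs_sub_comm] at h2
      have h3 : |√(q k) - √(Q k)| * 1 ≤ |√(q k) - √(Q k)| * (√(q k) + √(Q k)) :=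
        mul_le_mul_of_nonneg_left (by linarith) (abs_nonneg _)
      linarith
    have := abs_sub_le (√(q k)) (√(Q k)) (side k)
    linarith
  intro j
  have h1 : 0 ≤ (C₁ + A) * s ^ 2 := by positivity
  have h2 : 0 ≤ C4 * ((C₁ + A) * s ^ 2) := by positivity
  rw [add_mul, mul_assoc]
  by_cases hjk : j = k
  · subst hjk; linarith
  · linarith [hj j hjk]

/-- Lengths in normal coordinates and in the given coordinates. -/
theorem abs_sqLen_sub_le (F : Form) (Γ : Space → Bil) (p : Space) {R : ℝ} (hR : 0 ≤ R) :
    ∃ K > 0, ∀ s, 0 ≤ s → s ≤ 1 → ∀ y : Label → Space, (∀ i, ‖y i‖ ≤ R) → ∀ j,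
      |sqLen F y j - sqLen F (fun i => normalCoord Γ p s (y i)) j| ≤ K * s := by
  set r0 := ‖Γ p‖ * R ^ 2 with hr0
  have hr00 : 0 ≤ r0 := by positivity
  refine ⟨‖F‖ * (2 * R + (2 * R + 2 * r0)) * (2 * r0) + 1, by positivity,
    fun s hs hs1 y hyn j => ?_⟩
  set a := normalCoord Γ p s (y (sndL j)) - normalCoord Γ p s (y (fstL j)) with ha
  set b := y (sndL j) - y (fstL j) with hb
  have hab : ‖b - a‖ ≤ s * (2 * r0) := by
    have e : b - a = (normalCoord Γ p s (y (fstL j)) - y (fstL j))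
        - (normalCoord Γ p s (y (sndL j)) - y (sndL j)) := by
      rw [ha, hb]; abel
    rw [e]
    refine (norm_sub_le _ _).trans ?_
    have h1 := norm_normalCoord_sub_le Γ p hs (hyn (fstL j))
    have h2 := norm_normalCoord_sub_le Γ p hs (hyn (sndL j))
    linarith
  have hbn : ‖b‖ ≤ 2 * R := (norm_sub_le _ _).trans (by linarith [hyn (sndL j), hyn (fstL j)])
  have han : ‖a‖ ≤ 2 * R + 2 * r0 := by
    have : ‖a‖ ≤ ‖b‖ + ‖b - a‖ := by
      have := norm_sub_le b (b - a)
      rwa [sub_sub_cancel] at this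
    have h2 : s * (2 * r0) ≤ 2 * r0 := mul_le_of_le_one_left (by linarith) hs1
    linarith
  calc _ ≤ ‖F‖ * (‖b‖ + ‖a‖) * ‖b - a‖ := abs_form_sub_le F b a
    _ ≤ ‖F‖ * (2 * R + (2 * R + 2 * r0)) * (s * (2 * r0)) := by gcongr
    _ ≤ _ := by linarith

/-- The curvature term may be evaluated at the direction of aim. -/
theorem abs_dirCurv_sub_le {F : Form} (Rc : Matrix (Fin 3) (Fin 3) ℝ) (t : ℝ) {R C C₂ : ℝ}
    (hR : 0 ≤ R) (hC : 0 < C) (hC₂ : 0 < C₂) :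
    ∃ K > 0, ∀ s, 0 < s → s ≤ 1 → C₂ * s ≤ 1 / 2 → ∀ (V y u : Space) (c : ℝ), ‖y‖ ≤ R →
      ‖V - y‖ ≤ C * s → 0 < c → V = c • u → F u u = 1 → |F V V - 4| ≤ C₂ * s →
      |dirCurv Rc t ((1 / 2 : ℝ) • y) - dirCurv Rc t u| ≤ K * s := by
  refine ⟨45 * (‖formOf Rc‖ * (R + (R + C)) * (C + C₂ * (R + C))) + 1, by positivity,
    fun s hs hs1 hsC V y u c hyR hV1 hc hV hu hQ0 => ?_⟩
  have hc2 : F V V = c ^ 2 := by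
    rw [hV]
    simp only [map_smul, smul_apply, smul_eq_mul, hu]
    ring
  rw [hc2] at hQ0
  -- The velocity `V` has squared length `c ^ 2` close to 4, the squared length of the axis, so half
  -- of `V` is close to its unit direction `u`.
  have hcc : |c - 2| ≤ C₂ * s := by
    have e : |c - 2| * (c + 2) = |c ^ 2 - 4| := by
      conv_lhs => rw [← abs_of_pos (show 0 < c + 2 by linarith)]
      rw [← abs_mul]; congr 1; ring
    have : |c - 2| * 1 ≤ |c - 2| * (c + 2) :=
      mul_le_mul_of_nonneg_left (by linarith) (abs_nonneg _)
    linarith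
  have hc1 : 1 ≤ c := by have := (abs_le.mp hcc).1; linarith
  have hCs : C * s ≤ C := mul_le_of_le_one_right hC.le hs1
  have hun : ‖u‖ ≤ R + C := by
    have h1 : ‖c • u‖ ≤ R + C := by
      rw [← hV]
      have := norm_add_le (V - y) y
      rw [sub_add_cancel] at this
      linarith
    rw [norm_smul, Real.norm_of_nonneg hc.le] at h1
    have : 1 * ‖u‖ ≤ c * ‖u‖ := mul_le_mul_of_nonneg_right hc1 (norm_nonneg u)
    linarith
  have h3 : ‖(1 / 2 : ℝ)‖ = 1 / 2 := by norm_num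
  have hd : ‖(1 / 2 : ℝ) • y - u‖ ≤ (C + C₂ * (R + C)) * s := by
    have e : (1 / 2 : ℝ) • y - u = (1 / 2 : ℝ) • ((c - 2) • u - (V - y)) := by
      rw [hV]; module
    rw [e, norm_smul]
    have h1 : ‖(c - 2) • u‖ ≤ C₂ * s * (R + C) := by
      rw [norm_smul, Real.norm_eq_abs]; gcongr
    have h2 := norm_sub_le ((c - 2) • u) (V - y)
    rw [h3]
    have h4 : 0 ≤ C₂ * s * (R + C) := by positivity
    have h5 : 0 ≤ C * s := by positivity
    linarith
  have hyh : ‖(1 / 2 : ℝ) • y‖ ≤ R := by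
    rw [norm_smul, h3]; linarith [norm_nonneg y]
  have e : dirCurv Rc t ((1 / 2 : ℝ) • y) - dirCurv Rc t u
      = -45 * (formOf Rc ((1 / 2 : ℝ) • y) ((1 / 2 : ℝ) • y) - formOf Rc u u) := by
    simp only [dirCurv]; ring
  rw [e, abs_mul]
  have h6 := abs_form_sub_le (formOf Rc) ((1 / 2 : ℝ) • y) u
  have h7 : ‖formOf Rc‖ * (‖(1 / 2 : ℝ) • y‖ + ‖u‖) * ‖(1 / 2 : ℝ) • y - u‖
      ≤ ‖formOf Rc‖ * (R + (R + C)) * ((C + C₂ * (R + C)) * s) := by gcongr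
  have h8 : |(-45 : ℝ)| = 45 := by norm_num
  rw [h8]
  linarith

/-- In a radar configuration close to the bipyramid on nine links, the tenth link is close to its
flat length as well, and the defects of all squared lengths satisfy one linear relation. -/
theorem IsLocalGeom.linkSq_expand (h : IsLocalGeom D g Γ) {p : Space} (hp : p ∈ D) {R C C₁ η : ℝ}
    (hR : 1 ≤ R) (hC : 0 < C) (hC₁ : 0 < C₁) (hη : 0 < η)
    {E : Matrix (Fin 3) (Fin 3) ℝ} (hE : E.transpose * g p * E = 1) :
    ∃ C₂ > 0, ∃ s₁ > 0, ∀ s, 0 < s → s ≤ s₁ → ∀ (B : BVP D Γ p R C s) (y : Label → Space),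
      y (.B 0) = 0 → (∀ i, y i ∈ Metric.closedBall (0 : Space) R) → ∀ k,
      (∀ j ≠ k, |B.linkSq g y j - sideSq j| ≤ C₁ * s ^ 2) →
      |√(B.linkSq g y k) - side k| ≤ 1 / 2 →
      (∀ j, |B.linkSq g y j - sideSq j| ≤ C₂ * s ^ 2) ∧
      ∀ (u : Space) (c : ℝ), 0 < c → formOf (g p) u u = 1 → B.V 0 (y (.B 1)) = c • u →
        |∑ j, stress j * (B.linkSq g y j - sideSq j) - s ^ 2 *
          dirCurv (ricciOf (connDeriv Γ p)) (E.transpose * ricciOf (connDeriv Γ p) * E).trace u|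
          ≤ η * s ^ 2 := by
  have hpd := h.posDef p hp
  have hR0 : 0 ≤ R := by linarith
  obtain ⟨ξ', hξ', hnear⟩ := stressCorr_near hpd _ (h.connDeriv_symm hp) (h.connDeriv_compat hp) hE
    R (η / 4) (by positivity)
  -- Two uses of the expansion: a crude one for a bound that does not involve `η`, and a sharp one.
  -- The stresses have total absolute value 57, and 57/240 is less than 1/4.
  obtain ⟨s1, hs1, hexp1⟩ := h.sqDist_expand hp hR hC one_pos
  obtain ⟨s2, hs2, hexp2⟩ := h.sqDist_expand hp hR hC (ε := η / 240) (by positivity)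
  generalize ht : (E.transpose * ricciOf (connDeriv Γ p) * E).trace = t at hnear ⊢
  generalize hRc : ricciOf (connDeriv Γ p) = Rc at hnear ⊢
  obtain ⟨Mc', hMc'⟩ := exists_corr_bound (formOf (g p)) (connDeriv Γ p) R
  obtain ⟨Mc, hMc0, hMc⟩ : ∃ Mc, 0 < Mc ∧ ∀ a ∈ Metric.closedBall (0 : Space) R,
      ∀ b ∈ Metric.closedBall (0 : Space) R,
        |corr (formOf (g p)) (connDeriv Γ p) a (b - a)| ≤ Mc :=
    ⟨|Mc'| + 1, by positivity, fun a ha b hb => (hMc' a ha b hb).trans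
      (by linarith [le_abs_self Mc'])⟩
  obtain ⟨C5, hC5, s3, hs3, hdef⟩ := exists_defect_bound hC₁ (A := Mc + 1) (by positivity)
  obtain ⟨ξ, hξ, hst⟩ := gram_stress (η / (4 * C5)) (by positivity)
  obtain ⟨K1, hK1, hlen⟩ := abs_sqLen_sub_le (formOf (g p)) Γ p hR0
  have hC2 : 0 < C5 + (Mc + 1) := by positivity
  obtain ⟨K2, hK2, hdir⟩ := abs_dirCurv_sub_le (F := formOf (g p)) Rc t hR0 hC hC2
  refine ⟨C5 + (Mc + 1), hC2, min (min (min s1 s2) (min s3 (min 1 (1 / (2 * (C5 + (Mc + 1)))))))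
    (min (ξ / C5) (min (ξ' / (C5 + K1)) (η / (4 * K2)))),
    by positivity, fun s hs hs0 B y hy0 hyR k hk hkk => ?_⟩
  simp only [le_min_iff] at hs0
  obtain ⟨⟨⟨hss1, hss2⟩, hss3, hs1', hsC2⟩, hsξ, hsξ', hsη⟩ := hs0
  rw [le_div_iff₀ (by positivity)] at hsC2 hsξ hsξ' hsη
  have hs20 : 0 ≤ s ^ 2 := sq_nonneg s
  have hs2le : s ^ 2 ≤ s := by rw [sq]; exact mul_le_of_le_one_left hs.le hs1'
  have hyn : ∀ i, ‖y i‖ ≤ R := fun i => by simpa using hyR i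
  have hQ1 : ∀ j, |B.linkSq g y j - (sqLen (formOf (g p)) (fun i => normalCoord Γ p s (y i)) j
      + s ^ 2 * corr (formOf (g p)) (connDeriv Γ p) (y (fstL j)) (y (sndL j) - y (fstL j)))|
      ≤ 1 * s ^ 2 := fun j => hexp1 s hs hss1 B _ (hyR _) _ (hyR _)
  have hQ2 : ∀ j, |B.linkSq g y j - (sqLen (formOf (g p)) (fun i => normalCoord Γ p s (y i)) j
      + s ^ 2 * corr (formOf (g p)) (connDeriv Γ p) (y (fstL j)) (y (sndL j) - y (fstL j)))|
      ≤ η / 240 * s ^ 2 := fun j => hexp2 s hs hss2 B _ (hyR _) _ (hyR _)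
  have hcr : ∀ j, |corr (formOf (g p)) (connDeriv Γ p) (y (fstL j)) (y (sndL j) - y (fstL j))| ≤ Mc :=
    fun j => hMc _ (hyR _) _ (hyR _)
  have hlen' := hlen s hs.le hs1' y hyn
  -- These are squared distances of five points of a Euclidean space, so they satisfy the Gram
  -- relation exactly.
  have hgram : gramDet (sqLen (formOf (g p)) fun i => normalCoord Γ p s (y i)) = 0 :=
    gramDet_sqLen (isSymm_of_posDef hpd) (by simp [hy0, normalCoord])
  have hq0 : ∀ j, 0 ≤ sqLen (formOf (g p)) (fun i => normalCoord Γ p s (y i)) j := fun j => by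
    rw [sqLen, formOf_apply]
    simpa using hpd.posSemidef.dotProduct_mulVec_nonneg
      (normalCoord Γ p s (y (sndL j)) - normalCoord Γ p s (y (fstL j)))
  have hsc : stressCorr (formOf (g p)) (connDeriv Γ p) y = ∑ j, stress j *
    corr (formOf (g p)) (connDeriv Γ p) (y (fstL j)) (y (sndL j) - y (fstL j)) := rfl
  have hm0 : (0 : Space) ∈ Metric.closedBall (0 : Space) R := by simpa using hR0
  have hV1 : ‖B.V 0 (y (.B 1)) - y (.B 1)‖ ≤ C * s := by
    have := (B.geod 0 hm0 _ (hyR (.B 1)) 0 (by simp)).2.2.2.2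
    rwa [B.W_zero 0 hm0 _ (hyR _), sub_zero] at this
  have hQ0 : B.linkSq g y 0 = formOf (g p) (B.V 0 (y (.B 1))) (B.V 0 (y (.B 1))) := by
    have e1 : fstL 0 = .B 0 := rfl
    have e2 : sndL 0 = .B 1 := rfl
    simp only [BVP.linkSq, BVP.sqDist, e1, e2, hy0, smul_zero, add_zero]
  generalize B.linkSq g y = Q at *
  generalize sqLen (formOf (g p)) (fun i => normalCoord Γ p s (y i)) = q at *
  have hQq : ∀ j, |Q j - q j| ≤ (Mc + 1) * s ^ 2 := fun j => by
    have h1 := hQ1 j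
    have h2 : |s ^ 2 * corr (formOf (g p)) (connDeriv Γ p) (y (fstL j)) (y (sndL j) - y (fstL j))|
        ≤ s ^ 2 * Mc := by
      rw [abs_mul, abs_of_nonneg hs20]
      exact mul_le_mul_of_nonneg_left (hcr j) hs20
    have := abs_add_le _ _ |>.trans (add_le_add h1 h2)
    rw [← sub_sub, sub_add_cancel] at this
    linarith
  have hδall := hdef s hs hss3 q Q k hQq hk hkk (hq0 k) hgram
  have hQall : ∀ j, |Q j - sideSq j| ≤ (C5 + (Mc + 1)) * s ^ 2 := fun j => by
    have := abs_sub_le (Q j) (q j) (sideSq j)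
    linarith [hQq j, hδall j]
  refine ⟨hQall, fun u c hc hu hV => ?_⟩
  have hC5s : C5 * s ^ 2 ≤ C5 * s := mul_le_mul_of_nonneg_left hs2le hC5.le
  have t1 : |∑ j, stress j * (q j - sideSq j)| ≤ η / 4 * s ^ 2 := by
    have hδn : ‖fun j => q j - sideSq j‖ ≤ C5 * s ^ 2 :=
      (pi_norm_le_iff_of_nonneg (by positivity)).mpr hδall
    refine (hst (fun j => q j - sideSq j) (hδn.trans (by linarith)) ?_).trans ?_
    · rw [← hgram]; congr 1; funext j; simp
    calc η / (4 * C5) * ‖fun j => q j - sideSq j‖ ≤ η / (4 * C5) * (C5 * s ^ 2) := by gcongr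
      _ = _ := by field_simp
  have t2 := abs_sum_stress_le hQ2
  have hyl : ∀ j, |sqLen (formOf (g p)) y j - sideSq j| ≤ ξ' := fun j => by
    have := abs_sub_le (sqLen (formOf (g p)) y j) (q j) (sideSq j)
    linarith [hlen' j, hδall j]
  have t3 := hnear y hy0 ((pi_norm_le_iff_of_nonneg hR0).mpr hyn) hyl
  have e1 : -45 * ((1 / 4) * y (.B 1) ⬝ᵥ Rc.mulVec (y (.B 1))) + 27 / 2 * t
      = dirCurv Rc t ((1 / 2 : ℝ) • y (.B 1)) := by
    rw [dirCurv, ← formOf_apply]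
    simp only [map_smul, smul_apply, smul_eq_mul]
    ring
  rw [e1] at t3
  have t4 : |dirCurv Rc t ((1 / 2 : ℝ) • y (.B 1)) - dirCurv Rc t u| ≤ η / 4 := by
    refine (hdir s hs hs1' (by linarith) _ _ u c (hyn (.B 1)) hV1 hc hV hu ?_).trans (by linarith)
    have h1 := hQall 0
    have hs4 : sideSq 0 = 4 := by simp [sideSq, side_eq]; norm_num
    rw [hs4, hQ0] at h1
    exact h1.trans (mul_le_mul_of_nonneg_left hs2le hC2.le)
  -- Four errors, each at most a quarter of the allowance: the nonlinearity of the Gram relation,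
  -- the remainder of the expansion, the distance of the configuration from an exact bipyramid, and
  -- the difference between half the axis coordinate and the direction of aim.
  have hsum : ∑ j, stress j * (Q j - sideSq j) - s ^ 2 * dirCurv Rc t u
      = ∑ j, stress j * (q j - sideSq j) + ∑ j, stress j * (Q j - (q j + s ^ 2 *
        corr (formOf (g p)) (connDeriv Γ p) (y (fstL j)) (y (sndL j) - y (fstL j))))
        + s ^ 2 * ((stressCorr (formOf (g p)) (connDeriv Γ p) y
          - dirCurv Rc t ((1 / 2 : ℝ) • y (.B 1)))
          + (dirCurv Rc t ((1 / 2 : ℝ) • y (.B 1)) - dirCurv Rc t u)) := by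
    rw [sub_add_sub_cancel, hsc, mul_sub, Finset.mul_sum, ← Finset.sum_add_distrib, ← add_sub_assoc,
      ← Finset.sum_add_distrib]
    congr 1
    refine Finset.sum_congr rfl fun j _ => ?_
    ring
  rw [hsum]
  refine (abs_add_le _ _).trans ?_
  rw [abs_mul, abs_of_nonneg hs20]
  have t5 := mul_le_mul_of_nonneg_left ((abs_add_le _ _).trans (add_le_add t3 t4)) hs20
  have t6 := (abs_add_le _ _).trans (add_le_add t1 t2)
  have : 0 ≤ η * s ^ 2 := by positivity
  linarith

end

/-! ### First-order comparison with configurations of the tangent space. -/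

noncomputable section

variable {D : Set Space} {g : Space → Matrix (Fin 3) (Fin 3) ℝ} {Γ : Space → Bil}

theorem abs_form_sub_form_le (L L' : Form) (u v u' v' : Space) :
    |L u v - L' u' v'| ≤ ‖L - L'‖ * ‖u‖ * ‖v‖ + ‖L'‖ * ‖u - u'‖ * ‖v‖ + ‖L'‖ * ‖u'‖ * ‖v - v'‖ := by
  have e : L u v - L' u' v' = (L - L') u v + L' (u - u') v + L' u' (v - v') := by
    simp only [map_sub, sub_apply]; ring
  rw [e]
  exact (abs_add_three _ _ _).trans
    (add_le_add_three ((L - L').le_opNorm₂ _ _) (L'.le_opNorm₂ _ _) (L'.le_opNorm₂ _ _))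

theorem abs_quad_defect_le {G G₀ : Form} {d e : Space} {M r κ : ℝ} (hM : ‖G₀‖ ≤ M) (hd : ‖d‖ ≤ r)
    (hκ : κ ≤ 1) (he : ‖e‖ ≤ κ) (hG : ‖G - G₀‖ ≤ κ) :
    |G (d + e) (d + e) - G₀ d d| ≤ (M * (2 * r + 1) + (r + 1) ^ 2) * κ := by
  have h1 := abs_form_sub_form_le G G₀ (d + e) (d + e) d d
  rw [add_sub_cancel_left] at h1
  have hn : ‖d + e‖ ≤ r + 1 := (norm_add_le _ _).trans (by linarith)
  have hκ0 : 0 ≤ κ := (norm_nonneg _).trans he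
  have hM0 : 0 ≤ M := (norm_nonneg _).trans hM
  have hr0 : 0 ≤ r := (norm_nonneg _).trans hd
  have t1 : ‖G - G₀‖ * ‖d + e‖ * ‖d + e‖ ≤ κ * (r + 1) * (r + 1) := by gcongr
  have t2 : ‖G₀‖ * ‖e‖ * ‖d + e‖ ≤ M * κ * (r + 1) := by gcongr
  have t3 : ‖G₀‖ * ‖d‖ * ‖e‖ ≤ M * r * κ := by gcongr
  calc _ ≤ κ * (r + 1) * (r + 1) + M * κ * (r + 1) + M * r * κ := by linarith
    _ = _ := by ring

/-- Not only is the defect of a squared length small, it also varies slowly with the configuration.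
The factor `κ` in this Lipschitz bound is what makes the equation for the lengths a contraction. -/
theorem abs_quad_defect_sub_le {G G' G₀ : Form} {d e d' e' : Space} {M r κ δ : ℝ} (hM : ‖G₀‖ ≤ M)
    (hd : ‖d‖ ≤ r) (hd' : ‖d'‖ ≤ r) (hκ : κ ≤ 1) (he : ‖e‖ ≤ κ) (he' : ‖e'‖ ≤ κ)
    (hG' : ‖G' - G₀‖ ≤ κ) (hdd : ‖d - d'‖ ≤ δ) (hee : ‖e - e'‖ ≤ κ * δ) (hGG : ‖G - G'‖ ≤ κ * δ) :
    |(G (d + e) (d + e) - G₀ d d) - (G' (d' + e') (d' + e') - G₀ d' d')|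
      ≤ (2 * M * (r + 2) + (r + 1) ^ 2 + 4 * (r + 1)) * (κ * δ) := by
  have hκ0 : 0 ≤ κ := (norm_nonneg _).trans he
  have hM0 : 0 ≤ M := (norm_nonneg _).trans hM
  have hr0 : 0 ≤ r := (norm_nonneg _).trans hd
  have hδ0 : 0 ≤ δ := (norm_nonneg _).trans hdd
  have hn : ‖d + e‖ ≤ r + 1 := (norm_add_le _ _).trans (by linarith)
  have hn' : ‖d' + e'‖ ≤ r + 1 := (norm_add_le _ _).trans (by linarith)
  have hnn : ‖d + e - (d' + e')‖ ≤ 2 * δ := by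
    rw [add_sub_add_comm]
    refine (norm_add_le _ _).trans ?_
    have : κ * δ ≤ δ := mul_le_of_le_one_left hδ0 hκ
    linarith
  have e1 : (G (d + e) (d + e) - G₀ d d) - (G' (d' + e') (d' + e') - G₀ d' d')
      = ((G - G₀) (d + e) (d + e) - (G' - G₀) (d' + e') (d' + e'))
        + (G₀ e d - G₀ e' d') + (G₀ d e - G₀ d' e') + (G₀ e e - G₀ e' e') := by
    simp only [map_add, sub_apply, add_apply]; ring
  rw [e1]
  have b1 := abs_form_sub_form_le (G - G₀) (G' - G₀) (d + e) (d + e) (d' + e') (d' + e')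
  have b2 := abs_form_sub_form_le G₀ G₀ e d e' d'
  have b3 := abs_form_sub_form_le G₀ G₀ d e d' e'
  have b4 := abs_form_sub_form_le G₀ G₀ e e e' e'
  rw [sub_sub_sub_cancel_right] at b1
  rw [sub_self, norm_zero, zero_mul, zero_mul, zero_add] at b2 b3 b4
  have c1 : ‖G - G'‖ * ‖d + e‖ * ‖d + e‖ + ‖G' - G₀‖ * ‖d + e - (d' + e')‖ * ‖d + e‖
      + ‖G' - G₀‖ * ‖d' + e'‖ * ‖d + e - (d' + e')‖
      ≤ κ * δ * (r + 1) * (r + 1) + κ * (2 * δ) * (r + 1) + κ * (r + 1) * (2 * δ) := by gcongr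
  have c2 : ‖G₀‖ * ‖e - e'‖ * ‖d‖ + ‖G₀‖ * ‖e'‖ * ‖d - d'‖ ≤ M * (κ * δ) * r + M * κ * δ := by gcongr
  have c3 : ‖G₀‖ * ‖d - d'‖ * ‖e‖ + ‖G₀‖ * ‖d'‖ * ‖e - e'‖ ≤ M * δ * κ + M * r * (κ * δ) := by gcongr
  have c4 : ‖G₀‖ * ‖e - e'‖ * ‖e‖ + ‖G₀‖ * ‖e'‖ * ‖e - e'‖ ≤ M * (κ * δ) * 1 + M * 1 * (κ * δ) := by
    have := he.trans hκ; have := he'.trans hκ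
    gcongr
  have a1 := abs_add_le ((G - G₀) (d + e) (d + e) - (G' - G₀) (d' + e') (d' + e'))
    (G₀ e d - G₀ e' d')
  have a2 := abs_add_le ((G - G₀) (d + e) (d + e) - (G' - G₀) (d' + e') (d' + e')
    + (G₀ e d - G₀ e' d')) (G₀ d e - G₀ d' e')
  have a3 := abs_add_le ((G - G₀) (d + e) (d + e) - (G' - G₀) (d' + e') (d' + e')
    + (G₀ e d - G₀ e' d') + (G₀ d e - G₀ d' e')) (G₀ e e - G₀ e' e')
  linarith

open Classical in
/-- The configuration with `B₁` at the origin and the other machines where the exponential map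
takes the points of `P`. -/
def BVP.lift {p : Space} {R C s : ℝ} (B : BVP D Γ p R C s) (P : Label → Space) : Label → Space :=
  fun i => if i = .B 0 then 0 else B.X (P i)

variable {p : Space} {R C s : ℝ}

theorem BVP.lift_zero (B : BVP D Γ p R C s) (P : Label → Space) : B.lift P (.B 0) = 0 := by
  simp [BVP.lift]

theorem BVP.lift_of_ne (B : BVP D Γ p R C s) (P : Label → Space) {i : Label} (hi : i ≠ .B 0) :
    B.lift P i = B.X (P i) := by simp [BVP.lift, hi]

theorem BVP.lift_mem (B : BVP D Γ p R C s) (hR : 1 ≤ R) {P : Label → Space}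
    (hP : ∀ i, ‖P i‖ ≤ R - 1) (i : Label) : B.lift P i ∈ Metric.closedBall (0 : Space) R := by
  by_cases hi : i = .B 0
  · rw [hi, B.lift_zero]; simp; linarith
  · rw [B.lift_of_ne P hi]; exact B.X_mem _ (by simpa using hP i)

theorem BVP.lift_near (B : BVP D Γ p R C s) (hC : 0 ≤ C * s) {P : Label → Space}
    (hP0 : P (.B 0) = 0) (hP : ∀ i, ‖P i‖ ≤ R - 1) (i : Label) : ‖B.lift P i - P i‖ ≤ C * s := by
  by_cases hi : i = .B 0
  · rw [hi, B.lift_zero, hP0]; simpa using hC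
  · rw [B.lift_of_ne P hi]; exact B.X_near _ (by simpa using hP i)

theorem BVP.lift_lip (B : BVP D Γ p R C s) (hC : 0 ≤ C * s) {P P' : Label → Space}
    (hP0 : P (.B 0) = 0) (hP0' : P' (.B 0) = 0) (hP : ∀ i, ‖P i‖ ≤ R - 1)
    (hP' : ∀ i, ‖P' i‖ ≤ R - 1) (i : Label) :
    ‖(B.lift P i - P i) - (B.lift P' i - P' i)‖ ≤ C * s * ‖P - P'‖ := by
  by_cases hi : i = .B 0
  · rw [hi, B.lift_zero, B.lift_zero, hP0, hP0']; simp; positivity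
  · rw [B.lift_of_ne P hi, B.lift_of_ne P' hi]
    refine (B.X_lip _ (by simpa using hP i) _ (by simpa using hP' i)).trans ?_
    gcongr
    exact norm_le_pi_norm (P - P') i

/-- To first order, the squared optical distances are those of the tangent space. -/
theorem IsLocalGeom.linkSq_lift (h : IsLocalGeom D g Γ) (hp : p ∈ D) (hR : 1 ≤ R) (hC : 0 < C) :
    ∃ K > 0, ∃ s₁ > 0, ∀ s, 0 < s → s ≤ s₁ → ∀ (B : BVP D Γ p R C s) (P P' : Label → Space),
      P (.B 0) = 0 → P' (.B 0) = 0 → (∀ i, ‖P i‖ ≤ R - 1) → (∀ i, ‖P' i‖ ≤ R - 1) → ∀ k,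
      |B.linkSq g (B.lift P) k - sqLen (formOf (g p)) P k| ≤ K * s ∧
      |(B.linkSq g (B.lift P) k - sqLen (formOf (g p)) P k)
        - (B.linkSq g (B.lift P') k - sqLen (formOf (g p)) P' k)| ≤ K * s * ‖P - P'‖ := by
  obtain ⟨ρ, hρ, M, hM, hsub, hb, hL⟩ := h.exists_bounds hp
  -- One constant that dominates all first-order errors: of the two lifts and the velocity, of the
  -- variation of the velocity, and of the metric and its variation.
  set c := 3 * C + 2 * C * (C + 1) + 2 * M * (C + 1) + M * R with hc
  have hR0 : 0 < R := by linarith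
  have hcp : 0 < c := by positivity
  set K1 := M * (2 * (2 * R) + 1) + (2 * R + 1) ^ 2 with hK1
  set K2 := 2 * M * (2 * R + 2) + (2 * R + 1) ^ 2 + 4 * (2 * R + 1) with hK2
  have hK1p : 0 < K1 := by positivity
  have hK2p : 0 < K2 := by positivity
  refine ⟨(K1 + 2 * K2) * c, by positivity, min (min 1 (1 / c)) (ρ / R), by positivity,
    fun s hs hs0 B P P' hP0 hP0' hP hP' k => ?_⟩
  simp only [le_min_iff] at hs0
  obtain ⟨⟨hs1, hsc⟩, hsρ⟩ := hs0
  rw [le_div_iff₀ (by positivity)] at hsc hsρ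
  have hCs : 0 ≤ C * s := by positivity
  have hκ : c * s ≤ 1 := by linarith
  have hpm : p ∈ Metric.closedBall p ρ := Metric.mem_closedBall_self hρ.le
  have hmem : ∀ a ∈ Metric.closedBall (0 : Space) R, p + s • a ∈ Metric.closedBall p ρ := by
    intro a ha
    rw [mem_closedBall_zero_iff] at ha
    rw [mem_closedBall_iff_norm, add_sub_cancel_left, norm_smul, Real.norm_of_nonneg hs.le]
    exact (mul_le_mul_of_nonneg_left ha hs.le).trans hsρ
  set Δ := ‖P - P'‖ with hΔ
  have hΔ0 : 0 ≤ Δ := norm_nonneg _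
  set a := fun i => B.lift P i with ha
  set a' := fun i => B.lift P' i with ha'
  have ham : ∀ i, a i ∈ Metric.closedBall (0 : Space) R := B.lift_mem hR hP
  have ham' : ∀ i, a' i ∈ Metric.closedBall (0 : Space) R := B.lift_mem hR hP'
  have hPi : ∀ i, ‖P i - P' i‖ ≤ Δ := fun i => norm_le_pi_norm (P - P') i
  have hnear : ∀ Q : Label → Space, Q (.B 0) = 0 → (∀ i, ‖Q i‖ ≤ R - 1) → ∀ i,
      ‖B.lift Q i - Q i‖ ≤ C * s := fun Q h0 hQ i => B.lift_near hCs h0 hQ i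
  have hlip : ∀ i, ‖(a i - P i) - (a' i - P' i)‖ ≤ C * s * Δ := B.lift_lip hCs hP0 hP0' hP hP'
  have haa : ∀ i, ‖a i - a' i‖ ≤ (C + 1) * Δ := fun i => by
    have e : a i - a' i = ((a i - P i) - (a' i - P' i)) + (P i - P' i) := by abel
    rw [e]
    refine (norm_add_le _ _).trans ?_
    have : C * s * Δ ≤ C * 1 * Δ := by gcongr
    linarith [hlip i, hPi i]
  -- the velocity of a link, its flat value and the difference
  have hdn : ∀ Q : Label → Space, (∀ i, ‖Q i‖ ≤ R - 1) → ‖Q (sndL k) - Q (fstL k)‖ ≤ 2 * R :=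
    fun Q hQ => (norm_sub_le _ _).trans (by linarith [hQ (sndL k), hQ (fstL k)])
  have hen : ∀ Q : Label → Space, Q (.B 0) = 0 → (∀ i, ‖Q i‖ ≤ R - 1) →
      ‖B.V (B.lift Q (fstL k)) (B.lift Q (sndL k)) - (Q (sndL k) - Q (fstL k))‖ ≤ 3 * C * s := by
    intro Q h0 hQ
    have m1 := B.lift_mem hR hQ (fstL k)
    have m2 := B.lift_mem hR hQ (sndL k)
    have h1 := (B.geod _ m1 _ m2 0 (by simp)).2.2.2.2
    rw [B.W_zero _ m1 _ m2] at h1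
    have e : B.V (B.lift Q (fstL k)) (B.lift Q (sndL k)) - (Q (sndL k) - Q (fstL k))
        = (B.V (B.lift Q (fstL k)) (B.lift Q (sndL k))
          - (B.lift Q (sndL k) - B.lift Q (fstL k)))
          + (B.lift Q (sndL k) - Q (sndL k)) - (B.lift Q (fstL k) - Q (fstL k)) := by abel
    rw [e]
    refine (norm_sub_le _ _).trans ((add_le_add_left (norm_add_le _ _) _).trans ?_)
    linarith [hnear Q h0 hQ (fstL k), hnear Q h0 hQ (sndL k)]
  have hee : ‖(B.V (a (fstL k)) (a (sndL k)) - (P (sndL k) - P (fstL k)))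
      - (B.V (a' (fstL k)) (a' (sndL k)) - (P' (sndL k) - P' (fstL k)))‖ ≤ c * s * Δ := by
    have h1 := B.V_lip _ (ham (fstL k)) _ (ham (sndL k)) _ (ham' (fstL k)) _ (ham' (sndL k))
    have e : (B.V (a (fstL k)) (a (sndL k)) - (P (sndL k) - P (fstL k)))
      - (B.V (a' (fstL k)) (a' (sndL k)) - (P' (sndL k) - P' (fstL k)))
      = ((B.V (a (fstL k)) (a (sndL k)) - (a (sndL k) - a (fstL k)))
        - (B.V (a' (fstL k)) (a' (sndL k)) - (a' (sndL k) - a' (fstL k))))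
        + ((a (sndL k) - P (sndL k)) - (a' (sndL k) - P' (sndL k)))
        - ((a (fstL k) - P (fstL k)) - (a' (fstL k) - P' (fstL k))) := by abel
    rw [e]
    refine (norm_sub_le _ _).trans ((add_le_add_left (norm_add_le _ _) _).trans ?_)
    have h2 : C * s * (‖a (fstL k) - a' (fstL k)‖ + ‖a (sndL k) - a' (sndL k)‖)
        ≤ C * s * ((C + 1) * Δ + (C + 1) * Δ) := by
      gcongr
      · exact haa _
      · exact haa _
    have h3 : 0 ≤ (C + 2 * M * (C + 1) + M * R) * (s * Δ) := by positivity
    have e2 : c * s * Δ = C * s * ((C + 1) * Δ + (C + 1) * Δ) + C * s * Δ + C * s * Δ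
      + (C + 2 * M * (C + 1) + M * R) * (s * Δ) := by rw [hc]; ring
    rw [e2]
    linarith [hlip (fstL k), hlip (sndL k)]
  have hGn : ∀ b ∈ Metric.closedBall (0 : Space) R,
      ‖formOf (g (p + s • b)) - formOf (g p)‖ ≤ c * s := by
    intro b hbm
    refine (hL _ (hmem b hbm) _ hpm).2.trans ?_
    rw [add_sub_cancel_left, norm_smul, Real.norm_of_nonneg hs.le]
    rw [mem_closedBall_zero_iff] at hbm
    have h1 : M * (s * ‖b‖) ≤ M * (s * R) := by gcongr
    have h2 : 0 ≤ (3 * C + 2 * C * (C + 1) + 2 * M * (C + 1)) * s := by positivity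
    have e2 : c * s = M * (s * R) + (3 * C + 2 * C * (C + 1) + 2 * M * (C + 1)) * s := by
      rw [hc]; ring
    linarith
  have hGG : ‖formOf (g (p + s • a (fstL k))) - formOf (g (p + s • a' (fstL k)))‖ ≤ c * s * Δ := by
    refine (hL _ (hmem _ (ham _)) _ (hmem _ (ham' _))).2.trans ?_
    rw [add_sub_add_left_eq_sub, ← smul_sub, norm_smul, Real.norm_of_nonneg hs.le]
    have h1 : M * (s * ‖a (fstL k) - a' (fstL k)‖) ≤ M * (s * ((C + 1) * Δ)) := by
      gcongr; exact haa _
    have h2 : 0 ≤ (3 * C + 2 * C * (C + 1) + M * (C + 1) + M * R) * (s * Δ) := by positivity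
    have e2 : c * s * Δ = M * (s * ((C + 1) * Δ))
      + (3 * C + 2 * C * (C + 1) + M * (C + 1) + M * R) * (s * Δ) := by rw [hc]; ring
    linarith
  have h3c : 3 * C * s ≤ c * s := by
    gcongr
    have : 0 ≤ 2 * C * (C + 1) + 2 * M * (C + 1) + M * R := by positivity
    linarith
  have hV : ∀ Q : Label → Space, B.linkSq g (B.lift Q) k
      = formOf (g (p + s • B.lift Q (fstL k)))
        ((Q (sndL k) - Q (fstL k)) +
          (B.V (B.lift Q (fstL k)) (B.lift Q (sndL k)) - (Q (sndL k) - Q (fstL k))))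
        ((Q (sndL k) - Q (fstL k)) +
          (B.V (B.lift Q (fstL k)) (B.lift Q (sndL k)) - (Q (sndL k) - Q (fstL k)))) := by
    intro Q; rw [add_sub_cancel]; rfl
  have hM0 := (hb p hpm).2
  have hfin : 0 < c * s := by positivity
  constructor
  · rw [hV P]
    refine (abs_quad_defect_le hM0 (hdn P hP) hκ ((hen P hP0 hP).trans h3c)
      (hGn _ (ham (fstL k)))).trans ?_
    have : 0 ≤ 2 * K2 * (c * s) := by positivity
    rw [← hK1]; linarith
  · rw [hV P, hV P']
    -- Both ends of the link move, hence `2 * Δ` for the difference vector.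
    refine (abs_quad_defect_sub_le hM0 (hdn P hP) (hdn P' hP') hκ ((hen P hP0 hP).trans h3c)
      ((hen P' hP0' hP').trans h3c) (hGn _ (ham' (fstL k))) (δ := 2 * Δ) ?_ ?_ ?_).trans ?_
    · rw [sub_sub_sub_comm]
      exact (norm_sub_le _ _).trans (by linarith [hPi (sndL k), hPi (fstL k)])
    · have : 0 ≤ c * s * Δ := by positivity
      exact hee.trans (by linarith)
    · have : 0 ≤ c * s * Δ := by positivity
      exact hGG.trans (by linarith)
    · rw [← hK2]
      have : 0 ≤ K1 * (c * s * Δ) := by positivity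
      linarith

/-- Optical distances are continuous. -/
theorem BVP.continuousOn_linkSq (h : IsLocalGeom D g Γ) (B : BVP D Γ p R C s) (k : Fin 10) :
    ContinuousOn (fun y => B.linkSq g y k) {y | ∀ i, y i ∈ Metric.closedBall (0 : Space) R} := by
  have hf : ∀ i, ContinuousOn (fun y : Label → Space => y i)
      {y | ∀ i, y i ∈ Metric.closedBall (0 : Space) R} := fun i => (continuous_apply i).continuousOn
  have hV : ContinuousOn (fun z : Space × Space => B.V z.1 z.2 - (z.2 - z.1))
      (Metric.closedBall 0 R ×ˢ Metric.closedBall 0 R) := by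
    refine LipschitzOnWith.continuousOn (K := Real.toNNReal (2 * |C * s|)) ?_
    refine LipschitzOnWith.of_dist_le_mul fun z hz z' hz' => ?_
    rw [dist_eq_norm, dist_eq_norm, Real.coe_toNNReal _ (by positivity)]
    refine (B.V_lip _ hz.1 _ hz.2 _ hz'.1 _ hz'.2).trans ?_
    have h1 : ‖z.1 - z'.1‖ ≤ ‖z - z'‖ := norm_fst_le (z - z')
    have h2 : ‖z.2 - z'.2‖ ≤ ‖z - z'‖ := norm_snd_le (z - z')
    calc C * s * (‖z.1 - z'.1‖ + ‖z.2 - z'.2‖) ≤ |C * s| * (‖z - z'‖ + ‖z - z'‖) := by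
          gcongr
          exact le_abs_self _
      _ = _ := by ring
  have hV' : ContinuousOn (fun z : Space × Space => B.V z.1 z.2)
      (Metric.closedBall 0 R ×ˢ Metric.closedBall 0 R) := by
    have h1 : ContinuousOn (fun z : Space × Space => z.2 - z.1)
      (Metric.closedBall 0 R ×ˢ Metric.closedBall 0 R) := by fun_prop
    refine (hV.add h1).congr fun z _ => ?_
    simp
  have h2 : ContinuousOn (fun y : Label → Space => B.V (y (fstL k)) (y (sndL k)))
      {y | ∀ i, y i ∈ Metric.closedBall (0 : Space) R} :=
    hV'.comp (f := fun y : Label → Space => (y (fstL k), y (sndL k)))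
      ((hf _).prodMk (hf _)) fun y hy => ⟨hy _, hy _⟩
  have h3 : ContinuousOn (fun y : Label → Space => formOf (g (p + s • y (fstL k))))
      {y | ∀ i, y i ∈ Metric.closedBall (0 : Space) R} := by
    refine h.smooth.continuousOn.comp (f := fun y : Label → Space => p + s • y (fstL k)) ?_ ?_
    · exact ((hf _).const_smul s).const_add p
    · intro y hy
      have := (B.geod _ (hy (fstL k)) _ (hy (fstL k)) 0 (by simp)).1
      rwa [B.Y_zero _ (hy _) _ (hy _)] at this
  exact (h3.clm_apply h2).clm_apply h2

end

/-! ### Explicit Euclidean configurations with nine prescribed lengths. -/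

noncomputable section

/-- Squared side lengths of the bipyramid on the first nine links. -/
def flatNine : Fin 9 → ℝ := fun k => sideSq k.castSucc

/-- A configuration in coordinates adapted to the points `B₁`, `B₂` and `A₁`. -/
def adapted (b : ℝ) (a c d : Fin 3 → ℝ) : Label → Space
  | .B j => ![0, ![b, 0, 0]] j
  | .A n => ![a n, c n, d n]

theorem sqLen_adapted {b : ℝ} {a c d : Fin 3 → ℝ} {m : Fin 9 → ℝ} (hd0 : d 0 = 0)
    (hb : b ^ 2 = m 0) (ha0 : 2 * b * a 0 = m 0 + m 1 - m 4) (ha1 : 2 * b * a 1 = m 0 + m 2 - m 5)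
    (ha2 : 2 * b * a 2 = m 0 + m 3 - m 6) (hc0 : a 0 ^ 2 + c 0 ^ 2 = m 1)
    (hd1 : a 1 ^ 2 + c 1 ^ 2 + d 1 ^ 2 = m 2) (hd2 : a 2 ^ 2 + c 2 ^ 2 + d 2 ^ 2 = m 3)
    (hc1 : 2 * (a 0 * a 1 + c 0 * c 1) = m 1 + m 2 - m 7)
    (hc2 : 2 * (a 0 * a 2 + c 0 * c 2) = m 1 + m 3 - m 8) (k : Fin 9) :
    sqLen (formOf 1) (adapted b a c d) k.castSucc = m k := by
  fin_cases k <;>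
    simp [sqLen, formOf_apply, fstL, sndL, adapted, Matrix.one_mulVec, dotProduct,
      Fin.sum_univ_three, hd0] <;> linarith

/-- The configuration with prescribed squared lengths of the first nine links. -/
def chol (m : Fin 9 → ℝ) : Label → Space :=
  let b := √(m 0)
  let a : Fin 3 → ℝ := ![(m 0 + m 1 - m 4) / (2 * b), (m 0 + m 2 - m 5) / (2 * b),
    (m 0 + m 3 - m 6) / (2 * b)]
  let c0 := √(m 1 - a 0 ^ 2)
  let c1 := ((m 1 + m 2 - m 7) / 2 - a 0 * a 1) / c0
  let c2 := ((m 1 + m 3 - m 8) / 2 - a 0 * a 2) / c0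
  adapted b a ![c0, c1, c2] ![0, √(m 2 - a 1 ^ 2 - c1 ^ 2), -√(m 3 - a 2 ^ 2 - c2 ^ 2)]

/-- Coordinates are solved for one after another. At the flat values the quantities under the four
roots are 4, 3, 9/4 and 9/4, so the solution is smooth nearby and hence Lipschitz. The opposite
signs of the last two roots put the second and the third `A` on different sides, giving the free
link length 3; equal signs would make them coincide. -/
theorem exists_chol : ∃ K > 0, ∃ ρ > 0, ∀ m ∈ Metric.closedBall flatNine ρ,
    chol m (.B 0) = 0 ∧ (∀ k, sqLen (formOf 1) (chol m) k.castSucc = m k) ∧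
    (∃ b > 0, chol m (.B 1) = Pi.single 0 b) ∧ (∀ i, ‖chol m i‖ ≤ K) ∧
    |sqLen (formOf 1) (chol m) (Fin.last 9) - 9| ≤ 1 ∧
    ∀ m' ∈ Metric.closedBall flatNine ρ, ‖chol m - chol m'‖ ≤ K * ‖m - m'‖ := by
  have v : flatNine = ![4, 4, 4, 4, 4, 4, 4, 9, 9] := by
    funext k
    fin_cases k <;> simp [flatNine, sideSq, side_eq] <;> norm_num
  have v0 : flatNine 0 = 4 := by rw [v]; rfl
  have v1 : flatNine 1 = 4 := by rw [v]; rfl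
  have v2 : flatNine 2 = 4 := by rw [v]; rfl
  have v3 : flatNine 3 = 4 := by rw [v]; rfl
  have v4 : flatNine 4 = 4 := by rw [v]; rfl
  have v5 : flatNine 5 = 4 := by rw [v]; rfl
  have v6 : flatNine 6 = 4 := by rw [v]; rfl
  have v7 : flatNine 7 = 9 := by rw [v]; rfl
  have v8 : flatNine 8 = 9 := by rw [v]; rfl
  set b : (Fin 9 → ℝ) → ℝ := fun m => √(m 0) with hb
  set a0 : (Fin 9 → ℝ) → ℝ := fun m => (m 0 + m 1 - m 4) / (2 * b m) with ha0
  set a1 : (Fin 9 → ℝ) → ℝ := fun m => (m 0 + m 2 - m 5) / (2 * b m) with ha1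
  set a2 : (Fin 9 → ℝ) → ℝ := fun m => (m 0 + m 3 - m 6) / (2 * b m) with ha2
  set p0 : (Fin 9 → ℝ) → ℝ := fun m => m 1 - a0 m ^ 2 with hp0
  set c0 : (Fin 9 → ℝ) → ℝ := fun m => √(p0 m) with hc0
  set c1 : (Fin 9 → ℝ) → ℝ := fun m => ((m 1 + m 2 - m 7) / 2 - a0 m * a1 m) / c0 m with hc1
  set c2 : (Fin 9 → ℝ) → ℝ := fun m => ((m 1 + m 3 - m 8) / 2 - a0 m * a2 m) / c0 m with hc2
  set p1 : (Fin 9 → ℝ) → ℝ := fun m => m 2 - a1 m ^ 2 - c1 m ^ 2 with hp1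
  set p2 : (Fin 9 → ℝ) → ℝ := fun m => m 3 - a2 m ^ 2 - c2 m ^ 2 with hp2
  set d1 : (Fin 9 → ℝ) → ℝ := fun m => √(p1 m) with hd1
  set d2 : (Fin 9 → ℝ) → ℝ := fun m => -√(p2 m) with hd2
  have hch : ∀ m, chol m = adapted (b m) ![a0 m, a1 m, a2 m] ![c0 m, c1 m, c2 m]
    ![0, d1 m, d2 m] := fun m => rfl
  have hm : ∀ k, ContDiffAt ℝ 1 (fun m : Fin 9 → ℝ => m k) flatNine := fun k => contDiffAt_apply ..
  have wb : b flatNine = 2 := by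
    simp only [hb, v0]; rw [show (4 : ℝ) = 2 ^ 2 by norm_num]; exact Real.sqrt_sq (by norm_num)
  have sb : ContDiffAt ℝ 1 b flatNine := (hm 0).sqrt (by rw [v0]; norm_num)
  have w2b : 2 * b flatNine ≠ 0 := by rw [wb]; norm_num
  have s2b : ContDiffAt ℝ 1 (fun m => 2 * b m) flatNine := contDiffAt_const.mul sb
  have wa0 : a0 flatNine = 1 := by simp only [ha0, v0, v1, v4, wb]; norm_num
  have wa1 : a1 flatNine = 1 := by simp only [ha1, v0, v2, v5, wb]; norm_num
  have wa2 : a2 flatNine = 1 := by simp only [ha2, v0, v3, v6, wb]; norm_num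
  have sa0 : ContDiffAt ℝ 1 a0 flatNine := (((hm 0).add (hm 1)).sub (hm 4)).div s2b w2b
  have sa1 : ContDiffAt ℝ 1 a1 flatNine := (((hm 0).add (hm 2)).sub (hm 5)).div s2b w2b
  have sa2 : ContDiffAt ℝ 1 a2 flatNine := (((hm 0).add (hm 3)).sub (hm 6)).div s2b w2b
  have wp0 : p0 flatNine = 3 := by simp only [hp0, v1, wa0]; norm_num
  have sp0 : ContDiffAt ℝ 1 p0 flatNine := (hm 1).sub (sa0.pow 2)
  have sc0 : ContDiffAt ℝ 1 c0 flatNine := sp0.sqrt (by rw [wp0]; norm_num)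
  have wc0 : c0 flatNine ^ 2 = 3 := by
    simp only [hc0, wp0]; exact Real.sq_sqrt (by norm_num)
  have wc0' : c0 flatNine ≠ 0 := by intro h0; rw [h0] at wc0; norm_num at wc0
  have wc1 : c1 flatNine ^ 2 = 3 / 4 := by
    simp only [hc1, v1, v2, v7, wa0, wa1, div_pow, wc0]; norm_num
  have wc2 : c2 flatNine ^ 2 = 3 / 4 := by
    simp only [hc2, v1, v3, v8, wa0, wa2, div_pow, wc0]; norm_num
  have sc1 : ContDiffAt ℝ 1 c1 flatNine :=
    (((((hm 1).add (hm 2)).sub (hm 7)).div_const 2).sub (sa0.mul sa1)).div sc0 wc0'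
  have sc2 : ContDiffAt ℝ 1 c2 flatNine :=
    (((((hm 1).add (hm 3)).sub (hm 8)).div_const 2).sub (sa0.mul sa2)).div sc0 wc0'
  have wp1 : p1 flatNine = 9 / 4 := by simp only [hp1, v2, wa1, wc1]; norm_num
  have wp2 : p2 flatNine = 9 / 4 := by simp only [hp2, v3, wa2, wc2]; norm_num
  have sp1 : ContDiffAt ℝ 1 p1 flatNine := ((hm 2).sub (sa1.pow 2)).sub (sc1.pow 2)
  have sp2 : ContDiffAt ℝ 1 p2 flatNine := ((hm 3).sub (sa2.pow 2)).sub (sc2.pow 2)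
  have sd1 : ContDiffAt ℝ 1 d1 flatNine := sp1.sqrt (by rw [wp1]; norm_num)
  have sd2 : ContDiffAt ℝ 1 d2 flatNine := (sp2.sqrt (by rw [wp2]; norm_num)).neg
  have s0 : ContDiffAt ℝ 1 (fun _ : Fin 9 → ℝ => (0 : ℝ)) flatNine := contDiffAt_const
  have smooth : ContDiffAt ℝ 1 chol flatNine := by
    have e : chol = fun m => adapted (b m) ![a0 m, a1 m, a2 m] ![c0 m, c1 m, c2 m]
      ![0, d1 m, d2 m] := funext hch
    rw [e, contDiffAt_pi]
    rintro (n | j) <;> rw [contDiffAt_pi] <;> intro i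
    · fin_cases n <;> fin_cases i
      · exact sa0
      · exact sc0
      · exact s0
      · exact sa1
      · exact sc1
      · exact sd1
      · exact sa2
      · exact sc2
      · exact sd2
    · fin_cases j <;> fin_cases i
      · exact s0
      · exact s0
      · exact s0
      · exact sb
      · exact s0
      · exact s0
  obtain ⟨K, t, ht, hK⟩ := smooth.exists_lipschitzOnWith
  have hlast : ContinuousAt (fun m => sqLen (formOf 1) (chol m) (Fin.last 9)) flatNine :=
    (continuous_sqLen (formOf 1) (Fin.last 9)).continuousAt.comp smooth.continuousAt
  have wlast : sqLen (formOf 1) (chol flatNine) (Fin.last 9) = 9 := by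
    have e1 : fstL (Fin.last 9) = .A 1 := rfl
    have e2 : sndL (Fin.last 9) = .A 2 := rfl
    have e3 : c1 flatNine = c2 flatNine := by
      simp only [hc1, hc2, v1, v2, v3, v7, v8, wa0, wa1, wa2]
    have e4 : d2 flatNine = -d1 flatNine := by simp only [hd1, hd2, wp1, wp2]
    have e5 : d1 flatNine ^ 2 = 9 / 4 := by
      simp only [hd1, wp1]; exact Real.sq_sqrt (by norm_num)
    rw [hch, sqLen, e1, e2, formOf_apply]
    simp only [adapted, Matrix.one_mulVec, dotProduct, Fin.sum_univ_three, Pi.sub_apply]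
    simp
    rw [wa1, wa2, e3, e4]
    linarith
  have hev : ∀ᶠ m in nhds flatNine, m ∈ t ∧ 0 < m 0 ∧ 0 < p0 m ∧ 0 < p1 m ∧ 0 < p2 m ∧
      |sqLen (formOf 1) (chol m) (Fin.last 9) - 9| < 1 := by
    refine Filter.Eventually.and ht (Filter.Eventually.and ?_ (Filter.Eventually.and ?_
      (Filter.Eventually.and ?_ (Filter.Eventually.and ?_ ?_))))
    · exact (hm 0).continuousAt.eventually (lt_mem_nhds (by change (0 : ℝ) < flatNine 0; rw [v0]; norm_num))
    · exact sp0.continuousAt.eventually (lt_mem_nhds (by rw [wp0]; norm_num))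
    · exact sp1.continuousAt.eventually (lt_mem_nhds (by rw [wp1]; norm_num))
    · exact sp2.continuousAt.eventually (lt_mem_nhds (by rw [wp2]; norm_num))
    · exact (hlast.sub continuousAt_const).abs.eventually
        (gt_mem_nhds (by
          change |sqLen (formOf 1) (chol flatNine) (Fin.last 9) - 9| < 1
          rw [wlast]; norm_num))
  obtain ⟨ρ, hρ, hball⟩ := Metric.nhds_basis_closedBall.eventually_iff.mp hev
  have hmem : flatNine ∈ Metric.closedBall flatNine ρ := Metric.mem_closedBall_self hρ.le
  have hLip : ∀ m ∈ Metric.closedBall flatNine ρ, ∀ m' ∈ Metric.closedBall flatNine ρ,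
      ‖chol m - chol m'‖ ≤ K * ‖m - m'‖ := fun m hm m' hm' => by
    have := hK.dist_le_mul _ (hball hm).1 _ (hball hm').1
    rwa [dist_eq_norm, dist_eq_norm] at this
  refine ⟨K * (1 + ρ) + ‖chol flatNine‖ + 1, by positivity, ρ, hρ, fun m hmm => ?_⟩
  obtain ⟨-, q0, q1, q2, q3, q4⟩ := hball hmm
  have hb0 : 0 < b m := Real.sqrt_pos.mpr q0
  have hc00 : 0 < c0 m := Real.sqrt_pos.mpr q1
  refine ⟨by rw [hch]; rfl, fun k => ?_, ⟨b m, hb0, ?_⟩, fun i => ?_, q4.le, fun m' hm' => ?_⟩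
  · rw [hch]
    have hsq := Real.sq_sqrt q1.le
    have hsq1 := Real.sq_sqrt q2.le
    have hsq2 := Real.sq_sqrt q3.le
    refine sqLen_adapted rfl (Real.sq_sqrt q0.le) ?_ ?_ ?_ ?_ ?_ ?_ ?_ ?_ k
    · change 2 * b m * a0 m = _; simp only [ha0]; field_simp
    · change 2 * b m * a1 m = _; simp only [ha1]; field_simp
    · change 2 * b m * a2 m = _; simp only [ha2]; field_simp
    · change a0 m ^ 2 + c0 m ^ 2 = m 1
      simp only [hc0, hsq]; simp only [hp0]; ring
    · change a1 m ^ 2 + c1 m ^ 2 + d1 m ^ 2 = m 2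
      simp only [hd1, hsq1]; simp only [hp1]; ring
    · change a2 m ^ 2 + c2 m ^ 2 + d2 m ^ 2 = m 3
      simp only [hd2, neg_sq, hsq2]; simp only [hp2]; ring
    · change 2 * (a0 m * a1 m + c0 m * c1 m) = _
      simp only [hc1]
      rw [mul_div_cancel₀ _ hc00.ne']; ring
    · change 2 * (a0 m * a2 m + c0 m * c2 m) = _
      simp only [hc2]
      rw [mul_div_cancel₀ _ hc00.ne']; ring
  · rw [hch]
    funext i
    fin_cases i <;> simp [adapted]
  · have h1 := hLip m hmm flatNine hmem
    have h2 : ‖m - flatNine‖ ≤ ρ := by rwa [mem_closedBall_iff_norm] at hmm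
    have h3 := norm_le_pi_norm (chol m) i
    have h4 : ‖chol m‖ ≤ ‖chol m - chol flatNine‖ + ‖chol flatNine‖ := by
      have := norm_add_le (chol m - chol flatNine) (chol flatNine)
      rwa [sub_add_cancel] at this
    have h5 : (K : ℝ) * ‖m - flatNine‖ ≤ K * ρ := by gcongr
    have h6 : (0 : ℝ) ≤ K := K.2
    linarith
  · refine (hLip m hmm m' hm').trans ?_
    gcongr
    have h6 : (0 : ℝ) ≤ K := K.2
    have : 0 ≤ K * ρ := by positivity
    have := norm_nonneg (chol flatNine)
    linarith

end

/-! ### Continuous families of configurations in the curved space. -/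

noncomputable section

variable {D : Set Space} {g : Space → Matrix (Fin 3) (Fin 3) ℝ} {Γ : Space → Bil}

theorem exists_lower_bound {H : Matrix (Fin 3) (Fin 3) ℝ} (hH : H.PosDef) :
    ∃ m > 0, ∀ v : Space, m * ‖v‖ ^ 2 ≤ formOf H v v := by
  have hc : Continuous fun v : Space => formOf H v v :=
    ((formOf H).continuous).clm_apply continuous_id
  obtain ⟨v0, hv0, hmin⟩ := (isCompact_sphere (0 : Space) 1).exists_isMinOn
    (NormedSpace.sphere_nonempty.mpr zero_le_one) hc.continuousOn
  refine ⟨formOf H v0 v0, ?_, fun v => ?_⟩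
  · have hne : v0 ≠ 0 := by rintro rfl; simp at hv0
    rw [formOf_apply]
    simpa using hH.dotProduct_mulVec_pos hne
  · rcases eq_or_ne v 0 with rfl | hv
    · simp
    have hv' : 0 < ‖v‖ := norm_pos_iff.mpr hv
    have := hmin (a := ‖v‖⁻¹ • v) (by simp [norm_smul, hv'.ne'])
    simp only [Set.mem_ofPred_eq, map_smul, smul_apply, smul_eq_mul] at this
    calc formOf H v0 v0 * ‖v‖ ^ 2 ≤ (‖v‖⁻¹ * (‖v‖⁻¹ * formOf H v v)) * ‖v‖ ^ 2 := by gcongr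
      _ = _ := by field_simp

theorem formOf_frame {H E : Matrix (Fin 3) (Fin 3) ℝ} (hE : E.transpose * H * E = 1) (u v : Space) :
    formOf H (E.mulVec u) (E.mulVec v) = formOf 1 u v := by
  rw [formOf_apply, formOf_apply, Matrix.mulVec_mulVec, Matrix.dotProduct_mulVec,
    Matrix.vecMul_mulVec, ← Matrix.dotProduct_mulVec, ← hE, Matrix.mul_assoc]

/-- A frame is an isometry from the standard inner product to `H`, so one bound serves all
orientations. -/
theorem exists_frame_bound {H : Matrix (Fin 3) (Fin 3) ℝ} (hH : H.PosDef) :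
    ∃ M > 0, ∀ E : Matrix (Fin 3) (Fin 3) ℝ, E.transpose * H * E = 1 → ∀ v : Space,
      ‖E.mulVec v‖ ≤ M * ‖v‖ := by
  obtain ⟨m, hm, hlow⟩ := exists_lower_bound hH
  refine ⟨√(‖formOf 1‖ / m) + 1, by positivity, fun E hE v => ?_⟩
  have h1 := hlow (E.mulVec v)
  rw [formOf_frame hE] at h1
  have h2 : formOf 1 v v ≤ ‖formOf 1‖ * ‖v‖ * ‖v‖ :=
    (le_abs_self _).trans ((formOf 1).le_opNorm₂ v v)
  have h3 : ‖E.mulVec v‖ ^ 2 ≤ (√(‖formOf 1‖ / m) * ‖v‖) ^ 2 := by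
    rw [mul_pow, Real.sq_sqrt (by positivity), div_mul_eq_mul_div, le_div_iff₀ hm]
    linarith
  have h4 := abs_le_of_sq_le_sq' h3 (by positivity)
  linarith [h4.2, norm_nonneg v]

/-- A continuous family of radar configurations with prescribed orientation and with prescribed
lengths of nine links. -/
theorem IsLocalGeom.exists_family (h : IsLocalGeom D g Γ) {p : Space} (hp : p ∈ D) :
    ∃ R₀ ≥ 1, ∃ ρ > 0, ∀ R ≥ R₀, ∀ C > 0, ∃ s₁ > 0, ∀ s, 0 < s → s ≤ s₁ →
      ∀ (B : BVP D Γ p R C s) (F : ℝ → Matrix (Fin 3) (Fin 3) ℝ) (τ : ℝ → Fin 9 → ℝ),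
      Continuous F → (∀ r, (F r).transpose * g p * F r = 1) → Continuous τ →
      (∀ r, ‖τ r - flatNine‖ ≤ ρ) → ∃ y : ℝ → Label → Space, Continuous y ∧ ∀ r,
        y r (.B 0) = 0 ∧ (∀ i, y r i ∈ Metric.closedBall (0 : Space) R) ∧
        (∀ k, B.linkSq g (y r) k.castSucc = τ r k) ∧
        |√(B.linkSq g (y r) (Fin.last 9)) - 3| ≤ 2 / 5 ∧
        ∃ c : ℝ, 0 < c ∧ B.V 0 (y r (.B 1)) = c • fun i => F r i 0 := by
  obtain ⟨M, hM, hframe⟩ := exists_frame_bound (h.posDef p hp)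
  obtain ⟨K, hK, ρ, hρ, hchol⟩ := exists_chol
  refine ⟨M * K + 1, le_add_of_nonneg_left (by positivity), ρ / 2, by positivity,
    fun R hR C hC => ?_⟩
  have hR1 : 1 ≤ R := le_trans (le_add_of_nonneg_left (by positivity)) hR
  obtain ⟨K', hK', s1, hs1, hlin⟩ := h.linkSq_lift hp hR1 hC
  refine ⟨min (min s1 (1 / (2 * K'))) (min (ρ / (2 * K')) (1 / (2 * (K' * (M * K))))),
    by positivity, fun s hs hs0 B F τ hF hFr hτ hτr => ?_⟩
  simp only [le_min_iff] at hs0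
  obtain ⟨⟨hss1, hs2⟩, hs3, hs4⟩ := hs0
  rw [le_div_iff₀ (by positivity)] at hs2 hs3 hs4
  have hK's : 0 ≤ K' * s := by positivity
  -- The flat configuration with trial squared lengths `m`, turned by the frame; its image under the
  -- exponential map has squared lengths `m + e r m`.
  set P : ℝ → (Fin 9 → ℝ) → Label → Space := fun r m i => (F r).mulVec (chol m i) with hP
  have hP0 : ∀ r, ∀ m ∈ Metric.closedBall flatNine ρ, P r m (.B 0) = 0 := fun r m hm => by
    simp only [hP, (hchol m hm).1, Matrix.mulVec_zero]
  have hPn : ∀ r, ∀ m ∈ Metric.closedBall flatNine ρ, ∀ i, ‖P r m i‖ ≤ R - 1 := fun r m hm i => by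
    refine (hframe _ (hFr r) _).trans ?_
    have : M * ‖chol m i‖ ≤ M * K := by gcongr; exact (hchol m hm).2.2.2.1 i
    linarith
  have hPs : ∀ r m k, sqLen (formOf (g p)) (P r m) k = sqLen (formOf 1) (chol m) k := by
    intro r m k
    simp only [sqLen, hP, ← Matrix.mulVec_sub, formOf_frame (hFr r)]
  have hPl : ∀ r, ∀ m ∈ Metric.closedBall flatNine ρ, ∀ m' ∈ Metric.closedBall flatNine ρ,
      ‖P r m - P r m'‖ ≤ M * K * ‖m - m'‖ := by
    intro r m hm m' hm'
    refine (pi_norm_le_iff_of_nonneg (by positivity)).mpr fun i => ?_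
    simp only [hP, Pi.sub_apply, ← Matrix.mulVec_sub]
    refine (hframe _ (hFr r) _).trans ?_
    have h1 := (norm_le_pi_norm (chol m - chol m') i).trans ((hchol m hm).2.2.2.2.2 m' hm')
    rw [mul_assoc]
    exact mul_le_mul_of_nonneg_left h1 hM.le
  set e : ℝ → (Fin 9 → ℝ) → Fin 9 → ℝ := fun r m k =>
    B.linkSq g (B.lift (P r m)) k.castSucc - m k with he
  have he' : ∀ r, ∀ m ∈ Metric.closedBall flatNine ρ, ∀ k, e r m k
      = B.linkSq g (B.lift (P r m)) k.castSucc - sqLen (formOf (g p)) (P r m) k.castSucc := by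
    intro r m hm k
    rw [hPs, (hchol m hm).2.1]
  have heb : ∀ r, ∀ m ∈ Metric.closedBall flatNine ρ, ‖e r m‖ ≤ K' * s := by
    intro r m hm
    refine (pi_norm_le_iff_of_nonneg hK's).mpr fun k => ?_
    rw [he' r m hm, Real.norm_eq_abs]
    exact (hlin s hs hss1 B _ _ (hP0 r m hm) (hP0 r m hm) (hPn r m hm) (hPn r m hm) _).1
  have hel : ∀ r r', ∀ m ∈ Metric.closedBall flatNine ρ, ∀ m' ∈ Metric.closedBall flatNine ρ,
      ‖e r m - e r' m'‖ ≤ K' * s * ‖P r m - P r' m'‖ := by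
    intro r r' m hm m' hm'
    refine (pi_norm_le_iff_of_nonneg (by positivity)).mpr fun k => ?_
    rw [Pi.sub_apply, he' r m hm, he' r' m' hm', Real.norm_eq_abs]
    exact (hlin s hs hss1 B _ _ (hP0 r m hm) (hP0 r' m' hm') (hPn r m hm) (hPn r' m' hm') _).2
  have hel' : ∀ r, ∀ m ∈ Metric.closedBall flatNine ρ, ∀ m' ∈ Metric.closedBall flatNine ρ,
      ‖e r m - e r m'‖ ≤ 1 / 2 * ‖m - m'‖ := by
    intro r m hm m' hm'
    refine (hel r r m hm m' hm').trans ?_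
    have h1 := mul_le_mul_of_nonneg_left (hPl r m hm m' hm') hK's
    have h2 : K' * s * (M * K) ≤ 1 / 2 := by linarith
    have h3 := mul_le_mul_of_nonneg_right h2 (norm_nonneg (m - m'))
    linarith
  have hball : ∀ v ∈ Metric.closedBall (0 : Fin 9 → ℝ) ρ, flatNine + v ∈ Metric.closedBall flatNine ρ := by
    intro v hv
    rw [mem_closedBall_iff_norm, add_sub_cancel_left]
    simpa using hv
  -- The trial lengths are corrected so that the actual lengths are the prescribed ones; the error
  -- is small and half-Lipschitz, so `exists_add_eq` applies.
  have hsol : ∀ r, ∃ m ∈ Metric.closedBall flatNine ρ, m + e r m = τ r := by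
    intro r
    obtain ⟨⟨v, hv, hve⟩, -⟩ := exists_add_eq (e := fun v => e r (flatNine + v)) (R := ρ)
      (c := K' * s) (w := τ r - flatNine) hρ.le
      (fun x hx y hy => by
        have := hel' r _ (hball x hx) _ (hball y hy)
        rwa [add_sub_add_left_eq_sub] at this)
      (fun x hx => heb r _ (hball x hx)) (by linarith [hτr r])
    refine ⟨flatNine + v, hball v hv, ?_⟩
    rw [add_assoc, hve]; abel
  choose m hm hme using hsol
  -- The solution is continuous in the parameter because the half-Lipschitz dependence of the error
  -- on `m` can be absorbed.
  have hmc : Continuous m := by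
    rw [continuous_iff_continuousAt]
    intro r0
    rw [ContinuousAt, tendsto_iff_norm_sub_tendsto_zero]
    have hbound : ∀ r, ‖m r - m r0‖
        ≤ 2 * (‖τ r - τ r0‖ + K' * s * ‖P r (m r0) - P r0 (m r0)‖) := by
      intro r
      have e1 : m r - m r0 = (τ r - τ r0) - (e r (m r) - e r (m r0))
          - (e r (m r0) - e r0 (m r0)) := by
        rw [← hme r, ← hme r0]; abel
      have h1 := hel' r _ (hm r) _ (hm r0)
      have h2 := hel r r0 _ (hm r0) _ (hm r0)
      have h3 := (norm_sub_le ((τ r - τ r0) - (e r (m r) - e r (m r0)))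
        (e r (m r0) - e r0 (m r0))).trans (add_le_add_left (norm_sub_le _ _) _)
      rw [← e1] at h3
      linarith
    refine squeeze_zero (fun r => norm_nonneg _) hbound ?_
    have hc : Continuous fun r => 2 * (‖τ r - τ r0‖ + K' * s * ‖P r (m r0) - P r0 (m r0)‖) := by
      have : Continuous fun r => P r (m r0) :=
        continuous_pi fun i => hF.matrix_mulVec continuous_const
      fun_prop
    have := hc.tendsto r0
    simpa using this
  have hcc : ContinuousOn chol (Metric.closedBall flatNine ρ) := by
    refine LipschitzOnWith.continuousOn (K := K.toNNReal) (LipschitzOnWith.of_dist_le_mul ?_)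
    intro m1 h1 m2 h2
    rw [dist_eq_norm, dist_eq_norm, Real.coe_toNNReal _ hK.le]
    exact (hchol m1 h1).2.2.2.2.2 m2 h2
  have hPc : Continuous fun r => P r (m r) := by
    have : Continuous fun r => chol (m r) := hcc.comp_continuous hmc hm
    exact continuous_pi fun i => hF.matrix_mulVec ((continuous_apply i).comp this)
  have hmm := fun r => hchol (m r) (hm r)
  refine ⟨fun r => B.lift (P r (m r)), ?_, fun r => ⟨B.lift_zero _,
    B.lift_mem hR1 (hPn r _ (hm r)), fun k => ?_, ?_, ?_⟩⟩
  · have h1 : Continuous fun r => B.lift (P r (m r)) - P r (m r) := by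
      rw [continuous_iff_continuousAt]
      intro r0
      rw [ContinuousAt, tendsto_iff_norm_sub_tendsto_zero]
      refine squeeze_zero (fun r => norm_nonneg _) (g := fun r => C * s * ‖P r (m r) - P r0 (m r0)‖)
        (fun r => ?_) ?_
      · refine (pi_norm_le_iff_of_nonneg (by positivity)).mpr fun i => ?_
        exact B.lift_lip (by positivity) (hP0 r _ (hm r)) (hP0 r0 _ (hm r0)) (hPn r _ (hm r))
          (hPn r0 _ (hm r0)) i
      · have hc : Continuous fun r => C * s * ‖P r (m r) - P r0 (m r0)‖ :=
          continuous_const.mul (hPc.sub continuous_const).norm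
        have := hc.tendsto r0
        simpa using this
    refine (h1.add hPc).congr fun r => ?_
    simp
  · have := congrFun (hme r) k
    simp only [Pi.add_apply, he] at this
    rw [← this]; ring
  · have h1 := (hlin s hs hss1 B _ _ (hP0 r _ (hm r)) (hP0 r _ (hm r)) (hPn r _ (hm r))
      (hPn r _ (hm r)) (Fin.last 9)).1
    rw [hPs] at h1
    have h2 := (hmm r).2.2.2.2.1
    generalize B.linkSq g (B.lift (P r (m r))) (Fin.last 9) = q at *
    have h3 : |q - 9| ≤ 3 / 2 := by
      have := abs_sub_le q (sqLen (formOf 1) (chol (m r)) (Fin.last 9)) 9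
      linarith
    obtain ⟨h4, h5⟩ := abs_le.mp h3
    rw [abs_le]
    constructor
    · have : (13 / 5 : ℝ) ≤ √q := Real.le_sqrt_of_sq_le (by norm_num; linarith)
      linarith
    · have : √q ≤ 17 / 5 := Real.sqrt_le_iff.mpr ⟨by norm_num, by norm_num; linarith⟩
      linarith
  · obtain ⟨b, hb, hb1⟩ := (hmm r).2.2.1
    refine ⟨b, hb, ?_⟩
    change B.V 0 (B.lift (P r (m r)) (.B 1)) = _
    -- The second `B` was placed by the exponential map at the first, so the direction of aim is
    -- exactly the first vector of the frame.
    rw [B.lift_of_ne _ (i := .B 1) (by decide), B.V_X _ (by simpa using hPn r _ (hm r) (.B 1))]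
    simp only [hP, hb1]
    funext i
    simp [mul_comm]

end

/-! ### Configurations with an arbitrary exceptional link. -/

noncomputable section

variable {D : Set Space} {g : Space → Matrix (Fin 3) (Fin 3) ℝ} {Γ : Space → Bil}

theorem abs_sqrt_sub_le {q a : ℝ} (ha : 2 ≤ a) (hq : |q - a ^ 2| ≤ 1) : |√q - a| ≤ |q - a ^ 2| / 2 := by
  have hq0 : 0 ≤ q := by have := (abs_le.mp hq).1; nlinarith
  have h1 : |√q - a| * (√q + a) = |q - a ^ 2| := by
    conv_lhs => rw [← abs_of_nonneg (show 0 ≤ √q + a by positivity)]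
    rw [← abs_mul]
    congr 1
    linear_combination Real.sq_sqrt hq0
  have h2 : |√q - a| * 2 ≤ |√q - a| * (√q + a) :=
    mul_le_mul_of_nonneg_left (by linarith [Real.sqrt_nonneg q]) (abs_nonneg _)
  linarith

open scoped MatrixOrder in
theorem exists_frame {H : Matrix (Fin 3) (Fin 3) ℝ} (hH : H.PosDef) :
    ∃ E : Matrix (Fin 3) (Fin 3) ℝ, E.transpose * H * E = 1 := by
  obtain ⟨B, hB⟩ := CStarAlgebra.nonneg_iff_eq_star_mul_self.mp hH.posSemidef.nonneg
  have e : star B = B.transpose := by ext i j; simp [Matrix.star_apply]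
  rw [e] at hB
  have hdet : IsUnit B.det := by
    rw [isUnit_iff_ne_zero]
    intro h0
    have := hH.det_pos
    rw [hB, Matrix.det_mul, h0, mul_zero] at this
    exact lt_irrefl _ this
  refine ⟨B⁻¹, ?_⟩
  rw [hB, Matrix.mul_assoc, Matrix.mul_assoc, Matrix.mul_nonsing_inv B hdet, mul_one,
    ← Matrix.transpose_mul, Matrix.mul_nonsing_inv B hdet, Matrix.transpose_one]

theorem formOf_col {H E : Matrix (Fin 3) (Fin 3) ℝ} (hE : E.transpose * H * E = 1) (j : Fin 3) :
    formOf H (fun i => E i j) (fun i => E i j) = 1 := by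
  rw [formOf_apply, ← frame_mul_entry, hE, Matrix.one_apply_eq]

theorem exists_dirCurv_bound {H : Matrix (Fin 3) (Fin 3) ℝ} (hH : H.PosDef)
    (Rc : Matrix (Fin 3) (Fin 3) ℝ) (t : ℝ) :
    ∃ M > 0, ∀ u : Space, formOf H u u = 1 → |dirCurv Rc t u| ≤ M := by
  obtain ⟨m, hm, hlow⟩ := exists_lower_bound hH
  refine ⟨45 * (‖formOf Rc‖ * (1 / m)) + |27 / 2 * t| + 1, by positivity, fun u hu => ?_⟩
  have h1 := hlow u
  rw [hu] at h1
  have h2 : ‖u‖ ^ 2 ≤ 1 / m := by rw [le_div_iff₀ hm]; linarith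
  have h3 : |formOf Rc u u| ≤ ‖formOf Rc‖ * (1 / m) := by
    refine ((formOf Rc).le_opNorm₂ u u).trans ?_
    rw [mul_assoc, ← sq]
    gcongr
  rw [dirCurv]
  refine (abs_add_le _ _).trans ?_
  rw [abs_mul]
  have h8 : |(-45 : ℝ)| = 45 := by norm_num
  rw [h8]
  linarith

theorem abs_stress_le (k : Fin 10) : 4 ≤ |stress k| := by
  fin_cases k <;> norm_num [stress]

/-- A radar configuration of prescribed orientation with prescribed lengths of nine links. -/
theorem IsLocalGeom.exists_config (h : IsLocalGeom D g Γ) {p : Space} (hp : p ∈ D) :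
    ∃ R₀ ≥ 1, ∀ R ≥ R₀, ∀ C > 0, ∀ C₁ > 0, ∃ s₁ > 0, ∀ s, 0 < s → s ≤ s₁ →
      ∀ (B : BVP D Γ p R C s) (F : Matrix (Fin 3) (Fin 3) ℝ), F.transpose * g p * F = 1 →
      ∀ (k₀ : Fin 10) (δ : Fin 10 → ℝ), (∀ k ≠ k₀, |δ k| ≤ C₁ * s ^ 2) → ∃ y : Label → Space,
        y (.B 0) = 0 ∧ (∀ i, y i ∈ Metric.closedBall (0 : Space) R) ∧
        (∀ k ≠ k₀, B.linkSq g y k = sideSq k + δ k) ∧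
        |√(B.linkSq g y k₀) - side k₀| ≤ 2 / 5 ∧
        ∃ c : ℝ, 0 < c ∧ B.V 0 (y (.B 1)) = c • fun i => F i 0 := by
  obtain ⟨R₀, hR₀, ρ, hρ, hfam⟩ := h.exists_family hp
  have hpd := h.posDef p hp
  obtain ⟨E, hE⟩ := exists_frame hpd
  obtain ⟨Km, hKm, hKb⟩ := exists_dirCurv_bound hpd (ricciOf (connDeriv Γ p))
    (E.transpose * ricciOf (connDeriv Γ p) * E).trace
  refine ⟨R₀, hR₀, fun R hR C hC C₁ hC₁ => ?_⟩
  have hR1 : 1 ≤ R := le_trans hR₀ hR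
  obtain ⟨s1, hs1, hfam⟩ := hfam R hR C hC
  -- Bounds the prescribed deviations weighted by the stress, the curvature and the remainder
  -- together, in units of s².
  set X := 57 * C₁ + Km + 1 with hX
  have hXp : 0 < X := by positivity
  have hC₁X : C₁ ≤ X := by rw [hX]; linarith
  obtain ⟨C₂, hC₂, s2, hs2, hexp⟩ := h.linkSq_expand hp hR1 hC hXp one_pos hE
  refine ⟨min (min s1 s2) (min 1 (min (ρ / X) (1 / (2 * X)))), by positivity,
    fun s hs hs0 B F hF k₀ δ hδ => ?_⟩
  simp only [le_min_iff] at hs0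
  obtain ⟨⟨hss1, hss2⟩, hs3, hs4, hs5⟩ := hs0
  rw [le_div_iff₀ (by positivity)] at hs4 hs5
  have hss : s ^ 2 ≤ s := by rw [sq]; exact mul_le_of_le_one_left hs.le hs3
  have hXs : X * s ^ 2 ≤ X * s := mul_le_mul_of_nonneg_left hss hXp.le
  have hs20 : 0 ≤ s ^ 2 := sq_nonneg s
  have hC₁s : C₁ * s ^ 2 ≤ X * s ^ 2 := mul_le_mul_of_nonneg_right hC₁X hs20
  have hside9 : side (Fin.last 9) = 3 := by rw [side_eq]; rfl
  have hsq9 : sideSq (Fin.last 9) = 9 := by rw [sideSq, hside9]; norm_num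
  by_cases hk : k₀ = Fin.last 9
  · subst hk
    obtain ⟨y, -, hy⟩ := hfam s hs hss1 B (fun _ => F) (fun _ k => sideSq k.castSucc + δ k.castSucc)
      continuous_const (fun _ => hF) continuous_const (fun r => by
        refine (pi_norm_le_iff_of_nonneg hρ.le).mpr fun k => ?_
        simp only [Pi.sub_apply, flatNine, add_sub_cancel_left, Real.norm_eq_abs]
        exact (hδ _ (Fin.castSucc_lt_last k).ne).trans (by linarith))
    obtain ⟨h0, h1, h2, h3, h4⟩ := hy 0
    refine ⟨y 0, h0, h1, fun k hkl => ?_, by rw [hside9]; exact h3, h4⟩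
    obtain ⟨j, rfl⟩ := Fin.exists_castSucc_eq.mpr hkl
    exact h2 j
  · obtain ⟨j, rfl⟩ := Fin.exists_castSucc_eq.mpr hk
    -- A clamped parameter: the family is defined on the whole line, while the length of link `j`
    -- varies only within the range where the estimates hold.
    set x : ℝ → ℝ := fun r => max (-1) (min 1 r) with hx
    have hxc : Continuous x := by fun_prop
    have hxb : ∀ r, |x r| ≤ 1 := fun r => abs_le.mpr ⟨le_max_left _ _,
      max_le (by norm_num) (min_le_left _ _)⟩
    set ξ : ℝ → Fin 9 → ℝ := fun r k => if k = j then x r * (X * s ^ 2) else δ k.castSucc with hξ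
    have hξb : ∀ r k, |ξ r k| ≤ X * s ^ 2 := fun r k => by
      simp only [hξ]
      split_ifs with hkj
      · rw [abs_mul, abs_of_nonneg (show 0 ≤ X * s ^ 2 by positivity)]
        exact mul_le_of_le_one_left (by positivity) (hxb r)
      · exact (hδ _ fun e => hkj (Fin.castSucc_injective 9 e)).trans hC₁s
    obtain ⟨y, hyc, hy⟩ := hfam s hs hss1 B (fun _ => F) (fun r k => sideSq k.castSucc + ξ r k)
      continuous_const (fun _ => hF) (continuous_pi fun k => by
        by_cases hkj : k = j
        · simp only [hξ, if_pos hkj]; fun_prop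
        · simp only [hξ, if_neg hkj]; fun_prop) (fun r => by
        refine (pi_norm_le_iff_of_nonneg hρ.le).mpr fun k => ?_
        simp only [Pi.sub_apply, flatNine, add_sub_cancel_left, Real.norm_eq_abs]
        exact (hξb r k).trans (by linarith))
    set u : Space := fun i => F i 0 with hu
    have hu1 : formOf (g p) u u = 1 := formOf_col hF 0
    set δ' : Fin 9 → ℝ := fun k => if k = j then 0 else δ k.castSucc with hδ'
    set φ : ℝ → ℝ := fun r => stress (Fin.last 9) *
      (B.linkSq g (y r) (Fin.last 9) - 9 - δ (Fin.last 9)) with hφ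
    have hφc : Continuous φ := by
      have := (B.continuousOn_linkSq h (Fin.last 9)).comp_continuous hyc fun r => (hy r).2.1
      fun_prop
    -- By the linear relation, the stress-weighted mismatch of the last link is minus that of link
    -- `j` up to `X * s ^ 2`.
    have key : ∀ r, |φ r + stress j.castSucc * (x r * (X * s ^ 2))| ≤ X * s ^ 2 := by
      intro r
      obtain ⟨h0, h1, h2, h3, c, hc, h4⟩ := hy r
      have e1 := (hexp s hs hss2 B (y r) h0 h1 (Fin.last 9) (fun k hkl => by
        obtain ⟨i, rfl⟩ := Fin.exists_castSucc_eq.mpr hkl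
        rw [h2, add_sub_cancel_left]; exact hξb r i) (by rw [hside9]; exact h3.trans (by norm_num))).2 u c hc hu1 h4
      have e2 := hKb u hu1
      set Kd := dirCurv (ricciOf (connDeriv Γ p)) (E.transpose * ricciOf (connDeriv Γ p) * E).trace u
      have e3 : |s ^ 2 * Kd| ≤ s ^ 2 * Km := by
        rw [abs_mul, abs_of_nonneg hs20]
        exact mul_le_mul_of_nonneg_left e2 hs20
      have e4 : |∑ k, stress k * (Fin.snoc (α := fun _ => ℝ) δ' (δ (Fin.last 9)) k)|
          ≤ 57 * (C₁ * s ^ 2) := by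
        refine abs_sum_stress_le fun k => ?_
        refine Fin.lastCases ?_ (fun i => ?_) k
        · rw [Fin.snoc_last]; exact hδ _ (Fin.castSucc_lt_last j).ne'
        · rw [Fin.snoc_castSucc]
          simp only [hδ']
          split_ifs with hij
          · rw [abs_zero]; positivity
          · exact hδ _ fun e => hij (Fin.castSucc_injective 9 e)
      have e5 : φ r + stress j.castSucc * (x r * (X * s ^ 2))
          = (∑ k, stress k * (B.linkSq g (y r) k - sideSq k) - s ^ 2 * Kd) + s ^ 2 * Kd
            - ∑ k, stress k * (Fin.snoc (α := fun _ => ℝ) δ' (δ (Fin.last 9)) k) := by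
        rw [sub_add_cancel, Fin.sum_univ_castSucc, Fin.sum_univ_castSucc
          (fun k => stress k * (Fin.snoc (α := fun _ => ℝ) δ' (δ (Fin.last 9)) k))]
        simp only [Fin.snoc_last, Fin.snoc_castSucc, h2, add_sub_cancel_left, hφ, hsq9]
        have e6 : ∑ k : Fin 9, stress k.castSucc * ξ r k
            = stress j.castSucc * (x r * (X * s ^ 2)) + ∑ k : Fin 9, stress k.castSucc * δ' k := by
          have : ∀ k : Fin 9, stress k.castSucc * ξ r k
              = (if k = j then stress j.castSucc * (x r * (X * s ^ 2)) else 0)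
                + stress k.castSucc * δ' k := fun k => by
            simp only [hξ, hδ']
            split_ifs with hkj
            · rw [hkj]; ring
            · ring
          rw [Finset.sum_congr rfl fun k _ => this k, Finset.sum_add_distrib,
            Finset.sum_ite_eq' Finset.univ j, if_pos (Finset.mem_univ j)]
        rw [e6]
        ring
      rw [e5]
      refine (abs_sub _ _).trans ?_
      have e7 := (abs_add_le _ _).trans (add_le_add e1 e3)
      have e8 : X * s ^ 2 = 57 * (C₁ * s ^ 2) + s ^ 2 * Km + 1 * s ^ 2 := by rw [hX]; ring
      linarith
    have hx1 : x 1 = 1 := by simp [hx]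
    have hx2 : x (-1) = -1 := by simp [hx]
    have k1 := abs_le.mp (key 1)
    have k2 := abs_le.mp (key (-1))
    rw [hx1] at k1
    rw [hx2] at k2
    have hXs0 : 0 ≤ X * s ^ 2 := by positivity
    -- The stress of link `j` has absolute value at least 4, which beats the error `X * s ^ 2`. So
    -- the mismatch has opposite signs at the two extreme parameters and vanishes in between.
    obtain ⟨r, hr⟩ : ∃ r, φ r = 0 := by
      rcases le_abs.mp (abs_stress_le j.castSucc) with hp | hn
      · have := mul_le_mul_of_nonneg_right hp hXs0
        exact mem_range_of_exists_le_of_exists_ge hφc ⟨1, by linarith⟩ ⟨-1, by linarith⟩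
      · have := mul_le_mul_of_nonneg_right hn hXs0
        exact mem_range_of_exists_le_of_exists_ge hφc ⟨-1, by linarith⟩ ⟨1, by linarith⟩
    obtain ⟨h0, h1, h2, h3, h4⟩ := hy r
    refine ⟨y r, h0, h1, fun k hkj => ?_, ?_, h4⟩
    · revert hkj
      refine Fin.lastCases (fun _ => ?_) (fun i hij => ?_) k
      · rcases mul_eq_zero.mp hr with h5 | h5
        · exact absurd h5 (stress_ne _)
        · rw [hsq9]; linarith
      · rw [h2]
        have : i ≠ j := fun e => hij (by rw [e])
        simp only [hξ, if_neg this]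
    · have e : B.linkSq g (y r) j.castSucc - side j.castSucc ^ 2 = ξ r j := by
        rw [h2]; simp [sideSq]
      have hb := hξb r j
      have := abs_sqrt_sub_le (q := B.linkSq g (y r) j.castSucc) (two_le_side j.castSucc)
        (by rw [e]; linarith)
      rw [e] at this
      linarith

end

/-! ### Charts: signals and directions in terms of optical distances. -/

noncomputable section

theorem BVP.sqDist_pos {D : Set Space} {g : Space → Matrix (Fin 3) (Fin 3) ℝ} {Γ : Space → Bil}
    {p : Space} {R C s : ℝ} (h : IsLocalGeom D g Γ) (B : BVP D Γ p R C s) (hs : 0 < s) {a b : Space}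
    (ha : a ∈ Metric.closedBall (0 : Space) R) (hb : b ∈ Metric.closedBall (0 : Space) R)
    (hab : a ≠ b) : 0 < B.sqDist g a b := by
  have h1 := (B.isGeod ha hb).form_ne_zero h (by
    simp only [B.Y_zero a ha b hb, B.Y_one a ha b hb]
    intro e
    exact hab (smul_right_injective Space hs.ne' (add_left_cancel e)))
  simp only [B.Y_zero a ha b hb, B.W_zero a ha b hb, map_smul, smul_apply, smul_eq_mul] at h1
  have h2 : 0 < s * s * B.sqDist g a b := by rw [BVP.sqDist]; linarith
  exact pos_of_mul_pos_right h2 (by positivity)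

namespace StaticSpacetime

variable {S : StaticSpacetime} {U : Set Space} {p : Space} {R C s : ℝ}

theorem isLocalGeom_conn (S : StaticSpacetime) : IsLocalGeom S.domain S.opticalMetric S.conn :=
  S.optical_isLocalGeom

/-- Coordinates near `p`, at the scale `s`, that cover the events reached by short signals. -/
structure Chart (S : StaticSpacetime) (U : Set Space) (p : Space) (R C s : ℝ) where
  /-- The geodesics. -/
  bvp : BVP S.domain S.conn p R C s
  pos : 0 < s
  mem : ∀ a ∈ Metric.closedBall (0 : Space) R, p + s • a ∈ U
  reach : ∀ x T, T ≤ 8 * s → S.Signal (event 0 p) (event T x) →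
    ∃ y ∈ Metric.closedBall (0 : Space) R, x = p + s • y
  self_le : ∀ a ∈ Metric.closedBall (0 : Space) R, bvp.sqDist S.opticalMetric a a ≤ 1

/-- The geodesic from a point to itself that the boundary value problem selects need not be known to
be constant; the second-order expansion still bounds its length. Signals of duration up to 8 units
suffice because all echo counts considered are at most 7N. -/
theorem exists_chart (S : StaticSpacetime) (hU : IsOpen U) (hUD : U ⊆ S.domain) (hp : p ∈ U)
    (R₀ : ℝ) : ∃ R ≥ R₀, ∃ C > 0, ∃ s₁ > 0, ∀ s, 0 < s → s ≤ s₁ →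
      Nonempty (S.Chart U p R C s) := by
  obtain ⟨K, hK, ε, hε, hnear⟩ := S.exists_near_of_time (hUD hp)
  have hR : 1 ≤ max R₀ (max 1 (8 * K)) := (le_max_left _ _).trans (le_max_right _ _)
  obtain ⟨C, hC, s0, hs0, hbvp⟩ := S.isLocalGeom_conn.exists_bvp (hUD hp) hR
  obtain ⟨ρ, hρ, hsub⟩ := Metric.nhds_basis_closedBall.mem_iff.mp (hU.mem_nhds hp)
  set R := max R₀ (max 1 (8 * K)) with hRd
  have hR0 : 0 < R := by linarith
  obtain ⟨s2, hs2, hself⟩ := S.isLocalGeom_conn.sqDist_expand (hUD hp) hR hC one_pos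
  refine ⟨R, le_max_left _ _, C, hC, min (min s0 (min 1 s2)) (min (ρ / R) (ε / 9)), by positivity,
    fun s hs hs1 => ?_⟩
  simp only [le_min_iff] at hs1
  obtain ⟨⟨h1, h1', h1''⟩, h2, h3⟩ := hs1
  rw [le_div_iff₀ hR0] at h2
  obtain ⟨B⟩ := hbvp s hs h1
  refine ⟨⟨B, hs, fun a ha => hsub ?_, fun x T hT hsig => ⟨s⁻¹ • (x - p), ?_, ?_⟩,
    fun a ha => ?_⟩⟩
  · rw [mem_closedBall_zero_iff] at ha
    rw [mem_closedBall_iff_norm, add_sub_cancel_left, norm_smul, Real.norm_of_nonneg hs.le]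
    exact (mul_le_mul_of_nonneg_left ha hs.le).trans h2
  · rw [mem_closedBall_zero_iff, norm_smul, norm_inv, Real.norm_of_nonneg hs.le,
      inv_mul_le_iff₀ hs]
    have h4 := hnear x T (by linarith) hsig
    have h5 : K * T ≤ K * (8 * s) := by gcongr
    have h6 : s * (8 * K) ≤ s * R := by
      gcongr; exact (le_max_right _ _).trans (le_max_right _ _)
    linarith
  · rw [smul_inv_smul₀ hs.ne', add_sub_cancel]
  · have := hself s hs h1'' B a ha a ha
    simp only [sub_self, map_zero, corr, mul_zero, sub_zero, add_zero] at this
    have h4 := (abs_le.mp this).2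
    have h5 : s ^ 2 ≤ 1 := pow_le_one₀ hs.le h1'
    linarith

/-- Squared optical distances along the links, in units of the scale. -/
def Chart.sq (ch : S.Chart U p R C s) (y : Label → Space) (k : Fin 10) : ℝ :=
  ch.bvp.linkSq S.opticalMetric y k

section

variable (hUD : U ⊆ S.domain) (hl : ∀ x ∈ U, ∀ y ∈ U, x ≠ y → S.RadarLinkable x y)
include hl

/-- The optical geodesic lifts to one signal of duration `ℓ`, and linkability leaves room for only
one delay. -/
theorem signal_iff_of_isGeod {x v : ℝ → Space} (hx : IsGeod S.domain S.conn x v)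
    (h0 : x 0 ∈ U) (h1 : x 1 ∈ U) (hne : x 0 ≠ x 1) {ℓ : ℝ}
    (hℓ : 0 < ℓ) (hv : formOf (S.opticalMetric (x 0)) (v 0) (v 0) = ℓ ^ 2) (t t' : ℝ) :
    S.Signal (event t (x 0)) (event t' (x 1)) ↔ t' = t + ℓ := by
  obtain ⟨T, hT, hsig⟩ := exists_delay (hl _ h0 _ h1 hne).1
  obtain ⟨γ, w, h2, h3, h4, -⟩ := S.exists_null_of_isGeod hx hℓ hv 0
  have := (hsig 0 (0 + ℓ)).mp ⟨γ, w, h2, h3, h4⟩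
  rw [hsig]
  constructor <;> intro h <;> linarith

theorem Chart.signal_iff (ch : S.Chart U p R C s) {a b : Space}
    (ha : a ∈ Metric.closedBall (0 : Space) R) (hb : b ∈ Metric.closedBall (0 : Space) R)
    (hab : a ≠ b) (t t' : ℝ) :
    (S.Signal (event t (p + s • a)) (event t' (p + s • b)) ↔
      t' = t + s * √(ch.bvp.sqDist S.opticalMetric a b)) ∧
    (S.Signal (event t (p + s • b)) (event t' (p + s • a)) ↔
      t' = t + s * √(ch.bvp.sqDist S.opticalMetric a b)) := by
  have hs := ch.pos
  have hpos := ch.bvp.sqDist_pos S.isLocalGeom_conn hs ha hb hab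
  have hgeo := ch.bvp.isGeod ha hb
  have hne : p + s • a ≠ p + s • b := fun e =>
    hab (smul_right_injective Space hs.ne' (add_left_cancel e))
  have hℓ : 0 < s * √(ch.bvp.sqDist S.opticalMetric a b) := mul_pos hs (Real.sqrt_pos.mpr hpos)
  have hv : formOf (S.opticalMetric (p + s • a)) (s • ch.bvp.V a b) (s • ch.bvp.V a b)
      = (s * √(ch.bvp.sqDist S.opticalMetric a b)) ^ 2 := by
    rw [mul_pow, Real.sq_sqrt hpos.le, BVP.sqDist]
    simp only [map_smul, smul_apply, smul_eq_mul]
    ring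
  have e0 := ch.bvp.Y_zero a ha b hb
  have e1 := ch.bvp.Y_one a ha b hb
  have e2 := ch.bvp.W_zero a ha b hb
  constructor
  · have := signal_iff_of_isGeod hl hgeo (by simp only [e0]; exact ch.mem a ha)
      (by simp only [e1]; exact ch.mem b hb) (by simp only [e0, e1]; exact hne) hℓ
      (by simp only [e0, e2]; exact hv) t t'
    simpa only [e0, e1] using this
  -- The way back follows the reversed geodesic, which has the same length because speed is
  -- conserved.
  · have hend : formOf (S.opticalMetric (p + s • ch.bvp.Y a b 1)) (s • ch.bvp.W a b 1)
        (s • ch.bvp.W a b 1) = (s * √(ch.bvp.sqDist S.opticalMetric a b)) ^ 2 := by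
      rw [hgeo.form_eq S.isLocalGeom_conn (Set.right_mem_Icc.mpr zero_le_one)]
      simp only [e0, e2]; exact hv
    have := signal_iff_of_isGeod hl hgeo.reverse (by simp only [sub_zero, e1]; exact ch.mem b hb)
      (by simp only [sub_self, e0]; exact ch.mem a ha)
      (by simp only [sub_zero, sub_self, e0, e1]; exact hne.symm) hℓ
      (by simp only [sub_zero, map_neg, neg_apply, neg_neg]; exact hend) t t'
    simpa only [sub_zero, sub_self, e0, e1] using this

/-- The lift of the selected geodesic leaves along its initial velocity, and by `direction_unique`
no signal leaves otherwise. -/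
theorem Chart.aimedAt_iff (ch : S.Chart U p R C s) {a b : Space}
    (ha : a ∈ Metric.closedBall (0 : Space) R) (hb : b ∈ Metric.closedBall (0 : Space) R)
    (hab : a ≠ b) (u : Space) :
    S.AimedAt (p + s • a) (p + s • b) u ↔ ∃ c : ℝ, 0 < c ∧ ch.bvp.V a b = c • u := by
  have hs := ch.pos
  have hpos := ch.bvp.sqDist_pos S.isLocalGeom_conn hs ha hb hab
  have hgeo := ch.bvp.isGeod ha hb
  have hne : p + s • a ≠ p + s • b := fun e =>
    hab (smul_right_injective Space hs.ne' (add_left_cancel e))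
  have hℓ : 0 < s * √(ch.bvp.sqDist S.opticalMetric a b) := mul_pos hs (Real.sqrt_pos.mpr hpos)
  have e0 := ch.bvp.Y_zero a ha b hb
  have e1 := ch.bvp.Y_one a ha b hb
  have e2 := ch.bvp.W_zero a ha b hb
  obtain ⟨γ, w, h2, h3, h4, c, hc, h5⟩ := S.exists_null_of_isGeod hgeo hℓ (by
    simp only [e0, e2]
    rw [mul_pow, Real.sq_sqrt hpos.le, BVP.sqDist]
    simp only [map_smul, smul_apply, smul_eq_mul]
    ring) 0
  simp only [e0, e1, e2] at h3 h4 h5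
  constructor
  · rintro ⟨γ', w', k1, k2, k3, c', hc', k4⟩
    have := direction_unique (hl _ (ch.mem a ha) _ (ch.mem b hb) hne).1 h2 k1
      (by rw [h3, place_event]) k2 (by rw [h4, place_event]) k3
    rw [← this, h5, smul_smul] at k4
    have hcs : 0 < c * s := by positivity
    refine ⟨(c * s)⁻¹ * c', by positivity, ?_⟩
    rw [mul_smul, ← k4, inv_smul_smul₀ hcs.ne']
  · rintro ⟨c', hc', k⟩
    refine ⟨γ, w, h2, by rw [h3, place_event], by rw [h4, place_event], c * (s * c'), by positivity, ?_⟩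
    rw [h5, k, smul_smul, smul_smul, mul_assoc]

/-- Echo times between two machines do not depend on the direction. -/
theorem exists_echoTime {A B : Machine} (hA : A.pos ∈ U) (hB : B.pos ∈ U) (hAB : A.pos ≠ B.pos) :
    ∃ T > 0, ∃ T' > 0,
      (∀ t t', S.Signal (event t A.pos) (event t' B.pos) ↔ t' = t + T) ∧
      (∀ t t', S.Signal (event t B.pos) (event t' A.pos) ↔ t' = t + T') ∧
      (∀ (m : ℤ) (Δ : ℝ), S.EchoCount A B m Δ ↔ A.period * Δ = T + T') ∧
      ∀ (m : ℤ) (Δ : ℝ), S.EchoCount B A m Δ ↔ B.period * Δ = T + T' := by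
  obtain ⟨T, hT, h1⟩ := exists_delay (hl _ hA _ hB hAB).1
  obtain ⟨T', hT', h2⟩ := exists_delay (hl _ hA _ hB hAB).2
  have key : ∀ (A B : Machine) (T T' : ℝ),
      (∀ t t', S.Signal (event t A.pos) (event t' B.pos) ↔ t' = t + T) →
      (∀ t t', S.Signal (event t B.pos) (event t' A.pos) ↔ t' = t + T') →
      ∀ (m : ℤ) (Δ : ℝ), S.EchoCount A B m Δ ↔ A.period * Δ = T + T' := by
    intro A B T T' h1 h2 m Δ
    simp only [EchoCount, Machine.worldline, h1, h2]
    have hp := B.period_pos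
    constructor
    · rintro ⟨ζ, e1, e2⟩
      linarith
    · intro e
      refine ⟨(A.start + A.period * m + T - B.start) / B.period, ?_, ?_⟩
      · field_simp; ring
      · have : B.period * ((A.start + A.period * m + T - B.start) / B.period)
            = A.start + A.period * m + T - B.start := by field_simp
        linarith
  refine ⟨T, hT, T', hT', h1, h2, key A B T T' h1 h2, fun m Δ => ?_⟩
  rw [key B A T' T h2 h1, add_comm]

end

end StaticSpacetime

end

/-! ### Clocks: periods, echo counts and channels of configurations. -/

noncomputable section

theorem hop_comm (i j : Label) : hop i j = hop j i := by
  cases i <;> cases j <;> rfl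

theorem one_le_hop (i j : Label) : 1 ≤ hop i j := by
  cases i <;> cases j <;> simp [hop]

theorem hop_le_three (i j : Label) : hop i j ≤ 3 := by
  cases i <;> cases j <;> simp [hop]

/-- `k` is the index of the link between `i` and `j`. -/
def Joins (k : Fin 10) (i j : Label) : Prop := (fstL k = i ∧ sndL k = j) ∨ (fstL k = j ∧ sndL k = i)

theorem Joins.symm {k : Fin 10} {i j : Label} (h : Joins k i j) : Joins k j i := Or.symm h

theorem Joins.linkOf {k : Fin 10} {i j : Label} (h : Joins k i j) : linkOf k = s(i, j) := by
  rcases h with ⟨h1, h2⟩ | ⟨h1, h2⟩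
  · rw [OpenMachines.linkOf, h1, h2]
  · rw [OpenMachines.linkOf, h1, h2, Sym2.eq_swap]

theorem Joins.side {k : Fin 10} {i j : Label} (h : Joins k i j) : side k = hop i j := by
  rcases h with ⟨h1, h2⟩ | ⟨h1, h2⟩
  · rw [OpenMachines.side, h1, h2]
  · rw [OpenMachines.side, h1, h2, hop_comm]

theorem Joins.ne {k : Fin 10} {i j : Label} (h : Joins k i j) : i ≠ j := by
  have := fstL_ne_sndL k
  rcases h with ⟨h1, h2⟩ | ⟨h1, h2⟩
  · rwa [h1, h2] at this
  · rw [h1, h2] at this; exact this.symm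

theorem joins_fst_snd (k : Fin 10) : Joins k (fstL k) (sndL k) := Or.inl ⟨rfl, rfl⟩

theorem exists_joins {i j : Label} (h : i ≠ j) : ∃ k, Joins k i j := exists_linkOf i j h

theorem joins_of_linkOf {k : Fin 10} {i j : Label} (h : s(i, j) = linkOf k) : Joins k i j := by
  rw [linkOf, Sym2.eq_iff] at h
  rcases h with ⟨h1, h2⟩ | ⟨h1, h2⟩
  · exact Or.inl ⟨h1.symm, h2.symm⟩
  · exact Or.inr ⟨h2.symm, h1.symm⟩

theorem exists_third (i j : Label) : ∃ l, l ≠ i ∧ l ≠ j := by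
  revert i j; decide

namespace StaticSpacetime

variable {S : StaticSpacetime} {U : Set Space} {p : Space} {R C s : ℝ}

theorem IsArrangement.period_B {τ : ℝ} {M : Label → Machine} (hM : S.IsArrangement U p τ M)
    (hp : p ∈ S.domain) : (M (.B 0)).period = τ / S.lapse p := by
  have h1 := hM.proper_B
  rw [properPeriod, hM.pos_B] at h1
  rw [eq_div_iff (S.lapse_pos p hp).ne', mul_comm]
  exact h1

/-- For coinciding places the squared length would be at most 1, by `self_le`. -/
theorem Chart.ne_of_sq (ch : S.Chart U p R C s) {y : Label → Space}
    (hy : ∀ i, y i ∈ Metric.closedBall (0 : Space) R) (hq : ∀ k, 1 < ch.sq y k) {i j : Label}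
    (hij : i ≠ j) : y i ≠ y j := by
  intro e
  obtain ⟨k, hk⟩ := exists_joins hij
  have h1 := hq k
  have h2 : ch.sq y k = ch.bvp.sqDist S.opticalMetric (y i) (y i) := by
    rcases hk with ⟨h1, h2⟩ | ⟨h1, h2⟩ <;> rw [Chart.sq, BVP.linkSq, h1, h2, ← e]
  linarith [ch.self_le (y i) (hy i)]

theorem Chart.exists_positions (ch : S.Chart U p R C s) {τ : ℝ} {M : Label → Machine}
    (hM : S.IsArrangement U p τ M)
    (h : ∀ i, i ≠ .B 0 → ∃ T ≤ 8 * s, S.Signal (event 0 p) (event T (M i).pos)) :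
    ∃ y : Label → Space, y (.B 0) = 0 ∧ (∀ i, y i ∈ Metric.closedBall (0 : Space) R) ∧
      (∀ i, (M i).pos = p + s • y i) ∧ ∀ i j, i ≠ j → y i ≠ y j := by
  have hs := ch.pos
  have hR : 0 ≤ R := by
    obtain ⟨T, hT, hsig⟩ := h (.B 1) (by decide)
    obtain ⟨y, hy, -⟩ := ch.reach _ T hT hsig
    exact Metric.nonempty_closedBall.mp ⟨y, hy⟩
  have key : ∀ i, ∃ y ∈ Metric.closedBall (0 : Space) R, (M i).pos = p + s • y ∧
      (i = .B 0 → y = 0) := by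
    intro i
    by_cases hi : i = .B 0
    · exact ⟨0, by simpa using hR, by rw [hi, hM.pos_B, smul_zero, add_zero], fun _ => rfl⟩
    · obtain ⟨T, hT, hsig⟩ := h i hi
      obtain ⟨y, hy, he⟩ := ch.reach _ T hT hsig
      exact ⟨y, hy, he, fun e => absurd e hi⟩
  choose y hy hpos h0 using key
  refine ⟨y, h0 _ rfl, hy, hpos, fun i j hij e => hM.distinct i j hij ?_⟩
  rw [hpos, hpos, e]

section

variable (hl : ∀ x ∈ U, ∀ y ∈ U, x ≠ y → S.RadarLinkable x y)
include hl

theorem Chart.signal_link (ch : S.Chart U p R C s) {y : Label → Space}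
    (hy : ∀ i, y i ∈ Metric.closedBall (0 : Space) R) (hne : ∀ i j, i ≠ j → y i ≠ y j)
    {k : Fin 10} {i j : Label} (hk : Joins k i j) (t t' : ℝ) :
    S.Signal (event t (p + s • y i)) (event t' (p + s • y j)) ↔ t' = t + s * √(ch.sq y k) := by
  rcases hk with ⟨rfl, rfl⟩ | ⟨rfl, rfl⟩
  · exact (ch.signal_iff hl (hy _) (hy _) (hne _ _ (fstL_ne_sndL k)) t t').1
  · exact (ch.signal_iff hl (hy _) (hy _) (hne _ _ (fstL_ne_sndL k)) t t').2

theorem Chart.echoCount_iff (ch : S.Chart U p R C s) {y : Label → Space}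
    (hy : ∀ i, y i ∈ Metric.closedBall (0 : Space) R) (hne : ∀ i j, i ≠ j → y i ≠ y j)
    {k : Fin 10} {i j : Label} (hk : Joins k i j) {M : Label → Machine}
    (hM : ∀ i, (M i).pos = p + s • y i) (m : ℤ) (Δ : ℝ) :
    S.EchoCount (M i) (M j) m Δ ↔ (M i).period * Δ = 2 * (s * √(ch.sq y k)) := by
  have hU : ∀ i, (M i).pos ∈ U := fun i => by rw [hM]; exact ch.mem _ (hy i)
  have hs := ch.pos
  obtain ⟨T, -, T', -, h1, h2, h3, -⟩ := exists_echoTime hl (hU i) (hU j) (by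
    rw [hM, hM]
    exact fun e => hne i j hk.ne (smul_right_injective Space hs.ne' (add_left_cancel e)))
  have e1 := (h1 0 (0 + T)).mpr rfl
  have e2 := (h2 0 (0 + T')).mpr rfl
  rw [hM, hM] at e1 e2
  have e3 := (ch.signal_link hl hy hne hk _ _).mp e1
  have e4 := (ch.signal_link hl hy hne hk.symm _ _).mp e2
  rw [h3]
  constructor <;> intro h <;> linarith

/-- The two echoes on a link take the same total time, so equal counts in both directions mean equal
periods. -/
theorem periods_eq {τ : ℝ} {M : Label → Machine} (hM : S.IsArrangement U p τ M) {N : ℕ}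
    (hN : 1 ≤ N) (k₀ : Fin 10)
    (h : ∀ i j, i ≠ j → s(i, j) ≠ linkOf k₀ → ∃ m : ℤ, S.EchoCount (M i) (M j) m (2 * hop i j * N))
    (i j : Label) : (M i).period = (M j).period := by
  have direct : ∀ i j, i ≠ j → s(i, j) ≠ linkOf k₀ → (M i).period = (M j).period := by
    intro i j hij hk
    obtain ⟨T, -, T', -, -, -, h3, h4⟩ := exists_echoTime hl (hM.mem i) (hM.mem j)
      (hM.distinct i j hij)
    obtain ⟨m, hm⟩ := h i j hij hk
    obtain ⟨m', hm'⟩ := h j i hij.symm (by rwa [Sym2.eq_swap])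
    rw [h3] at hm
    rw [h4, hop_comm] at hm'
    have hpos : (0 : ℝ) < 2 * hop i j * N := by
      have := one_le_hop i j
      positivity
    exact mul_right_cancel₀ hpos.ne' (hm.trans hm'.symm)
  by_cases hij : i = j
  · rw [hij]
  by_cases hk : s(i, j) = linkOf k₀
  -- On the exceptional link the comparison goes through a third machine.
  · obtain ⟨l, hli, hlj⟩ := exists_third i j
    rw [direct i l hli.symm, direct l j hlj]
    · rw [← hk, Ne, Sym2.eq_iff]
      rintro (⟨e, -⟩ | ⟨e, -⟩)
      exacts [hli e, hlj e]
    · rw [← hk, Ne, Sym2.eq_iff]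
      rintro (⟨-, e⟩ | ⟨-, e⟩)
      exacts [hlj e, hli e]
  · exact direct i j hij hk

/-- Echo counts close to the flat ones determine a radar configuration. -/
theorem Chart.exists_config_of_echo (ch : S.Chart U p R C s) (hp : p ∈ S.domain) {N : ℕ} (hN : 1 ≤ N)
    {τ : ℝ} (hs : s = N * (τ / S.lapse p)) {M : Label → Machine}
    (hM : S.IsArrangement U p τ M) (k₀ : Fin 10)
    (h : ∀ i j, i ≠ j → s(i, j) ≠ linkOf k₀ → ∃ m : ℤ, S.EchoCount (M i) (M j) m (2 * hop i j * N))
    {i₀ j₀ : Label} (hij : s(i₀, j₀) = linkOf k₀) {m₀ : ℤ} {Δ : ℝ}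
    (hΔ : S.EchoCount (M i₀) (M j₀) m₀ Δ) (hΔN : |Δ - 2 * hop i₀ j₀ * N| < N) :
    ∃ y : Label → Space, y (.B 0) = 0 ∧ (∀ i, y i ∈ Metric.closedBall (0 : Space) R) ∧
      (∀ i, (M i).pos = p + s • y i) ∧ (∀ i j, i ≠ j → y i ≠ y j) ∧
      (∀ k ≠ k₀, √(ch.sq y k) = side k) ∧ √(ch.sq y k₀) = Δ / (2 * N) := by
  have hs0 := ch.pos
  have hN0 : (0 : ℝ) < N := by positivity
  have hper : ∀ i, (M i).period = τ / S.lapse p := fun i => by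
    rw [periods_eq hl hM hN k₀ h i (.B 0), hM.period_B hp]
  have hper0 : 0 < τ / S.lapse p := by rw [← hper (.B 0)]; exact (M (.B 0)).period_pos
  -- Flat echo counts are at most 6N and the exceptional one differs from its flat value by less
  -- than N.
  have bound : ∀ i j, i ≠ j → ∃ (m : ℤ) (Δ' : ℝ), S.EchoCount (M i) (M j) m Δ' ∧ Δ' ≤ 7 * N := by
    have hop3 : ∀ i j, (hop i j : ℝ) * N ≤ 3 * N := fun i j => by
      gcongr; exact_mod_cast hop_le_three i j
    intro i j hne
    by_cases hk : s(i, j) = linkOf k₀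
    · have hΔ7 : Δ ≤ 7 * N := by
        have := (abs_lt.mp hΔN).2
        have := hop3 i₀ j₀
        linarith
      rw [← hij, Sym2.eq_iff] at hk
      rcases hk with ⟨rfl, rfl⟩ | ⟨rfl, rfl⟩
      · exact ⟨m₀, Δ, hΔ, hΔ7⟩
      · obtain ⟨T, -, T', -, -, -, h3, h4⟩ := exists_echoTime hl (hM.mem j) (hM.mem i)
          (hM.distinct j i hne.symm)
        refine ⟨0, Δ, ?_, hΔ7⟩
        rw [h4, hper i]
        rw [h3, hper j] at hΔ
        exact hΔ
    · obtain ⟨m, hm⟩ := h i j hne hk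
      refine ⟨m, _, hm, ?_⟩
      have := hop3 i j
      linarith
  obtain ⟨y, hy0, hy, hpos, hne⟩ := ch.exists_positions hM (fun i hi => by
    obtain ⟨T, hT, T', hT', h1, -, h3, -⟩ := exists_echoTime hl (hM.mem (.B 0)) (hM.mem i)
      (hM.distinct _ _ hi.symm)
    obtain ⟨m, Δ', hm, hΔ'⟩ := bound (.B 0) i hi.symm
    rw [h3, hper] at hm
    refine ⟨T, ?_, ?_⟩
    · have : τ / S.lapse p * Δ' ≤ τ / S.lapse p * (7 * N) := by gcongr
      have e : 7 * s = τ / S.lapse p * (7 * N) := by rw [hs]; ring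
      linarith
    · have := (h1 0 (0 + T)).mpr rfl
      rwa [hM.pos_B, zero_add] at this)
  refine ⟨y, hy0, hy, hpos, hne, fun k hk => ?_, ?_⟩
  · obtain ⟨m, hm⟩ := h (fstL k) (sndL k) (fstL_ne_sndL k) (fun e => hk (linkOf_injective e))
    rw [ch.echoCount_iff hl hy hne (joins_fst_snd k) hpos, hper] at hm
    have : s * √(ch.sq y k) = s * side k := by
      rw [side]; linear_combination (-1 / 2) * hm - hop (fstL k) (sndL k) * hs
    exact mul_left_cancel₀ hs0.ne' this
  · rw [ch.echoCount_iff hl hy hne (joins_of_linkOf hij) hpos, hper] at hΔ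
    rw [eq_div_iff (by positivity)]
    have : (τ / S.lapse p) * (√(ch.sq y k₀) * (2 * N)) = (τ / S.lapse p) * Δ := by
      linear_combination -hΔ - 2 * √(ch.sq y k₀) * hs
    exact mul_left_cancel₀ (by positivity) this

end

/-- Five synchronized machines with equal periods. -/
def synced (x : Label → Space) (θ : ℝ) (hθ : 0 < θ) : Label → Machine := fun i => ⟨x i, 0, θ, hθ⟩

theorem Chart.isArrangement (ch : S.Chart U p R C s) (hp : p ∈ S.domain) {τ : ℝ}
    (hθ : 0 < τ / S.lapse p) {y : Label → Space} (hy0 : y (.B 0) = 0)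
    (hy : ∀ i, y i ∈ Metric.closedBall (0 : Space) R) (hne : ∀ i j, i ≠ j → y i ≠ y j) :
    S.IsArrangement U p τ (synced (fun i => p + s • y i) (τ / S.lapse p) hθ) where
  mem i := ch.mem _ (hy i)
  distinct i j hij e := hne i j hij (smul_right_injective Space ch.pos.ne' (add_left_cancel e))
  pos_B := by simp [synced, hy0]
  proper_B := by
    simp only [synced, properPeriod, hy0, smul_zero, add_zero]
    exact mul_div_cancel₀ _ (S.lapse_pos p hp).ne'

theorem zero_mem_phases : (0 : ℝ) ∈ phases := by norm_num [phases]

/-- The channels of synchronized machines. -/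
theorem Chart.mem_channel_synced (hl : ∀ x ∈ U, ∀ y ∈ U, x ≠ y → S.RadarLinkable x y)
    (ch : S.Chart U p R C s) {N : ℕ} {θ : ℝ} (hθ : 0 < θ) (hs : s = N * θ)
    {y : Label → Space}
    (hy : ∀ i, y i ∈ Metric.closedBall (0 : Space) R) (hne : ∀ i j, i ≠ j → y i ≠ y j)
    {k : Fin 10} {i j : Label} (hk : Joins k i j) (n : ℕ) (φ : ℝ) :
    (((n : ℤ), (0 : ℝ)), ((n : ℤ) + (hop i j * N : ℕ), φ)) ∈
      S.channel (synced (fun i => p + s • y i) θ hθ i) (synced (fun i => p + s • y i) θ hθ j) ↔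
    φ ∈ phases ∧ φ = N * (√(ch.sq y k) - side k) := by
  simp only [channel, Set.mem_ofPred_eq, zero_mem_phases, true_and, Machine.worldline, synced]
  refine and_congr_right fun _ => ?_
  rw [ch.signal_link hl hy hne hk, hk.side]
  push_cast
  constructor
  · intro e
    have : θ * φ = θ * (N * (√(ch.sq y k) - hop i j)) := by
      linear_combination e + √(ch.sq y k) * hs
    exact mul_left_cancel₀ hθ.ne' this
  · rintro rfl
    linear_combination -√(ch.sq y k) * hs

/-- All clocks have the same period if the phases of their channels are bounded. -/
theorem period_eq_of_hasChannels (hl : ∀ x ∈ U, ∀ y ∈ U, x ≠ y → S.RadarLinkable x y)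
    (hp : p ∈ S.domain) {N : ℕ} {τ : ℝ} {M : Label → Machine} {φ : Label → Label → ℕ → ℝ}
    (hM : S.IsArrangement U p τ M) (hc : S.HasChannels N M φ) (i : Label) :
    (M i).period = τ / S.lapse p := by
  rw [← hM.period_B hp]
  by_cases hi : i = .B 0
  · rw [hi]
  obtain ⟨T, hT, h1⟩ := exists_delay (hl _ (hM.mem i) _ (hM.mem (.B 0)) (hM.distinct _ _ hi)).1
  -- A difference of periods would accumulate in proportion to the tick, whereas the phase stays
  -- bounded.
  have key : ∀ n : ℕ, |((M (.B 0)).period - (M i).period) * n|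
      ≤ |T + (M i).start - (M (.B 0)).start - (M (.B 0)).period * (hop i (.B 0) * N : ℕ)|
        + (M (.B 0)).period := by
    intro n
    obtain ⟨-, h2, h3⟩ := hc i (.B 0) hi n
    simp only [Machine.worldline, h1] at h3
    push_cast at h3
    have e : ((M (.B 0)).period - (M i).period) * n
        = (T + (M i).start - (M (.B 0)).start - (M (.B 0)).period * (hop i (.B 0) * N : ℕ))
          - (M (.B 0)).period * φ i (.B 0) n := by
      push_cast; linarith
    rw [e]
    refine (abs_sub _ _).trans ?_
    rw [abs_mul, abs_of_pos (M (.B 0)).period_pos]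
    have h4 : |φ i (.B 0) n| ≤ 1 := by
      rw [phases, Set.mem_Ioc] at h2
      rw [abs_le]; constructor <;> linarith [h2.1, h2.2]
    have := mul_le_mul_of_nonneg_left h4 (M (.B 0)).period_pos.le
    linarith
  by_contra hne
  have hpos : 0 < |(M (.B 0)).period - (M i).period| := abs_pos.mpr (sub_ne_zero.mpr (Ne.symm hne))
  obtain ⟨n, hn⟩ := exists_nat_gt ((|T + (M i).start - (M (.B 0)).start
    - (M (.B 0)).period * (hop i (.B 0) * N : ℕ)| + (M (.B 0)).period)
    / |(M (.B 0)).period - (M i).period|)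
  rw [div_lt_iff₀ hpos] at hn
  have := key n
  rw [abs_mul, Nat.abs_cast] at this
  linarith

end StaticSpacetime

end

/-! ### Echo counts and curvature. -/

noncomputable section

/-- In a frame, one term of the contraction is symmetric by torsion-freeness and the other by
skewness of the curvature with both skew slots filled by the same frame vector. -/
theorem IsLocalGeom.ricciOf_isSymm {D : Set Space} {g : Space → Matrix (Fin 3) (Fin 3) ℝ}
    {Γ : Space → Bil} (h : IsLocalGeom D g Γ) {x : Space} (hx : x ∈ D) :
    (ricciOf (connDeriv Γ x)).IsSymm := by
  obtain ⟨E, hE⟩ := exists_frame (h.posDef x hx)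
  have key : ∀ u v : Space, u ⬝ᵥ (ricciOf (connDeriv Γ x)).mulVec v
      = v ⬝ᵥ (ricciOf (connDeriv Γ x)).mulVec u := by
    intro u v
    rw [ricciOf_frame hE, ricciOf_frame hE]
    refine Finset.sum_congr rfl fun k _ => ?_
    have h1 := h.connDeriv_compat hx (fun i => E i k) (fun i => E i k) u v
    rw [h.connDeriv_symm hx _ u v]
    linarith
  ext i j
  have := key (Pi.single j 1) (Pi.single i 1)
  simpa using this

theorem formOf_single (A : Matrix (Fin 3) (Fin 3) ℝ) (i j : Fin 3) :
    formOf A (Pi.single i 1) (Pi.single j 1) = A i j := by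
  simp [formOf_apply]

theorem formOf_add_matrix (A B : Matrix (Fin 3) (Fin 3) ℝ) (u v : Space) :
    formOf (A + B) u v = formOf A u v + formOf B u v := by
  simp only [formOf_apply, Matrix.add_mulVec, dotProduct_add]

theorem formOf_smul_matrix (c : ℝ) (A : Matrix (Fin 3) (Fin 3) ℝ) (u v : Space) :
    formOf (c • A) u v = c * formOf A u v := by
  simp only [formOf_apply, Matrix.smul_mulVec, dotProduct_smul, smul_eq_mul]

theorem isOpen_formOf_ne (A : Matrix (Fin 3) (Fin 3) ℝ) : IsOpen {u : Space | formOf A u u ≠ 0} := by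
  have : Continuous fun u : Space => formOf A u u := by fun_prop
  exact isOpen_ne_fun this continuous_const

/-- A non-zero quadratic form vanishes on a set with dense complement. -/
theorem dense_formOf_ne {A : Matrix (Fin 3) (Fin 3) ℝ} (hA : A.IsSymm) (hA0 : A ≠ 0) :
    Dense {u : Space | formOf A u u ≠ 0} := by
  have hw : ∃ w : Space, formOf A w w ≠ 0 := by
    by_contra! hw
    refine hA0 (Matrix.ext fun i j => ?_)
    have h1 := hw (Pi.single i 1 + Pi.single j 1)
    have h2 := hw (Pi.single i 1)
    have h3 := hw (Pi.single j 1)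
    have h4 := formOf_comm hA (Pi.single i 1) (Pi.single j 1)
    simp only [map_add, add_apply] at h1
    rw [← formOf_single A, Matrix.zero_apply]
    linarith
  obtain ⟨w, hw⟩ := hw
  rw [Metric.dense_iff]
  intro u r hr
  by_contra hne
  rw [Set.not_nonempty_iff_eq_empty] at hne
  have key : ∀ t : ℝ, |t| * ‖w‖ < r → formOf A (u + t • w) (u + t • w) = 0 := by
    intro t ht
    by_contra h0
    have : u + t • w ∈ Metric.ball u r ∩ {u : Space | formOf A u u ≠ 0} := by
      refine ⟨?_, h0⟩
      rw [Metric.mem_ball, dist_eq_norm, add_sub_cancel_left, norm_smul, Real.norm_eq_abs]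
      exact ht
    rw [hne] at this
    exact this
  have hn : 0 < ‖w‖ + 1 := by positivity
  have hsmall : ∀ c : ℝ, |c| ≤ 1 → formOf A (u + (c * (r / (‖w‖ + 1))) • w)
      (u + (c * (r / (‖w‖ + 1))) • w) = 0 := by
    intro c hc
    refine key _ ?_
    rw [abs_mul, abs_of_pos (div_pos hr hn)]
    calc |c| * (r / (‖w‖ + 1)) * ‖w‖ ≤ 1 * (r / (‖w‖ + 1)) * ‖w‖ := by gcongr
      _ = r * (‖w‖ / (‖w‖ + 1)) := by ring
      _ < r * 1 := by
        gcongr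
        rw [div_lt_one hn]; linarith
      _ = r := mul_one r
  -- The second difference of the form at three points of the line isolates its value at `w`, which
  -- is not zero.
  have e1 := hsmall 1 (by norm_num)
  have e2 := hsmall (-1) (by norm_num)
  have e3 := hsmall 0 (by norm_num)
  simp only [map_add, add_apply, map_smul, smul_apply, smul_eq_mul, zero_mul, zero_smul,
    add_zero] at e1 e2 e3
  have : (r / (‖w‖ + 1)) ^ 2 * formOf A w w = 0 := by linarith
  rcases mul_eq_zero.mp this with h | h
  · exact (pow_pos (div_pos hr hn) 2).ne' h
  · exact hw h

/-- The quadratic form of `dirCurv`. -/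
theorem formOf_dirCurv (Rc H : Matrix (Fin 3) (Fin 3) ℝ) (t : ℝ) {u : Space}
    (hu : formOf H u u = 1) :
    formOf ((-45 : ℝ) • Rc + (27 / 2 * t) • H) u u = dirCurv Rc t u := by
  rw [formOf_add_matrix, formOf_smul_matrix, formOf_smul_matrix, hu, dirCurv, mul_one]

/-- Taking the trace of the matrix gives (-45 + 3 · 27/2) t = -9t/2. If the matrix vanished, so
would `t`, and then the Ricci tensor itself. -/
theorem dirCurv_matrix_ne_zero {H E Rc : Matrix (Fin 3) (Fin 3) ℝ} (hE : E.transpose * H * E = 1)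
    (hR : Rc ≠ 0) :
    (-45 : ℝ) • Rc + (27 / 2 * (E.transpose * Rc * E).trace) • H ≠ 0 := by
  intro h0
  set t := (E.transpose * Rc * E).trace with ht
  have h1 : E.transpose * ((-45 : ℝ) • Rc + (27 / 2 * t) • H) * E = 0 := by
    rw [h0, mul_zero, zero_mul]
  rw [Matrix.mul_add, Matrix.add_mul, Matrix.mul_smul, Matrix.mul_smul, Matrix.smul_mul,
    Matrix.smul_mul, hE] at h1
  have h2 := congrArg Matrix.trace h1
  rw [Matrix.trace_add, Matrix.trace_smul, Matrix.trace_smul, ← ht, Matrix.trace_one,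
    Matrix.trace_zero] at h2
  have h3 : t = 0 := by
    simp only [smul_eq_mul, Fintype.card_fin] at h2
    push_cast at h2
    linarith
  rw [h3, mul_zero, zero_smul, add_zero, smul_eq_zero] at h0
  rcases h0 with h | h
  · norm_num at h
  · exact hR h

theorem dirCurv_frame (E R : Matrix (Fin 3) (Fin 3) ℝ) :
    dirCurv R (E.transpose * R * E).trace (fun i => E i 0) = curvK (E.transpose * R * E) := by
  rw [dirCurv, curvK, frame_mul_entry, formOf_apply]

namespace StaticSpacetime

variable {S : StaticSpacetime} {U : Set Space} {p : Space} {R C s : ℝ}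

theorem opticalRicci_eq (S : StaticSpacetime) (hp : p ∈ S.domain) :
    S.opticalRicci p = ricciOf (connDeriv S.conn p) :=
  ricci_eq_ricciOf ((S.isLocalGeom_conn.smooth_conn.contDiffAt
    (S.isLocalGeom_conn.isOpen.mem_nhds hp)).differentiableAt (by simp))

theorem scale_bounds {l τ s₁ : ℝ} (hl : 0 < l) {N : ℕ} (hN : 1 ≤ N) (hτ : 0 < τ)
    (h : N * τ < s₁ * l) : 0 < N * (τ / l) ∧ N * (τ / l) ≤ s₁ := by
  refine ⟨by positivity, ?_⟩
  rw [← mul_div_assoc, div_le_iff₀ hl]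
  exact h.le

theorem one_lt_of_sqrt {q : ℝ} (h : 1 < √q) : 1 < q := by
  rwa [Real.lt_sqrt zero_le_one, one_pow] at h

theorem Chart.null_and_flat (hl : ∀ x ∈ U, ∀ y ∈ U, x ≠ y → S.RadarLinkable x y)
    (ch : S.Chart U p R C s) {N : ℕ} {θ : ℝ} (hθ : 0 < θ) (hs : s = N * θ)
    {y : Label → Space}
    (hy : ∀ i, y i ∈ Metric.closedBall (0 : Space) R) (hne : ∀ i j, i ≠ j → y i ≠ y j)
    {k : Fin 10} {i j : Label} (hk : Joins k i j) (hq : √(ch.sq y k) = side k) :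
    S.NullChannel N (synced (fun i => p + s • y i) θ hθ) i j ∧
      S.FlatEcho N (synced (fun i => p + s • y i) θ hθ) i j := by
  constructor
  · intro n
    exact (ch.mem_channel_synced hl hθ hs hy hne hk n 0).mpr
      ⟨zero_mem_phases, by rw [hq, sub_self, mul_zero]⟩
  · intro m
    rw [ch.echoCount_iff hl hy hne hk (fun _ => rfl), hq, hk.side]
    simp only [synced]
    linear_combination -2 * (hop i j : ℝ) * hs

/-- `exists_config` with zero deviations, at the scale s = N p_t. Clocks started together with a
common period turn flat lengths into null phases. -/
theorem exists_nine_flat (hU : IsOpen U) (hUD : U ⊆ S.domain)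
    (hl : ∀ x ∈ U, ∀ y ∈ U, x ≠ y → S.RadarLinkable x y) (hp : p ∈ U)
    {E : Matrix (Fin 3) (Fin 3) ℝ} (hE : S.IsFrame p E) {e : Sym2 Label} (he : e ∈ links) :
    ∃ ε > 0, ∀ (N : ℕ) (τ : ℝ), 1 ≤ N → 0 < τ →
      N * τ < ε → ∃ M, S.IsArrangement U p τ M ∧
        S.AimedAt p (M (.B 1)).pos (fun i => E i 0) ∧
        (∀ i, (M i).period = τ / S.lapse p) ∧
        (∀ i j, i ≠ j → s(i, j) ≠ e → S.NullChannel N M i j ∧ S.FlatEcho N M i j) ∧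
        (∀ i j, s(i, j) = e → ∀ m : ℤ, ∃ Δ : ℝ,
          S.EchoCount (M i) (M j) m Δ ∧ |Δ - 2 * hop i j * N| < N) := by
  obtain ⟨k₀, rfl⟩ := exists_linkOf_eq he
  have hpD := hUD hp
  have hlam := S.lapse_pos p hpD
  obtain ⟨R₀, hR₀, hcfg⟩ := S.isLocalGeom_conn.exists_config hpD
  obtain ⟨R, hR, C, hC, s₁, hs₁, hch⟩ := S.exists_chart hU hUD hp R₀
  obtain ⟨s₂, hs₂, hcfg⟩ := hcfg R hR C hC 1 one_pos
  refine ⟨min s₁ s₂ * S.lapse p, by positivity, fun N τ hN hτ hNτ => ?_⟩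
  obtain ⟨hs0, hs1⟩ := scale_bounds hlam hN hτ hNτ
  obtain ⟨s, hs⟩ : ∃ s, s = N * (τ / S.lapse p) := ⟨_, rfl⟩
  rw [← hs] at hs0 hs1
  rw [le_min_iff] at hs1
  obtain ⟨ch⟩ := hch s hs0 hs1.1
  have hθ : 0 < τ / S.lapse p := by positivity
  have hN0 : (0 : ℝ) < N := by positivity
  obtain ⟨y, hy0, hy, hq, hlast, hc⟩ := hcfg s hs0 hs1.2 ch.bvp E hE k₀ 0
    (fun k _ => by rw [Pi.zero_apply, abs_zero]; positivity)
  have hq' : ∀ k ≠ k₀, √(ch.sq y k) = side k := fun k hk => by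
    rw [Chart.sq, hq k hk, Pi.zero_apply, add_zero, sideSq, Real.sqrt_sq (side_pos k).le]
  have hq1 : ∀ k, 1 < ch.sq y k := fun k => one_lt_of_sqrt (by
    have h2 := two_le_side k
    by_cases hk : k = k₀
    · rw [hk] at h2 ⊢
      have := (abs_le.mp hlast).1
      rw [Chart.sq]
      linarith
    · rw [hq' k hk]; linarith)
  have hne : ∀ i j, i ≠ j → y i ≠ y j := fun i j => ch.ne_of_sq hy hq1
  refine ⟨synced (fun i => p + s • y i) _ hθ, ch.isArrangement hpD hθ hy0 hy hne, ?_, fun i => rfl,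
    fun i j hij hk => ?_, fun i j hij m => ?_⟩
  · have h0 : (0 : Space) ∈ Metric.closedBall (0 : Space) R := by
      have := hy (.B 0)
      rwa [hy0] at this
    have := (ch.aimedAt_iff hl h0 (hy (.B 1)) (by rw [← hy0]; exact hne _ _ (by decide)) _).mpr hc
    rwa [smul_zero, add_zero] at this
  · obtain ⟨k, hk'⟩ := exists_joins hij
    refine ch.null_and_flat hl hθ hs hy hne hk' (hq' k ?_)
    rintro rfl
    exact hk hk'.linkOf.symm
  · have hk := joins_of_linkOf hij
    refine ⟨2 * (N * √(ch.sq y k₀)), ?_, ?_⟩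
    · rw [ch.echoCount_iff hl hy hne hk (fun _ => rfl)]
      simp only [synced]
      linear_combination -2 * √(ch.sq y k₀) * hs
    · rw [← hk.side, show 2 * (N * √(ch.sq y k₀)) - 2 * side k₀ * N
        = 2 * N * (√(ch.sq y k₀) - side k₀) by ring, abs_mul, abs_of_pos (by positivity)]
      calc 2 * (N : ℝ) * |√(ch.sq y k₀) - side k₀| ≤ 2 * N * (2 / 5) := by gcongr; exact hlast
        _ < N := by linarith

/-- Passage from squared lengths to echo counts: `q - h ^ 2 = d * (2 * h + d)` for the excess `d`,
and d² is of fourth order in `s`, hence negligible. -/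
theorem echo_estimate {st h N s K η C d Δ q : ℝ} (hst : 4 ≤ |st|) (hh : 2 ≤ h) (hN : 0 < N)
    (hΔ : √q = Δ / (2 * N)) (hd : d = √q - h) (hd1 : |d| ≤ 1 / 2) (hC : |q - h ^ 2| ≤ C * s ^ 2)
    (hCs : C ^ 2 * s ^ 2 ≤ η) (hexp : |st * (q - h ^ 2) - s ^ 2 * K| ≤ η * s ^ 2) :
    |Δ - 2 * h * N - N * s ^ 2 * (K / (st * h))| ≤ η * (N * s ^ 2) := by
  have hst0 : st ≠ 0 := fun e => by rw [e, abs_zero] at hst; linarith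
  have hη : 0 ≤ η := le_trans (by positivity) hCs
  have hq0 : 0 ≤ q := by
    by_contra hq
    rw [Real.sqrt_eq_zero_of_nonpos (by linarith)] at hd
    have := (abs_le.mp hd1).1
    linarith
  have hq : q - h ^ 2 = d * (2 * h + d) := by
    rw [hd]; nlinarith [Real.sq_sqrt hq0]
  have h1 : |d| ≤ C * s ^ 2 := by
    rw [hq, abs_mul] at hC
    have : 1 ≤ |2 * h + d| := by
      rw [le_abs]; left; linarith [(abs_le.mp hd1).1]
    nlinarith [abs_nonneg d]
  have h2 : d ^ 2 ≤ η * s ^ 2 := by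
    have : d ^ 2 ≤ (C * s ^ 2) ^ 2 := by rw [← sq_abs]; gcongr
    nlinarith [sq_nonneg s]
  have h3 : |(q - h ^ 2) - s ^ 2 * (K / st)| ≤ η * s ^ 2 / 4 := by
    have e : st * (q - h ^ 2) - s ^ 2 * K = st * ((q - h ^ 2) - s ^ 2 * (K / st)) := by
      field_simp
    rw [e, abs_mul] at hexp
    nlinarith [abs_nonneg ((q - h ^ 2) - s ^ 2 * (K / st))]
  have hΔ' : Δ - 2 * h * N = 2 * N * d := by
    rw [hd, hΔ]; field_simp
  have e : Δ - 2 * h * N - N * s ^ 2 * (K / (st * h))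
      = N * ((((q - h ^ 2) - s ^ 2 * (K / st)) - d ^ 2) / h) := by
    rw [hΔ', hq]; field_simp; ring
  rw [e, abs_mul, abs_div, abs_of_pos hN, abs_of_pos (show 0 < h by linarith)]
  have h4 : |((q - h ^ 2) - s ^ 2 * (K / st)) - d ^ 2| ≤ η * s ^ 2 / 4 + η * s ^ 2 := by
    refine (abs_sub _ _).trans (add_le_add h3 ?_)
    rwa [abs_of_nonneg (sq_nonneg d)]
  have h5 : |((q - h ^ 2) - s ^ 2 * (K / st)) - d ^ 2| / h ≤ η * s ^ 2 := by
    rw [div_le_iff₀ (by linarith)]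
    have : 0 ≤ η * s ^ 2 := by positivity
    nlinarith
  calc N * _ ≤ N * (η * s ^ 2) := by gcongr
    _ = _ := by ring

/-- With nine vanishing defects the linear relation has a single term on its left, which gives the
defect of the exceptional squared length; dividing by the stress and the side yields the functional.
-/
theorem echo_expand (hU : IsOpen U) (hUD : U ⊆ S.domain)
    (hl : ∀ x ∈ U, ∀ y ∈ U, x ≠ y → S.RadarLinkable x y) (hp : p ∈ U)
    {E : Matrix (Fin 3) (Fin 3) ℝ} (hE : S.IsFrame p E) (k₀ : Fin 10) {η : ℝ} (hη : 0 < η) :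
    ∃ ε > 0, ∀ (N : ℕ) (τ : ℝ), 1 ≤ N → 0 < τ → N * τ < ε → ∀ M, S.IsArrangement U p τ M →
      S.AimedAt p (M (.B 1)).pos (fun i => E i 0) →
      (∀ i j, i ≠ j → s(i, j) ≠ linkOf k₀ → S.FlatEcho N M i j) →
      ∀ i j, s(i, j) = linkOf k₀ → ∀ (m : ℤ) (Δ : ℝ), S.EchoCount (M i) (M j) m Δ →
        |Δ - 2 * hop i j * N| < N →
        |Δ - 2 * hop i j * N - N * (N * (τ / S.lapse p)) ^ 2 *
          (curvK (S.frameRicci p E) / (stress k₀ * side k₀))|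
          ≤ η * (N * (N * (τ / S.lapse p)) ^ 2) := by
  have hpD := hUD hp
  have hlam := S.lapse_pos p hpD
  obtain ⟨R, hR, C, hC, s₁, hs₁, hch⟩ := S.exists_chart hU hUD hp 1
  obtain ⟨C₂, hC₂, s₂, hs₂, hexp⟩ := S.isLocalGeom_conn.linkSq_expand hpD hR hC one_pos hη hE
  have hs₃ : 0 < √(η / C₂ ^ 2) := Real.sqrt_pos.mpr (by positivity)
  refine ⟨min (min s₁ s₂) (√(η / C₂ ^ 2)) * S.lapse p, by positivity,
    fun N τ hN hτ hNτ M hM haim hflat i j hij m Δ hΔ hΔN => ?_⟩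
  obtain ⟨hs0, hs1⟩ := scale_bounds hlam hN hτ hNτ
  obtain ⟨s, hs⟩ : ∃ s, s = N * (τ / S.lapse p) := ⟨_, rfl⟩
  rw [← hs] at hs0 hs1 ⊢
  rw [le_min_iff, le_min_iff] at hs1
  obtain ⟨⟨hs1, hs2⟩, hs3⟩ := hs1
  obtain ⟨ch⟩ := hch s hs0 hs1
  have hN0 : (0 : ℝ) < N := by positivity
  obtain ⟨y, hy0, hy, hpos, hne, hq, hqk⟩ := ch.exists_config_of_echo hl hpD hN hs hM k₀
    (fun i j h1 h2 => ⟨0, hflat i j h1 h2 0⟩) hij hΔ hΔN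
  have hside := (joins_of_linkOf hij).side
  rw [← hside] at hΔN ⊢
  have hsq : ∀ k ≠ k₀, ch.sq y k - sideSq k = 0 := fun k hk => by
    have h1 := hq k hk
    have h2 := side_pos k
    have h3 : 0 < ch.sq y k := Real.sqrt_pos.mp (by rw [h1]; exact h2)
    rw [sideSq, ← h1, Real.sq_sqrt h3.le, sub_self]
  have hd1 : |√(ch.sq y k₀) - side k₀| ≤ 1 / 2 := by
    have e : Δ - 2 * side k₀ * N = 2 * N * (√(ch.sq y k₀) - side k₀) := by
      rw [hqk]; field_simp
    rw [e, abs_mul, abs_of_pos (by positivity)] at hΔN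
    nlinarith
  obtain ⟨hC2, hexp⟩ := hexp s hs0 hs2 ch.bvp y hy0 hy k₀
    (fun k hk => by rw [← Chart.sq, hsq k hk, abs_zero]; positivity) hd1
  have h0 : (0 : Space) ∈ Metric.closedBall (0 : Space) R := by
      have := hy (.B 0)
      rwa [hy0] at this
  obtain ⟨c, hc, hV⟩ := (ch.aimedAt_iff hl h0 (hy (.B 1))
    (by rw [← hy0]; exact hne _ _ (by decide)) (fun i => E i 0)).mp (by
      rw [smul_zero, add_zero, ← hpos]; exact haim)
  have hexp := hexp _ c hc (formOf_col hE 0) hV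
  rw [Finset.sum_eq_single k₀ (fun k _ hk => by rw [← Chart.sq, hsq k hk, mul_zero])
    (by simp), dirCurv_frame, ← S.opticalRicci_eq hpD] at hexp
  refine echo_estimate (abs_stress_le k₀) (two_le_side k₀) hN0 hqk rfl hd1 (hC2 k₀) ?_ hexp
  have h4 : s ^ 2 ≤ η / C₂ ^ 2 := by
    rw [← Real.sq_sqrt (show 0 ≤ η / C₂ ^ 2 by positivity)]
    gcongr
  rw [le_div_iff₀ (by positivity)] at h4
  linarith

/-- If every link had its flat echo count at some tick, all defects would vanish and the linear
relation would force K(u) to be small. The good directions are those in which the quadratic form of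
K does not vanish. -/
theorem exists_nonflat_echo (hU : IsOpen U) (hUD : U ⊆ S.domain)
    (hl : ∀ x ∈ U, ∀ y ∈ U, x ≠ y → S.RadarLinkable x y) (hp : p ∈ U)
    (hcurv : S.opticalRicci p ≠ 0) : ∃ D : Set (Fin 3 → ℝ), IsOpen D ∧ Dense D ∧ ∀ u ∈ D,
      ∃ ε > 0, ∀ (N : ℕ) (τ : ℝ), 1 ≤ N → 0 < τ → N * τ < ε →
        ∀ M, S.IsArrangement U p τ M → S.AimedAt p (M (.B 1)).pos u →
          ∃ i j, i ≠ j ∧ ∀ m : ℤ, ¬ S.EchoCount (M i) (M j) m (2 * hop i j * N) := by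
  have hpD := hUD hp
  have hlam := S.lapse_pos p hpD
  have hpd := S.isLocalGeom_conn.posDef p hpD
  obtain ⟨E, hE⟩ := exists_frame hpd
  rw [S.opticalRicci_eq hpD] at hcurv
  have hsymm := S.isLocalGeom_conn.ricciOf_isSymm hpD
  set Rc := ricciOf (connDeriv S.conn p) with hRc
  set t := (E.transpose * Rc * E).trace with ht
  refine ⟨_, isOpen_formOf_ne _, dense_formOf_ne (A := (-45 : ℝ) • Rc
    + (27 / 2 * t) • S.opticalMetric p) ?_ (dirCurv_matrix_ne_zero hE hcurv), fun u hu => ?_⟩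
  · have h2 : (S.opticalMetric p).IsSymm := hpd.isHermitian
    exact (hsymm.smul _).add (h2.smul _)
  have hu' : formOf ((-45 : ℝ) • Rc + (27 / 2 * t) • S.opticalMetric p) u u ≠ 0 := hu
  obtain ⟨m, hm, hlow⟩ := exists_lower_bound hpd
  have hu0 : u ≠ 0 := fun e => hu' (by rw [e]; simp)
  have hnorm : 0 < formOf (S.opticalMetric p) u u :=
    lt_of_lt_of_le (mul_pos hm (pow_pos (norm_pos_iff.mpr hu0) 2)) (hlow u)
  obtain ⟨r, hr, hr2⟩ : ∃ r : ℝ, 0 < r ∧ r ^ 2 = formOf (S.opticalMetric p) u u :=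
    ⟨_, Real.sqrt_pos.mpr hnorm, Real.sq_sqrt hnorm.le⟩
  have hunit : formOf (S.opticalMetric p) (r⁻¹ • u) (r⁻¹ • u) = 1 := by
    simp only [map_smul, smul_apply, smul_eq_mul, ← hr2]
    field_simp
  have hK : dirCurv Rc t (r⁻¹ • u) ≠ 0 := by
    rw [← formOf_dirCurv Rc _ t hunit]
    simp only [map_smul, smul_apply, smul_eq_mul]
    exact mul_ne_zero (inv_ne_zero hr.ne') (mul_ne_zero (inv_ne_zero hr.ne') hu')
  obtain ⟨R, hR, C, hC, s₁, hs₁, hch⟩ := S.exists_chart hU hUD hp 1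
  -- A tolerance of half of |K| is enough for a contradiction.
  obtain ⟨C₂, hC₂, s₂, hs₂, hexp⟩ := S.isLocalGeom_conn.linkSq_expand hpD hR hC one_pos
    (half_pos (abs_pos.mpr hK)) hE
  refine ⟨min s₁ s₂ * S.lapse p, by positivity, fun N τ hN hτ hNτ M hM haim => ?_⟩
  by_contra! hcon
  obtain ⟨hs0, hs1⟩ := scale_bounds hlam hN hτ hNτ
  obtain ⟨s, hs⟩ : ∃ s, s = N * (τ / S.lapse p) := ⟨_, rfl⟩
  rw [← hs] at hs0 hs1
  rw [le_min_iff] at hs1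
  obtain ⟨ch⟩ := hch s hs0 hs1.1
  have hN0 : (0 : ℝ) < N := by positivity
  obtain ⟨m₀, hm₀⟩ := hcon (fstL 0) (sndL 0) (fstL_ne_sndL 0)
  obtain ⟨y, hy0, hy, hpos, hne, hq, hqk⟩ := ch.exists_config_of_echo hl hpD hN hs hM 0
    (fun i j h1 _ => hcon i j h1) (show s(fstL 0, sndL 0) = linkOf 0 from rfl) hm₀
    (by rw [sub_self, abs_zero]; exact hN0)
  have hq : ∀ k, √(ch.sq y k) = side k := fun k => by
    by_cases hk : k = 0
    · rw [hk, hqk, side]; field_simp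
    · exact hq k hk
  have hsq : ∀ k, ch.sq y k - sideSq k = 0 := fun k => by
    have h1 := hq k
    have h2 := side_pos k
    have h3 : 0 < ch.sq y k := Real.sqrt_pos.mp (by rw [h1]; exact h2)
    rw [sideSq, ← h1, Real.sq_sqrt h3.le, sub_self]
  have hexp := (hexp s hs0 hs1.2 ch.bvp y hy0 hy 0
    (fun k _ => by rw [← Chart.sq, hsq k, abs_zero]; positivity)
    (by rw [← Chart.sq, hq, sub_self, abs_zero]; norm_num)).2
  have h0 : (0 : Space) ∈ Metric.closedBall (0 : Space) R := by
      have := hy (.B 0)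
      rwa [hy0] at this
  obtain ⟨c, hc, hV⟩ := (ch.aimedAt_iff hl h0 (hy (.B 1))
    (by rw [← hy0]; exact hne _ _ (by decide)) u).mp (by
      rw [smul_zero, add_zero, ← hpos]; exact haim)
  have hexp := hexp (r⁻¹ • u) (c * r) (by positivity) hunit (by
    rw [hV, smul_smul, mul_assoc, mul_inv_cancel₀ hr.ne', mul_one])
  rw [Finset.sum_eq_zero (fun k _ => by rw [← Chart.sq, hsq k, mul_zero]), zero_sub, abs_neg,
    abs_mul, abs_of_pos (by positivity)] at hexp
  have := abs_pos.mpr hK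
  have h5 : 0 < s ^ 2 := by positivity
  nlinarith

end StaticSpacetime

end

/-! ### Least deviations of lengths on a set of links. -/

noncomputable section

/-- The effect of the length of a link on the stress sum. -/
def weight (k : Fin 10) : ℝ := |2 * stress k * side k|

theorem weight_eq (k : Fin 10) : weight k = 2 * side k * |stress k| := by
  rw [weight, abs_mul, abs_mul, abs_of_pos (side_pos k), abs_two]; ring

theorem sixteen_le_weight (k : Fin 10) : 16 ≤ weight k := by
  rw [weight_eq]
  nlinarith [abs_stress_le k, two_le_side k]

theorem sum_weight_le (I : Finset (Fin 10)) : ∑ k ∈ I, weight k ≤ 252 := by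
  calc ∑ k ∈ I, weight k ≤ ∑ k, weight k :=
        Finset.sum_le_sum_of_subset_of_nonneg (Finset.subset_univ _)
          fun k _ _ => abs_nonneg _
    _ = 252 := by
        simp only [weight_eq, side_eq, stress, Fin.sum_univ_succ]
        norm_num [Fin.succ, abs_of_pos, abs_of_neg]

theorem sixteen_le_sum_weight {I : Finset (Fin 10)} (hI : I.Nonempty) :
    16 ≤ ∑ k ∈ I, weight k := by
  obtain ⟨k, hk⟩ := hI
  exact (sixteen_le_weight k).trans
    (Finset.single_le_sum (f := weight) (fun k _ => abs_nonneg _) hk)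

/-- Lengths and squared lengths of the links. -/
theorem sq_sub_sideSq {q : ℝ} (hq : 0 ≤ q) (k : Fin 10) :
    q - sideSq k = (√q - side k) * (2 * side k + (√q - side k)) := by
  rw [sideSq]
  linear_combination (-1) * Real.sq_sqrt hq

theorem nonneg_of_sqrt_near {q : ℝ} {k : Fin 10} (h : |√q - side k| ≤ 1 / 2) : 0 ≤ q := by
  by_contra hq
  rw [Real.sqrt_eq_zero_of_nonpos (by linarith)] at h
  have := (abs_le.mp h).1
  linarith [two_le_side k]

theorem abs_sq_sub_le {q b : ℝ} {k : Fin 10} (h : |√q - side k| ≤ 1 / 2)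
    (hb : |√q - side k| ≤ b) : |q - sideSq k| ≤ 7 * b := by
  rw [sq_sub_sideSq (nonneg_of_sqrt_near h), abs_mul]
  have h1 : |2 * side k + (√q - side k)| ≤ 7 := by
    rw [abs_le] at h ⊢
    constructor <;> linarith [side_le_three k, side_pos k]
  calc |√q - side k| * |2 * side k + (√q - side k)| ≤ b * 7 := by
        gcongr
        exact (abs_nonneg _).trans hb
    _ = 7 * b := mul_comm _ _

theorem abs_sqrt_sub_le_abs {q : ℝ} {k : Fin 10} (h : |√q - side k| ≤ 1 / 2) :
    |√q - side k| ≤ |q - sideSq k| := by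
  rw [sq_sub_sideSq (nonneg_of_sqrt_near h), abs_mul]
  have h1 : 1 ≤ |2 * side k + (√q - side k)| := by
    rw [le_abs]; left
    linarith [(abs_le.mp h).1, two_le_side k]
  exact le_mul_of_one_le_right (abs_nonneg _) h1

theorem abs_stress_sum_sub_le {q : Fin 10 → ℝ} {b : ℝ} (h : ∀ k, |√(q k) - side k| ≤ 1 / 2)
    (hb : ∀ k, |√(q k) - side k| ≤ b) :
    |∑ k, stress k * (q k - sideSq k) - ∑ k, 2 * stress k * side k * (√(q k) - side k)|
      ≤ 57 * b ^ 2 := by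
  rw [← Finset.sum_sub_distrib]
  have e : ∀ k, stress k * (q k - sideSq k) - 2 * stress k * side k * (√(q k) - side k)
      = stress k * (√(q k) - side k) ^ 2 := fun k => by
    rw [sq_sub_sideSq (nonneg_of_sqrt_near (h k))]; ring
  simp only [e]
  refine abs_sum_stress_le fun k => ?_
  rw [abs_pow]
  have := hb k
  gcongr

variable {D : Set Space} {g : Space → Matrix (Fin 3) (Fin 3) ℝ} {Γ : Space → Bil}

/-- Every configuration of a flat shape up to a set `I` of links deviates on `I`. -/
theorem IsLocalGeom.le_deviation (h : IsLocalGeom D g Γ) {p : Space} (hp : p ∈ D)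
    {E : Matrix (Fin 3) (Fin 3) ℝ} (hE : E.transpose * g p * E = 1) {σ k₀ η : ℝ}
    (hσ : |σ| = 1) (hk₀ : 0 < k₀) (hη : 0 < η)
    (hmin : ∀ u, formOf (g p) u u = 1 → k₀ ≤ σ * dirCurv (ricciOf (connDeriv Γ p))
      (E.transpose * ricciOf (connDeriv Γ p) * E).trace u) {R C : ℝ} (hR : 1 ≤ R) (hC : 0 < C) :
    ∃ s₁ > 0, ∀ s, 0 < s → s ≤ s₁ → ∀ (B : BVP D Γ p R C s) (I : Finset (Fin 10)), I.Nonempty →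
      ∀ (y : Label → Space), y (.B 0) = 0 → (∀ i, y i ∈ Metric.closedBall (0 : Space) R) →
      (∀ k ∉ I, √(B.linkSq g y k) = side k) → ∀ b,
      (∀ k, |√(B.linkSq g y k) - side k| ≤ s ^ 2 * b) → k₀ / (∑ k ∈ I, weight k) - η ≤ b := by
  obtain ⟨C₂, hC₂, s₁, hs₁, hexp⟩ := h.linkSq_expand hp hR hC (C₁ := 7 * k₀) (by positivity) hη hE
  have hm₁ : 0 < √(1 / (2 * k₀)) := Real.sqrt_pos.mpr (by positivity)
  have hm₂ : 0 < √(η / (57 * k₀ ^ 2)) := Real.sqrt_pos.mpr (by positivity)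
  refine ⟨min s₁ (min (√(1 / (2 * k₀))) (√(η / (57 * k₀ ^ 2)))), by positivity,
    fun s hs hs1 B I hI y hy0 hy hoff b hb => ?_⟩
  rw [le_min_iff, le_min_iff] at hs1
  obtain ⟨hs1, hs2, hs3⟩ := hs1
  have hs2 : s ^ 2 * k₀ ≤ 1 / 2 := by
    have := (Real.le_sqrt hs.le (by positivity)).mp hs2
    rw [le_div_iff₀ (by positivity)] at this
    linarith
  -- Replacing squared lengths by lengths costs the squares of the deviations, weighted by the
  -- stress of total size 57.
  have hs3 : 57 * (s ^ 2 * k₀) ^ 2 ≤ η * s ^ 2 := by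
    have := (Real.le_sqrt hs.le (by positivity)).mp hs3
    rw [le_div_iff₀ (by positivity)] at this
    nlinarith [sq_nonneg s]
  have hS := sixteen_le_sum_weight hI
  set W := ∑ k ∈ I, weight k with hW
  have hs2' : 0 < s ^ 2 := by positivity
  by_contra hcon
  push Not at hcon
  -- Only a bound `b` that is too small has to be refuted, so the deviations may be taken of order
  -- s².
  have hb1 : b ≤ k₀ := by
    have : k₀ / W ≤ k₀ := div_le_self hk₀.le (by linarith)
    linarith
  have hdev : ∀ k, |√(B.linkSq g y k) - side k| ≤ s ^ 2 * k₀ := fun k =>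
    (hb k).trans (by gcongr)
  have hhalf : ∀ k, |√(B.linkSq g y k) - side k| ≤ 1 / 2 := fun k => (hdev k).trans hs2
  have hexp := (hexp s hs hs1 B y hy0 hy 0 (fun k _ => by
    have := abs_sq_sub_le (hhalf k) (hdev k)
    linarith) (hhalf 0)).2
  have hV : 0 < formOf (g p) (B.V 0 (y (.B 1))) (B.V 0 (y (.B 1))) := by
    have h1 : 0 < B.linkSq g y 0 := by
      refine Real.sqrt_pos.mp ?_
      linarith [(abs_le.mp (hhalf 0)).1, two_le_side 0]
    rw [BVP.linkSq, show fstL 0 = .B 0 from rfl, show sndL 0 = .B 1 from rfl, hy0, BVP.sqDist,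
      smul_zero, add_zero] at h1
    exact h1
  obtain ⟨r, hr, hr2⟩ : ∃ r : ℝ, 0 < r ∧
      r ^ 2 = formOf (g p) (B.V 0 (y (.B 1))) (B.V 0 (y (.B 1))) :=
    ⟨_, Real.sqrt_pos.mpr hV, Real.sq_sqrt hV.le⟩
  have hunit : formOf (g p) (r⁻¹ • B.V 0 (y (.B 1))) (r⁻¹ • B.V 0 (y (.B 1))) = 1 := by
    simp only [map_smul, smul_apply, smul_eq_mul, ← hr2]
    field_simp
  have hexp := hexp _ r hr hunit (by rw [smul_smul, mul_inv_cancel₀ hr.ne', one_smul])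
  have hm := hmin _ hunit
  generalize dirCurv (ricciOf (connDeriv Γ p)) (E.transpose * ricciOf (connDeriv Γ p) * E).trace
    (r⁻¹ • B.V 0 (y (.B 1))) = K at hexp hm
  have hK : k₀ ≤ |K| := by
    calc k₀ ≤ |σ * K| := hm.trans (le_abs_self _)
      _ = |K| := by rw [abs_mul, hσ, one_mul]
  have hsum := abs_stress_sum_sub_le hhalf hdev
  have hsum2 : |∑ k, 2 * stress k * side k * (√(B.linkSq g y k) - side k)| ≤ W * (s ^ 2 * b) := by
    rw [← Finset.sum_subset (Finset.subset_univ I) (fun k _ hk => by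
      rw [hoff k hk, sub_self, mul_zero]), hW, Finset.sum_mul]
    refine (Finset.abs_sum_le_sum_abs _ _).trans (Finset.sum_le_sum fun k _ => ?_)
    rw [abs_mul]
    exact mul_le_mul_of_nonneg_left (hb k) (abs_nonneg _)
  -- The links of `I` alone have to make up the curvature term, and their total weight `W` limits
  -- what deviations of size `s ^ 2 * b` can do.
  have h1 : s ^ 2 * |K| ≤ W * (s ^ 2 * b) + 57 * (s ^ 2 * k₀) ^ 2 + η * s ^ 2 := by
    rw [← abs_of_pos hs2', ← abs_mul, abs_of_pos hs2']
    rw [abs_le] at hsum hsum2 hexp ⊢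
    constructor <;> linarith [hsum.1, hsum.2, hsum2.1, hsum2.2, hexp.1, hexp.2]
  have h2 : k₀ ≤ W * b + 2 * η := by
    have : s ^ 2 * k₀ ≤ s ^ 2 * (W * b + 2 * η) := by
      calc s ^ 2 * k₀ ≤ s ^ 2 * |K| := by gcongr
        _ ≤ _ := by linarith
    exact le_of_mul_le_mul_left this hs2'
  -- The error `2 * η` is divided by `W ≥ 16`, so a loss of `η` in `b` covers it.
  rw [lt_sub_iff_add_lt, lt_div_iff₀ (by linarith)] at hcon
  nlinarith

/-- A configuration of flat shape up to small deviations on a set `I` of links. -/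
theorem IsLocalGeom.exists_deviation (h : IsLocalGeom D g Γ) {p : Space} (hp : p ∈ D)
    {E : Matrix (Fin 3) (Fin 3) ℝ} (hE : E.transpose * g p * E = 1) {σ k₀ η : ℝ}
    (hσ : |σ| = 1) (hk₀ : 0 < k₀) (hη : 0 < η)
    (hE0 : σ * dirCurv (ricciOf (connDeriv Γ p))
      (E.transpose * ricciOf (connDeriv Γ p) * E).trace (fun i => E i 0) = k₀) :
    ∃ R₀ ≥ 1, ∀ R ≥ R₀, ∀ C > 0, ∃ s₁ > 0, ∀ s, 0 < s → s ≤ s₁ →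
      ∀ (B : BVP D Γ p R C s) (I : Finset (Fin 10)), I.Nonempty →
      ∃ y : Label → Space, y (.B 0) = 0 ∧ (∀ i, y i ∈ Metric.closedBall (0 : Space) R) ∧
      (∀ k ∉ I, √(B.linkSq g y k) = side k) ∧
      ∀ k, |√(B.linkSq g y k) - side k| ≤ s ^ 2 * (k₀ / (∑ k ∈ I, weight k) + η) := by
  obtain ⟨R₀, hR₀, hcfg⟩ := h.exists_config hp
  refine ⟨R₀, hR₀, fun R hR C hC => ?_⟩
  obtain ⟨s₀, hs₀, hcfg⟩ := hcfg R hR C hC (7 * k₀) (by positivity)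
  obtain ⟨C₂, hC₂, s₁, hs₁, hexp⟩ := h.linkSq_expand hp (hR₀.trans hR) hC (C₁ := 7 * k₀)
    (by positivity) hη hE
  have hm₁ : 0 < √(1 / (2 * k₀)) := Real.sqrt_pos.mpr (by positivity)
  have hm₂ : 0 < √(η / (57 * C₂ ^ 2)) := Real.sqrt_pos.mpr (by positivity)
  refine ⟨min (min s₀ s₁) (min (√(1 / (2 * k₀))) (√(η / (57 * C₂ ^ 2)))), by positivity,
    fun s hs hs1 B I hI => ?_⟩
  rw [le_min_iff, le_min_iff, le_min_iff] at hs1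
  obtain ⟨⟨hs0, hs1⟩, hs2, hs3⟩ := hs1
  have hs2 : s ^ 2 * k₀ ≤ 1 / 2 := by
    have := (Real.le_sqrt hs.le (by positivity)).mp hs2
    rw [le_div_iff₀ (by positivity)] at this
    linarith
  have hs3 : 57 * (C₂ * s ^ 2) ^ 2 ≤ η * s ^ 2 := by
    have := (Real.le_sqrt hs.le (by positivity)).mp hs3
    rw [le_div_iff₀ (by positivity)] at this
    nlinarith [sq_nonneg s]
  have hS := sixteen_le_sum_weight hI
  obtain ⟨e, he⟩ := hI
  set W := ∑ k ∈ I, weight k with hW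
  have hs2' : 0 < s ^ 2 := by positivity
  have hβ0 : 0 < k₀ / W := div_pos hk₀ (by linarith)
  have hβ1 : k₀ / W ≤ k₀ := div_le_self hk₀.le (by linarith)
  -- Equal deviations on all links of `I`, with signs such that every weighted term has the sign of
  -- the curvature: this is the optimal way to share out the curvature term.
  set x : Fin 10 → ℝ := fun k => if k ∈ I then σ * (stress k / |stress k|) * (s ^ 2 * (k₀ / W))
    else 0 with hx
  have hxk : ∀ k, |x k| ≤ s ^ 2 * (k₀ / W) := fun k => by
    by_cases hk : k ∈ I
    · simp only [hx, if_pos hk]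
      rw [abs_mul, abs_mul, hσ, abs_div, abs_abs, div_self (abs_ne_zero.mpr (stress_ne k)),
        abs_of_pos (by positivity)]
      linarith
    · simp only [hx, if_neg hk, abs_zero]; positivity
  have hxh : ∀ k, |x k| ≤ 1 / 2 := fun k => by
    refine (hxk k).trans (le_trans ?_ hs2)
    gcongr
  have hsx : ∀ k, 0 ≤ side k + x k := fun k => by
    linarith [(abs_le.mp (hxh k)).1, two_le_side k]
  have hsqx : ∀ k, |√((side k + x k) ^ 2) - side k| = |x k| := fun k => by
    rw [Real.sqrt_sq (hsx k), add_sub_cancel_left]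
  have hδ : ∀ k ≠ e, |(fun k => (side k + x k) ^ 2 - sideSq k) k| ≤ 7 * k₀ * s ^ 2 := by
    intro k _
    have h1 : |√((side k + x k) ^ 2) - side k| ≤ s ^ 2 * k₀ := by
      rw [hsqx]
      exact (hxk k).trans (by gcongr)
    have := abs_sq_sub_le (h1.trans hs2) h1
    simp only
    linarith
  -- Nine lengths are imposed; the link `e` of `I` takes what the linear relation leaves to it,
  -- which must be close to `x e`.
  obtain ⟨y, hy0, hy, hq, hlast, c, hc, hV⟩ := hcfg s hs hs0 B E hE e _ hδ
  have hq : ∀ k ≠ e, √(B.linkSq g y k) - side k = x k := fun k hk => by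
    rw [hq k hk, add_sub_cancel, Real.sqrt_sq (hsx k), add_sub_cancel_left]
  have hhalf : ∀ k, |√(B.linkSq g y k) - side k| ≤ 1 / 2 := fun k => by
    by_cases hk : k = e
    · rw [hk]; linarith
    · rw [hq k hk]; exact hxh k
  obtain ⟨hC2, hexp⟩ := hexp s hs hs1 B y hy0 hy e (fun k hk => by
    have h1 : |√(B.linkSq g y k) - side k| ≤ s ^ 2 * k₀ := by
      rw [hq k hk]
      exact (hxk k).trans (by gcongr)
    have := abs_sq_sub_le (hhalf k) h1
    linarith) (hhalf e)
  have hexp := hexp _ c hc (formOf_col hE 0) hV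
  generalize dirCurv (ricciOf (connDeriv Γ p)) (E.transpose * ricciOf (connDeriv Γ p) * E).trace
    (fun i => E i 0) = K at hexp hE0
  have hK : K = σ * k₀ := by
    have : σ * σ = 1 := by rw [← abs_mul_abs_self, hσ, one_mul]
    rw [← hE0, ← mul_assoc, this, one_mul]
  have hsum := abs_stress_sum_sub_le hhalf (fun k => (abs_sqrt_sub_le_abs (hhalf k)).trans (hC2 k))
  have hxsum : ∑ k, 2 * stress k * side k * x k = σ * (s ^ 2 * k₀) := by
    rw [← Finset.sum_subset (Finset.subset_univ I) (fun k _ hk => by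
      simp only [hx, if_neg hk, mul_zero])]
    have : ∀ k ∈ I, 2 * stress k * side k * x k = weight k * (σ * (s ^ 2 * (k₀ / W))) := by
      intro k hk
      have h0 : |stress k| ≠ 0 := abs_ne_zero.mpr (stress_ne k)
      have h1 : stress k * (stress k / |stress k|) = |stress k| := by
        rw [← mul_div_assoc, ← abs_mul_abs_self, mul_div_assoc, div_self h0, mul_one]
      simp only [hx, if_pos hk, weight_eq]
      linear_combination (2 * side k * σ * (s ^ 2 * (k₀ / W))) * h1
    rw [Finset.sum_congr rfl this, ← Finset.sum_mul, ← hW]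
    have : W ≠ 0 := by linarith
    field_simp
  have hone : ∑ k, 2 * stress k * side k * (√(B.linkSq g y k) - side k)
      - ∑ k, 2 * stress k * side k * x k
      = 2 * stress e * side e * (√(B.linkSq g y e) - side e - x e) := by
    rw [← Finset.sum_sub_distrib, Finset.sum_eq_single e]
    · ring
    · intro k _ hk
      rw [hq k hk, sub_self]
    · simp
  have hfin : |2 * stress e * side e * (√(B.linkSq g y e) - side e - x e)| ≤ 2 * η * s ^ 2 := by
    rw [← hone, hxsum]
    rw [hK] at hexp
    rw [abs_le] at hexp hsum ⊢
    constructor <;> linarith [hexp.1, hexp.2, hsum.1, hsum.2]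
  refine ⟨y, hy0, hy, fun k hk => ?_, fun k => ?_⟩
  · have hke : k ≠ e := fun e' => hk (e' ▸ he)
    have := hq k hke
    simp only [hx, if_neg hk] at this
    linarith
  · by_cases hk : k = e
    · rw [hk]
      rw [abs_mul] at hfin
      have h16 := sixteen_le_weight e
      rw [weight] at h16
      have h1 : |√(B.linkSq g y e) - side e - x e| ≤ s ^ 2 * η := by
        have h2 : 16 * |√(B.linkSq g y e) - side e - x e| ≤ 2 * η * s ^ 2 :=
          le_trans (by gcongr) hfin
        have h3 : 0 < s ^ 2 * η := by positivity
        linarith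
      have h2 := hxk e
      rw [abs_le] at h1 h2 ⊢
      constructor <;> linarith [h1.1, h1.2, h2.1, h2.2]
    · rw [hq k hk]
      refine (hxk k).trans ?_
      gcongr
      linarith

end

/-! ### Phases of channels and the existence of least amplitudes. -/

noncomputable section

namespace StaticSpacetime

variable {S : StaticSpacetime} {U : Set Space} {p : Space} {R C s : ℝ}

/-- The radar configuration of five machines with given channels. -/
theorem Chart.exists_config_of_hasChannels (hl : ∀ x ∈ U, ∀ y ∈ U, x ≠ y → S.RadarLinkable x y)
    (ch : S.Chart U p R C s) (hp : p ∈ S.domain) {N : ℕ} (hN : 1 ≤ N) {τ : ℝ}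
    (hs : s = N * (τ / S.lapse p)) {M : Label → Machine} {φ : Label → Label → ℕ → ℝ}
    (hM : S.IsArrangement U p τ M) (hc : S.HasChannels N M φ) :
    ∃ y : Label → Space, y (.B 0) = 0 ∧ (∀ i, y i ∈ Metric.closedBall (0 : Space) R) ∧
      ∀ k, 2 * (N * (√(ch.sq y k) - side k)) = φ (fstL k) (sndL k) 0 + φ (sndL k) (fstL k) 0 := by
  have hs0 := ch.pos
  have hN1 : (1 : ℝ) ≤ N := by exact_mod_cast hN
  have hper := period_eq_of_hasChannels hl hp hM hc
  obtain ⟨θ, hθ⟩ : ∃ θ, θ = τ / S.lapse p := ⟨_, rfl⟩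
  rw [← hθ] at hper hs
  have hθ0 : 0 < θ := by rw [← hper (.B 0)]; exact (M (.B 0)).period_pos
  have hsig : ∀ i j, i ≠ j → S.Signal (event ((M i).start) (M i).pos)
      (event ((M j).start + θ * (hop i j * N + φ i j 0)) (M j).pos) := by
    intro i j hij
    have := (hc i j hij 0).2.2
    simp only [Machine.worldline, hper] at this
    push_cast at this
    rw [zero_add, zero_add, mul_zero, add_zero] at this
    exact this
  have hphase : ∀ i j, i ≠ j → φ i j 0 ≤ 1 / 2 := fun i j hij => (hc i j hij 0).2.1.2
  obtain ⟨y, hy0, hy, hpos, hne⟩ := ch.exists_positions hM (fun i hi => by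
    obtain ⟨T, hT, T', hT', h1, h2, -, -⟩ := exists_echoTime hl (hM.mem (.B 0)) (hM.mem i)
      (hM.distinct _ _ hi.symm)
    have e1 := (h1 _ _).mp (hsig (.B 0) i hi.symm)
    have e2 := (h2 _ _).mp (hsig i (.B 0) hi)
    refine ⟨T, ?_, ?_⟩
    · have h3 : T ≤ θ * (7 * N) := by
        have e3 : T + T' = θ * (hop (.B 0) i * N + φ (.B 0) i 0 + (hop i (.B 0) * N
            + φ i (.B 0) 0)) := by linarith
        have e4 : (hop (.B 0) i * N + φ (.B 0) i 0 + (hop i (.B 0) * N + φ i (.B 0) 0) : ℝ)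
            ≤ 7 * N := by
          have h5 : (hop (.B 0) i : ℝ) ≤ 3 := by exact_mod_cast hop_le_three _ _
          have h6 : (hop i (.B 0) : ℝ) ≤ 3 := by exact_mod_cast hop_le_three _ _
          nlinarith [hphase _ _ hi, hphase _ _ hi.symm]
        have := mul_le_mul_of_nonneg_left e4 hθ0.le
        linarith
      have e : 7 * s = θ * (7 * N) := by rw [hs]; ring
      linarith
    · have := (h1 0 (0 + T)).mpr rfl
      rwa [hM.pos_B, zero_add] at this)
  refine ⟨y, hy0, hy, fun k => ?_⟩
  have e1 := hsig _ _ (fstL_ne_sndL k)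
  have e2 := hsig _ _ (fstL_ne_sndL k).symm
  rw [hpos, hpos] at e1 e2
  have e1 := (ch.signal_link hl hy hne (joins_fst_snd k) _ _).mp e1
  have e2 := (ch.signal_link hl hy hne (joins_fst_snd k).symm _ _).mp e2
  rw [← (joins_fst_snd k).side] at e1
  rw [← (joins_fst_snd k).symm.side] at e2
  have : θ * (2 * (N * (√(ch.sq y k) - side k)))
      = θ * (φ (fstL k) (sndL k) 0 + φ (sndL k) (fstL k) 0) := by
    linear_combination (-1) * e1 - e2 - 2 * √(ch.sq y k) * hs
  exact mul_left_cancel₀ hθ0.ne' this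

/-- Clock offsets cancel in the sum of the two phases of a link, which is 2N times its excess
length. So N times the excess is at most the larger phase. -/
theorem Chart.exists_config_of_phaseBounds (hl : ∀ x ∈ U, ∀ y ∈ U, x ≠ y → S.RadarLinkable x y)
    (ch : S.Chart U p R C s) (hp : p ∈ S.domain) {N : ℕ} (hN : 1 ≤ N) {τ : ℝ}
    (hs : s = N * (τ / S.lapse p)) {L : Finset (Sym2 Label)} {a : ℝ}
    (ha : a ∈ S.phaseBounds U p N τ L) :
    ∃ y : Label → Space, y (.B 0) = 0 ∧ (∀ i, y i ∈ Metric.closedBall (0 : Space) R) ∧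
      (∀ k, linkOf k ∉ L → √(ch.sq y k) = side k) ∧
      ∀ k, N * |√(ch.sq y k) - side k| ≤ a := by
  obtain ⟨M, φ, hM, hc, hL, ha⟩ := ha
  obtain ⟨y, hy0, hy, hk⟩ := ch.exists_config_of_hasChannels hl hp hN hs hM hc
  have hN0 : (0 : ℝ) < N := by positivity
  refine ⟨y, hy0, hy, fun k hkL => ?_, fun k => ?_⟩
  · have h1 := hk k
    have hne := fstL_ne_sndL k
    rw [hL _ _ hne hkL, hL _ _ hne.symm (by rw [Sym2.eq_swap]; exact hkL), add_zero] at h1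
    have : (N : ℝ) * (√(ch.sq y k) - side k) = 0 := by linarith
    rcases mul_eq_zero.mp this with h | h
    · exact absurd h hN0.ne'
    · linarith
  · rw [← abs_of_pos hN0, ← abs_mul]
    have h1 := hk k
    have h2 := ha _ _ (fstL_ne_sndL k) 0
    have h3 := ha _ _ (fstL_ne_sndL k).symm 0
    rw [abs_le] at h2 h3 ⊢
    constructor <;> linarith [h2.1, h2.2, h3.1, h3.2]

theorem Chart.ne_of_near (ch : S.Chart U p R C s) {y : Label → Space}
    (hy : ∀ i, y i ∈ Metric.closedBall (0 : Space) R) (hq : ∀ k, |√(ch.sq y k) - side k| < 1 / 2)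
    {i j : Label} (hij : i ≠ j) : y i ≠ y j :=
  ch.ne_of_sq hy (fun k => one_lt_of_sqrt (by
    linarith [(abs_lt.mp (hq k)).1, two_le_side k])) hij

/-- With synchronized clocks both phases of a link equal N times its excess length, so the bound of
`exists_config_of_phaseBounds` is achieved. An amplitude below 1/2 keeps them in the range of
phases. -/
theorem Chart.mem_phaseBounds (hl : ∀ x ∈ U, ∀ y ∈ U, x ≠ y → S.RadarLinkable x y)
    (ch : S.Chart U p R C s) (hp : p ∈ S.domain) {N : ℕ} (hN : 1 ≤ N) {τ : ℝ}
    (hs : s = N * (τ / S.lapse p)) {L : Finset (Sym2 Label)} {a : ℝ} (ha : a < 1 / 2)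
    {y : Label → Space} (hy0 : y (.B 0) = 0)
    (hy : ∀ i, y i ∈ Metric.closedBall (0 : Space) R)
    (hL : ∀ k, linkOf k ∉ L → √(ch.sq y k) = side k)
    (hya : ∀ k, N * |√(ch.sq y k) - side k| ≤ a) : a ∈ S.phaseBounds U p N τ L := by
  have hN1 : (1 : ℝ) ≤ N := by exact_mod_cast hN
  have hs0 := ch.pos
  have hθ : 0 < τ / S.lapse p := by
    rw [hs] at hs0
    exact (mul_pos_iff_of_pos_left (by linarith)).mp hs0
  have hne : ∀ i j, i ≠ j → y i ≠ y j := fun i j => ch.ne_of_near hy fun k => by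
    have := hya k
    nlinarith [abs_nonneg (√(ch.sq y k) - side k)]
  choose! κ hκ using fun (q : Label × Label) (hq : q.1 ≠ q.2) => exists_joins hq
  refine ⟨synced (fun i => p + s • y i) _ hθ,
    fun i j _ => N * (√(ch.sq y (κ (i, j))) - side (κ (i, j))),
    ch.isArrangement hp hθ hy0 hy hne, fun i j hij n => ?_, fun i j hij hkL _ => ?_,
    fun i j hij _ => ?_⟩
  · refine (ch.mem_channel_synced hl hθ hs hy hne (hκ (i, j) hij) n _).mpr ⟨?_, rfl⟩
    have h1 := hya (κ (i, j))
    rw [← abs_of_pos (show (0 : ℝ) < N by linarith), ← abs_mul, abs_le] at h1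
    beta_reduce
    rw [phases, Set.mem_Ioc]
    constructor <;> linarith [h1.1, h1.2]
  · beta_reduce
    rw [hL _ (by rwa [(hκ (i, j) hij).linkOf]), sub_self, mul_zero]
  · rw [abs_mul, abs_of_pos (show (0 : ℝ) < N by linarith)]
    exact hya _

/-- Least amplitudes are N times least maximal deviations of length, by the two preceding
translations. The latter are attained, since lengths are continuous and the admissible
configurations form a compact set. -/
theorem Chart.exists_isLeast (hl : ∀ x ∈ U, ∀ y ∈ U, x ≠ y → S.RadarLinkable x y)
    (ch : S.Chart U p R C s) (hp : p ∈ S.domain) {N : ℕ} (hN : 1 ≤ N) {τ : ℝ}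
    (hs : s = N * (τ / S.lapse p)) {L : Finset (Sym2 Label)} {lo hi : ℝ} (hhi : N * hi < 1 / 2)
    (hex : ∃ y : Label → Space, y (.B 0) = 0 ∧ (∀ i, y i ∈ Metric.closedBall (0 : Space) R) ∧
      (∀ k, linkOf k ∉ L → √(ch.sq y k) = side k) ∧ ∀ k, |√(ch.sq y k) - side k| ≤ hi)
    (hlo : ∀ y : Label → Space, y (.B 0) = 0 → (∀ i, y i ∈ Metric.closedBall (0 : Space) R) →
      (∀ k, linkOf k ∉ L → √(ch.sq y k) = side k) → ∀ b, (∀ k, |√(ch.sq y k) - side k| ≤ b) →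
      lo ≤ b) :
    ∃ a, IsLeast (S.phaseBounds U p N τ L) a ∧ N * lo ≤ a ∧ a ≤ N * hi := by
  have hN0 : (0 : ℝ) < N := by positivity
  set Q : Set (Label → Space) := {y | ∀ i, y i ∈ Metric.closedBall (0 : Space) R} with hQ
  have hQc : IsCompact Q := by
    have : Q = Set.pi Set.univ fun _ => Metric.closedBall (0 : Space) R := by
      ext y; simp [hQ]
    rw [this]
    exact isCompact_univ_pi fun _ => isCompact_closedBall _ _
  have hd : ContinuousOn (fun y k => √(ch.sq y k) - side k) Q :=
    continuousOn_pi.mpr fun k =>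
      (ch.bvp.continuousOn_linkSq S.isLocalGeom_conn k).sqrt.sub continuousOn_const
  have hF : ContinuousOn (fun y : Label → Space =>
      (y (.B 0), fun k => √(ch.sq y k) - side k)) Q :=
    ((continuous_apply _).continuousOn).prodMk hd
  have hT : IsClosed {q : Space × (Fin 10 → ℝ) | q.1 = 0 ∧ ∀ k, linkOf k ∉ L → q.2 k = 0} := by
    have : {q : Space × (Fin 10 → ℝ) | q.1 = 0 ∧ ∀ k, linkOf k ∉ L → q.2 k = 0}
        = {q | q.1 = 0} ∩ ⋂ k, ⋂ _ : linkOf k ∉ L, {q | q.2 k = 0} := by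
      ext; simp
    rw [this]
    exact (isClosed_eq continuous_fst continuous_const).inter <| isClosed_iInter fun k => isClosed_iInter fun _ =>
      isClosed_eq ((continuous_apply k).comp continuous_snd) continuous_const
  have hZ := hQc.of_isClosed_subset (hF.preimage_isClosed_of_isClosed hQc.isClosed hT)
    Set.inter_subset_left
  obtain ⟨y₁, h10, h11, h12, h13⟩ := hex
  obtain ⟨y, ⟨hy, hy0, hyL⟩, hmin⟩ := hZ.exists_isMinOn
    ⟨y₁, h11, h10, fun k hk => sub_eq_zero.mpr (h12 k hk)⟩ (hd.norm.mono Set.inter_subset_left)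
  have hyL : ∀ k, linkOf k ∉ L → √(ch.sq y k) = side k := fun k hk => sub_eq_zero.mp (hyL k hk)
  set f : (Label → Space) → ℝ := fun y => ‖fun k => √(ch.sq y k) - side k‖ with hf
  have hfle : ∀ y k, |√(ch.sq y k) - side k| ≤ f y := fun y k =>
    norm_le_pi_norm (fun k => √(ch.sq y k) - side k) k
  have hle : ∀ y' : Label → Space, y' (.B 0) = 0 → (∀ i, y' i ∈ Metric.closedBall (0 : Space) R) →
      (∀ k, linkOf k ∉ L → √(ch.sq y' k) = side k) → ∀ b, (∀ k, |√(ch.sq y' k) - side k| ≤ b) →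
      f y ≤ b := by
    intro y' h0 h1 h2 b hb
    have h3 : f y ≤ f y' := hmin ⟨h1, h0, fun k hk => sub_eq_zero.mpr (h2 k hk)⟩
    exact h3.trans ((pi_norm_le_iff_of_nonneg ((abs_nonneg _).trans (hb 0))).mpr hb)
  have hfhi : N * f y ≤ N * hi := by
    gcongr
    exact hle y₁ h10 h11 h12 hi h13
  refine ⟨N * f y, ⟨?_, fun a ha => ?_⟩, ?_, hfhi⟩
  · refine ch.mem_phaseBounds hl hp hN hs (hfhi.trans_lt hhi) hy0 hy hyL fun k => ?_
    gcongr
    exact hfle y k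
  · obtain ⟨y', h0, h1, h2, h3⟩ := ch.exists_config_of_phaseBounds hl hp hN hs ha
    have := hle y' h0 h1 h2 (a / N) fun k => by
      rw [le_div_iff₀ hN0, mul_comm]
      exact h3 k
    rwa [le_div_iff₀ hN0, mul_comm] at this
  · gcongr
    exact hlo y hy0 hy hyL _ (hfle y)

end StaticSpacetime

end

/-! ### Varying the orientation: definite and indefinite curvature. -/

noncomputable section

/-- The rotation whose first column has the polar angles `θ` and `φ`. -/
def rot (θ φ : ℝ) : Matrix (Fin 3) (Fin 3) ℝ :=
  !![Real.cos θ, -Real.sin θ, 0;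
    Real.sin θ * Real.cos φ, Real.cos θ * Real.cos φ, -Real.sin φ;
    Real.sin θ * Real.sin φ, Real.cos θ * Real.sin φ, Real.cos φ]

theorem rot_orthogonal (θ φ : ℝ) : (rot θ φ).transpose * rot θ φ = 1 := by
  have h1 := Real.sin_sq_add_cos_sq θ
  have h2 := Real.sin_sq_add_cos_sq φ
  ext i j
  fin_cases i <;> fin_cases j <;>
    simp [rot, Matrix.mul_apply, Fin.sum_univ_three]
  · linear_combination h1 + Real.sin θ ^ 2 * h2
  · linear_combination Real.sin θ * Real.cos θ * h2
  · ring
  · linear_combination Real.sin θ * Real.cos θ * h2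
  · linear_combination h1 + Real.cos θ ^ 2 * h2
  · ring
  · ring
  · ring
  · linear_combination h2

theorem continuous_rot {θ φ : ℝ → ℝ} (hθ : Continuous θ) (hφ : Continuous φ) :
    Continuous fun r => rot (θ r) (φ r) := by
  refine continuous_matrix fun i j => ?_
  fin_cases i <;> fin_cases j <;> simp [rot] <;> fun_prop

/-- The polar angles are arguments of complex numbers, one made of the last two coordinates, the
other of the first coordinate and the norm of the former. -/
theorem exists_rot_col {w : Space} (hw : formOf 1 w w = 1) :
    ∃ θ φ, (fun i => rot θ φ i 0) = w := by
  have hw' : w 0 ^ 2 + w 1 ^ 2 + w 2 ^ 2 = 1 := by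
    rw [formOf_apply, Matrix.one_mulVec, dotProduct, Fin.sum_univ_three] at hw
    linarith
  obtain ⟨z, hz⟩ : ∃ z : ℂ, z = ⟨w 1, w 2⟩ := ⟨_, rfl⟩
  obtain ⟨v, hv⟩ : ∃ v : ℂ, v = ⟨w 0, ‖z‖⟩ := ⟨_, rfl⟩
  have h1 := Complex.norm_mul_cos_arg z
  have h2 := Complex.norm_mul_sin_arg z
  have h3 := Complex.norm_mul_cos_arg v
  have h4 := Complex.norm_mul_sin_arg v
  have hz2 : ‖z‖ ^ 2 = w 1 ^ 2 + w 2 ^ 2 := by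
    rw [← Complex.normSq_eq_norm_sq, Complex.normSq_apply, hz]; ring
  have hv1 : ‖v‖ = 1 := by
    have : ‖v‖ ^ 2 = 1 := by
      rw [← Complex.normSq_eq_norm_sq, Complex.normSq_apply, hv]
      linear_combination hw' + hz2
    exact (pow_eq_one_iff_of_nonneg (norm_nonneg _) two_ne_zero).mp this
  rw [hv1, one_mul] at h3 h4
  refine ⟨v.arg, z.arg, funext fun i => ?_⟩
  fin_cases i
  · simp only [rot]
    simpa [hv] using h3
  · have : Real.sin v.arg * Real.cos z.arg = w 1 := by
      rw [h4, show v.im = ‖z‖ by rw [hv], h1, hz]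
    simpa [rot] using this
  · have : Real.sin v.arg * Real.sin z.arg = w 2 := by
      rw [h4, show v.im = ‖z‖ by rw [hv], h2, hz]
    simpa [rot] using this

theorem frame_mul {H E Q : Matrix (Fin 3) (Fin 3) ℝ} (hE : E.transpose * H * E = 1)
    (hQ : Q.transpose * Q = 1) : (E * Q).transpose * H * (E * Q) = 1 := by
  calc (E * Q).transpose * H * (E * Q) = Q.transpose * (E.transpose * H * E) * Q := by
        rw [Matrix.transpose_mul]; simp only [Matrix.mul_assoc]
    _ = 1 := by rw [hE, Matrix.mul_one, hQ]

theorem mul_col (E Q : Matrix (Fin 3) (Fin 3) ℝ) (j : Fin 3) :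
    (fun i => (E * Q) i j) = E.mulVec fun i => Q i j := by
  ext i; rfl

theorem exists_rot_frame {H E : Matrix (Fin 3) (Fin 3) ℝ} (hE : E.transpose * H * E = 1)
    {u : Space} (hu : formOf H u u = 1) : ∃ θ φ, (fun i => (E * rot θ φ) i 0) = u := by
  have h1 : E * (E.transpose * H) = 1 := mul_eq_one_comm.mp hE
  have h2 : E.mulVec ((E.transpose * H).mulVec u) = u := by
    rw [Matrix.mulVec_mulVec, h1, Matrix.one_mulVec]
  obtain ⟨θ, φ, h3⟩ := exists_rot_col (w := (E.transpose * H).mulVec u) (by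
    rw [← formOf_frame hE, h2, hu])
  exact ⟨θ, φ, by rw [mul_col, h3, h2]⟩

/-- A path of frames between frames with given first vectors. -/
theorem exists_frame_path {H E : Matrix (Fin 3) (Fin 3) ℝ} (hE : E.transpose * H * E = 1)
    {u v : Space} (hu : formOf H u u = 1) (hv : formOf H v v = 1) :
    ∃ F : ℝ → Matrix (Fin 3) (Fin 3) ℝ, Continuous F ∧
      (∀ r, (F r).transpose * H * F r = 1) ∧ (fun i => F 0 i 0) = u ∧ (fun i => F 1 i 0) = v := by
  obtain ⟨θ₀, φ₀, h₀⟩ := exists_rot_frame hE hu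
  obtain ⟨θ₁, φ₁, h₁⟩ := exists_rot_frame hE hv
  refine ⟨fun r => E * rot ((1 - r) * θ₀ + r * θ₁) ((1 - r) * φ₀ + r * φ₁),
    continuous_const.matrix_mul (continuous_rot (by fun_prop) (by fun_prop)),
    fun r => frame_mul hE (rot_orthogonal _ _), ?_, ?_⟩
  · rw [← h₀]
    simp only [sub_zero, one_mul, zero_mul, add_zero]
  · rw [← h₁]
    simp only [sub_self, zero_mul, one_mul, zero_add]

/-- A nonsingular quadratic form that is semidefinite is definite. -/
theorem formOf_pos_of_nonneg {A : Matrix (Fin 3) (Fin 3) ℝ} (hA : A.IsSymm) (hdet : A.det ≠ 0)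
    (h : ∀ u, 0 ≤ formOf A u u) {u : Space} (hu : u ≠ 0) : 0 < formOf A u u := by
  have h1 : A.PosSemidef := Matrix.PosSemidef.of_dotProduct_mulVec_nonneg hA fun u => by
    have := h u
    rwa [formOf_apply] at this
  have h2 : A.PosDef := h1.posDef_iff_isUnit.mpr ((Matrix.isUnit_iff_isUnit_det A).mpr hdet.isUnit)
  have := h2.dotProduct_mulVec_pos hu
  rwa [formOf_apply]

theorem exists_unit_scale {H : Matrix (Fin 3) (Fin 3) ℝ} (hH : H.PosDef) {u : Space} (hu : u ≠ 0) :
    ∃ r : ℝ, 0 < r ∧ formOf H (r⁻¹ • u) (r⁻¹ • u) = 1 := by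
  have hpos : 0 < formOf H u u := by
    rw [formOf_apply]; exact hH.dotProduct_mulVec_pos hu
  refine ⟨√(formOf H u u), Real.sqrt_pos.mpr hpos, ?_⟩
  have := Real.sq_sqrt hpos.le
  have h0 := (Real.sqrt_pos.mpr hpos).ne'
  simp only [map_smul, smul_apply, smul_eq_mul]
  rw [← mul_assoc, ← mul_inv, ← sq, this, inv_mul_cancel₀ hpos.ne']

theorem isCompact_unit {H : Matrix (Fin 3) (Fin 3) ℝ} (hH : H.PosDef) :
    IsCompact {u : Space | formOf H u u = 1} := by
  obtain ⟨m, hm, hlow⟩ := exists_lower_bound hH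
  refine Metric.isCompact_of_isClosed_isBounded ?_ ?_
  · exact isClosed_eq (by fun_prop) continuous_const
  · refine isBounded_iff_forall_norm_le.mpr ⟨√(1 / m), fun u (hu : formOf H u u = 1) => ?_⟩
    refine Real.le_sqrt_of_sq_le ?_
    rw [le_div_iff₀ hm, mul_comm]
    exact (hlow u).trans hu.le

/-- Either a nonsingular quadratic form takes both signs, or its absolute value attains a positive
minimum among the unit vectors. -/
theorem indefinite_or_exists_min {H A E : Matrix (Fin 3) (Fin 3) ℝ} (hH : H.PosDef)
    (hE : E.transpose * H * E = 1) (hA : A.IsSymm) (hdet : A.det ≠ 0) :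
    (∃ u v, formOf H u u = 1 ∧ formOf H v v = 1 ∧ formOf A u u < 0 ∧ 0 < formOf A v v) ∨
    ∃ σ k₀ : ℝ, |σ| = 1 ∧ 0 < k₀ ∧ (∀ u, formOf H u u = 1 → k₀ ≤ σ * formOf A u u) ∧
      ∃ u, formOf H u u = 1 ∧ σ * formOf A u u = k₀ := by
  -- A semidefinite nonsingular form is definite, and then its minimum on the compact set of unit
  -- vectors is positive.
  have key : ∀ σ : ℝ, |σ| = 1 → (∀ u, formOf H u u = 1 → 0 ≤ σ * formOf A u u) →
      ∃ σ k₀ : ℝ, |σ| = 1 ∧ 0 < k₀ ∧ (∀ u, formOf H u u = 1 → k₀ ≤ σ * formOf A u u) ∧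
      ∃ u, formOf H u u = 1 ∧ σ * formOf A u u = k₀ := by
    intro σ hσ hnn
    have hσ0 : σ ≠ 0 := fun e => by rw [e, abs_zero] at hσ; norm_num at hσ
    have hpos : ∀ u, u ≠ 0 → 0 < formOf (σ • A) u u := by
      intro u hu
      refine formOf_pos_of_nonneg (hA.smul σ) ?_ (fun v => ?_) hu
      · rw [Matrix.det_smul]
        exact mul_ne_zero (pow_ne_zero _ hσ0) hdet
      · by_cases hv : v = 0
        · rw [hv]; simp
        obtain ⟨r, hr, hr1⟩ := exists_unit_scale hH hv
        have := hnn _ hr1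
        simp only [map_smul, smul_apply, smul_eq_mul] at this
        rw [formOf_smul_matrix]
        have h2 : 0 < r⁻¹ := inv_pos.mpr hr
        have h3 : 0 ≤ r⁻¹ * r⁻¹ * (σ * formOf A v v) := by linarith
        exact nonneg_of_mul_nonneg_right h3 (by positivity)
    obtain ⟨u, hu, hmin⟩ := (isCompact_unit hH).exists_isMinOn
      (f := fun u => σ * formOf A u u) ⟨_, formOf_col hE 0⟩
      (Continuous.continuousOn (by fun_prop))
    have hu : formOf H u u = 1 := hu
    have hu0 : u ≠ 0 := fun e => by rw [e] at hu; simp at hu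
    refine ⟨σ, σ * formOf A u u, hσ, ?_, fun v hv => hmin hv, u, hu, rfl⟩
    rw [← formOf_smul_matrix]
    exact hpos u hu0
  by_cases h1 : ∃ u, formOf H u u = 1 ∧ formOf A u u < 0
  · by_cases h2 : ∃ v, formOf H v v = 1 ∧ 0 < formOf A v v
    · obtain ⟨u, hu, hu'⟩ := h1
      obtain ⟨v, hv, hv'⟩ := h2
      exact Or.inl ⟨u, v, hu, hv, hu', hv'⟩
    · push Not at h2
      exact Or.inr (key (-1) (by norm_num) fun u hu => by linarith [h2 u hu])
  · push Not at h1
    exact Or.inr (key 1 (by norm_num) fun u hu => by linarith [h1 u hu])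

/-- Minima over all sets of a given size inherit strict monotonicity from sets. -/
theorem exists_strictAntiOn_card {α : Type*} [DecidableEq α] {P : Finset α → Set ℝ} {X : Finset α}
    {a : Finset α → ℝ} (hleast : ∀ L ⊆ X, L.Nonempty → IsLeast (P L) (a L))
    (hanti : ∀ L L', L.Nonempty → L ⊂ L' → L' ⊆ X → a L' < a L) :
    ∃ b : ℕ → ℝ, (∀ m ∈ Set.Icc 1 X.card,
      IsLeast {c | ∃ L ⊆ X, L.card = m ∧ c ∈ P L} (b m)) ∧ StrictAntiOn b (Set.Icc 1 X.card) := by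
  have hex : ∀ m, ∃ c, m ∈ Set.Icc 1 X.card → (IsLeast {c | ∃ L ⊆ X, L.card = m ∧ c ∈ P L} c ∧
      ∃ L ⊆ X, L.card = m ∧ c = a L) := by
    intro m
    by_cases hm : m ∈ Set.Icc 1 X.card
    · obtain ⟨L₀, hL₀⟩ := Finset.powersetCard_nonempty.mpr hm.2
      obtain ⟨L, hL, hmin⟩ := Finset.exists_min_image (X.powersetCard m) a ⟨L₀, hL₀⟩
      have hne : ∀ L' : Finset α, L'.card = m → L'.Nonempty := fun L' h =>
        Finset.card_pos.mp (by rw [h]; exact hm.1)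
      rw [Finset.mem_powersetCard] at hL
      refine ⟨a L, fun _ => ⟨⟨⟨L, hL.1, hL.2, (hleast L hL.1 (hne L hL.2)).1⟩, ?_⟩, L, hL.1, hL.2,
        rfl⟩⟩
      rintro c ⟨L', h1, h2, h3⟩
      exact (hmin L' (Finset.mem_powersetCard.mpr ⟨h1, h2⟩)).trans
        ((hleast L' h1 (hne L' h2)).2 h3)
    · exact ⟨0, fun h => absurd h hm⟩
  choose b hb using hex
  refine ⟨b, fun m hm => (hb m hm).1, fun m hm m' hm' hlt => ?_⟩
  obtain ⟨-, L, hLX, hLm, hbL⟩ := hb m hm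
  -- The set that is optimal for the smaller size is enlarged to the larger size; its own minimum
  -- drops strictly, and the minimum over all sets is no larger.
  obtain ⟨L', hL', hL'X, hcard⟩ := Finset.exists_subsuperset_card_eq hLX (hLm.trans_le hlt.le) hm'.2
  have hne : L.Nonempty := Finset.card_pos.mp (by rw [hLm]; exact hm.1)
  have hss : L ⊂ L' := by
    refine hL'.ssubset_of_ne fun e => ?_
    rw [← e, hLm] at hcard
    exact hlt.ne hcard
  rw [hbL]
  refine lt_of_le_of_lt ((hb m' hm').1.2 ⟨L', hL'X, hcard,
    (hleast L' hL'X (hne.mono hL')).1⟩) (hanti L L' hne hss hL'X)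

namespace StaticSpacetime

variable {S : StaticSpacetime} {U : Set Space} {p : Space}

/-- If the curvature takes both signs, some orientation admits null phases on all links. -/
theorem exists_null_of_indefinite (hU : IsOpen U) (hUD : U ⊆ S.domain)
    (hl : ∀ x ∈ U, ∀ y ∈ U, x ≠ y → S.RadarLinkable x y) (hp : p ∈ U)
    {E : Matrix (Fin 3) (Fin 3) ℝ} (hE : S.IsFrame p E) {u v : Space}
    (hu : formOf (S.opticalMetric p) u u = 1) (hv : formOf (S.opticalMetric p) v v = 1)
    (hKu : dirCurv (S.opticalRicci p) (S.frameRicci p E).trace u < 0)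
    (hKv : 0 < dirCurv (S.opticalRicci p) (S.frameRicci p E).trace v) {N : ℕ} (hN : 1 ≤ N) :
    ∃ ε > 0, ∀ τ : ℝ, 0 < τ → τ < ε →
      ∃ M, S.IsArrangement U p τ M ∧ ∀ i j, i ≠ j → S.NullChannel N M i j := by
  have hpD := hUD hp
  have hlam := S.lapse_pos p hpD
  obtain ⟨F, hFc, hFo, hF0, hF1⟩ := exists_frame_path hE hu hv
  rw [frameRicci, S.opticalRicci_eq hpD] at hKu hKv
  obtain ⟨R₀, hR₀, ρ, hρ, hfam⟩ := S.isLocalGeom_conn.exists_family hpD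
  obtain ⟨R, hR, C, hC, s₁, hs₁, hch⟩ := S.exists_chart hU hUD hp R₀
  obtain ⟨s₂, hs₂, hfam⟩ := hfam R hR C hC
  set Rc := ricciOf (connDeriv S.conn p) with hRc
  set t := (E.transpose * Rc * E).trace with ht
  obtain ⟨η, hη, hη0, hη1⟩ : ∃ η > 0, η < -dirCurv Rc t u ∧ η < dirCurv Rc t v := by
    obtain ⟨η, h1, h2⟩ := exists_between (lt_min (neg_pos.mpr hKu) hKv)
    exact ⟨η, h1, (lt_min_iff.mp h2).1, (lt_min_iff.mp h2).2⟩
  obtain ⟨C₂, hC₂, s₃, hs₃, hexp⟩ := S.isLocalGeom_conn.linkSq_expand hpD (hR₀.trans hR) hC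
    one_pos hη hE
  have hN0 : (0 : ℝ) < N := by positivity
  refine ⟨min s₁ (min s₂ s₃) * S.lapse p / N, by positivity, fun τ hτ hNτ => ?_⟩
  rw [lt_div_iff₀ hN0, mul_comm] at hNτ
  obtain ⟨hs0, hs1⟩ := scale_bounds hlam hN hτ hNτ
  obtain ⟨s, hs⟩ : ∃ s, s = N * (τ / S.lapse p) := ⟨_, rfl⟩
  rw [← hs] at hs0 hs1
  rw [le_min_iff, le_min_iff] at hs1
  obtain ⟨ch⟩ := hch s hs0 hs1.1
  -- Nine lengths stay flat while the axis turns from a direction of negative to one of positive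
  -- curvature.
  obtain ⟨y, hyc, hy⟩ := hfam s hs0 hs1.2.1 ch.bvp F (fun _ => flatNine) hFc hFo continuous_const
    (fun _ => by rw [sub_self, norm_zero]; exact hρ.le)
  have hqc : Continuous fun r => ch.sq (y r) (Fin.last 9) :=
    (ch.bvp.continuousOn_linkSq S.isLocalGeom_conn (Fin.last 9)).comp_continuous hyc
      fun r => (hy r).2.1
  have hnine : ∀ r, ∀ k ≠ Fin.last 9, ch.sq (y r) k - sideSq k = 0 := by
    intro r k hk
    obtain ⟨j, rfl⟩ := Fin.exists_castSucc_eq.mpr hk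
    have := (hy r).2.2.1 j
    rw [Chart.sq, this, flatNine, sub_self]
  have hlast : side (Fin.last 9) = 3 := by rw [side_eq]; rfl
  have hst : stress (Fin.last 9) = -4 := rfl
  have hexp : ∀ r u, (fun i => F r i 0) = u →
      |-4 * (ch.sq (y r) (Fin.last 9) - sideSq (Fin.last 9)) - s ^ 2 * dirCurv Rc t u|
        ≤ η * s ^ 2 := by
    rintro r u rfl
    obtain ⟨hy0, hyb, -, hq, c, hc, hV⟩ := hy r
    have := (hexp s hs0 hs1.2.2 ch.bvp (y r) hy0 hyb (Fin.last 9) (fun k hk => by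
      have := hnine r k hk
      rw [Chart.sq] at this
      rw [this, abs_zero]; positivity) (by rw [hlast]; linarith)).2 _ c hc (formOf_col (hFo r) 0) hV
    rwa [Finset.sum_eq_single (Fin.last 9) (fun k _ hk => by
      rw [← Chart.sq, hnine r k hk, mul_zero]) (by simp), hst] at this
  have hs2 : 0 < s ^ 2 := by positivity
  have e0 : sideSq (Fin.last 9) ≤ ch.sq (y 0) (Fin.last 9) := by
    have := (abs_le.mp (hexp 0 u hF0)).2
    nlinarith
  have e1 : ch.sq (y 1) (Fin.last 9) ≤ sideSq (Fin.last 9) := by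
    have := (abs_le.mp (hexp 1 v hF1)).1
    nlinarith
  -- The stress of the last link is negative, so its length is at least the flat one at the start
  -- and at most the flat one at the end.
  obtain ⟨r, -, hr⟩ := intermediate_value_Icc' zero_le_one hqc.continuousOn ⟨e1, e0⟩
  have hall : ∀ k, √(ch.sq (y r) k) = side k := fun k => by
    have : ch.sq (y r) k = side k ^ 2 := by
      by_cases hk : k = Fin.last 9
      · rw [hk]; exact hr
      · exact sub_eq_zero.mp (hnine r k hk)
    rw [this, Real.sqrt_sq (side_pos k).le]
  have hθ : 0 < τ / S.lapse p := by positivity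
  have hne : ∀ i j, i ≠ j → y r i ≠ y r j := fun i j => ch.ne_of_near (hy r).2.1 fun k => by
    rw [hall, sub_self, abs_zero]; norm_num
  refine ⟨synced (fun i => p + s • y r i) _ hθ, ch.isArrangement hpD hθ (hy r).1 (hy r).2.1 hne,
    fun i j hij => ?_⟩
  obtain ⟨k, hk⟩ := exists_joins hij
  exact (ch.null_and_flat hl hθ hs (hy r).2.1 hne hk (hall k)).1

/-- The frame starts with a direction of least |K|, so upper and lower estimates for the least
amplitude agree up to the tolerance: it is N s² k₀ / W, with W the total weight of the set. A
further link adds at least 16 to W, and W never exceeds 252. -/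
theorem exists_phase_minima_of_definite (hU : IsOpen U) (hUD : U ⊆ S.domain)
    (hl : ∀ x ∈ U, ∀ y ∈ U, x ≠ y → S.RadarLinkable x y) (hp : p ∈ U)
    {E : Matrix (Fin 3) (Fin 3) ℝ} (hE : S.IsFrame p E) {σ k₀ : ℝ} (hσ : |σ| = 1) (hk₀ : 0 < k₀)
    (hmin : ∀ u, formOf (S.opticalMetric p) u u = 1 →
      k₀ ≤ σ * dirCurv (S.opticalRicci p) (S.frameRicci p E).trace u)
    (hE0 : σ * dirCurv (S.opticalRicci p) (S.frameRicci p E).trace (fun i => E i 0) = k₀)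
    {N : ℕ} (hN : 1 ≤ N) :
    ∃ ε > 0, ∀ τ : ℝ, 0 < τ → τ < ε → ∃ a : Finset (Sym2 Label) → ℝ,
      (∀ L ⊆ links, L.Nonempty → IsLeast (S.phaseBounds U p N τ L) (a L)) ∧
      ∀ L L', L.Nonempty → L ⊂ L' → L' ⊆ links → a L' < a L := by
  have hpD := hUD hp
  have hlam := S.lapse_pos p hpD
  rw [frameRicci, S.opticalRicci_eq hpD] at hmin hE0
  have hη : 0 < k₀ / 10000 := by positivity
  obtain ⟨R₀, hR₀, hdev⟩ := S.isLocalGeom_conn.exists_deviation hpD hE hσ hk₀ hη hE0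
  obtain ⟨R, hR, C, hC, s₁, hs₁, hch⟩ := S.exists_chart hU hUD hp R₀
  obtain ⟨s₂, hs₂, hdev⟩ := hdev R hR C hC
  obtain ⟨s₃, hs₃, hlow⟩ := S.isLocalGeom_conn.le_deviation hpD hE hσ hk₀ hη hmin (hR₀.trans hR) hC
  have hN0 : (0 : ℝ) < N := by positivity
  -- This bound on the scale keeps all amplitudes in question at most 1/4, inside the range of
  -- phases.
  have hm : 0 < √(1 / (4 * N * k₀)) := Real.sqrt_pos.mpr (by positivity)
  refine ⟨min (min s₁ (√(1 / (4 * N * k₀)))) (min s₂ s₃) * S.lapse p / N, by positivity,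
    fun τ hτ hNτ => ?_⟩
  rw [lt_div_iff₀ hN0, mul_comm] at hNτ
  obtain ⟨hs0, hs1⟩ := scale_bounds hlam hN hτ hNτ
  obtain ⟨s, hs⟩ : ∃ s, s = N * (τ / S.lapse p) := ⟨_, rfl⟩
  rw [← hs] at hs0 hs1
  rw [le_min_iff, le_min_iff, le_min_iff] at hs1
  obtain ⟨⟨h1, h4⟩, h2, h3⟩ := hs1
  obtain ⟨ch⟩ := hch s hs0 h1
  have hs2 : 0 < s ^ 2 := by positivity
  have h4 : N * (s ^ 2 * k₀) ≤ 1 / 4 := by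
    have := (Real.le_sqrt hs0.le (by positivity)).mp h4
    rw [le_div_iff₀ (by positivity)] at this
    linarith
  set J : Finset (Sym2 Label) → Finset (Fin 10) := fun L =>
    Finset.univ.filter fun k => linkOf k ∈ L with hJ
  have hmem : ∀ L k, k ∈ J L ↔ linkOf k ∈ L := fun L k => by simp [hJ]
  have hJne : ∀ L ⊆ links, L.Nonempty → (J L).Nonempty := by
    rintro L hL ⟨e, he⟩
    obtain ⟨k, rfl⟩ := exists_linkOf_eq (hL he)
    exact ⟨k, (hmem L k).mpr he⟩
  set W : Finset (Sym2 Label) → ℝ := fun L => ∑ k ∈ J L, weight k with hW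
  have hex : ∀ L, ∃ a, L ⊆ links → L.Nonempty → IsLeast (S.phaseBounds U p N τ L) a ∧
      N * (s ^ 2 * (k₀ / W L - k₀ / 10000)) ≤ a ∧ a ≤ N * (s ^ 2 * (k₀ / W L + k₀ / 10000)) := by
    intro L
    by_cases hL : L ⊆ links ∧ L.Nonempty
    · have hI := hJne L hL.1 hL.2
      have hW16 : 16 ≤ W L := sixteen_le_sum_weight hI
      obtain ⟨y, hy0, hy, hyL, hyd⟩ := hdev s hs0 h2 ch.bvp _ hI
      obtain ⟨a, ha⟩ := ch.exists_isLeast hl hpD hN hs (L := L)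
        (lo := s ^ 2 * (k₀ / W L - k₀ / 10000)) (hi := s ^ 2 * (k₀ / W L + k₀ / 10000)) (by
          have h5 : k₀ / W L + k₀ / 10000 ≤ k₀ := by
            have : k₀ / W L ≤ k₀ / 16 := by gcongr
            linarith
          have : N * (s ^ 2 * (k₀ / W L + k₀ / 10000)) ≤ N * (s ^ 2 * k₀) := by gcongr
          linarith)
        ⟨y, hy0, hy, fun k hk => hyL k (by rwa [hmem]), hyd⟩ (fun y hy0 hy hyL b hb => by
          have := hlow s hs0 h3 ch.bvp _ hI y hy0 hy (fun k hk => hyL k (by rwa [hmem] at hk))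
            (b / s ^ 2) (fun k => by
              rw [mul_div_cancel₀ _ hs2.ne']; exact hb k)
          rwa [le_div_iff₀ hs2, mul_comm] at this)
      exact ⟨a, fun _ _ => ha⟩
    · exact ⟨0, fun h h' => absurd ⟨h, h'⟩ hL⟩
  choose a ha using hex
  refine ⟨a, fun L hL hne => (ha L hL hne).1, fun L L' hne hss hL' => ?_⟩
  have hL := hss.subset.trans hL'
  have e1 := (ha L hL hne).2.1
  have e2 := (ha L' hL' (hne.mono hss.subset)).2.2
  have hW16 : 16 ≤ W L := sixteen_le_sum_weight (hJne L hL hne)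
  have hWL' : W L' ≤ 252 := sum_weight_le _
  have hWW : W L + 16 ≤ W L' := by
    obtain ⟨e, he', he⟩ := Finset.exists_of_ssubset hss
    obtain ⟨k, rfl⟩ := exists_linkOf_eq (hL' he')
    have hk : k ∉ J L := by rwa [hmem]
    have hsub : insert k (J L) ⊆ J L' := by
      intro j hj
      rcases Finset.mem_insert.mp hj with rfl | hj
      · exact (hmem _ _).mpr he'
      · exact (hmem _ _).mpr (hss.subset ((hmem _ _).mp hj))
    calc W L + 16 ≤ weight k + ∑ j ∈ J L, weight j := by
          rw [add_comm]
          gcongr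
          exact sixteen_le_weight k
      _ = ∑ j ∈ insert k (J L), weight j := (Finset.sum_insert hk).symm
      _ ≤ W L' := Finset.sum_le_sum_of_subset_of_nonneg hsub fun _ _ _ => abs_nonneg _
  -- One more link lowers `k₀ / W` by at least 16 k₀ / 252², which exceeds twice the tolerance `k₀ /
  -- 10000`.
  have hgap : k₀ / W L' + k₀ / 10000 < k₀ / W L - k₀ / 10000 := by
    have h5 : k₀ / W L - k₀ / W L' = k₀ * (W L' - W L) / (W L * W L') := by
      have : W L ≠ 0 := by linarith
      have : W L' ≠ 0 := by linarith
      field_simp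
    have h6 : k₀ * 16 / (252 * 252) ≤ k₀ * (W L' - W L) / (W L * W L') := by
      have : W L ≤ 252 := by linarith
      have : 0 < W L' := by linarith
      have h7 : 0 ≤ k₀ * (W L' - W L) := mul_nonneg hk₀.le (by linarith)
      gcongr
      linarith
    linarith
  have : N * (s ^ 2 * (k₀ / W L' + k₀ / 10000)) < N * (s ^ 2 * (k₀ / W L - k₀ / 10000)) := by
    gcongr
  linarith

end StaticSpacetime

end

/-! ### Generic curvature and the curvature functionals. -/

noncomputable section

/-- The curvature matrices whose form `dirCurv` is nonsingular. -/
def genericRicci : Set (Matrix (Fin 3) (Fin 3) ℝ) :=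
  {R | ((-45 : ℝ) • R + (27 / 2 * R.trace) • (1 : Matrix (Fin 3) (Fin 3) ℝ)).det ≠ 0}

theorem isOpen_genericRicci : IsOpen genericRicci := by
  have : Continuous fun R : Matrix (Fin 3) (Fin 3) ℝ =>
      ((-45 : ℝ) • R + (27 / 2 * R.trace) • (1 : Matrix (Fin 3) (Fin 3) ℝ)).det := by
    have h1 : Continuous fun R : Matrix (Fin 3) (Fin 3) ℝ => R.trace :=
      Continuous.matrix_trace continuous_id
    refine Continuous.matrix_det ?_
    fun_prop
  exact isOpen_ne_fun this continuous_const

/-- Adding 2t/9 times the identity to the Ricci matrix shifts the matrix of the form by -t times the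
identity, since -45 · 2/9 + (27/2) · 3 · 2/9 = -1. The result is singular only when t is one of
finitely many eigenvalues. -/
theorem isSymm_subset_closure_genericRicci :
    {R : Matrix (Fin 3) (Fin 3) ℝ | R.IsSymm} ⊆ closure (genericRicci ∩ {R | R.IsSymm}) := by
  intro R (hR : R.IsSymm)
  set A := (-45 : ℝ) • R + (27 / 2 * R.trace) • (1 : Matrix (Fin 3) (Fin 3) ℝ) with hA
  have hfin : {t : ℝ | A.charpoly.IsRoot t}.Finite :=
    Polynomial.finite_setOfPred_isRoot A.charpoly_monic.ne_zero
  have hdense : Dense {t : ℝ | A.charpoly.IsRoot t}ᶜ := hfin.countable.dense_compl ℝ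
  have hcont : Continuous fun t : ℝ => R + (2 / 9 * t) • (1 : Matrix (Fin 3) (Fin 3) ℝ) := by
    fun_prop
  have h0 : R = (fun t : ℝ => R + (2 / 9 * t) • (1 : Matrix (Fin 3) (Fin 3) ℝ)) 0 := by simp
  suffices h : (fun t : ℝ => R + (2 / 9 * t) • (1 : Matrix (Fin 3) (Fin 3) ℝ)) 0
      ∈ closure (genericRicci ∩ {R | R.IsSymm}) by rwa [← h0] at h
  refine map_mem_closure (f := fun t : ℝ => R + (2 / 9 * t) • (1 : Matrix (Fin 3) (Fin 3) ℝ))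
    hcont (hdense 0) fun t ht => ⟨?_, ?_⟩
  · have e : (-45 : ℝ) • (R + (2 / 9 * t) • (1 : Matrix (Fin 3) (Fin 3) ℝ))
        + (27 / 2 * (R + (2 / 9 * t) • (1 : Matrix (Fin 3) (Fin 3) ℝ)).trace)
          • (1 : Matrix (Fin 3) (Fin 3) ℝ) = -(Matrix.scalar (Fin 3) t - A) := by
      rw [Matrix.trace_add, Matrix.trace_smul, Matrix.trace_one, hA, Matrix.scalar_apply, ← Matrix.smul_one_eq_diagonal]
      simp only [smul_eq_mul, Fintype.card_fin]
      push_cast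
      module
    rw [genericRicci, Set.mem_ofPred_eq, e, Matrix.det_neg]
    refine mul_ne_zero (pow_ne_zero _ (by norm_num)) fun h => ht ?_
    rw [Set.mem_ofPred_eq, Polynomial.IsRoot.def, Matrix.eval_charpoly, h]
  · exact hR.add (Matrix.isSymm_one.smul _)

/-- Passing to the frame is a congruence, which multiplies the determinant by the square of that of
`E`. -/
theorem det_ne_zero_of_frame {H E Rc : Matrix (Fin 3) (Fin 3) ℝ} (hE : E.transpose * H * E = 1)
    (h : E.transpose * Rc * E ∈ genericRicci) :
    ((-45 : ℝ) • Rc + (27 / 2 * (E.transpose * Rc * E).trace) • H).det ≠ 0 := by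
  have e : (-45 : ℝ) • (E.transpose * Rc * E) + (27 / 2 * (E.transpose * Rc * E).trace) • 1
      = E.transpose * ((-45 : ℝ) • Rc + (27 / 2 * (E.transpose * Rc * E).trace) • H) * E := by
    rw [Matrix.mul_add, Matrix.add_mul, Matrix.mul_smul, Matrix.mul_smul, Matrix.smul_mul,
      Matrix.smul_mul, hE]
  rw [genericRicci, Set.mem_ofPred_eq, e, Matrix.det_mul, Matrix.det_mul] at h
  exact right_ne_zero_of_mul (left_ne_zero_of_mul h)

/-- `curvK` as a linear functional. -/
def curvKLin : Matrix (Fin 3) (Fin 3) ℝ →ₗ[ℝ] ℝ where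
  toFun := curvK
  map_add' A B := by simp only [curvK, Matrix.add_apply, Matrix.trace_add]; ring
  map_smul' c A := by
    simp only [curvK, Matrix.smul_apply, Matrix.trace_smul, smul_eq_mul, RingHom.id_apply]; ring

/-- The dependence on the curvature of the echo count on a link. -/
def echoCurv (e : Sym2 Label) : Matrix (Fin 3) (Fin 3) ℝ →ₗ[ℝ] ℝ :=
  ∑ k, if linkOf k = e then (stress k * side k)⁻¹ • curvKLin else 0

theorem echoCurv_linkOf (k : Fin 10) (R : Matrix (Fin 3) (Fin 3) ℝ) :
    echoCurv (linkOf k) R = curvK R / (stress k * side k) := by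
  rw [echoCurv, Finset.sum_eq_single k (fun j _ hj => if_neg fun e => hj (linkOf_injective e))
    (by simp), if_pos rfl, LinearMap.smul_apply, smul_eq_mul, div_eq_inv_mul]
  rfl

theorem exists_echoCurv_ne_zero {e : Sym2 Label} (he : e ∈ links) :
    ∃ R : Matrix (Fin 3) (Fin 3) ℝ, R.IsSymm ∧ echoCurv e R ≠ 0 := by
  obtain ⟨k, rfl⟩ := exists_linkOf_eq he
  refine ⟨1, Matrix.isSymm_one, ?_⟩
  rw [echoCurv_linkOf]
  refine div_ne_zero ?_ (mul_ne_zero (stress_ne k) (side_pos k).ne')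
  rw [curvK, Matrix.trace_one]
  norm_num

theorem card_links : links.card = 10 := by
  have : links = Finset.univ.image linkOf := by
    ext e
    simp only [Finset.mem_image, Finset.mem_univ, true_and]
    exact ⟨exists_linkOf_eq, fun ⟨k, hk⟩ => hk ▸ linkOf_mem k⟩
  rw [this, Finset.card_image_of_injective _ linkOf_injective, Finset.card_univ, Fintype.card_fin]

namespace StaticSpacetime

variable {S : StaticSpacetime} {U : Set Space} {p : Space}

/-- An indefinite form would allow null phases on all links, contrary to the assumption. Otherwise
the frame is turned until its first vector is a direction of least |K|; this does not change the
trace. -/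
theorem exists_phase_minima (hU : IsOpen U) (hUD : U ⊆ S.domain)
    (hl : ∀ x ∈ U, ∀ y ∈ U, x ≠ y → S.RadarLinkable x y) (hp : p ∈ U)
    {E : Matrix (Fin 3) (Fin 3) ℝ} (hE : S.IsFrame p E) (hG : S.frameRicci p E ∈ genericRicci)
    {N : ℕ} (hN : 1 ≤ N) :
    ∃ ε > 0, ∀ τ : ℝ, 0 < τ → τ < ε →
      (¬ ∃ M, S.IsArrangement U p τ M ∧ ∀ i j, i ≠ j → S.NullChannel N M i j) →
      ∃ a : Finset (Sym2 Label) → ℝ,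
      (∀ L ⊆ links, L.Nonempty → IsLeast (S.phaseBounds U p N τ L) (a L)) ∧
      ∀ L L', L.Nonempty → L ⊂ L' → L' ⊆ links → a L' < a L := by
  have hpD := hUD hp
  have hpd := S.isLocalGeom_conn.posDef p hpD
  have hsymm := S.isLocalGeom_conn.ricciOf_isSymm hpD
  rw [← S.opticalRicci_eq hpD] at hsymm
  have hH : (S.opticalMetric p).IsSymm := hpd.isHermitian
  have hK : ∀ u, formOf (S.opticalMetric p) u u = 1 → formOf ((-45 : ℝ) • S.opticalRicci p
      + (27 / 2 * (S.frameRicci p E).trace) • S.opticalMetric p) u u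
      = dirCurv (S.opticalRicci p) (S.frameRicci p E).trace u :=
    fun u hu => formOf_dirCurv _ _ _ hu
  rcases indefinite_or_exists_min hpd hE ((hsymm.smul (-45 : ℝ)).add (hH.smul _))
    (det_ne_zero_of_frame hE hG) with ⟨u, v, hu, hv, hKu, hKv⟩ | ⟨σ, k₀, hσ, hk₀, hmin, u, hu, hmu⟩
  · obtain ⟨ε, hε, hnull⟩ := exists_null_of_indefinite hU hUD hl hp hE hu hv
      ((hK u hu).symm.trans_lt hKu) (hKv.trans_eq (hK v hv)) hN
    exact ⟨ε, hε, fun τ hτ hτε h => absurd (hnull τ hτ hτε) h⟩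
  · obtain ⟨θ, φ, hcol⟩ := exists_rot_frame hE hu
    have hE' : S.IsFrame p (E * rot θ φ) := frame_mul hE (rot_orthogonal θ φ)
    have htr : (S.frameRicci p (E * rot θ φ)).trace = (S.frameRicci p E).trace :=
      trace_frame_eq hE' hE
    obtain ⟨ε, hε, hmain⟩ := exists_phase_minima_of_definite hU hUD hl hp hE' hσ hk₀
      (fun w hw => by rw [htr, ← hK w hw]; exact hmin w hw)
      (by rw [htr, hcol, ← hK u hu]; exact hmu) hN
    exact ⟨ε, hε, fun τ hτ hτε _ => hmain τ hτ hτε⟩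

end StaticSpacetime

end
end OpenMachines
open OpenMachines in
theorem mainTheorem3 :
    ∃ (κ : Sym2 Label → Matrix (Fin 3) (Fin 3) ℝ →ₗ[ℝ] ℝ)
      (G : Set (Matrix (Fin 3) (Fin 3) ℝ)),
      (∀ e ∈ links, ∃ R : Matrix (Fin 3) (Fin 3) ℝ, R.IsSymm ∧ κ e R ≠ 0) ∧
      IsOpen G ∧
      {R | R.IsSymm} ⊆ closure (G ∩ {R | R.IsSymm}) ∧
      ∀ (S : StaticSpacetime) (U : Set (Fin 3 → ℝ)), IsOpen U → U ⊆ S.domain →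
        (∀ x ∈ U, ∀ y ∈ U, x ≠ y → S.RadarLinkable x y) →
        ∀ p ∈ U,
          -- nine two-way channels with null phases and flat echo counts, in any orientation and
          -- with any exceptional link; all clocks have the coordinate period of B1
          (∀ E, S.IsFrame p E → ∀ e ∈ links, ∃ ε > 0, ∀ (N : ℕ) (τ : ℝ), 1 ≤ N → 0 < τ →
            N * τ < ε → ∃ M, S.IsArrangement U p τ M ∧
              S.AimedAt p (M (.B 1)).pos (fun i => E i 0) ∧
              (∀ i, (M i).period = τ / S.lapse p) ∧
              (∀ i j, i ≠ j → s(i, j) ≠ e → S.NullChannel N M i j ∧ S.FlatEcho N M i j) ∧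
              (∀ i j, s(i, j) = e → ∀ m : ℤ, ∃ Δ : ℝ,
                S.EchoCount (M i) (M j) m Δ ∧ |Δ - 2 * hop i j * N| < N)) ∧
          -- the echo count on the exceptional link depends on the curvature
          (∀ E, S.IsFrame p E → ∀ e ∈ links, ∀ η > 0, ∃ ε > 0, ∀ (N : ℕ) (τ : ℝ), 1 ≤ N →
            0 < τ → N * τ < ε → ∀ M, S.IsArrangement U p τ M →
              S.AimedAt p (M (.B 1)).pos (fun i => E i 0) →
              (∀ i j, i ≠ j → s(i, j) ≠ e → S.FlatEcho N M i j) →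
              ∀ i j, s(i, j) = e → ∀ (m : ℤ) (Δ : ℝ), S.EchoCount (M i) (M j) m Δ →
                |Δ - 2 * hop i j * N| < N →
                |Δ - 2 * hop i j * N - N * (N * (τ / S.lapse p)) ^ 2 * κ e (S.frameRicci p E)|
                  ≤ η * (N * (N * (τ / S.lapse p)) ^ 2)) ∧
          -- under curvature some echo count must differ from its flat value
          (S.opticalRicci p ≠ 0 → ∃ D : Set (Fin 3 → ℝ), IsOpen D ∧ Dense D ∧ ∀ u ∈ D,
            ∃ ε > 0, ∀ (N : ℕ) (τ : ℝ), 1 ≤ N → 0 < τ → N * τ < ε →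
              ∀ M, S.IsArrangement U p τ M → S.AimedAt p (M (.B 1)).pos u →
                ∃ i j, i ≠ j ∧ ∀ m : ℤ, ¬ S.EchoCount (M i) (M j) m (2 * hop i j * N)) ∧
          -- the least possible maximum amplitude of a phase decreases with the number of links
          -- allowed to have non-zero phases
          (∀ E, S.IsFrame p E → S.frameRicci p E ∈ G → ∀ N : ℕ, 1 ≤ N → ∃ ε > 0, ∀ τ : ℝ,
            0 < τ → τ < ε →
            (¬ ∃ M, S.IsArrangement U p τ M ∧ ∀ i j, i ≠ j → S.NullChannel N M i j) →
            (∃ a : ℕ → ℝ,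
              (∀ m ∈ Set.Icc 1 10, IsLeast
                {b | ∃ L ⊆ links, L.card = m ∧ b ∈ S.phaseBounds U p N τ L} (a m)) ∧
              StrictAntiOn a (Set.Icc 1 10)) ∧
            (∃ a : Finset (Sym2 Label) → ℝ,
              (∀ L ⊆ links, L.Nonempty → IsLeast (S.phaseBounds U p N τ L) (a L)) ∧
              ∀ L L', L.Nonempty → L ⊂ L' → L' ⊆ links → a L' < a L)) ∧
          -- all clocks have the coordinate period of B1
          (∀ (N : ℕ) (τ : ℝ) M φ, 1 ≤ N → 0 < τ → S.IsArrangement U p τ M →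
            S.HasChannels N M φ → ∀ i, (M i).period = τ / S.lapse p) := by
  refine ⟨echoCurv, genericRicci, fun e he => exists_echoCurv_ne_zero he, isOpen_genericRicci,
    isSymm_subset_closure_genericRicci, fun S U hU hUD hl p hp => ⟨fun E hE e he =>
      StaticSpacetime.exists_nine_flat hU hUD hl hp hE he, fun E hE e he η hη => ?_,
      fun hcurv => StaticSpacetime.exists_nonflat_echo hU hUD hl hp hcurv, fun E hE hG N hN => ?_,
      fun N τ M φ _ _ hM hc =>
        StaticSpacetime.period_eq_of_hasChannels hl (hUD hp) hM hc⟩⟩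
  · obtain ⟨k, rfl⟩ := exists_linkOf_eq he
    simp only [echoCurv_linkOf]
    exact StaticSpacetime.echo_expand hU hUD hl hp hE k hη
  · obtain ⟨ε, hε, hmain⟩ := StaticSpacetime.exists_phase_minima hU hUD hl hp hE hG hN
    refine ⟨ε, hε, fun τ hτ hτε hnull => ?_⟩
    obtain ⟨a, hleast, hanti⟩ := hmain τ hτ hτε hnull
    -- The statement by number of links follows from the one by sets of links.
    have hcard := exists_strictAntiOn_card hleast hanti
    rw [card_links] at hcard
    exact ⟨hcard, a, hleast, hanti⟩
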